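/- **Definitions.** A *continuum* is a nonempty compact connected metrizable space. An *arc* is a space homeomorphic to $[0,1]$. A *tree* is a continuum which is a union of finitely many arcs with pairwise finite intersections and which contains no circle. A continuum $X$ is *tree-like* if for every open cover $\mathcal U$ of $X$ there is a continuous map from $X$ to a tree each of whose point preimages lies in a member of $\mathcal U$. The *valence* of a map $f:X\to Y$ is the maximum over $y\in Y$ of the number of connected components of $f^{-1}(y)$. For $f,g:X\to Z$ put $[g,f]=\{(x,y)\in X\times X: g(x)=f(y)\}$, and let $\Delta X$ be the diagonal of $X\times X$. An arc $A\subset X\times X$ is *monotone* if $A\cap(\{x\}\times X)$ and $A\cap (X\times\{x\})$ are connected or empty for all $x\in X$. Let $\tau_2:[0,1]\to[0,1]$ be the tent map, $\tau_2(x)=2x$ for $x\le\frac12$ and $\tau_2(x)=2-2x$ for $x\ge\frac12$; let $\tau_2^{-m}A$ be the preimage of $A$ under the $m$-fold iterate of $\tau_2$, and $\varepsilon_n=\frac1{9\cdot 2^n}$. For $n\ge 0$ let $T_n$ be the interval $[0,1]$ together with, for each $p\in\{0,\frac23\}\cup\bigcup_{m=0}^{n-1}\tau_2^{-m}\{\frac13,1\}$,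 three arcs $F^p_i=\{F^p_i(t):t\in[0,1]\}$, $i\in\{0,1,2\}$ (indices modulo $3$), with $F^p_i(0)=p$ and otherwise disjoint from each other and from $[0,1]$. For $\Gamma\subset T_n\times T_n$ consider the following conditions (with index $n$): - (C1) $A=\Gamma\cap([0,1]\times[0,1])$ is the union of three monotone arcs, one from $(0,\varepsilon_n)$ to $(\frac12,1)$, one from $(\frac12,1)$ to $(\frac23,\frac23+\varepsilon_n)$, and one from $(\frac23,\frac23-\varepsilon_n)$ to $(1,0)$. - (C2) $(p,\tau_2(p))\in A$ for all $p\in\tau_2^{-m}\{\frac13,1\}$, $0\le m\le n$. - (C3) For each $i$, $\Gamma\cap(F^0_i\times[0,1])$ is a monotone arc from $(0,\varepsilon_n)$ to $(F^0_i(\frac12),0)$, and $\Gamma\cap(F^{2/3}_i\times[0,1])$ is the union of two monotone arcs, one from $(\frac23,\frac23+\varepsilon_n)$ and one from $(\frac23,\frac23-\varepsilon_n)$, both to $(F^{2/3}_i(\frac12),\frac23)$. - (C4) For $p\in\{0,\frac23\}$ and each $i$, $\Gamma\cap(F^p_i\times F^p_{i+1})$ is a monotone arc from $(F^p_i(\frac12),p)$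 to $(F^p_i(1),F^p_{i+1}(1))$. - (C5) For $p\in\tau_2^{-m}\{\frac13,1\}$, $0\le m\le n-1$, and each $i$, $\Gamma\cap(F^p_i\times F^{\tau_2(p)}_i)$ is a monotone arc from $(p,\tau_2(p))$ to $(F^p_i(1),F^{\tau_2(p)}_i(1))$. - (C6) For $p\in\tau_2^{-n}\{\frac13,1\}$ and each $i$, $\{p\}\times F^{\tau_2(p)}_i\subset\Gamma$. **Theorem.** Every $T_n$ is a tree, and the following hold. 1. Let $n\ge0$ and let $\Gamma_n\subset (T_n\times T_n)\setminus\Delta T_n$ satisfy (C1)–(C6) with index $n$. Then there are continuous maps $f_n,g_n:T_{n+1}\to T_n$, $f_n$ of valence $6$ and $g_n$ of valence $12$, such that $(f_n(x),g_n(x))\in\Gamma_n$ for all $x\in T_{n+1}$, the set $[g_n,f_n]$ misses $\Delta T_{n+1}$, and $[g_n,f_n]$ contains a set $\Gamma_{n+1}$ satisfying (C1)–(C6) with index $n+1$. 2. There are sets $\Gamma_n\subset(T_n\times T_n)\setminus\Delta T_n$ satisfying (C1)–(C6) with index $n$ and continuous maps $f_n,g_n:T_{n+1}\to T_n$ $(n\ge0)$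 such that for all $n$: $(f_n(x),g_n(x))\in\Gamma_n$ for all $x\in T_{n+1}$; $\Gamma_{n+1}\subset[g_n,f_n]$; $f_n\circ g_{n+1}=g_n\circ f_{n+1}$; $f_n$ has valence $6$ and $g_n$ has valence $12$; and $f_0,g_0$ have no coincidence point, i.e. $f_0(x)\neq g_0(x)$ for all $x\in T_1$. Moreover $X=\varprojlim(T_n,f_n)$ is a tree-like continuum, and $\langle x_n\rangle_n\mapsto\langle g_n(x_{n+1})\rangle_n$ is a well-defined continuous self-map of $X$ without fixed points. -/

import Mathlib

namespace TriodTrees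

/-! ### Arcs, continua, trees, tree-like continua -/

/-- `A` is an arc with endpoints `a` and `b`. -/
def IsArcFromTo {X : Type*} [TopologicalSpace X] (A : Set X) (a b : X) : Prop :=
  ∃ γ : unitInterval → X, Topology.IsEmbedding γ ∧ Set.range γ = A ∧ γ 0 = a ∧ γ 1 = b

/-- `A` is a monotone arc in `X × X` with endpoints `a` and `b`: it meets every vertical and every
horizontal fibre in a connected (or empty) set. -/
def IsMonotoneArcFromTo {X : Type*} [TopologicalSpace X] (A : Set (X × X)) (a b : X × X) : Prop :=
  IsArcFromTo A a b ∧
    ∀ x : X, IsPreconnected (A ∩ ({x} ×ˢ Set.univ)) ∧ IsPreconnected (A ∩ (Set.univ ×ˢ {x}))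

/-- A continuum is a (nonempty) compact connected metrizable space. -/
def IsContinuum (X : Type*) [TopologicalSpace X] : Prop :=
  CompactSpace X ∧ ConnectedSpace X ∧ TopologicalSpace.MetrizableSpace X

/-- A tree is a continuum which is the union of finitely many arcs with pairwise finite
intersections, and which contains no circle. -/
def IsTree (X : Type*) [TopologicalSpace X] : Prop :=
  IsContinuum X ∧
    (∃ 𝒜 : Set (Set X), 𝒜.Finite ∧ (∀ A ∈ 𝒜, ∃ a b, IsArcFromTo A a b) ∧
      𝒜.Pairwise (fun A B => (A ∩ B).Finite) ∧ ⋃₀ 𝒜 = Set.univ) ∧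
    ∀ S : Set X, IsEmpty (S ≃ₜ Circle)

/-- A continuum is tree-like if it admits maps to trees with arbitrarily small fibres. Smallness is
measured by open covers, which for compact metric spaces is the same as by diameters. A
nondegenerate subcontinuum of a tree is a tree, so for a nondegenerate continuum it does not matter
whether the maps are required to be onto. -/
def IsTreeLike (X : Type) [TopologicalSpace X] : Prop :=
  IsContinuum X ∧
    ∀ 𝒰 : Set (Set X), (∀ U ∈ 𝒰, IsOpen U) → ⋃₀ 𝒰 = Set.univ →
      ∃ (Y : Type) (_ : TopologicalSpace Y) (φ : C(X, Y)),
        IsTree Y ∧ ∀ y : Y, ∃ U ∈ 𝒰, φ ⁻¹' {y} ⊆ U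

/-! ### Coincidence sets, valence, inverse limits -/

/-- The coincidence set `[g, f]`. -/
def coincidenceSet {X Z : Type*} (g f : X → Z) : Set (X × X) := {z | g z.1 = f z.2}

/-- `k` is the maximum, over all `y`, of the number of connected components of `f ⁻¹' {y}`. -/
def HasValence {X Y : Type*} [TopologicalSpace X] (f : X → Y) (k : ℕ∞) : Prop :=
  IsGreatest (Set.range fun y : Y => ENat.card (ConnectedComponents ↥(f ⁻¹' {y}))) k

/-- The inverse limit of a sequence of maps `f n : X (n + 1) → X n`, with the topology of a subspace
of the product. -/
abbrev InverseLimit {X : ℕ → Type*} (f : ∀ n, X (n + 1) → X n) :=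
  {x : ∀ n, X n // ∀ n, f n (x (n + 1)) = x n}

/-! ### The trees -/

/-- The tent map `τ₂` (used on `[0, 1]` only). -/
noncomputable def tau (x : ℝ) : ℝ := if x ≤ 1 / 2 then 2 * x else 2 - 2 * x

/-- `τ₂⁻ᵐ {1/3, 1}`, as a subset of `[0, 1]`. -/
def tauPre (m : ℕ) : Set ℝ := {x | x ∈ Set.Icc (0 : ℝ) 1 ∧ tau^[m] x ∈ ({1 / 3, 1} : Set ℝ)}

/-- The points of `[0, 1]` where triods are attached to form the `n`-th tree. -/
def attachPts (n : ℕ) : Set ℝ := {0, 2 / 3} ∪ ⋃ m : ℕ, ⋃ _ : m < n, tauPre m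

/-- The ambient space `ℝ × ℝ³` in which all the trees are realized. -/
abbrev Amb : Type := ℝ × (Fin 3 → ℝ)

/-- The point `x` of the interval `[0, 1]`, inside the ambient space. -/
def pt (x : ℝ) : Amb := (x, 0)

/-- The point `F^p_i(t)`: the one at distance `t` from `p` in the `i`-th of three directions. In
particular `F^p_i(0) = p`. -/
def leg (p : ℝ) (i : Fin 3) (t : ℝ) : Amb := (p, Pi.single i t)

/-- The interval `[0, 1]`, inside the ambient space. -/
def seg : Set Amb := pt '' Set.Icc 0 1

/-- The arc `F^p_i`. -/
def legArc (p : ℝ) (i : Fin 3) : Set Amb := leg p i '' Set.Icc 0 1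

/-- The `n`-th tree, as a subset of the ambient space. -/
def treeSet (n : ℕ) : Set Amb := seg ∪ ⋃ p ∈ attachPts n, ⋃ i : Fin 3, legArc p i

/-- The tree `T_n`, a space with the subspace topology. -/
abbrev T (n : ℕ) : Type := ↥(treeSet n)

/-! ### The conditions on `Γ_n` -/

/-- `ε_n = 1 / (9 · 2ⁿ)`. -/
noncomputable def eps (n : ℕ) : ℝ := 1 / (9 * 2 ^ n)

/-- The conditions (C1)-(C6) for a set `G` of pairs of points of the ambient space. -/
structure CondAmb (n : ℕ) (G : Set (Amb × Amb)) : Prop where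
  c1 : ∃ A₁ A₂ A₃ : Set (Amb × Amb),
    IsMonotoneArcFromTo A₁ (pt 0, pt (eps n)) (pt (1 / 2), pt 1) ∧
    IsMonotoneArcFromTo A₂ (pt (1 / 2), pt 1) (pt (2 / 3), pt (2 / 3 + eps n)) ∧
    IsMonotoneArcFromTo A₃ (pt (2 / 3), pt (2 / 3 - eps n)) (pt 1, pt 0) ∧
    G ∩ (seg ×ˢ seg) = A₁ ∪ A₂ ∪ A₃
  c2 : ∀ m ≤ n, ∀ p ∈ tauPre m, (pt p, pt (tau p)) ∈ G ∩ (seg ×ˢ seg)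
  c3_zero : ∀ i : Fin 3,
    IsMonotoneArcFromTo (G ∩ (legArc 0 i ×ˢ seg)) (pt 0, pt (eps n)) (leg 0 i (1 / 2), pt 0)
  c3_two_thirds : ∀ i : Fin 3, ∃ B₁ B₂ : Set (Amb × Amb),
    IsMonotoneArcFromTo B₁ (pt (2 / 3), pt (2 / 3 + eps n)) (leg (2 / 3) i (1 / 2), pt (2 / 3)) ∧
    IsMonotoneArcFromTo B₂ (pt (2 / 3), pt (2 / 3 - eps n)) (leg (2 / 3) i (1 / 2), pt (2 / 3)) ∧
    G ∩ (legArc (2 / 3) i ×ˢ seg) = B₁ ∪ B₂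
  c4 : ∀ p ∈ ({0, 2 / 3} : Set ℝ), ∀ i : Fin 3,
    IsMonotoneArcFromTo (G ∩ (legArc p i ×ˢ legArc p (i + 1)))
      (leg p i (1 / 2), pt p) (leg p i 1, leg p (i + 1) 1)
  c5 : ∀ m < n, ∀ p ∈ tauPre m, ∀ i : Fin 3,
    IsMonotoneArcFromTo (G ∩ (legArc p i ×ˢ legArc (tau p) i))
      (pt p, pt (tau p)) (leg p i 1, leg (tau p) i 1)
  c6 : ∀ p ∈ tauPre n, ∀ i : Fin 3, {pt p} ×ˢ legArc (tau p) i ⊆ G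

/-- The conditions (C1)-(C6) for a set `Γ ⊆ T_n × T_n`. -/
def Cond (n : ℕ) (Γ : Set (T n × T n)) : Prop :=
  CondAmb n (Prod.map Subtype.val Subtype.val '' Γ)

end TriodTrees

open TriodTrees

namespace TriodTrees
open Set Topology

/-! ### Monotone functions and arcs -/

/-! Everything rests on the inductive step (part 1); part 2 follows by iterating it from an explicit
`Γ_0`. Since `(f_{n+1}, g_{n+1})` takes values in `Γ_{n+1} ⊆ [g_n, f_n]`, one gets `f_n ∘ g_{n+1} =
g_n ∘ f_{n+1}`, so the `g_n` induce a self-map of the inverse limit. A fixed point of it would be a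
coincidence of `f_0` and `g_0`, which is impossible because `Γ_0` misses the diagonal. The limit is
tree-like because its projections to the trees `T_n` have arbitrarily small fibres.

For the inductive step, the model is a pair of commuting tent maps: `f_n` imitates `tau3`, with
three branches, and `g_n` imitates `tau ∘ tau3`, with six. Over the interval, `Γ_n` is a perturbed
graph of `tau` which is pushed off the diagonal at the fixed points `0` and `2/3`, and at `2/3` it
is torn apart. The triods bridge the gap: inside `Γ_n` one passes from `(2/3, 2/3 + ε)` to `(2/3,
2/3 - ε)` by moving the first coordinate out along a leg `F_i`, letting the second coordinate slide
to `2/3` and then into the next leg `F_{i+1}`, and coming back by the other side. The cyclic shift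
of the index keeps the two coordinates apart. The remaining triods carry the preimages of these
excursions.

A path in `Γ_n` is built that runs through the spine three times, over the branches of `tau3`, with
an excursion at every point of `excPts (n + 1)` (`exists_excursion`, `Excursions.mem_path`). Both
coordinates of this path follow one and the same walk `tour n` in `T_n`: the first coordinate
follows it once, the second forwards and then backwards, because `tau` maps `excPts (n + 1)`
two-to-one onto `excPts n`. So on the interval `f = tour n ∘ mu` and `g = tour n ∘ lam`, with `mu`
monotone and `lam` monotone on pieces. Where `tau3` reaches `0` at the point `2/3`, the second
coordinate only comes down to `ε_n`; there `lam` leaps between the positions of `2/3 + ε_n/3` and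
`2/3 - ε_n/3`, which the tour does not distinguish. This leap is the new gap of `Γ_{n+1}` at `2/3`.

Whenever `lam x = mu y`, the pair `(x, y)` lies in `[g, f]`. Two monotone functions with the same
end values can be matched along a monotone arc that may be steered through prescribed points
(`exists_matching`). Such arcs over the interval and over the legs are assembled into `Γ_{n+1}` by
`exists_condAmb_of_arcs`.

For the valences, the tour is at a given point for at most six positions, namely three points under
`tau3` and two directions of an excursion. The map `f` follows the tour once and `g` twice, and the
legs contribute no more than the bounds 6 and 12 allow. Over `2/3` all six positions occur and are
separated, so the bounds are attained. -/

/-- A descent would, by the intermediate value theorem, make some value occur on both sides of a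
point where another value is taken, against the order-connectedness of fibres. The cases only decide
on which side the repeated value is found. -/
theorem monotone_of_isPreconnected_fibers {h : unitInterval → ℝ} (hc : Continuous h)
    (hf : ∀ v, IsPreconnected (h ⁻¹' {v})) (h01 : h 0 ≤ h 1) : Monotone h := by
  have hoc : ∀ v, OrdConnected (h ⁻¹' {v}) := fun v => (hf v).ordConnected
  have ivt : ∀ x y : unitInterval, ∀ v, x ≤ y → (v ∈ Icc (h x) (h y) ∨ v ∈ Icc (h y) (h x)) →
      ∃ z, x ≤ z ∧ z ≤ y ∧ h z = v := by
    intro x y v hxy hv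
    rcases hv with hv | hv
    · obtain ⟨z, hz, rfl⟩ := intermediate_value_Icc hxy hc.continuousOn hv
      exact ⟨z, hz.1, hz.2, rfl⟩
    · obtain ⟨z, hz, rfl⟩ := intermediate_value_Icc' hxy hc.continuousOn hv
      exact ⟨z, hz.1, hz.2, rfl⟩
  have key : ∀ x y z : unitInterval, x ≤ y → y ≤ z → h x = h z → h y = h z := by
    intro x y z hxy hyz hxz
    exact (hoc (h z)).out (show h x = h z from hxz) (show h z = h z from rfl) ⟨hxy, hyz⟩
  intro x y hxy
  by_contra! hlt
  rcases le_or_gt (h 0) (h y) with h0 | h0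
  · obtain ⟨z, -, hz2, hz⟩ := ivt 0 x (h y) unitInterval.nonneg' (Or.inl ⟨h0, hlt.le⟩)
    have := key z x y hz2 hxy hz
    linarith
  · rcases le_or_gt (h x) (h 1) with h1 | h1
    · obtain ⟨z, hz1, -, hz⟩ := ivt y 1 (h x) unitInterval.le_one' (Or.inl ⟨hlt.le, h1⟩)
      have := key x y z hxy hz1 hz.symm
      linarith
    · obtain ⟨z, -, hz2, hz⟩ := ivt x y (h 1) hxy (Or.inr ⟨by linarith, h1.le⟩)
      have := key z y 1 hz2 unitInterval.le_one' hz
      linarith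

/-- As `φ` is injective on the first projection of the arc, the level sets of `φ` along it are
exactly its vertical slices, hence connected; similarly for `ψ`. Clamping the parameter makes
everything total and constant outside `[0, 1]`, so that pieces can later be glued by adding them. -/
theorem IsMonotoneArcFromTo.exists_param {X : Type*} [TopologicalSpace X] {A : Set (X × X)}
    {a b : X × X} (hA : IsMonotoneArcFromTo A a b) {φ ψ : X → ℝ} (hφ : Continuous φ)
    (hψ : Continuous ψ) (hφi : InjOn φ (Prod.fst '' A)) (hψi : InjOn ψ (Prod.snd '' A))
    (h1 : φ a.1 ≤ φ b.1) (h2 : ψ a.2 ≤ ψ b.2) :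
    ∃ γ : ℝ → X × X, Continuous γ ∧ γ '' Icc 0 1 = A ∧ (∀ t, γ t ∈ A) ∧ InjOn γ (Icc 0 1) ∧
      (∀ t ≤ 0, γ t = a) ∧ (∀ t, 1 ≤ t → γ t = b) ∧ Monotone (fun t => φ (γ t).1) ∧ Monotone (fun t => ψ (γ t).2) := by
  obtain ⟨⟨γ, hγ, hr, h0, h1'⟩, hconn⟩ := hA
  have hmem : ∀ t, γ t ∈ A := fun t => hr ▸ mem_range_self t
  have m1 : Monotone (fun t => φ (γ t).1) := by
    apply monotone_of_isPreconnected_fibers (by fun_prop (disch := exact hγ.continuous))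
    · intro v
      by_cases hv : ∃ t, φ (γ t).1 = v
      · obtain ⟨t, rfl⟩ := hv
        have := (hconn (γ t).1).1
        have e : A ∩ ({(γ t).1} ×ˢ univ) = γ '' ((fun t => φ (γ t).1) ⁻¹' {φ (γ t).1}) := by
          ext z
          constructor
          · rintro ⟨hz, hz1, -⟩
            rw [← hr] at hz
            obtain ⟨s, rfl⟩ := hz
            exact ⟨s, by simp only [mem_singleton_iff] at hz1; simp [hz1], rfl⟩
          · rintro ⟨s, hs, rfl⟩
            refine ⟨hmem s, ?_, mem_univ _⟩
            exact hφi ⟨_, hmem s, rfl⟩ ⟨_, hmem t, rfl⟩ hs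
        rw [e] at this
        exact hγ.isPreconnected_image.1 this
      · have : (fun t => φ (γ t).1) ⁻¹' {v} = ∅ := by
          ext t; simp only [mem_preimage, mem_singleton_iff, mem_empty_iff_false, iff_false]
          exact fun h => hv ⟨t, h⟩
        rw [this]; exact isPreconnected_empty
    · simpa [h0, h1'] using h1
  have m2 : Monotone (fun t => ψ (γ t).2) := by
    apply monotone_of_isPreconnected_fibers (by fun_prop (disch := exact hγ.continuous))
    · intro v
      by_cases hv : ∃ t, ψ (γ t).2 = v
      · obtain ⟨t, rfl⟩ := hv
        have := (hconn (γ t).2).2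
        have e : A ∩ (univ ×ˢ {(γ t).2}) = γ '' ((fun t => ψ (γ t).2) ⁻¹' {ψ (γ t).2}) := by
          ext z
          constructor
          · rintro ⟨hz, -, hz1⟩
            rw [← hr] at hz
            obtain ⟨s, rfl⟩ := hz
            exact ⟨s, by simp only [mem_singleton_iff] at hz1; simp [hz1], rfl⟩
          · rintro ⟨s, hs, rfl⟩
            refine ⟨hmem s, mem_univ _, ?_⟩
            exact hψi ⟨_, hmem s, rfl⟩ ⟨_, hmem t, rfl⟩ hs
        rw [e] at this
        exact hγ.isPreconnected_image.1 this
      · have : (fun t => ψ (γ t).2) ⁻¹' {v} = ∅ := by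
          ext t; simp only [mem_preimage, mem_singleton_iff, mem_empty_iff_false, iff_false]
          exact fun h => hv ⟨t, h⟩
        rw [this]; exact isPreconnected_empty
    · simpa [h0, h1'] using h2
  have hpm : Monotone (projIcc (0 : ℝ) 1 zero_le_one) := monotone_projIcc _
  refine ⟨fun t => γ (projIcc 0 1 zero_le_one t), hγ.continuous.comp continuous_projIcc, ?_,
    fun t => hmem _, ?_, ?_, ?_, m1.comp hpm, m2.comp hpm⟩
  · rw [← hr]
    ext z
    constructor
    · rintro ⟨t, -, rfl⟩; exact mem_range_self _
    · rintro ⟨t, rfl⟩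
      exact ⟨t, t.2, by simp⟩
  · intro s hs t ht h
    have := hγ.injective h
    rw [projIcc_of_mem _ hs, projIcc_of_mem _ ht] at this
    exact congrArg Subtype.val this
  · intro t ht
    show γ (projIcc 0 1 zero_le_one t) = a
    rw [projIcc_of_le_left _ ht]; exact h0
  · intro t ht
    show γ (projIcc 0 1 zero_le_one t) = b
    rw [projIcc_of_right_le _ ht]; exact h1'

theorem ordConnected_fiber_of_monotoneOn {X : ℝ → ℝ} {a b : ℝ}
    (h : MonotoneOn X (Icc a b) ∨ AntitoneOn X (Icc a b)) (c : ℝ) :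
    OrdConnected (Icc a b ∩ X ⁻¹' {c}) := by
  constructor
  rintro x ⟨hx, hxc⟩ y ⟨hy, hyc⟩ z ⟨hxz, hzy⟩
  have hz : z ∈ Icc a b := ⟨hx.1.trans hxz, hzy.trans hy.2⟩
  refine ⟨hz, ?_⟩
  simp only [mem_preimage, mem_singleton_iff] at *
  rcases h with h | h
  · have := h hx hz hxz; have := h hz hy hzy; linarith
  · have := h hx hz hxz; have := h hz hy hzy; linarith

/-- A slice of the image comes from a level set of `X` or `Y`, which is an interval by monotonicity,
or is empty if the line misses the range of `ι` or `κ`. Compactness of `[a, b]` turns injectivity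
into an embedding. -/
theorem isMonotoneArcFromTo_image {Z : Type*} [TopologicalSpace Z] [T2Space Z] {ι κ : ℝ → Z}
    (hι : Continuous ι) (hκ : Continuous κ) (hιi : Function.Injective ι)
    (hκi : Function.Injective κ) {X Y : ℝ → ℝ} {a b : ℝ} (hab : a < b)
    (hXc : ContinuousOn X (Icc a b)) (hYc : ContinuousOn Y (Icc a b))
    (hX : MonotoneOn X (Icc a b) ∨ AntitoneOn X (Icc a b))
    (hY : MonotoneOn Y (Icc a b) ∨ AntitoneOn Y (Icc a b))
    (hinj : ∀ s ∈ Icc a b, ∀ t ∈ Icc a b, X s = X t → Y s = Y t → s = t) :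
    IsMonotoneArcFromTo ((fun t => (ι (X t), κ (Y t))) '' Icc a b)
      (ι (X a), κ (Y a)) (ι (X b), κ (Y b)) := by
  set Γ : ℝ → Z × Z := fun t => (ι (X t), κ (Y t)) with hΓ
  have hΓc : ContinuousOn Γ (Icc a b) :=
    (hι.comp_continuousOn hXc).prodMk (hκ.comp_continuousOn hYc)
  refine ⟨?_, ?_⟩
  · let e : unitInterval ≃ₜ Icc a b := (iccHomeoI a b hab).symm
    refine ⟨fun t => Γ (e t), ?_, ?_, ?_, ?_⟩
    · have hc : Continuous (fun t : unitInterval => Γ (e t)) :=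
        (continuousOn_iff_continuous_domRestrict.1 hΓc).comp e.continuous
      refine (hc.isClosedEmbedding ?_).isEmbedding
      intro s t h
      simp only [hΓ, Prod.mk.injEq] at h
      have := hinj _ (e s).2 _ (e t).2 (hιi h.1) (hκi h.2)
      exact e.injective (Subtype.ext this)
    · ext z
      constructor
      · rintro ⟨t, rfl⟩; exact ⟨e t, (e t).2, rfl⟩
      · rintro ⟨t, ht, rfl⟩
        exact ⟨e.symm ⟨t, ht⟩, by simp⟩
    · have : ((e 0 : Icc a b) : ℝ) = a := by simp [e, iccHomeoI_symm_apply_coe]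
      simp only [this, hΓ]
    · have : ((e 1 : Icc a b) : ℝ) = b := by simp [e, iccHomeoI_symm_apply_coe]
      simp only [this, hΓ]
  · intro x
    constructor
    · have e : Γ '' Icc a b ∩ ({x} ×ˢ univ) = Γ '' (Icc a b ∩ (fun t => ι (X t)) ⁻¹' {x}) := by
        ext z
        constructor
        · rintro ⟨⟨t, ht, rfl⟩, h1, -⟩; exact ⟨t, ⟨ht, h1⟩, rfl⟩
        · rintro ⟨t, ⟨ht, h1⟩, rfl⟩; exact ⟨⟨t, ht, rfl⟩, h1, mem_univ _⟩
      rw [e]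
      refine IsPreconnected.image ?_ _ (hΓc.mono inter_subset_left)
      by_cases hx : ∃ c, ι c = x
      · obtain ⟨c, rfl⟩ := hx
        have := (ordConnected_fiber_of_monotoneOn hX c).isPreconnected
        convert this using 2
        ext t; simp [hιi.eq_iff]
      · convert isPreconnected_empty using 1
        ext t; simp only [mem_inter_iff, mem_preimage, mem_singleton_iff, mem_empty_iff_false,
          iff_false, not_and]
        exact fun _ h => hx ⟨_, h⟩
    · have e : Γ '' Icc a b ∩ (univ ×ˢ {x}) = Γ '' (Icc a b ∩ (fun t => κ (Y t)) ⁻¹' {x}) := by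
        ext z
        constructor
        · rintro ⟨⟨t, ht, rfl⟩, -, h1⟩; exact ⟨t, ⟨ht, h1⟩, rfl⟩
        · rintro ⟨t, ⟨ht, h1⟩, rfl⟩; exact ⟨⟨t, ht, rfl⟩, mem_univ _, h1⟩
      rw [e]
      refine IsPreconnected.image ?_ _ (hΓc.mono inter_subset_left)
      by_cases hx : ∃ c, κ c = x
      · obtain ⟨c, rfl⟩ := hx
        have := (ordConnected_fiber_of_monotoneOn hY c).isPreconnected
        convert this using 2
        ext t; simp [hκi.eq_iff]
      · convert isPreconnected_empty using 1
        ext t; simp only [mem_inter_iff, mem_preimage, mem_singleton_iff, mem_empty_iff_false,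
          iff_false, not_and]
        exact fun _ h => hx ⟨_, h⟩

/-! ### Interpolation -/

/-- The two monotonicities together say that `ρ` is `K`-Lipschitz. -/
theorem continuous_of_monotone_of_monotone_sub {ρ : ℝ → ℝ} {K : ℝ} (h1 : Monotone ρ)
    (h2 : Monotone fun x => K * x - ρ x) : Continuous ρ := by
  have hK : 0 ≤ K := by
    have a := h1 zero_le_one; have b := h2 (zero_le_one (α := ℝ)); simp only at b; linarith
  refine LipschitzWith.continuous (K := ⟨K, hK⟩) (LipschitzWith.of_dist_le_mul fun x y => ?_)
  rw [Real.dist_eq, Real.dist_eq]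
  change _ ≤ K * _
  rcases le_total x y with h | h
  · have a := h1 h; have b := h2 h; simp only at b
    rw [abs_of_nonpos (by linarith), abs_of_nonpos (by linarith)]; linarith
  · have a := h1 h; have b := h2 h; simp only at b
    rw [abs_of_nonneg (by linarith), abs_of_nonneg (by linarith)]; linarith

/-- The interpolant is the lower envelope of the functions that equal `T q` up to `q` and rise with
slope `K` afterwards. The slope bounds on `T` say that none of them undercuts another at its own
node. -/
theorem exists_monotone_interpolation (Q : Finset ℝ) (T : ℝ → ℝ) (K : ℝ) (hK : 0 ≤ K)
    (hT : ∀ q ∈ Q, ∀ q' ∈ Q, q ≤ q' → 0 ≤ T q' - T q ∧ T q' - T q ≤ K * (q' - q)) :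
    ∃ ρ : ℝ → ℝ, Monotone ρ ∧ (Monotone fun x => K * x - ρ x) ∧ ∀ q ∈ Q, ρ q = T q := by
  rcases Q.eq_empty_or_nonempty with rfl | hQ
  · exact ⟨fun _ => 0, monotone_const, by simpa using monotone_id.const_mul hK, by simp⟩
  refine ⟨fun x => Q.inf' hQ fun q => T q + K * max (x - q) 0, ?_, ?_, ?_⟩
  · intro x y hxy
    refine Finset.le_inf' _ _ fun q hq => (Finset.inf'_le _ hq).trans ?_
    gcongr
  · intro x y hxy
    obtain ⟨q, hq, e⟩ := Finset.exists_mem_eq_inf' hQ fun q => T q + K * max (x - q) 0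
    have h2 : (Q.inf' hQ fun q => T q + K * max (y - q) 0) ≤ T q + K * max (y - q) 0 :=
      Finset.inf'_le _ hq
    simp only
    rw [e]
    have : max (y - q) 0 ≤ max (x - q) 0 + (y - x) := by
      apply max_le
      · linarith [le_max_left (x - q) 0]
      · linarith [le_max_right (x - q) 0]
    have := mul_le_mul_of_nonneg_left this hK
    linarith
  · intro q hq
    apply le_antisymm
    · refine (Finset.inf'_le _ hq).trans ?_
      simp
    · refine Finset.le_inf' _ _ fun r hr => ?_
      rcases le_total q r with h | h
      · have := (hT q hq r hr h).1
        have := mul_nonneg hK (le_max_right (q - r) 0)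
        linarith
      · have := (hT r hr q hq h).2
        rw [max_eq_left (by linarith)]
        linarith

theorem exists_strictMono_interpolation (Q : Finset ℝ) (T : ℝ → ℝ)
    (hT : StrictMonoOn T Q) :
    ∃ ρ : ℝ → ℝ, Continuous ρ ∧ StrictMono ρ ∧ ∀ q ∈ Q, ρ q = T q := by
  have h1 : ∀ᶠ c in 𝓝[>] (0 : ℝ), ∀ z ∈ Q ×ˢ Q, z.1 < z.2 → c * (z.2 - z.1) ≤ T z.2 - T z.1 := by
    rw [Filter.eventually_all_finset]
    rintro ⟨q, q'⟩ hz
    rw [Finset.mem_product] at hz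
    simp only at hz
    by_cases hlt : q < q'
    · have hpos : 0 < T q' - T q := sub_pos.2 (hT hz.1 hz.2 hlt)
      have hc : Filter.Tendsto (fun c : ℝ => c * (q' - q)) (𝓝[>] 0) (𝓝 (0 * (q' - q))) :=
        (Continuous.tendsto (by fun_prop) 0).mono_left nhdsWithin_le_nhds
      rw [zero_mul] at hc
      filter_upwards [hc.eventually (gt_mem_nhds hpos)] with c hc _ using hc.le
    · exact Filter.Eventually.of_forall fun c h => absurd h hlt
  have h2 : ∀ᶠ K in Filter.atTop (α := ℝ), ∀ z ∈ Q ×ˢ Q, z.1 < z.2 →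
      T z.2 - T z.1 ≤ K * (z.2 - z.1) := by
    rw [Filter.eventually_all_finset]
    rintro ⟨q, q'⟩ hz
    by_cases hlt : q < q'
    · filter_upwards [Filter.eventually_ge_atTop ((T q' - T q) / (q' - q))] with K hK _
      exact (div_le_iff₀ (sub_pos.2 hlt)).1 hK
    · exact Filter.Eventually.of_forall fun c h => absurd h hlt
  obtain ⟨c, hc, hcpos⟩ := (h1.and self_mem_nhdsWithin).exists
  obtain ⟨K, hK, hK0⟩ := (h2.and (Filter.eventually_ge_atTop c)).exists
  have hcpos : (0 : ℝ) < c := hcpos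
  -- Strictness comes from splitting off a linear function of small slope `c`, below every slope of
  -- `T`, and adding it back afterwards.
  obtain ⟨ρ, m1, m2, e⟩ := exists_monotone_interpolation Q (fun q => T q - c * q) (K - c)
    (by linarith) (by
      intro q hq q' hq' hle
      rcases hle.eq_or_lt with rfl | hlt
      · simp
      · have a := hc (q, q') (Finset.mem_product.2 ⟨hq, hq'⟩) hlt
        have b := hK (q, q') (Finset.mem_product.2 ⟨hq, hq'⟩) hlt
        simp only at a b
        constructor <;> linarith)
  refine ⟨fun x => ρ x + c * x, ?_, ?_, ?_⟩
  · exact (continuous_of_monotone_of_monotone_sub m1 m2).add (by fun_prop)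
  · intro x y hxy
    have := m1 hxy.le
    have := mul_lt_mul_of_pos_left hxy hcpos
    simp only; linarith
  · intro q hq
    simp [e q hq]

/-! ### Matching two monotone functions -/

/-- On each antidiagonal `x + y = s` the difference `lam x - mu (s - x)` is nondecreasing in `x`, so
its zeros form a nonempty compact interval. Both ends of this interval move forward with speed at
most one as `s` grows. Projecting `φ s` to the interval keeps this property, so `X` and `s - X` are
monotone and `X` is Lipschitz. The function `φ` steers the arc: it passes through any solution lying
on the graph of `φ`. -/
theorem exists_matching {lam mu : ℝ → ℝ} (hlc : Continuous lam) (hmc : Continuous mu)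
    (hl : Monotone lam) (hm : Monotone mu) {a b c d : ℝ} (hab : a ≤ b) (hcd : c ≤ d)
    (h0 : lam a = mu c) (h1 : lam b = mu d) {φ : ℝ → ℝ} (hφ : Monotone φ)
    (hφ' : Monotone fun s => s - φ s) :
    ∃ X Y : ℝ → ℝ, (∀ s, X s + Y s = s) ∧ MonotoneOn X (Icc (a + c) (b + d)) ∧
      MonotoneOn Y (Icc (a + c) (b + d)) ∧ ContinuousOn X (Icc (a + c) (b + d)) ∧
      ContinuousOn Y (Icc (a + c) (b + d)) ∧
      ∀ s ∈ Icc (a + c) (b + d), X s ∈ Icc a b ∧ Y s ∈ Icc c d ∧ lam (X s) = mu (Y s) ∧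
        ∀ x ∈ Icc a b, s - x ∈ Icc c d → lam x = mu (s - x) →
          (x ≤ φ s → x ≤ X s) ∧ (φ s ≤ x → X s ≤ x) := by
  set Z : ℝ → Set ℝ := fun s => {x | x ∈ Icc a b ∧ s - x ∈ Icc c d ∧ lam x = mu (s - x)} with hZ
  have hne : ∀ s ∈ Icc (a + c) (b + d), (Z s).Nonempty := by
    rintro s ⟨hs1, hs2⟩
    have hle : max a (s - d) ≤ min b (s - c) := by
      simp only [max_le_iff, le_min_iff]
      refine ⟨⟨hab, by linarith⟩, by linarith, by linarith⟩
    have hF : Continuous fun x => lam x - mu (s - x) := by fun_prop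
    have hlo : lam (max a (s - d)) - mu (s - max a (s - d)) ≤ 0 := by
      rcases le_total a (s - d) with h | h
      · rw [max_eq_right h, sub_sub_cancel, ← h1, sub_nonpos]
        exact hl (by linarith)
      · rw [max_eq_left h, h0, sub_nonpos]
        exact hm (by linarith)
    have hhi : 0 ≤ lam (min b (s - c)) - mu (s - min b (s - c)) := by
      rcases le_total b (s - c) with h | h
      · rw [min_eq_left h, h1, sub_nonneg]
        exact hm (by linarith)
      · rw [min_eq_right h, sub_sub_cancel, ← h0, sub_nonneg]
        exact hl (by linarith)
    obtain ⟨x, hx, hx0⟩ := intermediate_value_Icc hle hF.continuousOn (mem_Icc.2 ⟨hlo, hhi⟩)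
    have e1 := (le_max_left a (s - d)).trans hx.1
    have e2 := (le_max_right a (s - d)).trans hx.1
    have e3 := hx.2.trans (min_le_left b (s - c))
    have e4 := hx.2.trans (min_le_right b (s - c))
    simp only at hx0
    exact ⟨x, ⟨e1, e3⟩, ⟨by linarith, by linarith⟩, by linarith⟩
  have hcpt : ∀ s, IsCompact (Z s) := by
    intro s
    refine isCompact_Icc.of_isClosed_subset ?_ (fun x hx => hx.1 : Z s ⊆ Icc a b)
    have e : Z s = Icc a b ∩ ((fun x => s - x) ⁻¹' Icc c d ∩ {x | lam x = mu (s - x)}) := rfl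
    rw [e]
    exact isClosed_Icc.inter ((isClosed_Icc.preimage (by fun_prop)).inter
      (isClosed_eq hlc (by fun_prop)))
  have hoc : ∀ s, ∀ x ∈ Z s, ∀ y ∈ Z s, ∀ z, x ≤ z → z ≤ y → z ∈ Z s := by
    rintro s x ⟨hx, hx', hxe⟩ y ⟨hy, hy', hye⟩ z hxz hzy
    refine ⟨⟨hx.1.trans hxz, hzy.trans hy.2⟩, ⟨by linarith [hy'.1], by linarith [hx'.2]⟩, ?_⟩
    have := hl hxz; have := hl hzy
    have := hm (show s - z ≤ s - x by linarith)
    have := hm (show s - y ≤ s - z by linarith)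
    linarith
  -- Exchange argument: solutions that move in the wrong order as `s` grows can be swapped between
  -- the two antidiagonals. `swap2` is the same with the roles of the coordinates exchanged.
  have swap1 : ∀ s s' x x', s ≤ s' → x ∈ Z s → x' ∈ Z s' → x' < x → x' ∈ Z s ∧ x ∈ Z s' := by
    rintro s s' x x' hs ⟨hx, hx', hxe⟩ ⟨hy, hy', hye⟩ hlt
    have i1 := hl hlt.le
    have i2 := hm (show s - x ≤ s - x' by linarith)
    have i3 := hm (show s - x' ≤ s' - x' by linarith)
    have i4 := hm (show s - x ≤ s' - x by linarith)
    have i5 := hm (show s' - x ≤ s' - x' by linarith)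
    refine ⟨⟨hy, ⟨by linarith [hx'.1], by linarith [hy'.2]⟩, by linarith⟩,
      ⟨hx, ⟨by linarith [hx'.1], by linarith [hy'.2]⟩, by linarith⟩⟩
  have swap2 : ∀ s s' x x', s ≤ s' → x ∈ Z s → x' ∈ Z s' → x + (s' - s) < x' →
      x + (s' - s) ∈ Z s' ∧ x' - (s' - s) ∈ Z s := by
    rintro s s' x x' hs ⟨hx, hx', hxe⟩ ⟨hy, hy', hye⟩ hlt
    have i1 := hl (show x ≤ x + (s' - s) by linarith)
    have i2 := hl hlt.le
    have i3 := hm (show s' - x' ≤ s - x by linarith)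
    have i4 := hl (show x' - (s' - s) ≤ x' by linarith)
    have i5 := hl (show x ≤ x' - (s' - s) by linarith)
    have e1 : s' - (x + (s' - s)) = s - x := by ring
    have e2 : s - (x' - (s' - s)) = s' - x' := by ring
    refine ⟨⟨⟨by linarith [hx.1], by linarith [hy.2]⟩, ⟨?_, ?_⟩, ?_⟩,
      ⟨⟨by linarith [hx.1], by linarith [hy.2]⟩, ⟨?_, ?_⟩, ?_⟩⟩ <;>
      first | rw [e1] | rw [e2]
    · exact hx'.1
    · exact hx'.2
    · linarith
    · exact hy'.1
    · exact hy'.2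
    · linarith
  set lo : ℝ → ℝ := fun s => sInf (Z s) with hlo
  set hi : ℝ → ℝ := fun s => sSup (Z s) with hhi
  have lomem : ∀ s ∈ Icc (a + c) (b + d), lo s ∈ Z s := fun s hs => (hcpt s).sInf_mem (hne s hs)
  have himem : ∀ s ∈ Icc (a + c) (b + d), hi s ∈ Z s := fun s hs => (hcpt s).sSup_mem (hne s hs)
  have lole : ∀ s, ∀ x ∈ Z s, lo s ≤ x := fun s x hx => csInf_le (hcpt s).bddBelow hx
  have lehi : ∀ s, ∀ x ∈ Z s, x ≤ hi s := fun s x hx => le_csSup (hcpt s).bddAbove hx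
  have lo1 : MonotoneOn lo (Icc (a + c) (b + d)) := by
    intro s hs s' hs' h
    by_contra! hlt
    have := lole _ _ (swap1 s s' _ _ h (lomem s hs) (lomem s' hs') hlt).1
    linarith
  have hi1 : MonotoneOn hi (Icc (a + c) (b + d)) := by
    intro s hs s' hs' h
    by_contra! hlt
    have := lehi _ _ (swap1 s s' _ _ h (himem s hs) (himem s' hs') hlt).2
    linarith
  have lo2 : MonotoneOn (fun s => s - lo s) (Icc (a + c) (b + d)) := by
    intro s hs s' hs' h
    by_contra! hlt
    have := lole _ _ (swap2 s s' _ _ h (lomem s hs) (lomem s' hs') (by linarith)).1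
    linarith
  have hi2 : MonotoneOn (fun s => s - hi s) (Icc (a + c) (b + d)) := by
    intro s hs s' hs' h
    by_contra! hlt
    have := lehi _ _ (swap2 s s' _ _ h (himem s hs) (himem s' hs') (by linarith)).2
    linarith
  set X : ℝ → ℝ := fun s => max (lo s) (min (φ s) (hi s)) with hX
  have Xm : MonotoneOn X (Icc (a + c) (b + d)) := by
    intro s hs s' hs' h
    exact max_le_max (lo1 hs hs' h) (min_le_min (hφ h) (hi1 hs hs' h))
  have Ym : MonotoneOn (fun s => s - X s) (Icc (a + c) (b + d)) := by
    intro s hs s' hs' h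
    have e : ∀ s, s - X s = min (s - lo s) (max (s - φ s) (s - hi s)) := by
      intro s; simp only [hX]
      rcases le_total (φ s) (hi s) with h1 | h1
      · rw [min_eq_left h1, max_eq_left (sub_le_sub_left h1 s)]
        exact (min_sub_sub_left s _ _).symm
      · rw [min_eq_right h1, max_eq_right (sub_le_sub_left h1 s)]
        exact (min_sub_sub_left s _ _).symm
    simp only [e]
    exact min_le_min (lo2 hs hs' h) (max_le_max (hφ' h) (hi2 hs hs' h))
  have Xmem : ∀ s ∈ Icc (a + c) (b + d), X s ∈ Z s := by
    intro s hs
    refine hoc s _ (lomem s hs) _ (himem s hs) _ (le_max_left _ _) ?_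
    exact max_le (lole s _ (himem s hs)) (min_le_right _ _)
  have Xc : ContinuousOn X (Icc (a + c) (b + d)) := by
    refine LipschitzOnWith.continuousOn (K := 1) (LipschitzOnWith.of_dist_le_mul ?_)
    intro s hs s' hs'
    rw [Real.dist_eq, Real.dist_eq, NNReal.coe_one, one_mul]
    rcases le_total s s' with h | h
    · have a1 := Xm hs hs' h; have a2 := Ym hs hs' h; simp only at a2
      rw [abs_of_nonpos (by linarith), abs_of_nonpos (by linarith)]; linarith
    · have a1 := Xm hs' hs h; have a2 := Ym hs' hs h; simp only at a2
      rw [abs_of_nonneg (by linarith), abs_of_nonneg (by linarith)]; linarith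
  refine ⟨X, fun s => s - X s, fun s => by ring, Xm, Ym, Xc, by fun_prop, ?_⟩
  intro s hs
  refine ⟨(Xmem s hs).1, (Xmem s hs).2.1, (Xmem s hs).2.2, ?_⟩
  intro x hx hx' hxe
  have hxZ : x ∈ Z s := ⟨hx, hx', hxe⟩
  exact ⟨fun h => (le_min h (lehi s x hxZ)).trans (le_max_right _ _),
    fun h => max_le (lole s x hxZ) ((min_le_left _ _).trans h)⟩

/-! ### Counting connected components -/

/-- The image of a component under `φ` is an interval; one containing both `φ (p i)` and `φ (p j)`
would contain the omitted level `z`. -/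
theorem le_card_connectedComponents {α ι : Type*} [TopologicalSpace α] [Fintype ι] {S : Set α}
    (p : ι → α) (hp : ∀ i, p i ∈ S) {φ : α → ℝ} (hφ : Continuous φ)
    (hsep : ∀ i j, i ≠ j → φ (p i) ≤ φ (p j) →
      ∃ z, φ (p i) ≤ z ∧ z ≤ φ (p j) ∧ ∀ x ∈ S, φ x ≠ z) :
    (Fintype.card ι : ℕ∞) ≤ ENat.card (ConnectedComponents S) := by
  have hinj : Function.Injective fun i => ((⟨p i, hp i⟩ : S) : ConnectedComponents S) := by
    have key : ∀ i j, φ (p i) ≤ φ (p j) →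
        ((⟨p i, hp i⟩ : S) : ConnectedComponents S) = ((⟨p j, hp j⟩ : S) : ConnectedComponents S) →
        i = j := by
      intro i j hle h
      by_contra hij
      obtain ⟨z, hz1, hz2, hz⟩ := hsep i j hij hle
      rw [ConnectedComponents.coe_eq_coe'] at h
      have hpre : IsPreconnected ((fun x : S => φ x) '' connectedComponent (⟨p j, hp j⟩ : S)) :=
        isPreconnected_connectedComponent.image _ (by fun_prop)
      obtain ⟨x, -, hx⟩ := hpre.ordConnected.out ⟨_, h, rfl⟩ ⟨_, mem_connectedComponent, rfl⟩
        (mem_Icc.2 ⟨hz1, hz2⟩)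
      exact hz x x.2 hx
    intro i j h
    rcases le_total (φ (p i)) (φ (p j)) with h' | h'
    · exact key i j h' h
    · exact (key j i h' h.symm).symm
  calc (Fintype.card ι : ℕ∞) = ENat.card ι := by simp
    _ ≤ _ := ENat.card_le_card_of_injective hinj

/-! ### The tent map and the triangle wave -/

theorem tau_of_le {x : ℝ} (h : x ≤ 1 / 2) : tau x = 2 * x := if_pos h

theorem tau_of_ge {x : ℝ} (h : 1 / 2 ≤ x) : tau x = 2 - 2 * x := by
  rcases h.eq_or_lt with rfl | h
  · norm_num [tau]
  · exact if_neg (not_le.2 h)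

theorem tau_mem {x : ℝ} (h : x ∈ Icc (0 : ℝ) 1) : tau x ∈ Icc (0 : ℝ) 1 := by
  rcases le_total x (1 / 2) with h' | h'
  · rw [tau_of_le h']; constructor <;> linarith [h.1]
  · rw [tau_of_ge h']; constructor <;> linarith [h.2]

theorem iterate_tau_mem {x : ℝ} (h : x ∈ Icc (0 : ℝ) 1) (m : ℕ) : tau^[m] x ∈ Icc (0 : ℝ) 1 := by
  induction m with
  | zero => exact h
  | succ m ih => rw [Function.iterate_succ_apply']; exact tau_mem ih

theorem tau_zero : tau 0 = 0 := by norm_num [tau]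
theorem tau_one : tau 1 = 0 := by norm_num [tau]
theorem tau_third : tau (1 / 3) = 2 / 3 := by norm_num [tau]
theorem tau_two_thirds : tau (2 / 3) = 2 / 3 := by norm_num [tau]

theorem iterate_tau_le (x : ℝ) (m : ℕ) : tau^[m] x ≤ 2 ^ m * x := by
  induction m with
  | zero => simp
  | succ m ih =>
    rw [Function.iterate_succ_apply', pow_succ]
    rcases le_total (tau^[m] x) (1 / 2) with h' | h'
    · rw [tau_of_le h']; linarith
    · rw [tau_of_ge h']; linarith

theorem abs_iterate_tau_sub_le (x : ℝ) (m : ℕ) :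
    |tau^[m] x - 2 / 3| ≤ 2 ^ m * |x - 2 / 3| := by
  induction m with
  | zero => simp
  | succ m ih =>
    rw [Function.iterate_succ_apply', pow_succ]
    have : |tau (tau^[m] x) - 2 / 3| ≤ 2 * |tau^[m] x - 2 / 3| := by
      rw [abs_le]
      rcases le_total (tau^[m] x) (1 / 2) with h' | h'
      · rw [tau_of_le h', abs_of_nonpos (by linarith)]; constructor <;> linarith
      · rw [tau_of_ge h']
        constructor <;> cases abs_cases (tau^[m] x - 2 / 3) <;> linarith
    linarith

theorem finite_tau_preimage {S : Set ℝ} (hS : S.Finite) : (tau ⁻¹' S).Finite := by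
  refine ((hS.image fun y => y / 2).union (hS.image fun y => 1 - y / 2)).subset ?_
  intro x hx
  rcases le_total x (1 / 2) with h' | h'
  · left; exact ⟨_, hx, by simp [tau_of_le h']⟩
  · right; exact ⟨_, hx, by simp only [tau_of_ge h']; ring⟩

theorem finite_iterate_tau_preimage {S : Set ℝ} (hS : S.Finite) (m : ℕ) :
    {x | tau^[m] x ∈ S}.Finite := by
  induction m with
  | zero => simpa using hS
  | succ m ih =>
    have e : {x | tau^[m + 1] x ∈ S} = tau ⁻¹' {x | tau^[m] x ∈ S} := by
      ext x; simp [Function.iterate_succ_apply]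
    rw [e]; exact finite_tau_preimage ih

theorem finite_tauPre (m : ℕ) : (tauPre m).Finite :=
  (finite_iterate_tau_preimage (S := {1 / 3, 1}) (toFinite _) m).subset fun _ hx => hx.2

theorem finite_attachPts (n : ℕ) : (attachPts n).Finite := by
  refine (toFinite _).union ?_
  exact (finite_lt_nat n).biUnion fun m _ => finite_tauPre m

/-- The triangle wave with period `2`, on `[0, 6]`. -/
def wave (z : ℝ) : ℝ := 1 - |(|(|z - 3| - 1)| - 1)|

theorem continuous_wave : Continuous wave := by unfold wave; fun_prop

theorem wave_symm (z : ℝ) : wave (6 - z) = wave z := by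
  unfold wave
  rw [show 6 - z - 3 = -(z - 3) by ring, abs_neg]

theorem wave_eq₁ {z : ℝ} (_h0 : 0 ≤ z) (h1 : z ≤ 1) : wave z = z := by
  unfold wave
  rw [abs_of_nonpos (show z - 3 ≤ 0 by linarith), abs_of_nonneg (show 0 ≤ -(z - 3) - 1 by linarith),
    abs_of_nonneg (by linarith)]
  ring

theorem wave_eq₂ {z : ℝ} (h0 : 1 ≤ z) (h1 : z ≤ 2) : wave z = 2 - z := by
  unfold wave
  rw [abs_of_nonpos (show z - 3 ≤ 0 by linarith), abs_of_nonneg (show 0 ≤ -(z - 3) - 1 by linarith),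
    abs_of_nonpos (by linarith)]
  ring

theorem wave_eq₃ {z : ℝ} (h0 : 2 ≤ z) (h1 : z ≤ 3) : wave z = z - 2 := by
  unfold wave
  rw [abs_of_nonpos (show z - 3 ≤ 0 by linarith), abs_of_nonpos (show -(z - 3) - 1 ≤ 0 by linarith),
    abs_of_nonpos (by linarith)]
  ring

theorem wave_eq₄ {z : ℝ} (h0 : 3 ≤ z) (h1 : z ≤ 4) : wave z = 4 - z := by
  rw [← wave_symm, wave_eq₃ (by linarith) (by linarith)]; ring

theorem wave_eq₅ {z : ℝ} (h0 : 4 ≤ z) (h1 : z ≤ 5) : wave z = z - 4 := by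
  rw [← wave_symm, wave_eq₂ (by linarith) (by linarith)]; ring

theorem wave_eq₆ {z : ℝ} (h0 : 5 ≤ z) (h1 : z ≤ 6) : wave z = 6 - z := by
  rw [← wave_symm, wave_eq₁ (by linarith) (by linarith)]

theorem wave_mem {z : ℝ} (h : z ∈ Icc (0 : ℝ) 6) : wave z ∈ Icc (0 : ℝ) 1 := by
  obtain ⟨h0, h6⟩ := h
  rcases le_total z 1 with h | h1
  · rw [wave_eq₁ h0 h]; constructor <;> linarith
  rcases le_total z 2 with h | h2
  · rw [wave_eq₂ h1 h]; constructor <;> linarith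
  rcases le_total z 3 with h | h3
  · rw [wave_eq₃ h2 h]; constructor <;> linarith
  rcases le_total z 4 with h | h4
  · rw [wave_eq₄ h3 h]; constructor <;> linarith
  rcases le_total z 5 with h | h5
  · rw [wave_eq₅ h4 h]; constructor <;> linarith
  · rw [wave_eq₆ h5 h6]; constructor <;> linarith

/-- The wave folds the line onto `[0, 1]` and turns doubling into the tent map. This is the reason
why tent maps of different degrees commute. -/
theorem tau_wave {z : ℝ} (h : z ∈ Icc (0 : ℝ) 3) : tau (wave z) = wave (2 * z) := by
  obtain ⟨h0, h3⟩ := h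
  rcases le_total z 1 with h | h1
  · rw [wave_eq₁ h0 h]
    rcases le_total z (1 / 2) with h' | h'
    · rw [tau_of_le h', wave_eq₁ (by linarith) (by linarith)]
    · rw [tau_of_ge h', wave_eq₂ (by linarith) (by linarith)]
  rcases le_total z 2 with h | h2
  · rw [wave_eq₂ h1 h]
    rcases le_total z (3 / 2) with h' | h'
    · rw [tau_of_ge (by linarith), wave_eq₃ (by linarith) (by linarith)]; ring
    · rw [tau_of_le (by linarith), wave_eq₄ (by linarith) (by linarith)]; ring
  · rw [wave_eq₃ h2 h3]
    rcases le_total z (5 / 2) with h' | h'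
    · rw [tau_of_le (by linarith), wave_eq₅ (by linarith) (by linarith)]; ring
    · rw [tau_of_ge (by linarith), wave_eq₆ (by linarith) (by linarith)]; ring

/-- The tent map with three monotone branches. -/
def tau3 (x : ℝ) : ℝ := wave (3 * x)

theorem tau3_mem {x : ℝ} (h : x ∈ Icc (0 : ℝ) 1) : tau3 x ∈ Icc (0 : ℝ) 1 :=
  wave_mem ⟨by linarith [h.1], by linarith [h.2]⟩

theorem tau_tau3 {x : ℝ} (h : x ∈ Icc (0 : ℝ) 1) : tau (tau3 x) = wave (6 * x) := by
  rw [tau3, tau_wave ⟨by linarith [h.1], by linarith [h.2]⟩]; congr 1; ring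

/-- Both sides are `wave (6 * x)`; on the right half this uses the symmetry of the wave about `3`.
-/
theorem tau3_tau {x : ℝ} (h : x ∈ Icc (0 : ℝ) 1) : tau3 (tau x) = tau (tau3 x) := by
  rw [tau_tau3 h, tau3]
  rcases le_total x (1 / 2) with h' | h'
  · rw [tau_of_le h']; congr 1; ring
  · rw [tau_of_ge h', ← wave_symm]; congr 1; ring

theorem iterate_tau_tau3 {x : ℝ} (h : x ∈ Icc (0 : ℝ) 1) (m : ℕ) :
    tau^[m] (tau3 x) = tau3 (tau^[m] x) := by
  induction m with
  | zero => rfl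
  | succ m ih =>
    rw [Function.iterate_succ_apply', Function.iterate_succ_apply', ih,
      tau3_tau (iterate_tau_mem h m)]

theorem tau3_zero : tau3 0 = 0 := by rw [tau3, wave_eq₁] <;> norm_num
theorem tau3_one : tau3 1 = 1 := by rw [tau3, wave_eq₃] <;> norm_num
theorem tau3_third : tau3 (1 / 3) = 1 := by rw [tau3, wave_eq₁] <;> norm_num
theorem tau3_two_thirds : tau3 (2 / 3) = 0 := by rw [tau3, wave_eq₂] <;> norm_num

/-! ### Orbits of the attaching points -/

theorem iterate_tau_add (x : ℝ) (m k : ℕ) : tau^[m + k] x = tau^[m] (tau^[k] x) :=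
  Function.iterate_add_apply _ _ _ _

theorem iterate_tau_fixed {x : ℝ} (h : tau x = x) (m : ℕ) : tau^[m] x = x :=
  Function.iterate_fixed h m

/-- After meeting `1/3` or `1` the orbit rests at the fixed point `2/3` or `0`. Hence the sets
`tauPre m` are pairwise disjoint and avoid both fixed points. -/
theorem tauPre_later {q : ℝ} {m k : ℕ} (h : q ∈ tauPre m) (hk : m < k) :
    tau^[k] q = 0 ∨ tau^[k] q = 2 / 3 := by
  obtain ⟨d, rfl⟩ := Nat.exists_eq_add_of_lt hk
  rw [show m + d + 1 = d + 1 + m by ring, iterate_tau_add, Function.iterate_succ_apply]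
  rcases h.2 with h | h
  · rw [h, tau_third, iterate_tau_fixed tau_two_thirds]; simp
  · rw [mem_singleton_iff.1 h, tau_one, iterate_tau_fixed tau_zero]; simp

theorem tauPre_unique {q : ℝ} {m k : ℕ} (h : q ∈ tauPre m) (h' : q ∈ tauPre k) : m = k := by
  by_contra hne
  wlog hlt : m < k generalizing m k
  · exact this h' h (Ne.symm hne) (by omega)
  have h2 := h'.2
  simp only [mem_insert_iff, mem_singleton_iff] at h2
  rcases tauPre_later h hlt with e | e <;> rw [e] at h2 <;> norm_num at h2

theorem zero_notMem_tauPre (m : ℕ) : (0 : ℝ) ∉ tauPre m := by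
  intro h
  have := h.2
  rw [iterate_tau_fixed tau_zero] at this
  norm_num at this

theorem two_thirds_notMem_tauPre (m : ℕ) : (2 / 3 : ℝ) ∉ tauPre m := by
  intro h
  have := h.2
  rw [iterate_tau_fixed tau_two_thirds] at this
  norm_num at this

theorem tau_mem_tauPre {q : ℝ} {m : ℕ} (h : q ∈ tauPre (m + 1)) : tau q ∈ tauPre m :=
  ⟨tau_mem h.1, by rw [← Function.iterate_succ_apply]; exact h.2⟩

theorem tau_of_mem_tauPre_zero {q : ℝ} (h : q ∈ tauPre 0) :
    (q = 1 / 3 ∧ tau q = 2 / 3) ∨ (q = 1 ∧ tau q = 0) := by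
  rcases h.2 with h | h
  · left; simp only [Function.iterate_zero, id] at h; exact ⟨h, by rw [h, tau_third]⟩
  · right; simp only [Function.iterate_zero, id, mem_singleton_iff] at h
    exact ⟨h, by rw [h, tau_one]⟩

theorem iterate_tau_tau3_tauPre {q : ℝ} {m : ℕ} (h : q ∈ tauPre m) : tau^[m] (tau3 q) = 1 := by
  rw [iterate_tau_tau3 h.1]
  rcases h.2 with h | h
  · rw [h, tau3_third]
  · rw [mem_singleton_iff.1 h, tau3_one]

theorem tau3_mem_tauPre {q : ℝ} {m : ℕ} (h : q ∈ tauPre m) : tau3 q ∈ tauPre m :=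
  ⟨tau3_mem h.1, by rw [iterate_tau_tau3_tauPre h]; simp⟩

/-- An iterate of `tau` stretches distances from the fixed point `0` by at most `2 ^ m`; the
companion `tauPre_dist` does the same at `2/3`. These bounds keep the attaching points clear of the
small neighbourhoods where `Γ` leaves the graph of `tau`. -/
theorem tauPre_ge {q : ℝ} {m : ℕ} (h : q ∈ tauPre m) : 1 / (3 * 2 ^ m) ≤ q := by
  have h1 := iterate_tau_le q m
  have h2 : (1 / 3 : ℝ) ≤ tau^[m] q := by
    rcases h.2 with h | h
    · rw [h]
    · rw [mem_singleton_iff.1 h]; norm_num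
  rw [div_le_iff₀ (by positivity)]
  nlinarith

theorem tauPre_dist {q : ℝ} {m : ℕ} (h : q ∈ tauPre m) : 1 / (3 * 2 ^ m) ≤ |q - 2 / 3| := by
  have h1 := abs_iterate_tau_sub_le q m
  have h2 : (1 / 3 : ℝ) ≤ |tau^[m] q - 2 / 3| := by
    rcases h.2 with h | h
    · rw [h]; norm_num [abs_of_nonpos]
    · rw [mem_singleton_iff.1 h]; norm_num
  rw [div_le_iff₀ (by positivity)]
  nlinarith

/-! ### The period three orbit and its preimages -/

/-- The orbit of period three over the fixed point `2 / 3`. -/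
def cyc : Set ℝ := {2 / 9, 4 / 9, 8 / 9}

theorem finite_cyc : cyc.Finite := toFinite {2 / 9, 4 / 9, 8 / 9}

/-- The preimages of the orbit of period three under the `n`-th iterate of the tent map. -/
noncomputable def excPts (n : ℕ) : Finset ℝ :=
  ((finite_iterate_tau_preimage finite_cyc n).inter_of_right (Icc 0 1)).toFinset

theorem mem_excPts {n : ℕ} {x : ℝ} : x ∈ excPts n ↔ x ∈ Icc (0 : ℝ) 1 ∧ tau^[n] x ∈ cyc := by
  simp [excPts]

theorem tau_mem_cyc {x : ℝ} (h : x ∈ cyc) : tau x ∈ cyc := by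
  rcases h with rfl | rfl | rfl <;> norm_num [tau, cyc]

theorem iterate_tau_mem_cyc {x : ℝ} (h : x ∈ cyc) (m : ℕ) : tau^[m] x ∈ cyc := by
  induction m with
  | zero => exact h
  | succ m ih => rw [Function.iterate_succ_apply']; exact tau_mem_cyc ih

theorem cyc_subset_Icc {x : ℝ} (h : x ∈ cyc) : x ∈ Icc (0 : ℝ) 1 := by
  rcases h with rfl | rfl | rfl <;> norm_num

theorem cyc_subset_excPts (n : ℕ) {x : ℝ} (h : x ∈ cyc) : x ∈ excPts n :=
  mem_excPts.2 ⟨cyc_subset_Icc h, iterate_tau_mem_cyc h n⟩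

theorem excPts_subset_succ {n : ℕ} {x : ℝ} (h : x ∈ excPts n) : x ∈ excPts (n + 1) := by
  rw [mem_excPts] at *
  exact ⟨h.1, by rw [Function.iterate_succ_apply']; exact tau_mem_cyc h.2⟩

theorem excPts_later {n k : ℕ} {x : ℝ} (h : x ∈ excPts n) (hk : n ≤ k) : tau^[k] x ∈ cyc := by
  obtain ⟨d, rfl⟩ := Nat.exists_eq_add_of_le hk
  rw [add_comm, iterate_tau_add]
  exact iterate_tau_mem_cyc (mem_excPts.1 h).2 d

theorem mem_excPts_succ {n : ℕ} {x : ℝ} (hx : x ∈ Icc (0 : ℝ) 1) :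
    x ∈ excPts (n + 1) ↔ tau x ∈ excPts n := by
  rw [mem_excPts, mem_excPts, Function.iterate_succ_apply]
  simp [hx, tau_mem hx]

/-- One orbit ends in a cycle of period three, the other at a fixed point. Consequently excursions
on the interval never start at an attaching point. -/
theorem excPts_disjoint_tauPre {n m : ℕ} {x : ℝ} (h : x ∈ excPts n) : x ∉ tauPre m := by
  intro h'
  have h1 := excPts_later h (le_max_left n (m + 1))
  have h2 := tauPre_later h' (show m < max n (m + 1) by simp)
  rcases h2 with e | e <;> rw [e] at h1 <;> norm_num [cyc] at h1

theorem excPts_ne_zero {n : ℕ} {x : ℝ} (h : x ∈ excPts n) : x ≠ 0 := by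
  rintro rfl
  have h1 := (mem_excPts.1 h).2
  rw [iterate_tau_fixed tau_zero] at h1
  norm_num [cyc] at h1

theorem excPts_ne_two_thirds {n : ℕ} {x : ℝ} (h : x ∈ excPts n) : x ≠ 2 / 3 := by
  rintro rfl
  have h1 := (mem_excPts.1 h).2
  rw [iterate_tau_fixed tau_two_thirds] at h1
  norm_num [cyc] at h1

theorem excPts_ne_half {n : ℕ} {x : ℝ} (h : x ∈ excPts n) : x ≠ 1 / 2 := by
  rintro rfl
  exact excPts_disjoint_tauPre (m := 1) h ⟨by norm_num, by norm_num [tau]⟩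

theorem excPts_ne_one {n : ℕ} {x : ℝ} (h : x ∈ excPts n) : x ≠ 1 := by
  rintro rfl
  exact excPts_disjoint_tauPre (m := 0) h ⟨by norm_num, by norm_num⟩

theorem excPts_notMem_attachPts {n k : ℕ} {x : ℝ} (h : x ∈ excPts n) : x ∉ attachPts k := by
  rintro (h' | h')
  · rcases h' with h' | h'
    · exact excPts_ne_zero h h'
    · exact excPts_ne_two_thirds h h'
  · simp only [mem_iUnion] at h'
    obtain ⟨m, -, h'⟩ := h'
    exact excPts_disjoint_tauPre h h'

theorem excPts_pos {n : ℕ} {x : ℝ} (h : x ∈ excPts n) : 0 < x :=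
  lt_of_le_of_ne (mem_excPts.1 h).1.1 (excPts_ne_zero h).symm

theorem excPts_lt_one {n : ℕ} {x : ℝ} (h : x ∈ excPts n) : x < 1 :=
  lt_of_le_of_ne (mem_excPts.1 h).1.2 (excPts_ne_one h)

theorem excPts_ge {n : ℕ} {x : ℝ} (h : x ∈ excPts n) : 2 / (9 * 2 ^ n) ≤ x := by
  rw [mem_excPts] at h
  have h1 := iterate_tau_le x n
  have h2 : (2 / 9 : ℝ) ≤ tau^[n] x := by
    rcases h.2 with h | h | h <;> rw [h] <;> norm_num
  rw [div_le_iff₀ (by positivity)]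
  nlinarith

theorem excPts_dist {n : ℕ} {x : ℝ} (h : x ∈ excPts n) : 2 / (9 * 2 ^ n) ≤ |x - 2 / 3| := by
  rw [mem_excPts] at h
  have h1 := abs_iterate_tau_sub_le x n
  have h2 : (2 / 9 : ℝ) ≤ |tau^[n] x - 2 / 3| := by
    rcases h.2 with h | h | h <;> rw [h] <;> norm_num [abs_of_nonpos, abs_of_nonneg]
  rw [div_le_iff₀ (by positivity)]
  nlinarith

theorem half_mem_excPts {n : ℕ} {x : ℝ} (h : x ∈ excPts n) : x / 2 ∈ excPts (n + 1) := by
  have := (mem_excPts.1 h).1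
  rw [mem_excPts_succ ⟨by linarith [this.1], by linarith [this.2]⟩,
    tau_of_le (by linarith [this.2])]
  convert h using 1; ring

theorem one_sub_half_mem_excPts {n : ℕ} {x : ℝ} (h : x ∈ excPts n) :
    1 - x / 2 ∈ excPts (n + 1) := by
  have := (mem_excPts.1 h).1
  rw [mem_excPts_succ ⟨by linarith [this.2], by linarith [this.1]⟩,
    tau_of_ge (by linarith [this.2])]
  convert h using 1; ring

theorem tau3_cyc {x : ℝ} (h : x ∈ cyc) : tau3 x = 2 / 3 := by
  rcases h with rfl | rfl | rfl
  · rw [tau3, wave_eq₁] <;> norm_num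
  · rw [tau3, wave_eq₂] <;> norm_num
  · rw [tau3, wave_eq₃] <;> norm_num

/-- Let `m + 1` be the first time the orbit of `x` enters the cycle. Each point of the cycle has
just one preimage outside it, namely `1/9`, `7/9` or `5/9`, and `tau3` sends all three to `1/3`. So
the orbit of `tau3 x` meets `1/3` at time `m`. In other words, away from the cycle an excursion
point lies over a triod of generation `m`. -/
theorem tau3_excPts {n : ℕ} {x : ℝ} (h : x ∈ excPts (n + 1)) (hc : x ∉ cyc) :
    ∃ m ≤ n, tau3 x ∈ tauPre m ∧ (x ∈ excPts n ↔ m < n) := by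
  have hx := (mem_excPts.1 h).1
  classical
  have hex : ∃ m, tau^[m] x ∈ cyc := ⟨_, (mem_excPts.1 h).2⟩
  obtain ⟨m, hm⟩ : ∃ m, Nat.find hex = m + 1 := by
    apply Nat.exists_eq_succ_of_ne_zero
    intro h0
    rw [Nat.find_eq_zero] at h0
    exact hc h0
  have h1 : tau^[m + 1] x ∈ cyc := hm ▸ Nat.find_spec hex
  have h2 : tau^[m] x ∉ cyc := Nat.find_min hex (by omega)
  have hy := iterate_tau_mem hx m
  rw [Function.iterate_succ_apply'] at h1
  have h3 : tau3 (tau^[m] x) = 1 / 3 := by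
    set y := tau^[m] x
    rcases le_total y (1 / 2) with h' | h'
    · rw [tau_of_le h'] at h1
      rcases h1 with h1 | h1 | h1
      · have : y = 1 / 9 := by linarith
        rw [this, tau3, wave_eq₁] <;> norm_num
      · exact absurd (by left; linarith) h2
      · exact absurd (by right; left; rw [mem_singleton_iff] at h1; linarith) h2
    · rw [tau_of_ge h'] at h1
      rcases h1 with h1 | h1 | h1
      · exact absurd (by right; right; rw [mem_singleton_iff]; linarith) h2
      · have : y = 7 / 9 := by linarith
        rw [this, tau3, wave_eq₃] <;> norm_num
      · have : y = 5 / 9 := by rw [mem_singleton_iff] at h1; linarith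
        rw [this, tau3, wave_eq₂] <;> norm_num
  refine ⟨m, ?_, ⟨tau3_mem hx, ?_⟩, ?_⟩
  · have := Nat.find_min' hex (mem_excPts.1 h).2
    omega
  · rw [iterate_tau_tau3 hx, h3]; simp
  · constructor
    · intro h'
      have := Nat.find_min' hex (mem_excPts.1 h').2
      omega
    · intro h'
      refine mem_excPts.2 ⟨hx, ?_⟩
      obtain ⟨d, rfl⟩ := Nat.exists_eq_add_of_lt h'
      rw [show m + d + 1 = d + (m + 1) by ring, iterate_tau_add]
      apply iterate_tau_mem_cyc
      rw [Function.iterate_succ_apply']; exact h1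

open Classical in
/-- The leg visited by the excursion at `x`. -/
noncomputable def legIdx (x : ℝ) : Fin 3 :=
  if h : ∃ m, tau^[m] x ∈ cyc then
    if tau^[Nat.find h] x = 2 / 9 then 0 else if tau^[Nat.find h] x = 4 / 9 then 1 else 2
  else 0

/-- Off the cycle the leg index is transported unchanged, as (C5) demands. -/
theorem legIdx_of_notMem {x : ℝ} (h : x ∉ cyc) : legIdx x = legIdx (tau x) := by
  classical
  by_cases hex : ∃ m, tau^[m] (tau x) ∈ cyc
  · have hex' : ∃ m, tau^[m] x ∈ cyc := by
      obtain ⟨m, hm⟩ := hex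
      exact ⟨m + 1, hm⟩
    have e : Nat.find hex' = Nat.find hex + 1 := by
      apply Nat.find_comp_succ
      simpa using h
    unfold legIdx
    rw [dif_pos hex', dif_pos hex, e, Function.iterate_succ_apply]
  · have hex' : ¬ ∃ m, tau^[m] x ∈ cyc := by
      rintro ⟨m, hm⟩
      cases m with
      | zero => exact h hm
      | succ m => exact hex ⟨m, hm⟩
    unfold legIdx
    rw [dif_neg hex', dif_neg hex]

theorem legIdx_of_mem {x : ℝ} (h : x ∈ cyc) :
    legIdx x = if x = 2 / 9 then 0 else if x = 4 / 9 then 1 else 2 := by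
  classical
  have hex : ∃ m, tau^[m] x ∈ cyc := ⟨0, h⟩
  have e : Nat.find hex = 0 := (Nat.find_eq_zero hex).2 h
  unfold legIdx
  rw [dif_pos hex, e]
  simp only [Function.iterate_zero, id]
  congr

/-- Along the cycle `2/9, 4/9, 8/9` the index advances by one, as (C4) demands. The period three of
the cycle matches the three legs. -/
theorem legIdx_tau_of_mem {x : ℝ} (h : x ∈ cyc) : legIdx (tau x) = legIdx x + 1 := by
  rw [legIdx_of_mem h, legIdx_of_mem (tau_mem_cyc h)]
  rcases h with rfl | rfl | rfl
  · rw [tau_of_le (by norm_num)]; norm_num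
  · rw [tau_of_le (by norm_num)]; norm_num; decide
  · rw [tau_of_ge (by norm_num)]; norm_num; decide

/-! ### The trees -/

theorem continuous_pt : Continuous pt := by unfold pt; fun_prop

theorem continuous_leg (p : ℝ) (i : Fin 3) : Continuous (leg p i) := by
  unfold leg
  refine continuous_const.prodMk (continuous_pi fun j => ?_)
  by_cases h : j = i
  · subst h; simpa using continuous_id'
  · simpa [Pi.single_eq_of_ne h] using continuous_const

theorem pt_injective : Function.Injective pt := fun _ _ h => congrArg Prod.fst h

theorem leg_injective (p : ℝ) (i : Fin 3) : Function.Injective (leg p i) :=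
  fun _ _ h => Pi.single_injective i (congrArg Prod.snd h)

@[simp] theorem leg_zero (p : ℝ) (i : Fin 3) : leg p i 0 = pt p := by simp [leg, pt]

@[simp] theorem leg_fst (p : ℝ) (i : Fin 3) (t : ℝ) : (leg p i t).1 = p := rfl
@[simp] theorem pt_fst (x : ℝ) : (pt x).1 = x := rfl
@[simp] theorem pt_snd (x : ℝ) : (pt x).2 = 0 := rfl
@[simp] theorem leg_snd (p : ℝ) (i : Fin 3) (t : ℝ) : (leg p i t).2 = Pi.single i t := rfl

theorem pt_eq_leg {x p : ℝ} {i : Fin 3} {t : ℝ} (h : pt x = leg p i t) : x = p ∧ t = 0 := by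
  refine ⟨congrArg Prod.fst h, ?_⟩
  have := congrArg Prod.snd h
  simp only [pt_snd, leg_snd] at this
  simpa using (congrFun this i).symm

theorem leg_eq_leg {p p' : ℝ} {i i' : Fin 3} {t t' : ℝ} (h : leg p i t = leg p' i' t') :
    p = p' ∧ t = t' ∧ (i = i' ∨ t = 0) := by
  refine ⟨congrArg Prod.fst h, ?_⟩
  have h2 := congrArg Prod.snd h
  simp only [leg_snd] at h2
  by_cases hi : i = i'
  · subst hi
    exact ⟨Pi.single_injective i h2, Or.inl rfl⟩
  · have e1 := congrFun h2 i
    have e2 := congrFun h2 i'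
    rw [Pi.single_eq_same, Pi.single_eq_of_ne hi] at e1
    rw [Pi.single_eq_same, Pi.single_eq_of_ne (Ne.symm hi)] at e2
    exact ⟨by rw [e1, e2], Or.inr e1⟩

theorem attachPts_subset_Icc {n : ℕ} {p : ℝ} (h : p ∈ attachPts n) : p ∈ Icc (0 : ℝ) 1 := by
  rcases h with h | h
  · rcases h with rfl | h
    · norm_num
    · rw [mem_singleton_iff] at h; subst h; norm_num
  · simp only [mem_iUnion] at h
    obtain ⟨m, -, h⟩ := h
    exact h.1

theorem zero_mem_attachPts (n : ℕ) : (0 : ℝ) ∈ attachPts n := Or.inl (by simp)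
theorem two_thirds_mem_attachPts (n : ℕ) : (2 / 3 : ℝ) ∈ attachPts n := Or.inl (by simp)

theorem mem_attachPts_of_tauPre {n m : ℕ} {p : ℝ} (h : p ∈ tauPre m) (hm : m < n) :
    p ∈ attachPts n := by
  right; simp only [mem_iUnion]; exact ⟨m, hm, h⟩

theorem mem_attachPts {n : ℕ} {p : ℝ} :
    p ∈ attachPts n ↔ p = 0 ∨ p = 2 / 3 ∨ ∃ m < n, p ∈ tauPre m := by
  simp [attachPts, or_assoc]

theorem mem_treeSet {n : ℕ} {z : Amb} : z ∈ treeSet n ↔ (∃ x ∈ Icc (0 : ℝ) 1, z = pt x) ∨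
    ∃ p ∈ attachPts n, ∃ i : Fin 3, ∃ t ∈ Icc (0 : ℝ) 1, z = leg p i t := by
  simp only [treeSet, seg, legArc, mem_union, mem_image, mem_iUnion, exists_prop, eq_comm]

theorem pt_mem_treeSet {n : ℕ} {x : ℝ} (h : x ∈ Icc (0 : ℝ) 1) : pt x ∈ treeSet n :=
  mem_treeSet.2 (Or.inl ⟨x, h, rfl⟩)

theorem leg_mem_treeSet {n : ℕ} {p : ℝ} (hp : p ∈ attachPts n) (i : Fin 3) {t : ℝ}
    (ht : t ∈ Icc (0 : ℝ) 1) : leg p i t ∈ treeSet n :=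
  mem_treeSet.2 (Or.inr ⟨p, hp, i, t, ht, rfl⟩)

theorem isCompact_seg : IsCompact seg := isCompact_Icc.image continuous_pt

theorem isCompact_legArc (p : ℝ) (i : Fin 3) : IsCompact (legArc p i) :=
  isCompact_Icc.image (continuous_leg p i)

theorem isCompact_treeSet (n : ℕ) : IsCompact (treeSet n) :=
  isCompact_seg.union ((finite_attachPts n).isCompact_biUnion fun p _ =>
    isCompact_iUnion fun i => isCompact_legArc p i)

theorem isPreconnected_seg : IsPreconnected seg :=
  isPreconnected_Icc.image _ continuous_pt.continuousOn

theorem isPreconnected_legArc (p : ℝ) (i : Fin 3) : IsPreconnected (legArc p i) :=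
  isPreconnected_Icc.image _ (continuous_leg p i).continuousOn

theorem legArc_subset_treeSet {n : ℕ} {p : ℝ} (hp : p ∈ attachPts n) (i : Fin 3) :
    legArc p i ⊆ treeSet n := by
  rintro _ ⟨t, ht, rfl⟩; exact leg_mem_treeSet hp i ht

theorem seg_subset_treeSet (n : ℕ) : seg ⊆ treeSet n := by
  rintro _ ⟨t, ht, rfl⟩; exact pt_mem_treeSet ht

theorem pt_mem_legArc (p : ℝ) (i : Fin 3) : pt p ∈ legArc p i := ⟨0, by simp, by simp⟩

theorem pt_mem_seg {x : ℝ} (h : x ∈ Icc (0 : ℝ) 1) : pt x ∈ seg := ⟨x, h, rfl⟩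

theorem leg_mem_legArc {p : ℝ} {i : Fin 3} {t : ℝ} (h : t ∈ Icc (0 : ℝ) 1) :
    leg p i t ∈ legArc p i := ⟨t, h, rfl⟩

theorem isPreconnected_treeSet (n : ℕ) : IsPreconnected (treeSet n) := by
  apply isPreconnected_of_forall (pt 0)
  intro y hy
  rcases mem_treeSet.1 hy with ⟨x, hx, rfl⟩ | ⟨p, hp, i, t, ht, rfl⟩
  · exact ⟨seg, seg_subset_treeSet n, pt_mem_seg (by simp), pt_mem_seg hx, isPreconnected_seg⟩
  · refine ⟨seg ∪ legArc p i, union_subset (seg_subset_treeSet n) (legArc_subset_treeSet hp i),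
      Or.inl (pt_mem_seg (by simp)), Or.inr (leg_mem_legArc ht), ?_⟩
    exact isPreconnected_seg.union (pt p) (pt_mem_seg (attachPts_subset_Icc hp))
      (pt_mem_legArc p i) (isPreconnected_legArc p i)

instance (n : ℕ) : CompactSpace (T n) := isCompact_iff_compactSpace.1 (isCompact_treeSet n)

instance (n : ℕ) : ConnectedSpace (T n) :=
  isConnected_iff_connectedSpace.1 ⟨⟨pt 0, pt_mem_treeSet (by simp)⟩, isPreconnected_treeSet n⟩

/-! ### Excluding circles -/

theorem isPreconnected_compl_singleton_circle (w : Circle) : IsPreconnected ({w}ᶜ : Set Circle) := by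
  have e : ({w}ᶜ : Set Circle) = (fun t => w * Circle.exp t) '' Ioo 0 (2 * Real.pi) := by
    ext z
    simp only [mem_compl_iff, mem_singleton_iff, mem_image]
    constructor
    · intro hz
      obtain ⟨s, hs⟩ : ∃ s, Circle.exp s = w⁻¹ * z := ⟨_, Circle.exp_arg _⟩
      have hpos : (0 : ℝ) < 2 * Real.pi := Real.two_pi_pos
      refine ⟨toIcoMod hpos 0 s, ⟨lt_of_le_of_ne (left_le_toIcoMod hpos 0 s) ?_, ?_⟩, ?_⟩
      · intro h0
        have h1 : Circle.exp (toIcoMod hpos 0 s) = Circle.exp s := by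
          rw [toIcoMod, Circle.periodic_exp.sub_zsmul_eq]
        rw [← h0, Circle.exp_zero, hs] at h1
        exact hz (inv_mul_eq_one.1 h1.symm).symm
      · simpa using toIcoMod_lt_right hpos 0 s
      · have h1 : Circle.exp (toIcoMod hpos 0 s) = Circle.exp s := by
          rw [toIcoMod, Circle.periodic_exp.sub_zsmul_eq]
        rw [h1, hs]; group
    · rintro ⟨t, ht, rfl⟩ h
      have h1 : Circle.exp t = 1 := by simpa using h
      rw [Circle.exp_eq_one] at h1
      obtain ⟨k, hk⟩ := h1
      have hpos : (0 : ℝ) < 2 * Real.pi := Real.two_pi_pos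
      rw [hk] at ht
      have k1 : (0 : ℝ) < k := by
        by_contra! hle
        nlinarith [ht.1]
      have k2 : (k : ℝ) < 1 := by
        by_contra! hle
        nlinarith [ht.2]
      have k3 : (0 : ℤ) < k := by exact_mod_cast k1
      have k4 : k < (1 : ℤ) := by exact_mod_cast k2
      omega
  rw [e]
  exact isPreconnected_Ioo.image _ (by fun_prop)

/-- Removing one point leaves a circle connected, but here the level `z` is met at most once while
`φ` takes values on both sides of it. -/
theorem not_homeomorph_circle_of_cut {X : Type*} [TopologicalSpace X] {S : Set X}
    (e : S ≃ₜ Circle) {φ : X → ℝ} (hφ : Continuous φ) {z : ℝ}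
    (hz : ∀ x ∈ S, ∀ y ∈ S, φ x = z → φ y = z → x = y) {a b : X} (ha : a ∈ S) (hb : b ∈ S)
    (haz : φ a < z) (hzb : z < φ b) : False := by
  have hpre : IsPreconnected ({x : S | φ x ≠ z}) := by
    by_cases hc : ∃ x : S, φ x = z
    · obtain ⟨x, hx⟩ := hc
      have h1 : {y : S | φ y ≠ z} = e.symm '' {e x}ᶜ := by
        ext y
        simp only [mem_ofPred_eq, mem_image, mem_compl_iff, mem_singleton_iff]
        constructor
        · intro hy
          refine ⟨e y, fun h => hy ?_, by simp⟩
          rw [e.injective h, hx]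
        · rintro ⟨w, hw, rfl⟩ h
          apply hw
          rw [← Subtype.ext (hz _ (e.symm w).2 _ x.2 h hx)]
          simp
      rw [h1]
      exact (isPreconnected_compl_singleton_circle _).image _ e.symm.continuous.continuousOn
    · have h1 : {y : S | φ y ≠ z} = e.symm '' univ := by
        ext y
        simp only [mem_ofPred_eq, image_univ, mem_range]
        exact ⟨fun _ => ⟨e y, by simp⟩, fun _ h => hc ⟨y, h⟩⟩
      rw [h1]
      exact isPreconnected_univ.image _ e.symm.continuous.continuousOn
  have h2 := (hpre.image (fun x : S => φ x) (by fun_prop)).ordConnected.out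
    ⟨⟨a, ha⟩, haz.ne, rfl⟩ ⟨⟨b, hb⟩, hzb.ne', rfl⟩ (mem_Icc.2 ⟨haz.le, hzb.le⟩)
  obtain ⟨x, hx, hx'⟩ := h2
  exact hx hx'

theorem treeSet_eq_pt {n : ℕ} {z : Amb} (hz : z ∈ treeSet n) (h : z.1 ∉ attachPts n) :
    z = pt z.1 := by
  rcases mem_treeSet.1 hz with ⟨x, hx, rfl⟩ | ⟨p, hp, i, t, ht, rfl⟩
  · rfl
  · exact absurd hp h

theorem treeSet_eq_leg {n : ℕ} {z : Amb} (hz : z ∈ treeSet n) {i : Fin 3} (h : z.2 i ≠ 0) :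
    z = leg z.1 i (z.2 i) := by
  rcases mem_treeSet.1 hz with ⟨x, hx, rfl⟩ | ⟨p, hp, j, t, ht, rfl⟩
  · simp at h
  · by_cases hij : i = j
    · subst hij; simp
    · simp [Pi.single_eq_of_ne hij] at h

theorem isEmpty_homeomorph_circle (n : ℕ) (S : Set (T n)) : IsEmpty (S ≃ₜ Circle) := by
  constructor
  intro e
  obtain ⟨a, b, hab⟩ : ∃ a b : S, a ≠ b :=
    ⟨e.symm 1, e.symm (-1), by
      intro h
      have h1 := congrArg (fun c : Circle => (c : ℂ)) (e.symm.injective h)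
      have h2 : ((-1 : Circle) : ℂ) = -1 := rfl
      simp only [Circle.coe_one, h2] at h1
      norm_num [Complex.ext_iff] at h1⟩
  by_cases h1 : (a : T n).1.1 = (b : T n).1.1
  · by_cases h2 : ∃ x y : S, (x : T n).1.1 < (y : T n).1.1
    · obtain ⟨x, y, hxy⟩ := h2
      -- Over a level that is not an attaching point the tree consists of a single point, so it cuts
      -- any circle.
      obtain ⟨z, ⟨hz1, hz2⟩, hz⟩ := ((Ioo_infinite hxy).sdiff (finite_attachPts n)).nonempty
      refine not_homeomorph_circle_of_cut e (φ := fun w => w.1.1) (by fun_prop) (z := z) ?_ x.2 y.2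
        hz1 hz2
      intro s _ t _ hs ht
      apply Subtype.ext
      rw [treeSet_eq_pt s.2 (by rw [hs]; exact hz), treeSet_eq_pt t.2 (by rw [ht]; exact hz), hs, ht]
    · have hconst : ∀ x y : S, (x : T n).1.1 = (y : T n).1.1 := by
        push Not at h2
        exact fun x y => le_antisymm (h2 y x) (h2 x y)
      obtain ⟨i, hi⟩ : ∃ i, (a : T n).1.2 i ≠ (b : T n).1.2 i := by
        by_contra! hall
        exact hab (Subtype.ext (Subtype.ext (Prod.ext h1 (funext hall))))
      have key : ∀ x y : S, (x : T n).1.2 i < (y : T n).1.2 i → False := by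
        intro x y hxy
        -- Now the whole set lies in one triod, where a nonzero value of the `i`-th coordinate is
        -- taken only once.
        obtain ⟨z, ⟨hz1, hz2⟩, hz⟩ := ((Ioo_infinite hxy).sdiff (finite_singleton 0)).nonempty
        refine not_homeomorph_circle_of_cut e (φ := fun w => w.1.2 i) (by fun_prop) (z := z) ?_
          x.2 y.2 hz1 hz2
        intro s hs' t ht' hs ht
        apply Subtype.ext
        have hz0 : z ≠ 0 := hz
        rw [treeSet_eq_leg s.2 (i := i) (by rw [hs]; exact hz0),
          treeSet_eq_leg t.2 (i := i) (by rw [ht]; exact hz0), hs, ht, hconst ⟨s, hs'⟩ ⟨t, ht'⟩]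
      rcases lt_or_gt_of_ne hi with h | h
      · exact key a b h
      · exact key b a h
  · have key : ∀ x y : S, (x : T n).1.1 < (y : T n).1.1 → False := by
      intro x y hxy
      obtain ⟨z, ⟨hz1, hz2⟩, hz⟩ := ((Ioo_infinite hxy).sdiff (finite_attachPts n)).nonempty
      refine not_homeomorph_circle_of_cut e (φ := fun w => w.1.1) (by fun_prop) (z := z) ?_ x.2 y.2
        hz1 hz2
      intro s _ t _ hs ht
      apply Subtype.ext
      rw [treeSet_eq_pt s.2 (by rw [hs]; exact hz), treeSet_eq_pt t.2 (by rw [ht]; exact hz), hs, ht]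
    rcases lt_or_gt_of_ne h1 with h | h
    · exact key a b h
    · exact key b a h

theorem isArc_preimage_val {S : Set Amb} {ι : ℝ → Amb} (hι : Continuous ι)
    (hi : Function.Injective ι) (hS : ∀ t ∈ Icc (0 : ℝ) 1, ι t ∈ S) :
    ∃ a b, IsArcFromTo (Subtype.val ⁻¹' (ι '' Icc 0 1) : Set S) a b := by
  refine ⟨_, _, fun t => ⟨ι t, hS t t.2⟩, ?_, ?_, rfl, rfl⟩
  · have hc : Continuous fun t : unitInterval => (⟨ι t, hS t t.2⟩ : S) := by fun_prop
    refine (hc.isClosedEmbedding ?_).isEmbedding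
    intro s t h
    exact Subtype.ext (hi (congrArg Subtype.val h))
  · ext z
    constructor
    · rintro ⟨t, rfl⟩; exact ⟨t, t.2, rfl⟩
    · rintro ⟨t, ht, h⟩; exact ⟨⟨t, ht⟩, Subtype.ext h⟩

theorem isTree_T (n : ℕ) : IsTree (T n) := by
  refine ⟨⟨inferInstance, inferInstance, inferInstance⟩, ?_, isEmpty_homeomorph_circle n⟩
  set ℬ : Set (Set Amb) := {seg} ∪ ⋃ p ∈ attachPts n, ⋃ i : Fin 3, {legArc p i} with hℬ
  have hfin : ℬ.Finite := (finite_singleton _).union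
    ((finite_attachPts n).biUnion fun p _ => finite_iUnion fun i => finite_singleton _)
  have hmem : ∀ A ∈ ℬ, A = seg ∨ ∃ p ∈ attachPts n, ∃ i, A = legArc p i := by
    intro A hA
    simpa [hℬ, eq_comm] using hA
  have hpair : ∀ A ∈ ℬ, ∀ B ∈ ℬ, A ≠ B → (A ∩ B).Finite := by
    have h1 : ∀ p i, (seg ∩ legArc p i).Finite := by
      intro p i
      refine (finite_singleton (pt p)).subset ?_
      rintro _ ⟨⟨x, hx, rfl⟩, ⟨t, ht, h⟩⟩
      rw [mem_singleton_iff, (pt_eq_leg h.symm).1]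
    intro A hA B hB hAB
    rcases hmem A hA with rfl | ⟨p, hp, i, rfl⟩ <;> rcases hmem B hB with rfl | ⟨q, hq, j, rfl⟩
    · exact absurd rfl hAB
    · exact h1 q j
    · rw [inter_comm]; exact h1 p i
    · refine (finite_singleton (pt p)).subset ?_
      rintro _ ⟨⟨t, ht, rfl⟩, ⟨s, hs, h⟩⟩
      obtain ⟨h1, h2, h3⟩ := leg_eq_leg h
      rcases h3 with h3 | h3
      · exact absurd (by rw [h1, h3]) hAB
      · rw [← h2, h3]; simp
  refine ⟨(fun A => (Subtype.val ⁻¹' A : Set (T n))) '' ℬ, hfin.image _, ?_, ?_, ?_⟩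
  · rintro _ ⟨A, hA, rfl⟩
    rcases hmem A hA with rfl | ⟨p, hp, i, rfl⟩
    · exact isArc_preimage_val continuous_pt pt_injective fun t ht => pt_mem_treeSet ht
    · exact isArc_preimage_val (continuous_leg p i) (leg_injective p i)
        fun t ht => leg_mem_treeSet hp i ht
  · rintro _ ⟨A, hA, rfl⟩ _ ⟨B, hB, rfl⟩ hAB
    simp only
    rw [← preimage_inter]
    exact (hpair A hA B hB (fun h => hAB (by rw [h]))).preimage Subtype.val_injective.injOn
  · rw [eq_univ_iff_forall]
    intro z
    rcases mem_treeSet.1 z.2 with ⟨x, hx, h⟩ | ⟨p, hp, i, t, ht, h⟩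
    · exact ⟨_, ⟨seg, by simp [hℬ], rfl⟩, x, hx, h.symm⟩
    · refine ⟨_, ⟨legArc p i, Or.inr ?_, rfl⟩, t, ht, h.symm⟩
      simp only [mem_iUnion]
      exact ⟨p, hp, i, rfl⟩

/-! ### Blowing up finitely many points of a line -/

/-- The position, after every point of `X` has been blown up to an interval of length `2`, of the
point `x` (its left end, if `x ∈ X`). -/
noncomputable def blowPos (X : Finset ℝ) (x : ℝ) : ℝ := x + 2 * ((X.filter (· < x)).card : ℝ)

/-- How far the position `s` is inside the interval that replaces `x`. -/
noncomputable def phase (X : Finset ℝ) (x s : ℝ) : ℝ := max 0 (min 2 (s - blowPos X x))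

/-- The map that collapses the intervals. -/
noncomputable def base (X : Finset ℝ) (s : ℝ) : ℝ := s - ∑ x ∈ X, phase X x s

/-- A point `y` of the line, together with a phase at each point of `X` that is compatible with it. -/
def Coherent (X : Finset ℝ) (y : ℝ) (ε : ℝ → ℝ) : Prop :=
  ∀ x ∈ X, 0 ≤ ε x ∧ ε x ≤ 2 ∧ (y < x → ε x = 0) ∧ (x < y → ε x = 2)

theorem blowPos_strictMono (X : Finset ℝ) : StrictMono (blowPos X) := by
  intro x y h
  unfold blowPos
  have : (X.filter (· < x)).card ≤ (X.filter (· < y)).card := by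
    apply Finset.card_le_card
    intro z
    simp only [Finset.mem_filter]
    exact fun hz => ⟨hz.1, hz.2.trans h⟩
  have : ((X.filter (· < x)).card : ℝ) ≤ (X.filter (· < y)).card := by exact_mod_cast this
  linarith

theorem continuous_phase (X : Finset ℝ) (x : ℝ) : Continuous (phase X x) := by
  unfold phase; fun_prop

theorem monotone_phase (X : Finset ℝ) (x : ℝ) : Monotone (phase X x) := by
  intro s t h
  exact max_le_max le_rfl (min_le_min le_rfl (by linarith))

theorem continuous_base (X : Finset ℝ) : Continuous (base X) := by
  unfold base
  exact continuous_id.sub (continuous_finsetSum _ fun x _ => continuous_phase X x)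

theorem base_add_sum_phase (X : Finset ℝ) (s : ℝ) : base X s + ∑ x ∈ X, phase X x s = s := by
  unfold base; ring

/-- Points below `x` contribute at most `2` each to the sum, and exactly `2` once `x ≤ y`; points
above `x` contribute nothing while `y ≤ x`. So the position minus `blowPos X x` is at most `0`,
equal to `ε x`, or at least `2`, according to the place of `y`, and the clamp does the rest. Thus
coherent data and positions determine each other. -/
theorem Coherent.phase_eq {X : Finset ℝ} {y : ℝ} {ε : ℝ → ℝ} (h : Coherent X y ε) {x : ℝ}
    (hx : x ∈ X) : phase X x (y + ∑ z ∈ X, ε z) = ε x := by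
  have hsplit : ∑ z ∈ X, ε z = ∑ z ∈ X.filter (· < x), ε z + ∑ z ∈ X.filter (¬ · < x), ε z :=
    (Finset.sum_filter_add_sum_filter_not X (· < x) ε).symm
  have hsplit2 : ∑ z ∈ X.filter (¬ · < x), ε z
      = ε x + ∑ z ∈ (X.filter (¬ · < x)).erase x, ε z :=
    (Finset.add_sum_erase _ _ (by simp [hx])).symm
  have hgt : ∀ z ∈ (X.filter (¬ · < x)).erase x, z ∈ X ∧ x < z := by
    intro z hz
    simp only [Finset.mem_erase, Finset.mem_filter, not_lt] at hz
    exact ⟨hz.2.1, lt_of_le_of_ne hz.2.2 (Ne.symm hz.1)⟩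
  have hlow : ∑ z ∈ X.filter (· < x), ε z ≤ 2 * ((X.filter (· < x)).card : ℝ) := by
    have := Finset.sum_le_card_nsmul (X.filter (· < x)) ε 2
      (fun z hz => (h z (Finset.mem_filter.1 hz).1).2.1)
    rw [nsmul_eq_mul] at this; linarith
  have hnn : 0 ≤ ∑ z ∈ (X.filter (¬ · < x)).erase x, ε z :=
    Finset.sum_nonneg fun z hz => (h z (hgt z hz).1).1
  have hlow2 : x ≤ y → ∑ z ∈ X.filter (· < x), ε z = 2 * ((X.filter (· < x)).card : ℝ) := by
    intro hxy
    rw [Finset.sum_congr rfl (g := fun _ => (2 : ℝ))]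
    · rw [Finset.sum_const, nsmul_eq_mul]; ring
    · intro z hz
      rw [Finset.mem_filter] at hz
      exact (h z hz.1).2.2.2 (hz.2.trans_le hxy)
  have hhigh : y ≤ x → ∑ z ∈ (X.filter (¬ · < x)).erase x, ε z = 0 := by
    intro hxy
    exact Finset.sum_eq_zero fun z hz => (h z (hgt z hz).1).2.2.1 (hxy.trans_lt (hgt z hz).2)
  obtain ⟨b0, b2, bl, bg⟩ := h x hx
  unfold phase blowPos
  rw [hsplit, hsplit2]
  rcases lt_trichotomy y x with hlt | rfl | hlt
  · rw [bl hlt, hhigh hlt.le, max_eq_left]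
    refine (min_le_right _ _).trans ?_
    linarith
  · rw [hlow2 le_rfl, hhigh le_rfl, min_eq_right (by linarith), max_eq_right (by linarith)]
    ring
  · rw [bg hlt, hlow2 hlt.le, min_eq_left (by linarith), max_eq_right (by norm_num)]

theorem Coherent.base_eq {X : Finset ℝ} {y : ℝ} {ε : ℝ → ℝ} (h : Coherent X y ε) :
    base X (y + ∑ z ∈ X, ε z) = y := by
  unfold base
  rw [Finset.sum_congr rfl fun x hx => h.phase_eq hx]
  ring

theorem exists_coherent (X : Finset ℝ) (s : ℝ) :
    ∃ y ε, Coherent X y ε ∧ y + ∑ z ∈ X, ε z = s := by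
  induction X using Finset.induction_on_max with
  | empty => exact ⟨s, fun _ => 0, by simp [Coherent], by simp⟩
  | insert m X hm ih =>
    obtain ⟨y, ε, hc, hs⟩ := ih
    have hmX : m ∉ X := fun h => lt_irrefl _ (hm m h)
    have key : ∀ y' e, 0 ≤ e → e ≤ 2 → (y' < m → e = 0) → (m < y' → e = 2) →
        Coherent X y' ε → y' + e = y →
        ∃ y ε, Coherent (insert m X) y ε ∧ y + ∑ z ∈ insert m X, ε z = s := by
      intro y' e h0 h2 hl hg hc' he
      refine ⟨y', fun x => if x = m then e else ε x, ?_, ?_⟩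
      · intro x hx
        rcases Finset.mem_insert.1 hx with rfl | hx
        · simp only [if_true]; exact ⟨h0, h2, hl, hg⟩
        · have : x ≠ m := fun h => hmX (h ▸ hx)
          simp only [if_neg this]; exact hc' x hx
      · rw [Finset.sum_insert hmX, if_pos rfl, ← add_assoc, he, ← hs]
        congr 1
        exact Finset.sum_congr rfl fun x hx => if_neg (by rintro rfl; exact hmX hx)
    -- After the smaller points have been removed, the interval replacing the largest point `m`
    -- occupies `[m, m + 2]`: the phase is `0` before it, `y - m` inside and `2` behind it.
    rcases le_total y m with h | h
    · exact key y 0 le_rfl (by norm_num) (fun _ => rfl) (fun h' => absurd h' (not_lt.2 h)) hc (by ring)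
    · have hbig : ∀ y', m ≤ y' → y' ≤ y → Coherent X y' ε := by
        intro y' h1 h2 x hx
        have := hm x hx
        obtain ⟨a, b, c, d⟩ := hc x hx
        exact ⟨a, b, fun h' => by linarith, fun _ => d (by linarith)⟩
      rcases le_total y (m + 2) with h' | h'
      · exact key m (y - m) (by linarith) (by linarith) (fun h => absurd h (lt_irrefl _))
          (fun h => absurd h (lt_irrefl _)) (hbig m le_rfl h) (by ring)
      · exact key (y - 2) 2 (by norm_num) le_rfl (fun h => by linarith) (fun _ => rfl)
          (hbig _ (by linarith) (by linarith)) (by ring)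

theorem coherent_base (X : Finset ℝ) (s : ℝ) : Coherent X (base X s) fun x => phase X x s := by
  obtain ⟨y, ε, hc, rfl⟩ := exists_coherent X s
  rw [hc.base_eq]
  intro x hx
  simp only [hc.phase_eq hx]
  exact hc x hx

/-- If the base went down, no phase could go up, whereas base and phases add up to the position. -/
theorem monotone_base (X : Finset ℝ) : Monotone (base X) := by
  intro s t hst
  by_contra! hlt
  have : ∑ x ∈ X, phase X x t ≤ ∑ x ∈ X, phase X x s := by
    apply Finset.sum_le_sum
    intro x hx
    obtain ⟨a, b, c, d⟩ := coherent_base X s x hx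
    obtain ⟨a', b', c', d'⟩ := coherent_base X t x hx
    rcases lt_or_ge (base X t) x with h | h
    · simp only at c' a; rw [c' h]; exact a
    · simp only at d b'; rw [d (by linarith)]; exact b'
  have h1 := base_add_sum_phase X s
  have h2 := base_add_sum_phase X t
  linarith

theorem coherent_blowPos (X : Finset ℝ) (q : ℝ) :
    Coherent X q fun x => if x < q then 2 else 0 := by
  intro x _
  refine ⟨by dsimp only; split_ifs <;> norm_num, by dsimp only; split_ifs <;> norm_num, fun h => if_neg (not_lt.2 h.le),
    fun h => if_pos h⟩

theorem blowPos_eq (X : Finset ℝ) (q : ℝ) :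
    blowPos X q = q + ∑ x ∈ X, if x < q then (2 : ℝ) else 0 := by
  unfold blowPos
  rw [← Finset.sum_filter, Finset.sum_const, nsmul_eq_mul]
  ring

theorem base_blowPos (X : Finset ℝ) (q : ℝ) : base X (blowPos X q) = q := by
  rw [blowPos_eq, (coherent_blowPos X q).base_eq]

theorem eq_blowPos_of_base_eq {X : Finset ℝ} {s q : ℝ} (h : base X s = q) (hq : q ∉ X) :
    s = blowPos X q := by
  rw [← base_add_sum_phase X s, blowPos_eq, h]
  congr 1
  apply Finset.sum_congr rfl
  intro x hx
  obtain ⟨-, -, c, d⟩ := coherent_base X s x hx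
  rw [h] at c d
  split_ifs with hlt
  · exact d hlt
  · exact c (lt_of_le_of_ne (not_lt.1 hlt) fun h => hq (h ▸ hx))

/-! ### Excursions -/

/-- The height reached at time `e` of an excursion that goes up during `[0, 1]` and down during
`[1, 2]`. -/
noncomputable def tri (e : ℝ) : ℝ := min e (2 - e)

theorem continuous_tri : Continuous tri := by unfold tri; fun_prop

@[simp] theorem tri_zero : tri 0 = 0 := by norm_num [tri]
@[simp] theorem tri_two : tri 2 = 0 := by norm_num [tri]

theorem tri_of_le {e : ℝ} (h : e ≤ 1) : tri e = e := min_eq_left (by linarith)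
theorem tri_of_ge {e : ℝ} (h : 1 ≤ e) : tri e = 2 - e := min_eq_right (by linarith)

theorem tri_eq_iff {e r : ℝ} : tri e = r → e = r ∨ e = 2 - r := by
  intro h
  rcases le_total e 1 with h' | h'
  · left; rw [← h, tri_of_le h']
  · right; rw [← h, tri_of_ge h']; ring

theorem tri_two_sub (e : ℝ) : tri (2 - e) = tri e := by
  unfold tri; rw [min_comm]; congr 1; ring

theorem Coherent.tri_eq_zero {X : Finset ℝ} {y : ℝ} {ε : ℝ → ℝ} (h : Coherent X y ε) {x : ℝ}
    (hx : x ∈ X) (hxy : x ≠ y) : tri (ε x) = 0 := by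
  obtain ⟨-, -, a, b⟩ := h x hx
  rcases lt_or_gt_of_ne hxy with h | h
  · rw [b h, tri_two]
  · rw [a h, tri_zero]

/-- Only the excursion at `y` itself can be in progress; all others have phase `0` or `2`, where the
height vanishes. So the sum in `tour` never leaves the tree. -/
theorem Coherent.sum_single {X : Finset ℝ} {y : ℝ} {ε : ℝ → ℝ} (h : Coherent X y ε)
    (hy : y ∈ X) (i : ℝ → Fin 3) :
    ∑ x ∈ X, (Pi.single (i x) (tri (ε x)) : Fin 3 → ℝ) = Pi.single (i y) (tri (ε y)) := by
  rw [Finset.sum_eq_single y]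
  · intro x hx hxy
    rw [h.tri_eq_zero hx hxy, Pi.single_zero]
  · exact fun h => absurd hy h

theorem Coherent.sum_single_of_notMem {X : Finset ℝ} {y : ℝ} {ε : ℝ → ℝ} (h : Coherent X y ε)
    (hy : y ∉ X) (i : ℝ → Fin 3) :
    ∑ x ∈ X, (Pi.single (i x) (tri (ε x)) : Fin 3 → ℝ) = 0 := by
  refine Finset.sum_eq_zero fun x hx => ?_
  rw [h.tri_eq_zero hx (fun e => hy (e ▸ hx)), Pi.single_zero]

/-- The closed walk in the `n`-th tree along which the maps `f` and `g` proceed: it runs three times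
through the interval, with an excursion into a leg at each point of `excPts n`. -/
noncomputable def tour (n : ℕ) (s : ℝ) : Amb :=
  (wave (3 * base (excPts n) s),
    ∑ x ∈ excPts n, Pi.single (legIdx x) (tri (phase (excPts n) x s)))

theorem Coherent.tour_eq {n : ℕ} {y : ℝ} {ε : ℝ → ℝ} (h : Coherent (excPts n) y ε) :
    tour n (y + ∑ x ∈ excPts n, ε x) =
      (wave (3 * y), ∑ x ∈ excPts n, Pi.single (legIdx x) (tri (ε x))) := by
  unfold tour
  rw [h.base_eq]
  congr 1
  exact Finset.sum_congr rfl fun x hx => by rw [h.phase_eq hx]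

theorem tour_of_notMem {n : ℕ} {s : ℝ} (h : base (excPts n) s ∉ excPts n) :
    tour n s = pt (tau3 (base (excPts n) s)) := by
  unfold tour
  rw [(coherent_base _ s).sum_single_of_notMem h]
  rfl

theorem tour_of_mem {n : ℕ} {s : ℝ} (h : base (excPts n) s ∈ excPts n) :
    tour n s = leg (tau3 (base (excPts n) s)) (legIdx (base (excPts n) s))
      (tri (phase (excPts n) (base (excPts n) s) s)) := by
  unfold tour
  rw [(coherent_base _ s).sum_single h]
  rfl

theorem continuous_single_tri {Z : Type*} [TopologicalSpace Z] (i : Fin 3) {F : Z → ℝ}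
    (hF : Continuous F) : Continuous fun z => (Pi.single i (tri (F z)) : Fin 3 → ℝ) :=
  ((continuous_leg 0 i).snd.comp (continuous_tri.comp hF) :)

theorem continuous_tour (n : ℕ) : Continuous (tour n) := by
  unfold tour
  refine (continuous_wave.comp (continuous_const.mul (continuous_base _))).prodMk ?_
  exact continuous_finsetSum _ fun x _ => continuous_single_tri _ (continuous_phase _ x)

/-! ### Parametrizations of the arcs that make up `Γ` -/

/-- The arc is handed over as a pair of real monotone functions: `ι` and `κ` rebuild points from the
coordinates `φ` and `ψ`, which gives the injectivity needed by `exists_param`. -/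
theorem IsMonotoneArcFromTo.exists_coord {A : Set (Amb × Amb)} {a b : Amb × Amb}
    (hA : IsMonotoneArcFromTo A a b) {φ ψ : Amb → ℝ} {ι κ : ℝ → Amb} (hφ : Continuous φ)
    (hψ : Continuous ψ) (hι : ∀ z ∈ A, ι (φ z.1) = z.1) (hκ : ∀ z ∈ A, κ (ψ z.2) = z.2)
    (h1 : φ a.1 ≤ φ b.1) (h2 : ψ a.2 ≤ ψ b.2) :
    ∃ x v : ℝ → ℝ, Continuous x ∧ Continuous v ∧ Monotone x ∧ Monotone v ∧
      (∀ t ≤ 0, x t = φ a.1 ∧ v t = ψ a.2) ∧ (∀ t, 1 ≤ t → x t = φ b.1 ∧ v t = ψ b.2) ∧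
      (∀ t, (ι (x t), κ (v t)) ∈ A) ∧
      (∀ z ∈ A, ∃ t ∈ Icc (0 : ℝ) 1, x t = φ z.1 ∧ v t = ψ z.2) ∧
      ∀ s ∈ Icc (0 : ℝ) 1, ∀ t ∈ Icc (0 : ℝ) 1, x s = x t → v s = v t → s = t := by
  obtain ⟨γ, hγ, him, hmem, hinj, h0, h1', m1, m2⟩ := hA.exists_param hφ hψ
    (by
      rintro _ ⟨z, hz, rfl⟩ _ ⟨z', hz', rfl⟩ h
      rw [← hι z hz, ← hι z' hz', h])
    (by
      rintro _ ⟨z, hz, rfl⟩ _ ⟨z', hz', rfl⟩ h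
      rw [← hκ z hz, ← hκ z' hz', h]) h1 h2
  refine ⟨fun t => φ (γ t).1, fun t => ψ (γ t).2, by fun_prop, by fun_prop, m1, m2,
    fun t ht => by simp [h0 t ht], fun t ht => by simp [h1' t ht],
    fun t => ?_, ?_, ?_⟩
  · dsimp only
    rw [hι _ (hmem t), hκ _ (hmem t)]
    exact hmem t
  · intro z hz
    rw [← him] at hz
    obtain ⟨t, ht, rfl⟩ := hz
    exact ⟨t, ht, rfl, rfl⟩
  · intro s hs t ht e1 e2
    apply hinj hs ht
    apply Prod.ext
    · rw [← hι _ (hmem s), ← hι _ (hmem t)]; exact congrArg ι e1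
    · rw [← hκ _ (hmem s), ← hκ _ (hmem t)]; exact congrArg κ e2

theorem exists_reparam {a b : ℝ} (hab : a < b) (Q : Finset ℝ) (T : ℝ → ℝ)
    (hQ : ∀ q ∈ Q, a < q ∧ q < b ∧ 0 < T q ∧ T q < 1) (hT : StrictMonoOn T Q) :
    ∃ ρ : ℝ → ℝ, Continuous ρ ∧ StrictMono ρ ∧ ρ a = 0 ∧ ρ b = 1 ∧ ∀ q ∈ Q, ρ q = T q := by
  classical
  have ha : a ∉ Q := fun h => lt_irrefl _ (hQ a h).1
  have hb : b ∉ Q := fun h => lt_irrefl _ (hQ b h).2.1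
  obtain ⟨ρ, hc, hm, hρ⟩ := exists_strictMono_interpolation (insert a (insert b Q))
    (fun q => if q = a then 0 else if q = b then 1 else T q) (by
      intro q hq q' hq' hlt
      simp only [Finset.coe_insert, mem_insert_iff, Finset.mem_coe] at hq hq'
      rcases hq with rfl | rfl | hq <;> rcases hq' with rfl | rfl | hq'
      · exact absurd hlt (lt_irrefl _)
      · simp [hab.ne']
      · have := hQ _ hq'
        simp [this.1.ne', this.2.1.ne, this.2.2.1]
      · exact absurd hlt hab.not_gt
      · exact absurd hlt (lt_irrefl _)
      · exact absurd hlt (hQ _ hq').2.1.not_gt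
      · exact absurd hlt (hQ _ hq).1.not_gt
      · have := hQ _ hq
        simp [this.1.ne', this.2.1.ne, this.2.2.2, hab.ne']
      · have h1 := hQ _ hq
        have h2 := hQ _ hq'
        simp only [h1.1.ne', h1.2.1.ne, h2.1.ne', h2.2.1.ne, if_false]
        exact hT hq hq' hlt)
  refine ⟨ρ, hc, hm, by simp [hρ a (by simp)], by simp [hρ b (by simp), hab.ne'], ?_⟩
  intro q hq
  have := hQ _ hq
  simp [hρ q (by simp [hq]), this.1.ne', this.2.1.ne]

/-- An arc of `Γ` in the square of the interval, parametrized by prescribed values at finitely many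
points. The second coordinate is measured by `σ y + κ`. -/
theorem IsMonotoneArcFromTo.exists_spine {A : Set (Amb × Amb)} {a b c d σ κ : ℝ}
    (hA : IsMonotoneArcFromTo A (pt a, pt c) (pt b, pt d)) (hs : A ⊆ seg ×ˢ seg)
    (hσ : σ * σ = 1) (hab : a < b) (hcd : σ * c ≤ σ * d) (Q : Finset ℝ)
    (hQ : ∀ q ∈ Q, a < q ∧ q < b ∧ σ * c + κ < 2 * q ∧ 2 * q < σ * d + κ) :
    ∃ u V : ℝ → ℝ, Continuous u ∧ Continuous V ∧ Monotone u ∧ Monotone V ∧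
      (∀ t ≤ a, u t = a ∧ V t = σ * c + κ) ∧ (∀ t, b ≤ t → u t = b ∧ V t = σ * d + κ) ∧
      (∀ t, (pt (u t), pt (σ * (V t - κ))) ∈ A) ∧
      (∀ q ∈ Q, V q = 2 * q ∧ ((pt q, pt (σ * (2 * q - κ))) ∈ A → u q = q)) := by
  classical
  obtain ⟨x, v, hx, hv, mx, mv, h0, h1, hmem, hsurj, -⟩ := hA.exists_coord
    (φ := Prod.fst) (ψ := fun z => σ * z.1 + κ) (ι := pt) (κ := fun y => pt (σ * (y - κ)))
    continuous_fst (by fun_prop)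
    (by
      intro z hz
      obtain ⟨⟨t, -, h⟩, -⟩ := hs hz
      rw [← h]; rfl)
    (by
      intro z hz
      obtain ⟨-, ⟨t, -, h⟩⟩ := hs hz
      rw [← h]
      simp only [pt_fst, add_sub_cancel_right, ← mul_assoc, hσ, one_mul])
    hab.le (by simpa using hcd)
  simp only [pt_fst] at h0 h1 hmem hsurj
  -- The time assigned to `q` is that of the pinned point whenever this point lies on the arc;
  -- otherwise any time with second coordinate `2 * q` will do. Monotonicity of `v` makes the
  -- assignment strictly increasing.
  have htm : ∀ q, ∃ t, q ∈ Q → v t = 2 * q ∧ ((pt q, pt (σ * (2 * q - κ))) ∈ A → x t = q) := by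
    intro q
    by_cases hqA : (pt q, pt (σ * (2 * q - κ))) ∈ A
    · obtain ⟨t, -, e1, e2⟩ := hsurj _ hqA
      refine ⟨t, fun _ => ⟨?_, fun _ => e1⟩⟩
      rw [e2]; simp only [pt_fst, ← mul_assoc, hσ]; ring
    · by_cases hq : q ∈ Q
      · obtain ⟨-, -, l, r⟩ := hQ q hq
        obtain ⟨t, -, ht⟩ := intermediate_value_Icc (zero_le_one) hv.continuousOn
          (show 2 * q ∈ Icc (v 0) (v 1) by
            rw [(h0 0 le_rfl).2, (h1 1 le_rfl).2]; exact ⟨l.le, r.le⟩)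
        exact ⟨t, fun _ => ⟨ht, fun h => absurd h hqA⟩⟩
      · exact ⟨0, fun h => absurd h hq⟩
  choose tm htm using htm
  obtain ⟨ρ, hρ, hρm, hρa, hρb, hρQ⟩ := exists_reparam hab Q tm (by
      intro q hq
      obtain ⟨a1, a2, a3, a4⟩ := hQ q hq
      refine ⟨a1, a2, ?_, ?_⟩
      · by_contra! h
        have := (h0 _ h).2
        rw [(htm q hq).1] at this; linarith
      · by_contra! h
        have := (h1 _ h).2
        rw [(htm q hq).1] at this; linarith)
    (by
      intro q hq q' hq' hqq
      by_contra! h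
      have := mv h
      rw [(htm q hq).1, (htm q' hq').1] at this; linarith)
  refine ⟨x ∘ ρ, v ∘ ρ, hx.comp hρ, hv.comp hρ, mx.comp hρm.monotone, mv.comp hρm.monotone,
    fun t ht => h0 _ (hρa ▸ hρm.monotone ht), fun t ht => h1 _ (hρb ▸ hρm.monotone ht),
    fun t => hmem _, ?_⟩
  intro q hq
  simp only [Function.comp, hρQ q hq]
  exact htm q hq

/-- The supremum of the times with `x t ≤ c`. The last time is wanted because an arc of `Γ` may run
vertically for a while over `c`. -/
theorem exists_last_time {x : ℝ → ℝ} (hx : Continuous x) {a b c : ℝ} (ha : x a ≤ c)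
    (hb : ∀ t, b ≤ t → c < x t) : ∃ t, x t = c ∧ ∀ s, t < s → c < x s := by
  have hne : ({t | x t ≤ c} : Set ℝ).Nonempty := ⟨a, ha⟩
  have hbd : BddAbove ({t | x t ≤ c} : Set ℝ) := ⟨b, by
    intro t (ht : x t ≤ c)
    by_contra! h
    exact absurd (hb t h.le) (not_lt.2 ht)⟩
  have hcl : IsClosed ({t | x t ≤ c} : Set ℝ) := isClosed_le hx continuous_const
  have hmem' : x (sSup {t | x t ≤ c}) ≤ c := hcl.csSup_mem hne hbd
  have hgt : ∀ t, sSup {t | x t ≤ c} < t → c < x t := by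
    intro t ht
    by_contra! h
    exact absurd (le_csSup hbd (show t ∈ {t | x t ≤ c} from h)) (not_le.2 ht)
  refine ⟨_, le_antisymm hmem' ?_, hgt⟩
  refine ge_of_tendsto (hx.continuousAt.tendsto.mono_left
    (nhdsWithin_le_nhds (s := Ioi (sSup {t | x t ≤ c})))) ?_
  filter_upwards [self_mem_nhdsWithin] with t ht
  exact (hgt t ht).le

/-- A parametrization of the part of `Γ` in the square of the interval; `V` is the second coordinate,
unfolded at `1` and with the jump at `2 / 3` removed. -/
structure SpineParam (n : ℕ) (G : Set (Amb × Amb)) (u V : ℝ → ℝ) : Prop where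
  cu : Continuous u
  cV : Continuous V
  mu : Monotone u
  mV : Monotone V
  u_zero : u 0 = 0
  u_two_thirds : u (2 / 3) = 2 / 3
  u_one : u 1 = 1
  V_zero : V 0 = eps n
  V_half : V (1 / 2) = 1
  V_two_thirds : V (2 / 3) = 4 / 3 - eps n
  V_one : V 1 = 2 - 2 * eps n
  mem_left : ∀ t ∈ Icc (0 : ℝ) (2 / 3), (pt (u t), pt (wave (V t))) ∈ G
  mem_right : ∀ t ∈ Icc (2 / 3 : ℝ) 1, (pt (u t), pt (wave (V t + 2 * eps n))) ∈ G
  u_tauPre : ∀ m ≤ n, ∀ t ∈ tauPre m, u t = t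
  V_left : ∀ t < 2 / 3, ((∃ m ≤ n, t ∈ tauPre m) ∨ t ∈ Icc (0 : ℝ) 1 ∧ tau^[n + 1] t = 1) →
    V t = 2 * t
  V_right : ∀ t, 2 / 3 < t → ((∃ m ≤ n, t ∈ tauPre m) ∨ t ∈ Icc (0 : ℝ) 1 ∧ tau^[n + 1] t = 1) →
    V t + 2 * eps n = 2 * t
  u_eps : u (3 * eps (n + 1)) = eps n
  u_gt : ∀ t, 3 * eps (n + 1) < t → eps n < u t

/-! ### The numbers `eps n`, the special points, and the parametrization of the spine -/

theorem eps_pos (n : ℕ) : 0 < eps n := by unfold eps; positivity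

theorem eps_succ (n : ℕ) : eps (n + 1) = eps n / 2 := by unfold eps; rw [pow_succ]; field_simp

theorem eps_le (n : ℕ) : eps n ≤ 1 / 9 := by
  unfold eps
  have : (1 : ℝ) ≤ 2 ^ n := one_le_pow₀ (by norm_num)
  rw [div_le_div_iff₀ (by positivity) (by norm_num)]; linarith

theorem iterate_tau_pow (m : ℕ) {x : ℝ} (h : x ≤ 1) :
    tau^[m] (x / 2 ^ m) = x := by
  induction m with
  | zero => simp
  | succ m ih =>
    rw [Function.iterate_succ_apply, tau_of_le, show 2 * (x / 2 ^ (m + 1)) = x / 2 ^ m by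
      rw [pow_succ]; field_simp, ih]
    have : (1 : ℝ) ≤ 2 ^ m := one_le_pow₀ (by norm_num)
    rw [pow_succ, div_le_div_iff₀ (by positivity) (by norm_num)]; linarith

theorem three_eps_mem_tauPre (n : ℕ) : 3 * eps n ∈ tauPre n := by
  have : 3 * eps n = (1 / 3) / 2 ^ n := by unfold eps; field_simp; norm_num
  have h := eps_pos n
  have h' := eps_le n
  refine ⟨⟨by linarith, by linarith⟩, ?_⟩
  rw [this, iterate_tau_pow n (by norm_num)]; simp

/-- The points where the second coordinate of `Γ` is prescribed. -/
def special (n : ℕ) (t : ℝ) : Prop :=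
  (∃ m ≤ n, t ∈ tauPre m) ∨ t ∈ Icc (0 : ℝ) 1 ∧ tau^[n + 1] t = 1

theorem finite_special (n : ℕ) : {t | special n t}.Finite := by
  have h1 : (⋃ m ∈ Iic n, tauPre m).Finite := (finite_Iic n).biUnion fun m _ => finite_tauPre m
  refine (h1.union (finite_iterate_tau_preimage (finite_singleton 1) (n + 1))).subset ?_
  rintro t (⟨m, hm, h⟩ | h)
  · left; simp only [mem_iUnion]; exact ⟨m, hm, h⟩
  · right; exact h.2

theorem special.mem_Icc {n : ℕ} {t : ℝ} (h : special n t) : t ∈ Icc (0 : ℝ) 1 := by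
  rcases h with ⟨m, -, h⟩ | h
  exacts [h.1, h.1]

theorem special.ge {n : ℕ} {t : ℝ} (h : special n t) : 3 * eps n ≤ t := by
  have h2 : (0 : ℝ) < 2 ^ n := by positivity
  rcases h with ⟨m, hm, h⟩ | ⟨-, h⟩
  · refine le_trans ?_ (tauPre_ge h)
    have : (2 : ℝ) ^ m ≤ 2 ^ n := pow_le_pow_right₀ (by norm_num) hm
    unfold eps
    rw [mul_one_div, div_le_div_iff₀ (by positivity) (by positivity)]; linarith
  · have := iterate_tau_le t (n + 1)
    rw [h, pow_succ] at this
    unfold eps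
    rw [mul_one_div, div_le_iff₀ (by positivity)]; linarith

theorem special.dist {n : ℕ} {t : ℝ} (h : special n t) : 3 / 2 * eps n ≤ |t - 2 / 3| := by
  have h2 : (0 : ℝ) < 2 ^ n := by positivity
  rcases h with ⟨m, hm, h⟩ | ⟨-, h⟩
  · refine le_trans ?_ (tauPre_dist h)
    have : (2 : ℝ) ^ m ≤ 2 ^ n := pow_le_pow_right₀ (by norm_num) hm
    unfold eps
    rw [mul_one_div, div_le_div_iff₀ (by positivity) (by positivity)]; linarith
  · have := abs_iterate_tau_sub_le t (n + 1)
    rw [h, pow_succ] at this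
    have e : |(1 : ℝ) - 2 / 3| = 1 / 3 := by rw [abs_of_pos] <;> norm_num
    rw [e] at this
    unfold eps
    rw [mul_one_div, div_le_iff₀ (by positivity)]; linarith

set_option maxHeartbeats 1000000 in
theorem CondAmb.exists_spineParam {n : ℕ} {G : Set (Amb × Amb)} (hG : CondAmb n G) :
    ∃ u V : ℝ → ℝ, SpineParam n G u V := by
  classical
  obtain ⟨A₁, A₂, A₃, h₁, h₂, h₃, hA⟩ := hG.c1
  have hε := eps_pos n
  have hε' := eps_le n
  have hsub : A₁ ∪ A₂ ∪ A₃ ⊆ seg ×ˢ seg := hA ▸ inter_subset_right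
  have hGA : A₁ ∪ A₂ ∪ A₃ ⊆ G := hA ▸ inter_subset_left
  have s₁ : A₁ ⊆ seg ×ˢ seg := fun z hz => hsub (.inl (.inl hz))
  have s₂ : A₂ ⊆ seg ×ˢ seg := fun z hz => hsub (.inl (.inr hz))
  have s₃ : A₃ ⊆ seg ×ˢ seg := fun z hz => hsub (.inr hz)
  -- the range of the first coordinates
  have rng : ∀ {A : Set (Amb × Amb)} {a b c d : ℝ}, IsMonotoneArcFromTo A (pt a, pt c) (pt b, pt d) →
      A ⊆ seg ×ˢ seg → a ≤ b → ∀ {x y}, (pt x, pt y) ∈ A → a ≤ x ∧ x ≤ b := by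
    intro A a b c d h hs hab x y hxy
    obtain ⟨σ, hσ, hcd⟩ : ∃ σ : ℝ, σ * σ = 1 ∧ σ * c ≤ σ * d := by
      rcases le_total c d with h | h
      · exact ⟨1, by norm_num, by linarith⟩
      · exact ⟨-1, by norm_num, by linarith⟩
    obtain ⟨x', v, -, -, mx, -, h0, h1, -, hsurj, -⟩ := h.exists_coord
      (φ := Prod.fst) (ψ := fun z => σ * z.1) (ι := pt) (κ := fun y => pt (σ * y))
      continuous_fst (by fun_prop)
      (by
        intro z hz
        obtain ⟨⟨t, -, h⟩, -⟩ := hs hz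
        rw [← h]; rfl)
      (by
        intro z hz
        obtain ⟨-, ⟨t, -, h⟩⟩ := hs hz
        rw [← h]
        simp only [pt_fst, ← mul_assoc, hσ, one_mul])
      hab hcd
    obtain ⟨t, ht, e, -⟩ := hsurj _ hxy
    simp only [pt_fst] at e h0 h1
    have e1 := mx ht.1
    have e2 := mx ht.2
    rw [(h0 0 le_rfl).1, e] at e1
    rw [(h1 1 le_rfl).1, e] at e2
    exact ⟨e1, e2⟩
  have pin : ∀ m ≤ n, ∀ q ∈ tauPre m, (pt q, pt (tau q)) ∈ A₁ ∪ A₂ ∪ A₃ := fun m hm q hq => by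
    rw [← hA]; exact hG.c2 m hm q hq
  -- The three arcs lie over intervals that overlap only in end points, so the place of `q` decides
  -- which of them contains the pinned point of (C2).
  have p₁ : ∀ m ≤ n, ∀ q ∈ tauPre m, q < 1 / 2 → (pt q, pt (1 * (2 * q - 0))) ∈ A₁ := by
    intro m hm q hq hlt
    have := pin m hm q hq
    rw [tau_of_le hlt.le] at this
    rcases this with (h | h) | h
    · simpa using h
    · have := (rng h₂ s₂ (by norm_num) h).1; linarith
    · have := (rng h₃ s₃ (by norm_num) h).1; linarith
  have p₂ : ∀ m ≤ n, ∀ q ∈ tauPre m, 1 / 2 < q → q < 2 / 3 → (pt q, pt (-1 * (2 * q - 2))) ∈ A₂ := by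
    intro m hm q hq hlt hlt'
    have := pin m hm q hq
    rw [tau_of_ge hlt.le, show 2 - 2 * q = -1 * (2 * q - 2) by ring] at this
    rcases this with (h | h) | h
    · have := (rng h₁ s₁ (by norm_num) h).2; linarith
    · exact h
    · have := (rng h₃ s₃ (by norm_num) h).1; linarith
  have p₃ : ∀ m ≤ n, ∀ q ∈ tauPre m, 2 / 3 < q → (pt q, pt (-1 * (2 * q - 2))) ∈ A₃ := by
    intro m hm q hq hlt
    have := pin m hm q hq
    rw [tau_of_ge (by linarith), show 2 - 2 * q = -1 * (2 * q - 2) by ring] at this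
    rcases this with (h | h) | h
    · have := (rng h₁ s₁ (by norm_num) h).2; linarith
    · have := (rng h₂ s₂ (by norm_num) h).2; linarith
    · exact h
  obtain ⟨Q, hQ⟩ := (finite_special n).exists_finset
  have hQ : ∀ q, q ∈ Q ↔ special n q := hQ
  have tpin : special n (3 * eps n) := .inl ⟨n, le_rfl, three_eps_mem_tauPre n⟩
  obtain ⟨x₁, y₁, cx₁, cy₁, mx₁, my₁, lx₁, rx₁, memx₁, spx₁⟩ := h₁.exists_spine (σ := 1) (κ := 0)
    s₁ (by norm_num) (by norm_num) (by linarith) (Q.filter (· < 1 / 2))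
    (by
      intro q hq
      rw [Finset.mem_filter, hQ] at hq
      have := hq.1.ge
      refine ⟨by linarith, hq.2, by linarith, by linarith⟩)
  obtain ⟨u₂, V₂, cu₂, cV₂, mu₂, mV₂, l₂, r₂, mem₂, sp₂⟩ := h₂.exists_spine (σ := -1) (κ := 2)
    s₂ (by norm_num) (by norm_num) (by linarith) (Q.filter fun q => 1 / 2 < q ∧ q < 2 / 3)
    (by
      intro q hq
      rw [Finset.mem_filter, hQ] at hq
      have := hq.1.dist
      rw [abs_of_nonpos (by linarith)] at this
      refine ⟨hq.2.1, hq.2.2, by linarith, by linarith⟩)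
  obtain ⟨u₃, V₃, cu₃, cV₃, mu₃, mV₃, l₃, r₃, mem₃, sp₃⟩ := h₃.exists_spine (σ := -1) (κ := 2)
    s₃ (by norm_num) (by norm_num) (by linarith) (Q.filter fun q => 2 / 3 < q ∧ q < 1)
    (by
      intro q hq
      rw [Finset.mem_filter, hQ] at hq
      have := hq.1.dist
      rw [abs_of_nonneg (by linarith)] at this
      refine ⟨hq.2.1, hq.2.2, by linarith, by linarith⟩)
  have hx3 : x₁ (3 * eps n) = 3 * eps n := (spx₁ _ (by
    rw [Finset.mem_filter, hQ]; exact ⟨tpin, by linarith⟩)).2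
      (p₁ n le_rfl _ (three_eps_mem_tauPre n) (by linarith))
  -- The last time over `eps n`. It precedes `3 * eps n`, where the first coordinate is already
  -- pinned at `3 * eps n`.
  obtain ⟨te, hte, hte'⟩ := exists_last_time (c := eps n) cx₁ (a := 0) (b := 3 * eps n)
    (by rw [(lx₁ 0 le_rfl).1]; exact hε.le)
    (fun t ht => by have := mx₁ ht; linarith)
  have hte0 : 0 < te := by
    by_contra! h
    rw [(lx₁ te h).1] at hte; linarith
  have hte3 : te < 3 * eps n := by
    by_contra! h
    have := mx₁ h; linarith
  have he2 : eps (n + 1) = eps n / 2 := eps_succ n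
  -- The last time over `eps n` is moved to parameter `3 * eps (n + 1)`. This leaves the special
  -- points alone, since they are at least `3 * eps n = 6 * eps (n + 1)`.
  obtain ⟨ρ, cρ, mρ, hρ⟩ := exists_strictMono_interpolation
    (insert 0 (insert (1 / 2) (insert (3 * eps (n + 1)) (Q.filter (· < 1 / 2)))))
    (fun q => if q = 3 * eps (n + 1) then te else q) (by
      intro q hq q' hq' hlt
      simp only [Finset.coe_insert, mem_insert_iff, Finset.coe_filter, mem_ofPred_eq, hQ] at hq hq'
      have key : ∀ q, q = 0 ∨ q = 1 / 2 ∨ q = 3 * eps (n + 1) ∨ special n q ∧ q < 1 / 2 →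
          q = 0 ∨ q = 3 * eps (n + 1) ∨ 3 * eps n ≤ q := by
        rintro q (h | h | h | h)
        · exact .inl h
        · right; right; linarith
        · exact .inr (.inl h)
        · exact .inr (.inr h.1.ge)
      dsimp only
      rcases key q hq with h | h | h <;> rcases key q' hq' with h' | h' | h' <;>
        split_ifs <;> linarith)
  have hρ0 : ρ 0 = 0 := by rw [hρ 0 (by simp), if_neg (by linarith)]
  have hρh : ρ (1 / 2) = 1 / 2 := by rw [hρ (1 / 2) (by simp), if_neg (by linarith)]
  have hρe : ρ (3 * eps (n + 1)) = te := by rw [hρ _ (by simp), if_pos rfl]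
  have hρq : ∀ q, special n q → q < 1 / 2 → ρ q = q := by
    intro q hq hlt
    rw [hρ q (by simp only [Finset.mem_insert, Finset.mem_filter, hQ]; exact .inr (.inr (.inr ⟨hq, hlt⟩))),
      if_neg]
    have := hq.ge; linarith
  have l₁ : ∀ t ≤ 0, x₁ (ρ t) = 0 ∧ y₁ (ρ t) = eps n := fun t ht => by
    have := mρ.monotone ht
    rw [hρ0] at this
    simpa using lx₁ _ this
  have r₁ : ∀ t, 1 / 2 ≤ t → x₁ (ρ t) = 1 / 2 ∧ y₁ (ρ t) = 1 := fun t ht => by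
    have := mρ.monotone ht
    rw [hρh] at this
    simpa using rx₁ _ this
  have m₁ : ∀ t, x₁ (ρ t) ∈ Icc 0 (1 / 2) ∧ y₁ (ρ t) ∈ Icc (eps n) 1 := fun t => by
    have a1 := mx₁ (mρ.monotone (min_le_left t 0)); have a2 := mx₁ (mρ.monotone (le_max_left t (1 / 2)))
    have b1 := my₁ (mρ.monotone (min_le_left t 0)); have b2 := my₁ (mρ.monotone (le_max_left t (1 / 2)))
    have := l₁ (min t 0) (min_le_right _ _)
    have := r₁ (max t (1 / 2)) (le_max_right _ _)
    exact ⟨⟨by linarith, by linarith⟩, by linarith, by linarith⟩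
  simp only [neg_mul, one_mul] at l₂ r₂ l₃ r₃ mem₂ mem₃ sp₂ sp₃ p₂ p₃
  have m₂ : ∀ t, V₂ t ∈ Icc (1 : ℝ) 2 := fun t => by
    have a1 := mV₂ (min_le_left t (1 / 2)); have a2 := mV₂ (le_max_left t (2 / 3))
    have := l₂ (min t (1 / 2)) (min_le_right _ _)
    have := r₂ (max t (2 / 3)) (le_max_right _ _)
    constructor <;> linarith
  have m₃ : ∀ t, V₃ t ∈ Icc (1 : ℝ) 2 := fun t => by
    have a1 := mV₃ (min_le_left t (2 / 3)); have a2 := mV₃ (le_max_left t 1)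
    have := l₃ (min t (2 / 3)) (min_le_right _ _)
    have := r₃ (max t 1) (le_max_right _ _)
    constructor <;> linarith
  have loc₁ : ∀ t ≤ 1 / 2, u₂ t = 1 / 2 ∧ V₂ t = 1 ∧ u₃ t = 2 / 3 ∧ V₃ t = 4 / 3 + eps n := by
    intro t ht
    have := l₂ t ht
    have := l₃ t (by linarith)
    refine ⟨by linarith, by linarith, by linarith, by linarith⟩
  have loc₂ : ∀ t, 1 / 2 ≤ t → t ≤ 2 / 3 →
      x₁ (ρ t) = 1 / 2 ∧ y₁ (ρ t) = 1 ∧ u₃ t = 2 / 3 ∧ V₃ t = 4 / 3 + eps n := by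
    intro t ht ht'
    have := r₁ t ht
    have := l₃ t (by linarith)
    refine ⟨by linarith, by linarith, by linarith, by linarith⟩
  have loc₃ : ∀ t, 2 / 3 ≤ t →
      x₁ (ρ t) = 1 / 2 ∧ y₁ (ρ t) = 1 ∧ u₂ t = 2 / 3 ∧ V₂ t = 4 / 3 - eps n := by
    intro t ht
    have := r₁ t (by linarith)
    have := r₂ t (by linarith)
    refine ⟨by linarith, by linarith, by linarith, by linarith⟩
  have vv : ∀ t, t ≠ 2 / 3 → special n t → (t < 2 / 3 → y₁ (ρ t) + V₂ t - 1 = 2 * t) ∧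
      (2 / 3 < t → V₃ t = 2 * t) := by
    intro t hne ht
    constructor
    · intro hlt
      rcases lt_trichotomy t (1 / 2) with h | h | h
      · have := loc₁ t h.le
        rw [hρq t ht h, (spx₁ t (by rw [Finset.mem_filter, hQ]; exact ⟨ht, h⟩)).1]; linarith
      · have := loc₁ t h.le
        have := r₁ t h.ge
        linarith
      · have := loc₂ t h.le hlt.le
        rw [(sp₂ t (by rw [Finset.mem_filter, hQ]; exact ⟨ht, h, hlt⟩)).1]; linarith
    · intro hlt
      rcases ht.mem_Icc.2.eq_or_lt with rfl | h
      · have := r₃ 1 le_rfl; linarith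
      · exact (sp₃ t (by rw [Finset.mem_filter, hQ]; exact ⟨ht, hlt, h⟩)).1
  -- Each of the three pieces is constant outside its own interval, so addition glues them after
  -- subtraction of the resting values. The constant in `V` also removes the jump `2 * eps n` at
  -- `2/3`.
  refine ⟨fun t => x₁ (ρ t) + u₂ t + u₃ t - 7 / 6, fun t => y₁ (ρ t) + V₂ t + V₃ t - (7 / 3 + eps n), ?_⟩
  have S0 := loc₁ 0 (by norm_num)
  have Sh := loc₁ (1 / 2) le_rfl
  have S2 := loc₂ (2 / 3) (by norm_num) le_rfl
  have S3 := loc₃ (2 / 3) le_rfl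
  have S1 := loc₃ 1 (by norm_num)
  have R1 := r₃ 1 le_rfl
  have L0 := l₁ 0 le_rfl
  have Rh := r₁ (1 / 2) le_rfl
  constructor
  case cu => fun_prop
  case cV => fun_prop
  case mu =>
    intro s t h
    have := mx₁ (mρ.monotone h); have := mu₂ h; have := mu₃ h
    dsimp only; linarith
  case mV =>
    intro s t h
    have := my₁ (mρ.monotone h); have := mV₂ h; have := mV₃ h
    dsimp only; linarith
  case mem_left =>
    intro t ht
    rcases le_total t (1 / 2) with h | h
    · obtain ⟨a1, a2, a3, a4⟩ := loc₁ t h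
      have := hGA (.inl (.inl (memx₁ (ρ t))))
      have b := (m₁ t).2
      rw [a1, a2, a3, a4, wave_eq₁ (by linarith [b.1]) (by linarith [b.2])]
      convert this using 3 <;> ring
    · obtain ⟨a1, a2, a3, a4⟩ := loc₂ t h ht.2
      have := hGA (.inl (.inr (mem₂ t)))
      have b := m₂ t
      rw [a1, a2, a3, a4, wave_eq₂ (by linarith [b.1]) (by linarith [b.2])]
      convert this using 3 <;> ring
  case mem_right =>
    intro t ht
    obtain ⟨a1, a2, a3, a4⟩ := loc₃ t ht.1
    have := hGA (.inr (mem₃ t))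
    have b := m₃ t
    rw [a1, a2, a3, a4, wave_eq₂ (by linarith [b.1]) (by linarith [b.2])]
    convert this using 3 <;> ring
  case u_tauPre =>
    intro m hm t ht
    have hst : special n t := .inl ⟨m, hm, ht⟩
    rcases lt_or_ge t (1 / 2) with h | h
    · have := loc₁ t h.le
      rw [hρq t hst h, (spx₁ t (by rw [Finset.mem_filter, hQ]; exact ⟨hst, h⟩)).2 (p₁ m hm t ht h)]
      linarith
    · rcases h.eq_or_lt with rfl | h
      · linarith
      rcases lt_or_ge t (2 / 3) with h' | h'
      · have := loc₂ t h.le h'.le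
        rw [(sp₂ t (by rw [Finset.mem_filter, hQ]; exact ⟨hst, h, h'⟩)).2 (p₂ m hm t ht h h')]
        linarith
      · rcases h'.eq_or_lt with rfl | h'
        · exact absurd ht (two_thirds_notMem_tauPre m)
        have := loc₃ t h'.le
        rcases ht.1.2.eq_or_lt with rfl | h1
        · linarith
        rw [(sp₃ t (by rw [Finset.mem_filter, hQ]; exact ⟨hst, h', h1⟩)).2 (p₃ m hm t ht h')]
        linarith
  case V_left =>
    intro t ht hs
    have := (vv t ht.ne hs).1 ht
    have := (l₃ t ht.le).2
    linarith
  case V_right =>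
    intro t ht hs
    have := (vv t ht.ne' hs).2 ht
    have := loc₃ t ht.le
    linarith
  case u_eps =>
    have := loc₁ (3 * eps (n + 1)) (by linarith)
    rw [hρe, hte]; linarith
  case u_gt =>
    intro t ht
    have h1 := hte' (ρ t) (by rw [← hρe]; exact mρ ht)
    have h2 := mu₂ (min_le_left t (1 / 2))
    have h3 := mu₃ (min_le_left t (1 / 2))
    have := loc₁ (min t (1 / 2)) (min_le_right _ _)
    linarith
  all_goals linarith

/-- Parametrizations of the legs over a point of `tauPre m`. -/
theorem CondAmb.exists_legParam {n : ℕ} {G : Set (Amb × Amb)} (hG : CondAmb n G) {m : ℕ}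
    (hm : m ≤ n) {p : ℝ} (hp : p ∈ tauPre m) (i : Fin 3) :
    ∃ a b : ℝ → ℝ, Continuous a ∧ Continuous b ∧ Monotone a ∧ Monotone b ∧
      (∀ r ≤ 0, a r = 0 ∧ b r = 0) ∧ (∀ r, 1 ≤ r → b r = 1) ∧ (m < n → ∀ r, 1 ≤ r → a r = 1) ∧
      (m = n → ∀ r, a r = 0) ∧ ∀ r, (leg p i (a r), leg (tau p) i (b r)) ∈ G := by
  rcases hm.eq_or_lt with rfl | hlt
  -- In the last generation only the vertical arcs of (C6) are available: the first coordinate waits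
  -- at the foot of its leg.
  · have h6 := hG.c6 p hp i
    refine ⟨fun _ => 0, fun r => max 0 (min 1 r), continuous_const, by fun_prop, monotone_const, ?_,
      ?_, ?_, fun h => absurd h (lt_irrefl _), fun _ _ => rfl, ?_⟩
    · intro s t h; exact max_le_max le_rfl (min_le_min le_rfl h)
    · intro r hr; exact ⟨rfl, max_eq_left ((min_le_right _ _).trans hr)⟩
    · intro r hr; simp [min_eq_left hr]
    · intro r
      refine h6 ⟨by simp, leg_mem_legArc ⟨le_max_left _ _, max_le zero_le_one (min_le_left _ _)⟩⟩
  · obtain ⟨a, b, ca, cb, ma, mb, h0, h1, hmem, -⟩ := (hG.c5 m hlt p hp i).exists_coord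
      (φ := fun z => z.2 i) (ψ := fun z => z.2 i) (ι := leg p i) (κ := leg (tau p) i)
      (by fun_prop) (by fun_prop)
      (by rintro z ⟨-, ⟨t, -, h⟩, -⟩; rw [← h]; simp)
      (by rintro z ⟨-, -, ⟨t, -, h⟩⟩; rw [← h]; simp)
      (by simp) (by simp)
    refine ⟨a, b, ca, cb, ma, mb, fun r hr => by simpa using h0 r hr,
      fun r hr => by simpa using (h1 r hr).2, fun _ r hr => by simpa using (h1 r hr).1,
      fun h => absurd h hlt.ne, fun r => (hmem r).1⟩

/-- Parametrizations of the two arcs of `Γ` over a leg at `c ∈ {0, 2 / 3}`: the parameter `k` is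
negative on the arc that goes to the interval, and positive on the one that goes to the next leg. -/
theorem exists_bentParam {G : Set (Amb × Amb)} {c σ ε : ℝ} {i : Fin 3} (hσ : σ * σ = 1)
    (hε : 0 < ε) {B H : Set (Amb × Amb)} (hBG : B ⊆ G ∩ (legArc c i ×ˢ seg))
    (hHG : H ⊆ G ∩ (legArc c i ×ˢ legArc c (i + 1)))
    (hB : IsMonotoneArcFromTo B (pt c, pt (c + σ * ε)) (leg c i (1 / 2), pt c))
    (hH : IsMonotoneArcFromTo H (leg c i (1 / 2), pt c) (leg c i 1, leg c (i + 1) 1)) :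
    ∃ a k : ℝ → ℝ, Continuous a ∧ Continuous k ∧ Monotone a ∧ Monotone k ∧
      (∀ r ≤ 1 / 4, a r = 0 ∧ k r = -ε) ∧ (∀ r, 1 ≤ r → a r = 1 ∧ k r = 1) ∧ k (1 / 2) = 0 ∧
      (∀ r, (leg c i (a r), (c + σ * max (-k r) 0, Pi.single (i + 1) (max (k r) 0))) ∈ G) ∧
      ((∀ r, (leg c i r, pt c) ∈ B → (leg c i r, pt c) ∈ H) →
        (∀ r, (leg c i r, pt c) ∈ H → (leg c i r, pt c) ∈ B) →
        (∀ r < 1 / 2, k r < 0) ∧ ∀ r, 1 / 2 < r → 0 < k r) := by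
  obtain ⟨aB, kB, caB, ckB, maB, mkB, B0, B1, Bmem, Bsurj, Binj⟩ := hB.exists_coord
    (φ := fun z => z.2 i) (ψ := fun z => -σ * (z.1 - c)) (ι := leg c i)
    (κ := fun y => pt (c - σ * y)) (by fun_prop) (by fun_prop)
    (by intro z hz; obtain ⟨-, ⟨t, -, h⟩, -⟩ := hBG hz; rw [← h]; simp)
    (by
      intro z hz; obtain ⟨-, -, ⟨t, -, h⟩⟩ := hBG hz
      rw [← h]
      show pt (c - σ * (-σ * (t - c))) = pt t
      congr 1; linear_combination (t - c) * hσ)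
    (by simp) (by simp only [pt_fst, add_sub_cancel_left, sub_self]; nlinarith)
  obtain ⟨aH, kH, caH, ckH, maH, mkH, H0, H1, Hmem, Hsurj, Hinj⟩ := hH.exists_coord
    (φ := fun z => z.2 i) (ψ := fun z => z.2 (i + 1)) (ι := leg c i)
    (κ := leg c (i + 1)) (by fun_prop) (by fun_prop)
    (by intro z hz; obtain ⟨-, ⟨t, -, h⟩, -⟩ := hHG hz; rw [← h]; simp)
    (by intro z hz; obtain ⟨-, -, ⟨t, -, h⟩⟩ := hHG hz; rw [← h]; simp)
    (by simp; norm_num) (by simp)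
  have e : -σ * (σ * ε) = -ε := by linear_combination (-ε) * hσ
  simp only [pt_fst, pt_snd, leg_snd, Pi.single_eq_same, Pi.zero_apply, add_sub_cancel_left, e,
    sub_self, mul_zero] at B0 B1 H0 H1
  have sgB : ∀ t, kB t ≤ 0 := fun t => by
    have := mkB (le_max_left t 1); rwa [(B1 _ (le_max_right _ _)).2] at this
  have sgH : ∀ t, 0 ≤ kH t := fun t => by
    have := mkH (min_le_left t 0); rwa [(H0 _ (min_le_right _ _)).2] at this
  -- The arc `B` is run during `[1/4, 1/2]` and `H` during `[1/2, 1]`. The rest on `[0, 1/4]` is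
  -- deliberate: it gives the matching arcs of the next stage room to leave the foot of the leg
  -- before anything else moves.
  refine ⟨fun r => aB (4 * r - 1) + aH (2 * r - 1) - 1 / 2,
    fun r => kB (4 * r - 1) + kH (2 * r - 1), by fun_prop, by fun_prop, ?_, ?_, ?_, ?_, ?_, ?_, ?_⟩
  · intro s t h
    have := maB (show 4 * s - 1 ≤ 4 * t - 1 by linarith)
    have := maH (show 2 * s - 1 ≤ 2 * t - 1 by linarith)
    dsimp only; linarith
  · intro s t h
    have := mkB (show 4 * s - 1 ≤ 4 * t - 1 by linarith)
    have := mkH (show 2 * s - 1 ≤ 2 * t - 1 by linarith)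
    dsimp only; linarith
  · intro r hr
    have h1 := B0 (4 * r - 1) (by linarith)
    have h2 := H0 (2 * r - 1) (by linarith)
    dsimp only; rw [h1.1, h1.2, h2.1, h2.2]; constructor <;> ring
  · intro r hr
    have h1 := B1 (4 * r - 1) (by linarith)
    have h2 := H1 (2 * r - 1) (by linarith)
    dsimp only; rw [h1.1, h1.2, h2.1, h2.2]; constructor <;> ring
  · have h1 := B1 (4 * (1 / 2) - 1) (by norm_num)
    have h2 := H0 (2 * (1 / 2) - 1) (by norm_num)
    dsimp only; rw [h1.2, h2.2]; ring
  · intro r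
    dsimp only
    rcases le_total r (1 / 2) with h | h
    · have h2 := H0 (2 * r - 1) (by linarith)
      have hm := (hBG (Bmem (4 * r - 1))).1
      have hk := sgB (4 * r - 1)
      rw [h2.1, h2.2, max_eq_left (by linarith), max_eq_right (by linarith)]
      convert hm using 2
      · congr 1; ring
      · rw [Pi.single_zero]; unfold pt; congr 1; ring
    · have h2 := B1 (4 * r - 1) (by linarith)
      have hm := (hHG (Hmem (2 * r - 1))).1
      have hk := sgH (2 * r - 1)
      rw [h2.1, h2.2, max_eq_right (by linarith), max_eq_left (by linarith)]
      convert hm using 2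
      · congr 1; ring
      · unfold leg; congr 1
        · ring
        · congr 1; ring
  · intro hBH hHB
    have rB : ∀ t, aB t ≤ 1 / 2 := fun t => by
      have := maB (le_max_left t 1); rwa [(B1 _ (le_max_right _ _)).1] at this
    have rH : ∀ t, 1 / 2 ≤ aH t := fun t => by
      have := maH (min_le_left t 0); rwa [(H0 _ (min_le_right _ _)).1] at this
    -- On `B` the leg coordinate is at most `1/2`, on `H` at least `1/2`. A zero of `k` gives a
    -- point on both arcs, hence their common end, and injectivity of the arcs fixes the time.
    have uq : ∀ r, (leg c i r, pt c) ∈ B → (leg c i r, pt c) ∈ H → r = 1 / 2 := by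
      intro r h h'
      obtain ⟨t, -, e, -⟩ := Bsurj _ h
      obtain ⟨t', -, e', -⟩ := Hsurj _ h'
      simp only [leg_snd, Pi.single_eq_same] at e e'
      have := rB t; have := rH t'
      linarith
    constructor
    · intro r hr
      have h2 := H0 (2 * r - 1) (by linarith)
      dsimp only
      rw [h2.2, add_zero]
      refine lt_of_le_of_ne (sgB _) fun h0 => ?_
      have h4 : 0 ≤ 4 * r - 1 := by
        by_contra! h
        have := (B0 _ h.le).2; linarith
      have hm := Bmem (4 * r - 1)
      rw [h0, mul_zero, sub_zero] at hm
      have := uq _ hm (hBH _ hm)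
      have h1 := B1 1 le_rfl
      have := Binj (4 * r - 1) ⟨h4, by linarith⟩ 1 ⟨by norm_num, le_rfl⟩ (by rw [this, h1.1])
        (by rw [h0, h1.2])
      linarith
    · intro r hr
      have h2 := B1 (4 * r - 1) (by linarith)
      dsimp only
      rw [h2.2, zero_add]
      refine lt_of_le_of_ne (sgH _) fun h0 => ?_
      have h4 : 2 * r - 1 ≤ 1 := by
        by_contra! h
        have := (H1 _ h.le).2; linarith
      have hm := Hmem (2 * r - 1)
      rw [← h0, leg_zero] at hm
      have := uq _ (hHB _ hm) hm
      have h1 := H0 0 le_rfl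
      have := Hinj (2 * r - 1) ⟨by linarith, h4⟩ 0 ⟨le_rfl, by norm_num⟩ (by rw [this, h1.1])
        (by rw [← h0, h1.2])
      linarith

theorem CondAmb.exists_bentParam_zero {n : ℕ} {G : Set (Amb × Amb)} (hG : CondAmb n G)
    (i : Fin 3) :
    ∃ a k : ℝ → ℝ, Continuous a ∧ Continuous k ∧ Monotone a ∧ Monotone k ∧
      (∀ r ≤ 1 / 4, a r = 0 ∧ k r = -eps n) ∧ (∀ r, 1 ≤ r → a r = 1 ∧ k r = 1) ∧ k (1 / 2) = 0 ∧
      (∀ r, (leg 0 i (a r), (max (-k r) 0, Pi.single (i + 1) (max (k r) 0))) ∈ G) ∧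
      (∀ r < 1 / 2, k r < 0) ∧ ∀ r, 1 / 2 < r → 0 < k r := by
  obtain ⟨a, k, h1, h2, h3, h4, h5, h6, h7, h8, h9⟩ := exists_bentParam (σ := 1) (c := 0)
    (by norm_num) (eps_pos n) subset_rfl subset_rfl (by simpa using hG.c3_zero i)
    (hG.c4 0 (by simp) i)
  refine ⟨a, k, h1, h2, h3, h4, h5, h6, h7, fun r => by simpa using h8 r, h9 ?_ ?_⟩
  -- At `0` both arcs are full intersections with `Γ`, and a point over the foot `pt 0` belongs to
  -- the interval as well as to the leg. At `2/3` this fails, because the first arc is only one of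
  -- two; there the strict signs are not needed.
  · rintro r ⟨h, h', -⟩
    exact ⟨h, h', pt_mem_legArc _ _⟩
  · rintro r ⟨h, h', -⟩
    exact ⟨h, h', pt_mem_seg (by norm_num)⟩

theorem CondAmb.exists_bentParam_two_thirds {n : ℕ} {G : Set (Amb × Amb)} (hG : CondAmb n G)
    (i : Fin 3) {σ : ℝ} (hσ : σ = 1 ∨ σ = -1) :
    ∃ a k : ℝ → ℝ, Continuous a ∧ Continuous k ∧ Monotone a ∧ Monotone k ∧
      (∀ r ≤ 1 / 4, a r = 0 ∧ k r = -eps n) ∧ (∀ r, 1 ≤ r → a r = 1 ∧ k r = 1) ∧ k (1 / 2) = 0 ∧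
      (∀ r, (leg (2 / 3) i (a r),
        (2 / 3 + σ * max (-k r) 0, Pi.single (i + 1) (max (k r) 0))) ∈ G) := by
  obtain ⟨B₁, B₂, hB₁, hB₂, hB⟩ := hG.c3_two_thirds i
  obtain ⟨B, hB, hBG⟩ : ∃ B, IsMonotoneArcFromTo B (pt (2 / 3), pt (2 / 3 + σ * eps n))
      (leg (2 / 3) i (1 / 2), pt (2 / 3)) ∧ B ⊆ G ∩ (legArc (2 / 3) i ×ˢ seg) := by
    rcases hσ with rfl | rfl
    · exact ⟨B₁, by simpa using hB₁, hB ▸ subset_union_left⟩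
    · exact ⟨B₂, by simpa [sub_eq_add_neg] using hB₂, hB ▸ subset_union_right⟩
  obtain ⟨a, k, h1, h2, h3, h4, h5, h6, h7, h8, -⟩ := exists_bentParam
    (by rcases hσ with rfl | rfl <;> norm_num) (eps_pos n) hBG subset_rfl hB
    (hG.c4 (2 / 3) (by simp) i)
  exact ⟨a, k, h1, h2, h3, h4, h5, h6, h7, h8⟩

/-! ### Threefold unfolding of a function on `[0, 1]` -/

/-- The function `φ ∘ tau3` with its decreasing middle branch reflected, so that the three branches
join into one monotone function. The factor `1/3` makes `[0, 1]` correspond to itself when `φ` is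
the identity; the clamps make the formula total. -/
noncomputable def ext (φ : ℝ → ℝ) (x : ℝ) : ℝ :=
  (φ (max 0 (min 1 (3 * x))) + (φ 1 - φ (max 0 (min 1 (2 - 3 * x)))) +
    (φ (max 0 (min 1 (3 * x - 2))) - φ 0)) / 3

theorem continuous_ext {φ : ℝ → ℝ} (h : Continuous φ) : Continuous (ext φ) := by
  unfold ext; fun_prop

theorem monotone_ext {φ : ℝ → ℝ} (h : Monotone φ) : Monotone (ext φ) := by
  intro s t hst
  have cl : ∀ {a b : ℝ}, a ≤ b → φ (max 0 (min 1 a)) ≤ φ (max 0 (min 1 b)) := fun hab =>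
    h (max_le_max le_rfl (min_le_min le_rfl hab))
  have h1 := cl (show 3 * s ≤ 3 * t by linarith)
  have h2 := cl (show 2 - 3 * t ≤ 2 - 3 * s by linarith)
  have h3 := cl (show 3 * s - 2 ≤ 3 * t - 2 by linarith)
  unfold ext; linarith

theorem clamp_of_mem {x : ℝ} (h0 : 0 ≤ x) (h1 : x ≤ 1) : max 0 (min 1 x) = x := by
  rw [min_eq_right h1, max_eq_right h0]
theorem clamp_of_le {x : ℝ} (h0 : x ≤ 0) : max 0 (min 1 x) = 0 :=
  max_eq_left ((min_le_right _ _).trans h0)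
theorem clamp_of_ge {x : ℝ} (h0 : 1 ≤ x) : max 0 (min 1 x) = 1 := by
  rw [min_eq_left h0]; exact max_eq_right zero_le_one

theorem ext_of₁ (φ : ℝ → ℝ) {x : ℝ} (h0 : 0 ≤ x) (h1 : x ≤ 1 / 3) : 3 * ext φ x = φ (3 * x) := by
  unfold ext
  rw [clamp_of_mem (by linarith) (by linarith), clamp_of_ge (by linarith),
    clamp_of_le (by linarith)]; ring

theorem ext_of₂ (φ : ℝ → ℝ) {x : ℝ} (h0 : 1 / 3 ≤ x) (h1 : x ≤ 2 / 3) :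
    3 * ext φ x = 2 * φ 1 - φ (2 - 3 * x) := by
  unfold ext
  rw [clamp_of_ge (by linarith), clamp_of_mem (by linarith) (by linarith),
    clamp_of_le (by linarith)]; ring

theorem ext_of₃ (φ : ℝ → ℝ) {x : ℝ} (h0 : 2 / 3 ≤ x) (h1 : x ≤ 1) :
    3 * ext φ x = 2 * φ 1 - 2 * φ 0 + φ (3 * x - 2) := by
  unfold ext
  rw [clamp_of_ge (by linarith), clamp_of_le (by linarith),
    clamp_of_mem (by linarith) (by linarith)]; ring

theorem tau3_of₁ {x : ℝ} (h0 : 0 ≤ x) (h1 : x ≤ 1 / 3) : tau3 x = 3 * x :=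
  wave_eq₁ (by linarith) (by linarith)
theorem tau3_of₂ {x : ℝ} (h0 : 1 / 3 ≤ x) (h1 : x ≤ 2 / 3) : tau3 x = 2 - 3 * x :=
  wave_eq₂ (by linarith) (by linarith)
theorem tau3_of₃ {x : ℝ} (h0 : 2 / 3 ≤ x) (h1 : x ≤ 1) : tau3 x = 3 * x - 2 :=
  wave_eq₃ (by linarith) (by linarith)

theorem wave_four_sub {z : ℝ} (h0 : 0 ≤ z) (h1 : z ≤ 2) : wave (4 - z) = wave z := by
  rcases le_total z 1 with h | h
  · rw [wave_eq₁ h0 h, wave_eq₄ (by linarith) (by linarith)]; ring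
  · rw [wave_eq₂ h h1, wave_eq₃ (by linarith) (by linarith)]; ring

theorem wave_four_add {z : ℝ} (h0 : 0 ≤ z) (h1 : z ≤ 2) : wave (4 + z) = wave z := by
  rcases le_total z 1 with h | h
  · rw [wave_eq₁ h0 h, wave_eq₅ (by linarith) (by linarith)]; ring
  · rw [wave_eq₂ h h1, wave_eq₆ (by linarith) (by linarith)]; ring

open Classical in
/-- Half the height of the jump of the second coordinate at an excursion point. -/
noncomputable def jump (n : ℕ) (x : ℝ) : ℝ := if x ∈ cyc then eps n else 0

theorem jump_nonneg (n : ℕ) (x : ℝ) : 0 ≤ jump n x := by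
  unfold jump; split_ifs
  exacts [(eps_pos n).le, le_rfl]

open Classical in
/-- The second coordinate of `Γ`, unfolded along three passages through the interval. -/
noncomputable def unfolded (n : ℕ) (V : ℝ → ℝ) (y : ℝ) : ℝ :=
  3 * ext V y + (∑ x ∈ excPts (n + 1), if x < y then 2 * jump n x else 0) +
    if 2 / 3 < y then 2 * eps n else 0

/-- Only the three points over the gap of `Γ` at `2/3` contribute. -/
theorem sum_jump (n : ℕ) (y : ℝ) :
    (∑ x ∈ excPts (n + 1), if x < y then 2 * jump n x else 0) =
      (if 2 / 9 < y then 2 * eps n else 0) + (if 4 / 9 < y then 2 * eps n else 0) +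
        (if 8 / 9 < y then 2 * eps n else 0) := by
  classical
  have hsub : ({2 / 9, 4 / 9, 8 / 9} : Finset ℝ) ⊆ excPts (n + 1) := by
    intro x hx
    apply cyc_subset_excPts
    simpa [cyc] using hx
  rw [← Finset.sum_subset hsub]
  · rw [Finset.sum_insert (by norm_num), Finset.sum_insert (by norm_num), Finset.sum_singleton]
    have h1 : jump n (2 / 9) = eps n := if_pos (by simp [cyc])
    have h2 : jump n (4 / 9) = eps n := if_pos (by simp [cyc])
    have h3 : jump n (8 / 9) = eps n := if_pos (by simp [cyc])
    rw [h1, h2, h3]; ring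
  · intro x _ hx
    have : x ∉ cyc := fun h => hx (by simpa [cyc] using h)
    simp [jump, this]

namespace SpineParam

theorem V_mem {n : ℕ} {S : Set (Amb × Amb)} {u V : ℝ → ℝ} (H : SpineParam n S u V)
    {t : ℝ} (h : t ∈ Icc (0 : ℝ) 1) : eps n ≤ V t ∧ V t ≤ 2 - 2 * eps n :=
  ⟨H.V_zero ▸ H.mV h.1, H.V_one ▸ H.mV h.2⟩

theorem u_mem {n : ℕ} {S : Set (Amb × Amb)} {u V : ℝ → ℝ} (H : SpineParam n S u V)
    {t : ℝ} (h : t ∈ Icc (0 : ℝ) 1) : u t ∈ Icc (0 : ℝ) 1 :=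
  ⟨H.u_zero ▸ H.mu h.1, H.u_one ▸ H.mu h.2⟩

/-- Lifting through `tau3` turns points fixed by `u` into points fixed by `ext u`. -/
theorem ext_u {n : ℕ} {S : Set (Amb × Amb)} {u V : ℝ → ℝ} (H : SpineParam n S u V)
    {y : ℝ} (hy : y ∈ Icc (0 : ℝ) 1) (h : u (tau3 y) = tau3 y) : ext u y = y := by
  rcases le_total y (1 / 3) with h1 | h1
  · have := ext_of₁ u hy.1 h1
    rw [tau3_of₁ hy.1 h1] at h; linarith
  rcases le_total y (2 / 3) with h2 | h2
  · have := ext_of₂ u h1 h2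
    rw [tau3_of₂ h1 h2] at h; rw [H.u_one] at this; linarith
  · have := ext_of₃ u h2 hy.2
    rw [tau3_of₃ h2 hy.2] at h; rw [H.u_one, H.u_zero] at this; linarith

theorem wave_ext_u {n : ℕ} {S : Set (Amb × Amb)} {u V : ℝ → ℝ} (H : SpineParam n S u V)
    {y : ℝ} (hy : y ∈ Icc (0 : ℝ) 1) : wave (3 * ext u y) = u (tau3 y) := by
  have hm := H.u_mem (tau3_mem hy)
  rcases le_total y (1 / 3) with h1 | h1
  · rw [ext_of₁ u hy.1 h1]
    rw [tau3_of₁ hy.1 h1] at hm ⊢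
    exact wave_eq₁ hm.1 hm.2
  rcases le_total y (2 / 3) with h2 | h2
  · rw [ext_of₂ u h1 h2, H.u_one]
    rw [tau3_of₂ h1 h2] at hm ⊢
    rw [wave_eq₂ (by linarith [hm.2]) (by linarith [hm.1])]; ring
  · rw [ext_of₃ u h2 hy.2, H.u_one, H.u_zero]
    rw [tau3_of₃ h2 hy.2] at hm ⊢
    rw [wave_eq₃ (by linarith [hm.1]) (by linarith [hm.2])]; ring

/-- The branches of `tau3` are cut further at the points of the cycle, where `tau3` passes the gap.
With the jumps `2 * eps n` restored at the cycle and at `2/3`, the constants add up to the folding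
value `4`, so the wave recovers the second coordinate of `Γ` on every piece. -/
theorem unfolded_cases (n : ℕ) (V : ℝ → ℝ) {y : ℝ} (hy : y ∈ Icc (0 : ℝ) 1) (hV0 : V 0 = eps n)
    (hV1 : V 1 = 2 - 2 * eps n) :
    (y ≤ 2 / 9 ∧ tau3 y = 3 * y ∧ unfolded n V y = V (3 * y)) ∨
    (2 / 9 < y ∧ y ≤ 1 / 3 ∧ tau3 y = 3 * y ∧ unfolded n V y = V (3 * y) + 2 * eps n) ∨
    (1 / 3 ≤ y ∧ y ≤ 4 / 9 ∧ tau3 y = 2 - 3 * y ∧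
      unfolded n V y = 4 - (V (2 - 3 * y) + 2 * eps n)) ∨
    (4 / 9 < y ∧ y ≤ 2 / 3 ∧ tau3 y = 2 - 3 * y ∧ unfolded n V y = 4 - V (2 - 3 * y)) ∨
    (2 / 3 < y ∧ y ≤ 8 / 9 ∧ tau3 y = 3 * y - 2 ∧ unfolded n V y = 4 + V (3 * y - 2)) ∨
    (8 / 9 < y ∧ tau3 y = 3 * y - 2 ∧ unfolded n V y = 4 + (V (3 * y - 2) + 2 * eps n)) := by
  unfold unfolded
  rw [sum_jump]
  rcases le_or_gt y (2 / 9) with h | h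
  · left
    refine ⟨h, tau3_of₁ hy.1 (by linarith), ?_⟩
    rw [ext_of₁ V hy.1 (by linarith)]
    rw [if_neg (by linarith), if_neg (by linarith), if_neg (by linarith), if_neg (by linarith)]; ring
  rcases le_total y (1 / 3) with h1 | h1
  · right; left
    refine ⟨h, h1, tau3_of₁ hy.1 (by linarith), ?_⟩
    rw [ext_of₁ V hy.1 (by linarith)]
    rw [if_pos (by linarith), if_neg (by linarith), if_neg (by linarith), if_neg (by linarith)]; ring
  rcases le_or_gt y (4 / 9) with h2 | h2
  · right; right; left
    refine ⟨h1, h2, tau3_of₂ h1 (by linarith), ?_⟩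
    rw [ext_of₂ V h1 (by linarith), hV1]
    rw [if_pos (by linarith), if_neg (by linarith), if_neg (by linarith), if_neg (by linarith)]; ring
  rcases le_or_gt y (2 / 3) with h3 | h3
  · right; right; right; left
    refine ⟨h2, h3, tau3_of₂ h1 (by linarith), ?_⟩
    rw [ext_of₂ V h1 (by linarith), hV1]
    rw [if_pos (by linarith), if_pos (by linarith), if_neg (by linarith), if_neg (by linarith)]; ring
  rcases le_or_gt y (8 / 9) with h4 | h4
  · right; right; right; right; left
    refine ⟨h3, h4, tau3_of₃ h3.le hy.2, ?_⟩
    rw [ext_of₃ V h3.le hy.2, hV1, hV0]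
    rw [if_pos (by linarith), if_pos (by linarith), if_neg (by linarith), if_pos (by linarith)]; ring
  · right; right; right; right; right
    refine ⟨h4, tau3_of₃ h3.le hy.2, ?_⟩
    rw [ext_of₃ V h3.le hy.2, hV1, hV0]
    rw [if_pos (by linarith), if_pos (by linarith), if_pos (by linarith), if_pos (by linarith)]; ring

theorem mem_unfolded {n : ℕ} {S : Set (Amb × Amb)} {u V : ℝ → ℝ} (H : SpineParam n S u V)
    {y : ℝ} (hy : y ∈ Icc (0 : ℝ) 1) :
    (pt (wave (3 * ext u y)), pt (wave (unfolded n V y))) ∈ S := by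
  rw [H.wave_ext_u hy]
  have hε := eps_pos n
  have hm := H.V_mem (tau3_mem hy)
  have hl := H.mem_left (tau3 y)
  have hr := H.mem_right (tau3 y)
  rcases unfolded_cases n V hy H.V_zero H.V_one with ⟨h, e, e'⟩ | ⟨h, h', e, e'⟩ | ⟨h, h', e, e'⟩ |
    ⟨h, h', e, e'⟩ | ⟨h, h', e, e'⟩ | ⟨h, e, e'⟩ <;> rw [e'] <;> rw [e] at hm hl hr ⊢
  · exact hl ⟨by linarith [hy.1], by linarith⟩
  · exact hr ⟨by linarith, by linarith⟩
  · rw [wave_four_sub (by linarith [hm.1]) (by linarith [hm.2])]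
    exact hr ⟨by linarith, by linarith⟩
  · rw [wave_four_sub (by linarith [hm.1]) (by linarith [hm.2])]
    exact hl ⟨by linarith, by linarith⟩
  · rw [wave_four_add (by linarith [hm.1]) (by linarith [hm.2])]
    exact hl ⟨by linarith, by linarith⟩
  · rw [wave_four_add (by linarith [hm.1]) (by linarith [hm.2])]
    exact hr ⟨by linarith, by linarith [hy.2]⟩

/-- At special points `V` (with its jump) is twice the argument, as it would be for the unperturbed
graph of `tau`; lifted through three branches this gives the slope six. -/
theorem unfolded_special {n : ℕ} {S : Set (Amb × Amb)} {u V : ℝ → ℝ} (H : SpineParam n S u V)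
    {y : ℝ} (hy : y ∈ Icc (0 : ℝ) 1) (hs : special n (tau3 y))
    (hc : y ∉ cyc) : unfolded n V y = 6 * y := by
  have hl := fun h => H.V_left (tau3 y) h hs
  have hr := fun h => H.V_right (tau3 y) h hs
  have c1 : y ≠ 2 / 9 := fun h => hc (by simp [cyc, h])
  have c2 : y ≠ 4 / 9 := fun h => hc (by simp [cyc, h])
  have c3 : y ≠ 8 / 9 := fun h => hc (by simp [cyc, h])
  rcases unfolded_cases n V hy H.V_zero H.V_one with ⟨h, e, e'⟩ | ⟨h, h', e, e'⟩ | ⟨h, h', e, e'⟩ |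
    ⟨h, h', e, e'⟩ | ⟨h, h', e, e'⟩ | ⟨h, e, e'⟩ <;> rw [e'] <;> rw [e] at hl hr
  · rw [hl (by linarith [lt_of_le_of_ne h c1])]; ring
  · rw [hr (by linarith)]; ring
  · rw [hr (by linarith [lt_of_le_of_ne h' c2])]; ring
  · rw [hl (by linarith)]; ring
  · rw [hl (by linarith [lt_of_le_of_ne h' c3])]; ring
  · rw [hr (by linarith)]; ring

theorem unfolded_cyc {n : ℕ} {S : Set (Amb × Amb)} {u V : ℝ → ℝ} (H : SpineParam n S u V)
    {y : ℝ} (hc : y ∈ cyc) : unfolded n V y = 6 * y - eps n := by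
  have hV := H.V_two_thirds
  have hy := cyc_subset_Icc hc
  rcases hc with rfl | rfl | rfl <;>
  rcases unfolded_cases n V hy H.V_zero H.V_one with ⟨h, e, e'⟩ | ⟨h, h', e, e'⟩ | ⟨h, h', e, e'⟩ |
    ⟨h, h', e, e'⟩ | ⟨h, h', e, e'⟩ | ⟨h, e, e'⟩ <;> first
    | (exfalso; linarith) | (rw [e']; norm_num [hV]; try linarith)

theorem unfolded_zero {n : ℕ} {S : Set (Amb × Amb)} {u V : ℝ → ℝ} (H : SpineParam n S u V) : unfolded n V 0 = eps n := by
  rcases unfolded_cases n V (y := 0) (by norm_num) H.V_zero H.V_one with ⟨h, e, e'⟩ | ⟨h, h', e, e'⟩ | ⟨h, h', e, e'⟩ |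
    ⟨h, h', e, e'⟩ | ⟨h, h', e, e'⟩ | ⟨h, e, e'⟩ <;> first
    | (exfalso; linarith) | (rw [e']; norm_num [H.V_zero])

theorem unfolded_half {n : ℕ} {S : Set (Amb × Amb)} {u V : ℝ → ℝ} (H : SpineParam n S u V) : unfolded n V (1 / 2) = 3 := by
  have hV := H.V_half
  norm_num at hV
  rcases unfolded_cases n V (y := 1 / 2) (by norm_num) H.V_zero H.V_one with ⟨h, e, e'⟩ | ⟨h, h', e, e'⟩ | ⟨h, h', e, e'⟩ |
    ⟨h, h', e, e'⟩ | ⟨h, h', e, e'⟩ | ⟨h, e, e'⟩ <;> first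
    | (exfalso; linarith) | (rw [e']; norm_num [hV])

theorem unfolded_two_thirds {n : ℕ} {S : Set (Amb × Amb)} {u V : ℝ → ℝ} (H : SpineParam n S u V) : unfolded n V (2 / 3) = 4 - eps n := by
  rcases unfolded_cases n V (y := 2 / 3) (by norm_num) H.V_zero H.V_one with ⟨h, e, e'⟩ | ⟨h, h', e, e'⟩ | ⟨h, h', e, e'⟩ |
    ⟨h, h', e, e'⟩ | ⟨h, h', e, e'⟩ | ⟨h, e, e'⟩ <;> first
    | (exfalso; linarith) | (rw [e']; norm_num [H.V_zero])

theorem unfolded_one {n : ℕ} {S : Set (Amb × Amb)} {u V : ℝ → ℝ} (H : SpineParam n S u V) : unfolded n V 1 = 6 := by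
  rcases unfolded_cases n V (y := 1) (by norm_num) H.V_zero H.V_one with ⟨h, e, e'⟩ | ⟨h, h', e, e'⟩ | ⟨h, h', e, e'⟩ |
    ⟨h, h', e, e'⟩ | ⟨h, h', e, e'⟩ | ⟨h, e, e'⟩ <;> first
    | (exfalso; linarith) | (rw [e']; norm_num [H.V_one])

theorem unfolded_excPts {n : ℕ} {S : Set (Amb × Amb)} {u V : ℝ → ℝ} (H : SpineParam n S u V)
    {x : ℝ} (hx : x ∈ excPts (n + 1)) :
    unfolded n V x = 6 * x - jump n x ∧ ext u x = x := by
  have hI := (mem_excPts.1 hx).1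
  by_cases hc : x ∈ cyc
  · refine ⟨by rw [H.unfolded_cyc hc, jump, if_pos hc], H.ext_u hI ?_⟩
    rw [tau3_cyc hc, H.u_two_thirds]
  · obtain ⟨m, hm, ht, -⟩ := tau3_excPts hx hc
    refine ⟨?_, H.ext_u hI (H.u_tauPre m hm _ ht)⟩
    rw [H.unfolded_special hI (.inl ⟨m, hm, ht⟩) hc, jump, if_neg hc, sub_zero]

end SpineParam

/-! ### Excursions of the path -/

/-- Over the cycle the path has to cross the gap of `Γ` at `2/3`. It goes out along one arc of (C3)
and the arc of (C4), then returns along the arc of (C4) and the other arc of (C3); the height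
changes by `2 * eps n` in total. At any other excursion point the path follows the arc over two legs
from (C5), or from (C6) in the last generation, to its end and comes back, without change of height.
The clauses about `J` and `G` say that the second coordinate enters its leg only when the height has
reached the middle of the jump. -/
theorem exists_excursion {n : ℕ} {S : Set (Amb × Amb)} (hS : CondAmb n S) {x : ℝ}
    (hx : x ∈ excPts (n + 1)) :
    ∃ E G J : ℝ → ℝ, (Continuous E ∧ Continuous G ∧ Continuous J) ∧
      (Monotone E ∧ Monotone G ∧ Monotone J) ∧ (E 0 = 0 ∧ E 2 = 2) ∧ (G 0 = 0 ∧ G 2 = 2) ∧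
      (J 0 = 0 ∧ J 2 = 2 * jump n x) ∧
      (∀ e ∈ Icc (0 : ℝ) 2, (J e < jump n x → G e = 0) ∧ (jump n x < J e → G e = 2)) ∧
      (x ∉ excPts n → ∀ e ∈ Icc (0 : ℝ) 2, (pt (tau3 x),
        ((wave (6 * x - jump n x + J e), Pi.single (legIdx (tau x)) (tri (G e))) : Amb)) ∈ S) ∧
      (x ∈ excPts n → ∀ e ∈ Icc (0 : ℝ) 2, (leg (tau3 x) (legIdx x) (tri (E e)),
        ((wave (6 * x - jump n x + J e), Pi.single (legIdx (tau x)) (tri (G e))) : Amb)) ∈ S) := by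
  have hI := (mem_excPts.1 hx).1
  have hε := eps_pos n
  have hε' := eps_le n
  by_cases hc : x ∈ cyc
  · -- orientation
    obtain ⟨σ, hσ, hw⟩ : ∃ σ : ℝ, (σ = 1 ∨ σ = -1) ∧
        ∀ s ∈ Icc (-eps n) (eps n), wave (6 * x + s) = 2 / 3 - σ * s := by
      rcases hc with rfl | rfl | rfl
      · refine ⟨1, .inl rfl, fun s hs => ?_⟩
        rw [wave_eq₂ (by linarith [hs.1]) (by linarith [hs.2])]; ring
      · refine ⟨-1, .inr rfl, fun s hs => ?_⟩
        rw [wave_eq₃ (by linarith [hs.1]) (by linarith [hs.2])]; ring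
      · refine ⟨1, .inl rfl, fun s hs => ?_⟩
        rw [wave_eq₆ (by linarith [hs.1]) (by linarith [hs.2])]; ring
    -- The sign `σ` tells whether the sixfold wave falls or rises at `x`; the path leaves on the
    -- side of `σ` and returns on the side of `-σ`.
    obtain ⟨a, k, ca, ck, ma, mk, l, r, -, hm⟩ := hS.exists_bentParam_two_thirds (legIdx x) hσ
    obtain ⟨a', k', ca', ck', ma', mk', l', r', -, hm'⟩ :=
      hS.exists_bentParam_two_thirds (legIdx x) (σ := -σ)
        (by rcases hσ with rfl | rfl <;> norm_num)
    have hj : jump n x = eps n := if_pos hc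
    have kr : ∀ {k : ℝ → ℝ}, Monotone k → (∀ r ≤ 1 / 4, k r = -eps n) →
        ∀ r, -eps n ≤ k r := by
      intro k mk l r
      have := mk (min_le_left r (1 / 4))
      rwa [l _ (min_le_right _ _)] at this
    have kl := kr mk fun r hr => (l r hr).2
    have kl' := kr mk' fun r hr => (l' r hr).2
    rw [hj]
    have key : ∀ e ∈ Icc (0 : ℝ) 2, (leg (tau3 x) (legIdx x) (tri (a e + 1 - a' (2 - e))),
        ((wave (6 * x - eps n + (min (k e) 0 + eps n - min (k' (2 - e)) 0)),
          Pi.single (legIdx (tau x)) (tri (max (k e) 0 + 1 - max (k' (2 - e)) 0))) : Amb)) ∈ S := by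
      intro e he
      rw [legIdx_tau_of_mem hc, tau3_cyc hc]
      rcases le_total e 1 with h | h
      · obtain ⟨h1, h2⟩ := r' (2 - e) (by linarith)
        have hb := ma h
        rw [(r 1 le_rfl).1] at hb
        have hb2 := mk h
        rw [(r 1 le_rfl).2] at hb2
        have := hm e
        rw [h1, h2, tri_of_le (by linarith), tri_of_le (by
          rcases le_total (k e) 0 with h | h
          · rw [max_eq_right h]; norm_num
          · rw [max_eq_left h]; norm_num; linarith)]
        have e1 : 6 * x - eps n + (min (k e) 0 + eps n - min 1 0) = 6 * x + min (k e) 0 := by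
          norm_num
        rw [e1, hw _ ⟨le_min (kl e) (by linarith), (min_le_right _ _).trans hε.le⟩]
        convert this using 2
        · congr 1; ring
        · congr 1
          · rw [show max (-k e) 0 = -min (k e) 0 by rw [← max_neg_neg, neg_zero]]; ring
          · norm_num
      · obtain ⟨h1, h2⟩ := r e h
        have hb := ma' (show 2 - e ≤ 1 by linarith)
        rw [(r' 1 le_rfl).1] at hb
        have hb2 := mk' (show 2 - e ≤ 1 by linarith)
        rw [(r' 1 le_rfl).2] at hb2
        have := hm' (2 - e)
        rw [h1, h2, tri_of_ge (by linarith), tri_of_ge (by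
          rcases le_total (k' (2 - e)) 0 with h | h
          · rw [max_eq_right h]; norm_num
          · rw [max_eq_left h]; norm_num; linarith)]
        have e1 : 6 * x - eps n + (min 1 0 + eps n - min (k' (2 - e)) 0) =
            6 * x + -(min (k' (2 - e)) 0) := by norm_num; ring
        rw [e1, hw _ ⟨by linarith [min_le_right (k' (2 - e)) 0], by
          linarith [le_min (kl' (2 - e)) (neg_nonpos.2 hε.le)]⟩]
        convert this using 2
        · congr 1; ring
        · congr 1
          · rw [show max (-k' (2 - e)) 0 = -min (k' (2 - e)) 0 by rw [← max_neg_neg, neg_zero]]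
            ring
          · congr 1; norm_num
    -- On each half of `[0, 2]` one of the two summands rests at its end value. So this is the
    -- outward run followed by the inward one, written as increasing phases whose image under `tri`
    -- goes up and down.
    refine ⟨fun e => a e + 1 - a' (2 - e), fun e => max (k e) 0 + 1 - max (k' (2 - e)) 0,
      fun e => min (k e) 0 + eps n - min (k' (2 - e)) 0,
      ⟨by fun_prop, by fun_prop, by fun_prop⟩, ⟨?_, ?_, ?_⟩, ?_, ?_, ?_, ?_, ?_, ?_⟩
    · intro s t h
      have := ma h; have := ma' (show 2 - t ≤ 2 - s by linarith)
      dsimp only; linarith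
    · intro s t h
      have := max_le_max (mk h) (le_refl 0)
      have := max_le_max (mk' (show 2 - t ≤ 2 - s by linarith)) (le_refl 0)
      dsimp only; linarith
    · intro s t h
      have := min_le_min (mk h) (le_refl 0)
      have := min_le_min (mk' (show 2 - t ≤ 2 - s by linarith)) (le_refl 0)
      dsimp only; linarith
    · norm_num [(l 0 (by norm_num)).1, (r 2 (by norm_num)).1, (l' 0 (by norm_num)).1,
        (r' 2 (by norm_num)).1]
    · norm_num [(l 0 (by norm_num)).2, (r 2 (by norm_num)).2, (l' 0 (by norm_num)).2,
        (r' 2 (by norm_num)).2, hε.le]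
    · norm_num [(l 0 (by norm_num)).2, (r 2 (by norm_num)).2, (l' 0 (by norm_num)).2,
        (r' 2 (by norm_num)).2, hε.le]
      ring
    · intro e he
      dsimp only
      rcases le_total e 1 with h | h
      · rw [(r' (2 - e) (by linarith)).2]
        constructor
        · intro hlt
          have : k e < 0 := by
            by_contra! h
            rw [min_eq_right h] at hlt; norm_num at hlt
          rw [max_eq_right this.le]; norm_num
        · intro hlt
          have := min_le_right (k e) 0
          norm_num at hlt
      · rw [(r e h).2]
        constructor
        · intro hlt
          have := min_le_right (k' (2 - e)) 0
          norm_num at hlt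
        · intro hlt
          have : k' (2 - e) < 0 := by
            by_contra! h
            rw [min_eq_right h] at hlt; norm_num at hlt
          rw [max_eq_right this.le]; norm_num
    · exact fun h => absurd (cyc_subset_excPts n hc) h
    · exact fun _ => key
  · obtain ⟨m, hm, ht, hmn⟩ := tau3_excPts hx hc
    obtain ⟨a, b, ca, cb, ma, mb, l, r, r', z, hmem⟩ := hS.exists_legParam hm ht (legIdx x)
    have hj : jump n x = 0 := if_neg hc
    have hb1 : ∀ {e}, e ≤ 1 → b e ≤ 1 := fun h => (r 1 le_rfl) ▸ mb h
    have key : ∀ e ∈ Icc (0 : ℝ) 2, ((wave (6 * x - jump n x + 0),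
        Pi.single (legIdx (tau x)) (tri (b e + 1 - b (2 - e)))) : Amb) =
        leg (tau (tau3 x)) (legIdx x) (b (min e (2 - e))) := by
      intro e he
      rw [tau_tau3 hI, hj, ← legIdx_of_notMem hc]
      unfold leg
      congr 1
      · congr 1; ring
      · congr 1
        rcases le_total e 1 with h | h
        · have := hb1 h
          rw [r (2 - e) (by linarith), tri_of_le (by linarith), min_eq_left (by linarith)]; ring
        · have := hb1 (show 2 - e ≤ 1 by linarith)
          rw [r e h, tri_of_ge (by linarith), min_eq_right (by linarith)]; ring
    by_cases hmn' : m < n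
    · have ha1 : ∀ {e}, e ≤ 1 → a e ≤ 1 := fun h => (r' hmn' 1 le_rfl) ▸ ma h
      refine ⟨fun e => a e + 1 - a (2 - e), fun e => b e + 1 - b (2 - e), fun _ => 0,
        ⟨by fun_prop, by fun_prop, by fun_prop⟩, ⟨?_, ?_, monotone_const⟩, ?_, ?_, ?_, ?_, ?_, ?_⟩
      · intro s t h
        have := ma h; have := ma (show 2 - t ≤ 2 - s by linarith)
        dsimp only; linarith
      · intro s t h
        have := mb h; have := mb (show 2 - t ≤ 2 - s by linarith)
        dsimp only; linarith
      · norm_num [(l 0 le_rfl).1, r' hmn' 2 (by norm_num)]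
      · norm_num [(l 0 le_rfl).2, r 2 (by norm_num)]
      · simp [hj]
      · intro e _; rw [hj]; simp
      · intro h; exact absurd (hmn.2 hmn') h
      · intro _ e he
        dsimp only
        rw [key e he]
        convert hmem (min e (2 - e)) using 3
        rcases le_total e 1 with h | h
        · have := ha1 h
          rw [r' hmn' (2 - e) (by linarith), tri_of_le (by linarith), min_eq_left (by linarith)]
          ring
        · have := ha1 (show 2 - e ≤ 1 by linarith)
          rw [r' hmn' e h, tri_of_ge (by linarith), min_eq_right (by linarith)]; ring
    -- In the last generation the tour of `T_n` has no excursion at `x`, so any `E` with the right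
    -- end values serves.
    · refine ⟨fun e => e, fun e => b e + 1 - b (2 - e), fun _ => 0,
        ⟨by fun_prop, by fun_prop, by fun_prop⟩, ⟨monotone_id, ?_, monotone_const⟩, ⟨rfl, rfl⟩,
        ?_, ?_, ?_, ?_, ?_⟩
      · intro s t h
        have := mb h; have := mb (show 2 - t ≤ 2 - s by linarith)
        dsimp only; linarith
      · norm_num [(l 0 le_rfl).2, r 2 (by norm_num)]
      · simp [hj]
      · intro e _; rw [hj]; simp
      · intro _ e he
        dsimp only
        rw [key e he]
        have := hmem (min e (2 - e))
        rwa [z (by omega), leg_zero] at this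
      · intro h; exact absurd (hmn.1 h) hmn'

/-! ### Order and positions in terms of coherent data -/

theorem Coherent.lt {X : Finset ℝ} {y y' : ℝ} {ε ε' : ℝ → ℝ} (h : Coherent X y ε)
    (h' : Coherent X y' ε') (hlt : y < y') : y + ∑ x ∈ X, ε x < y' + ∑ x ∈ X, ε' x := by
  have : ∑ x ∈ X, ε x ≤ ∑ x ∈ X, ε' x := by
    refine Finset.sum_le_sum fun x hx => ?_
    obtain ⟨a, b, c, d⟩ := h x hx
    obtain ⟨a', b', c', d'⟩ := h' x hx
    rcases lt_or_ge y x with hy | hy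
    · rw [c hy]; exact a'
    · rw [d' (by linarith)]; exact b
  linarith

theorem Coherent.eq_blowPos {X : Finset ℝ} {y : ℝ} {ε : ℝ → ℝ} (h : Coherent X y ε)
    (hy : y ∉ X) : y + ∑ x ∈ X, ε x = blowPos X y :=
  eq_blowPos_of_base_eq h.base_eq hy

theorem coherent_blowPos_add {X : Finset ℝ} {x e : ℝ} (he : e ∈ Icc (0 : ℝ) 2) :
    Coherent X x fun z => if z < x then 2 else if z = x then e else 0 := by
  intro z _
  dsimp only
  split_ifs with h1 h2
  · exact ⟨by norm_num, le_rfl, fun h => absurd h h1.not_gt, fun _ => rfl⟩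
  · exact ⟨he.1, he.2, fun h => absurd h2 h.ne', fun h => absurd h h1⟩
  · exact ⟨le_rfl, by norm_num, fun _ => rfl, fun h => absurd h h1⟩

theorem blowPos_add_eq {X : Finset ℝ} {x : ℝ} (hx : x ∈ X) (e : ℝ) :
    blowPos X x + e = x + ∑ z ∈ X, if z < x then 2 else if z = x then e else 0 := by
  have : ∀ z ∈ X, (if z < x then (2 : ℝ) else if z = x then e else 0) =
      (if z < x then 2 else 0) + if z = x then e else 0 := by
    intro z _
    by_cases h1 : z < x
    · simp [h1, h1.ne]
    · simp [h1]
  rw [Finset.sum_congr rfl this, Finset.sum_add_distrib, Finset.sum_ite_eq' X x, if_pos hx,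
    blowPos_eq]
  ring

theorem base_blowPos_add {X : Finset ℝ} {x e : ℝ} (hx : x ∈ X) (he : e ∈ Icc (0 : ℝ) 2) :
    base X (blowPos X x + e) = x := by
  rw [blowPos_add_eq hx, (coherent_blowPos_add he).base_eq]

theorem phase_blowPos_add {X : Finset ℝ} {x e : ℝ} (hx : x ∈ X) (he : e ∈ Icc (0 : ℝ) 2) :
    phase X x (blowPos X x + e) = e := by
  rw [blowPos_add_eq hx, (coherent_blowPos_add he).phase_eq hx]
  simp

theorem phase_of_base_lt {X : Finset ℝ} {x w : ℝ} (hx : x ∈ X) (h : base X w < x) :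
    phase X x w = 0 := (coherent_base X w x hx).2.2.1 h

theorem phase_of_lt_base {X : Finset ℝ} {x w : ℝ} (hx : x ∈ X) (h : x < base X w) :
    phase X x w = 2 := (coherent_base X w x hx).2.2.2 h

theorem phase_mem (X : Finset ℝ) (x w : ℝ) : phase X x w ∈ Icc (0 : ℝ) 2 :=
  ⟨le_max_left _ _, max_le (by norm_num) (min_le_left _ _)⟩

open Classical in
theorem sum_single_tri {X : Finset ℝ} (y : ℝ) (idx : ℝ → Fin 3) (F : ℝ → ℝ)
    (h : ∀ x ∈ X, x ≠ y → tri (F x) = 0) :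
    ∑ x ∈ X, (Pi.single (idx x) (tri (F x)) : Fin 3 → ℝ) =
      if y ∈ X then Pi.single (idx y) (tri (F y)) else 0 := by
  split_ifs with hy
  · rw [Finset.sum_eq_single y]
    · intro x hx hxy
      rw [h x hx hxy, Pi.single_zero]
    · exact fun h => absurd hy h
  · refine Finset.sum_eq_zero fun x hx => ?_
    rw [h x hx (fun e => hy (e ▸ hx)), Pi.single_zero]

/-! ### The path over the blown-up interval -/

/-- The excursions of the path: `E` and `G` are the phases of the two coordinates, `J` is the
change of the second coordinate inside the interval. -/
structure Excursions (n : ℕ) (S : Set (Amb × Amb)) (E G J : ℝ → ℝ → ℝ) : Prop where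
  cE : ∀ x ∈ excPts (n + 1), Continuous (E x)
  cG : ∀ x ∈ excPts (n + 1), Continuous (G x)
  cJ : ∀ x ∈ excPts (n + 1), Continuous (J x)
  mE : ∀ x ∈ excPts (n + 1), Monotone (E x)
  mG : ∀ x ∈ excPts (n + 1), Monotone (G x)
  mJ : ∀ x ∈ excPts (n + 1), Monotone (J x)
  E_zero : ∀ x ∈ excPts (n + 1), E x 0 = 0
  E_two : ∀ x ∈ excPts (n + 1), E x 2 = 2
  G_zero : ∀ x ∈ excPts (n + 1), G x 0 = 0
  G_two : ∀ x ∈ excPts (n + 1), G x 2 = 2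
  J_zero : ∀ x ∈ excPts (n + 1), J x 0 = 0
  J_two : ∀ x ∈ excPts (n + 1), J x 2 = 2 * jump n x
  J_lt : ∀ x ∈ excPts (n + 1), ∀ e ∈ Icc (0 : ℝ) 2, J x e < jump n x → G x e = 0
  lt_J : ∀ x ∈ excPts (n + 1), ∀ e ∈ Icc (0 : ℝ) 2, jump n x < J x e → G x e = 2
  mem_pt : ∀ x ∈ excPts (n + 1), x ∉ excPts n → ∀ e ∈ Icc (0 : ℝ) 2, (pt (tau3 x),
    ((wave (6 * x - jump n x + J x e), Pi.single (legIdx (tau x)) (tri (G x e))) : Amb)) ∈ S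
  mem_leg : ∀ x ∈ excPts (n + 1), x ∈ excPts n → ∀ e ∈ Icc (0 : ℝ) 2,
    (leg (tau3 x) (legIdx x) (tri (E x e)),
    ((wave (6 * x - jump n x + J x e), Pi.single (legIdx (tau x)) (tri (G x e))) : Amb)) ∈ S

theorem CondAmb.exists_excursions {n : ℕ} {S : Set (Amb × Amb)} (hS : CondAmb n S) :
    ∃ E G J, Excursions n S E G J := by
  have := fun x (hx : x ∈ excPts (n + 1)) => exists_excursion hS hx
  choose! E G J h1 h2 h3 h4 h5 h6 h7 h8 using this
  exact ⟨E, G, J, fun x hx => (h1 x hx).1, fun x hx => (h1 x hx).2.1, fun x hx => (h1 x hx).2.2,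
    fun x hx => (h2 x hx).1, fun x hx => (h2 x hx).2.1, fun x hx => (h2 x hx).2.2,
    fun x hx => (h3 x hx).1, fun x hx => (h3 x hx).2, fun x hx => (h4 x hx).1,
    fun x hx => (h4 x hx).2, fun x hx => (h5 x hx).1, fun x hx => (h5 x hx).2,
    fun x hx e he => (h6 x hx e he).1, fun x hx e he => (h6 x hx e he).2, h7, h8⟩

/-- The position of the first coordinate along the tour. -/
noncomputable def posF (n : ℕ) (u : ℝ → ℝ) (E : ℝ → ℝ → ℝ) (w : ℝ) : ℝ :=
  ext u (base (excPts (n + 1)) w) + ∑ x ∈ excPts n, E x (phase (excPts (n + 1)) x w)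

/-- A third of the unfolded second coordinate, without the jump at `2 / 3`. -/
noncomputable def posMid (n : ℕ) (V : ℝ → ℝ) (J : ℝ → ℝ → ℝ) (w : ℝ) : ℝ :=
  ext V (base (excPts (n + 1)) w) +
    (∑ x ∈ excPts (n + 1), J x (phase (excPts (n + 1)) x w)) / 3

/-- The position of the second coordinate along the tour, on the left half. -/
noncomputable def posL (n : ℕ) (V : ℝ → ℝ) (G J : ℝ → ℝ → ℝ) (w : ℝ) : ℝ :=
  posMid n V J w + ∑ x ∈ excPts n, G (x / 2) (phase (excPts (n + 1)) (x / 2) w)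

/-- The position of the second coordinate along the tour, between `1 / 2` and `2 / 3`. -/
noncomputable def posR (n : ℕ) (V : ℝ → ℝ) (G J : ℝ → ℝ → ℝ) (w : ℝ) : ℝ :=
  2 - posMid n V J w + ∑ x ∈ excPts n, (2 - G (1 - x / 2) (phase (excPts (n + 1)) (1 - x / 2) w))

open Classical in
/-- The unfolded second coordinate. -/
noncomputable def heightW (n : ℕ) (V : ℝ → ℝ) (J : ℝ → ℝ → ℝ) (w : ℝ) : ℝ :=
  3 * posMid n V J w + if 2 / 3 < base (excPts (n + 1)) w then 2 * eps n else 0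

open Classical in
/-- The second coordinate of the path. -/
noncomputable def sndW (n : ℕ) (V : ℝ → ℝ) (G J : ℝ → ℝ → ℝ) (w : ℝ) : Amb :=
  (wave (heightW n V J w), if base (excPts (n + 1)) w ∈ excPts (n + 1) then
    Pi.single (legIdx (tau (base (excPts (n + 1)) w)))
      (tri (G (base (excPts (n + 1)) w) (phase (excPts (n + 1)) (base (excPts (n + 1)) w) w)))
    else 0)

namespace Excursions

theorem E_mem {n : ℕ} {S : Set (Amb × Amb)} {E G J : ℝ → ℝ → ℝ} (H : Excursions n S E G J)
    {x e : ℝ} (hx : x ∈ excPts (n + 1)) (he : e ∈ Icc (0 : ℝ) 2) : E x e ∈ Icc (0 : ℝ) 2 :=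
  ⟨H.E_zero x hx ▸ H.mE x hx he.1, (H.mE x hx he.2).trans_eq (H.E_two x hx)⟩

theorem G_mem {n : ℕ} {S : Set (Amb × Amb)} {E G J : ℝ → ℝ → ℝ} (H : Excursions n S E G J)
    {x e : ℝ} (hx : x ∈ excPts (n + 1)) (he : e ∈ Icc (0 : ℝ) 2) : G x e ∈ Icc (0 : ℝ) 2 :=
  ⟨H.G_zero x hx ▸ H.mG x hx he.1, (H.mG x hx he.2).trans_eq (H.G_two x hx)⟩

theorem tri_E {n : ℕ} {S : Set (Amb × Amb)} {E G J : ℝ → ℝ → ℝ} (H : Excursions n S E G J)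
    {x w : ℝ} (hx : x ∈ excPts (n + 1)) (hne : x ≠ base (excPts (n + 1)) w) :
    tri (E x (phase (excPts (n + 1)) x w)) = 0 := by
  rcases lt_or_gt_of_ne hne with h | h
  · rw [phase_of_lt_base hx h, H.E_two x hx, tri_two]
  · rw [phase_of_base_lt hx h, H.E_zero x hx, tri_zero]

theorem tri_G {n : ℕ} {S : Set (Amb × Amb)} {E G J : ℝ → ℝ → ℝ} (H : Excursions n S E G J)
    {x w : ℝ} (hx : x ∈ excPts (n + 1)) (hne : x ≠ base (excPts (n + 1)) w) :
    tri (G x (phase (excPts (n + 1)) x w)) = 0 := by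
  rcases lt_or_gt_of_ne hne with h | h
  · rw [phase_of_lt_base hx h, H.G_two x hx, tri_two]
  · rw [phase_of_base_lt hx h, H.G_zero x hx, tri_zero]

/-- Since `ext u` is monotone and fixes the excursion points, comparing `ext u (base w)` with such a
point is decided by comparing `base w` with it. Hence the phases of the first coordinate fit its
place on the interval. -/
theorem coherent_posF {n : ℕ} {S : Set (Amb × Amb)} {E G J : ℝ → ℝ → ℝ}
    (H : Excursions n S E G J) {u V : ℝ → ℝ} (K : SpineParam n S u V) (w : ℝ) :
    Coherent (excPts n) (ext u (base (excPts (n + 1)) w))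
      fun x => E x (phase (excPts (n + 1)) x w) := by
  intro x hx
  have hx' := excPts_subset_succ hx
  have hm := H.E_mem hx' (phase_mem (excPts (n + 1)) x w)
  obtain ⟨-, -, c, d⟩ := coherent_base (excPts (n + 1)) w x hx'
  have hux := (K.unfolded_excPts hx').2
  refine ⟨hm.1, hm.2, fun h => ?_, fun h => ?_⟩
  · have : base (excPts (n + 1)) w < x := by
      by_contra! h'
      have := monotone_ext K.mu h'
      rw [hux] at this; linarith
    dsimp only at c ⊢
    rw [c this, H.E_zero x hx']
  · have : x < base (excPts (n + 1)) w := by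
      by_contra! h'
      have := monotone_ext K.mu h'
      rw [hux] at this; linarith
    dsimp only at d ⊢
    rw [d this, H.E_two x hx']

open Classical in
-- An excursion already completed has contributed its full jump, as recorded in `unfolded`, and a
-- future one nothing. Only the excursion at the present base point may be partly done.
theorem heightW_eq {n : ℕ} {S : Set (Amb × Amb)} {E G J : ℝ → ℝ → ℝ} (H : Excursions n S E G J)
    (V : ℝ → ℝ) (w : ℝ) :
    heightW n V J w = unfolded n V (base (excPts (n + 1)) w) +
      if base (excPts (n + 1)) w ∈ excPts (n + 1) then
        J (base (excPts (n + 1)) w) (phase (excPts (n + 1)) (base (excPts (n + 1)) w) w)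
      else 0 := by
  set y := base (excPts (n + 1)) w with hy
  have key : ∀ x ∈ excPts (n + 1), J x (phase (excPts (n + 1)) x w) =
      (if x < y then 2 * jump n x else 0) + if x = y then J x (phase (excPts (n + 1)) x w) else 0 := by
    intro x hx
    rcases lt_trichotomy x y with h | h | h
    · rw [if_pos h, if_neg h.ne, phase_of_lt_base hx h, H.J_two x hx, add_zero]
    · rw [if_neg h.not_lt, if_pos h, zero_add]
    · rw [if_neg h.not_gt, if_neg h.ne', phase_of_base_lt hx h, H.J_zero x hx, add_zero]
  unfold heightW posMid unfolded
  rw [← hy, Finset.sum_congr rfl key, Finset.sum_add_distrib, Finset.sum_ite_eq' _ y]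
  ring

theorem monotone_posMid {n : ℕ} {S : Set (Amb × Amb)} {E G J : ℝ → ℝ → ℝ}
    (H : Excursions n S E G J) {u V : ℝ → ℝ} (K : SpineParam n S u V) :
    Monotone (posMid n V J) := by
  intro s t h
  have h1 := monotone_ext K.mV (monotone_base (excPts (n + 1)) h)
  have h2 : ∑ x ∈ excPts (n + 1), J x (phase (excPts (n + 1)) x s) ≤
      ∑ x ∈ excPts (n + 1), J x (phase (excPts (n + 1)) x t) :=
    Finset.sum_le_sum fun x hx => H.mJ x hx (monotone_phase _ x h)
  unfold posMid; linarith

theorem continuous_posMid {n : ℕ} {S : Set (Amb × Amb)} {E G J : ℝ → ℝ → ℝ}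
    (H : Excursions n S E G J) {u V : ℝ → ℝ} (K : SpineParam n S u V) :
    Continuous (posMid n V J) := by
  unfold posMid
  exact ((continuous_ext K.cV).comp (continuous_base _)).add
    ((continuous_finsetSum _ fun x hx => (H.cJ x hx).comp (continuous_phase _ x)).div_const 3)

theorem monotone_heightW {n : ℕ} {S : Set (Amb × Amb)} {E G J : ℝ → ℝ → ℝ}
    (H : Excursions n S E G J) {u V : ℝ → ℝ} (K : SpineParam n S u V) :
    Monotone (heightW n V J) := by
  intro s t h
  have h1 := H.monotone_posMid K h
  have h2 := monotone_base (excPts (n + 1)) h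
  have hε := eps_pos n
  unfold heightW
  split_ifs <;> linarith

/-- Compatibility of a height with the phases of the second coordinate. -/
theorem heightW_compat {n : ℕ} {S : Set (Amb × Amb)} {E G J : ℝ → ℝ → ℝ}
    (H : Excursions n S E G J) {u V : ℝ → ℝ} (K : SpineParam n S u V) {x : ℝ}
    (hx : x ∈ excPts (n + 1)) (w : ℝ) :
    (heightW n V J w < 6 * x → G x (phase (excPts (n + 1)) x w) = 0) ∧
    (6 * x < heightW n V J w → G x (phase (excPts (n + 1)) x w) = 2) := by
  obtain ⟨-, -, c, d⟩ := coherent_base (excPts (n + 1)) w x hx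
  have hj := jump_nonneg n x
  have val : ∀ e ∈ Icc (0 : ℝ) 2, heightW n V J (blowPos (excPts (n + 1)) x + e) =
      6 * x - jump n x + J x e := by
    intro e he
    rw [H.heightW_eq, base_blowPos_add hx he, if_pos hx, phase_blowPos_add hx he,
      (K.unfolded_excPts hx).1]
  rcases lt_trichotomy x (base (excPts (n + 1)) w) with h | h | h
  · have hp : phase (excPts (n + 1)) x w = 2 := d h
    rw [hp]
    refine ⟨fun hlt => ?_, fun _ => H.G_two x hx⟩
    exfalso
    -- The position `w` lies beyond the interval replacing `x`, and at the end of that interval the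
    -- height is already `6 * x + jump n x`.
    have hw : blowPos (excPts (n + 1)) x + 2 ≤ w := by
      by_contra! hcon
      have : max 0 (min 2 (w - blowPos (excPts (n + 1)) x)) < 2 :=
        max_lt (by norm_num) ((min_le_right _ _).trans_lt (by linarith))
      exact absurd hp this.ne
    have := H.monotone_heightW K hw
    rw [val 2 (by norm_num), H.J_two x hx] at this
    linarith
  · have := H.heightW_eq V w
    rw [← h, if_pos hx, (K.unfolded_excPts hx).1] at this
    rw [this]
    have hm := phase_mem (excPts (n + 1)) x w
    exact ⟨fun h => H.J_lt x hx _ hm (by linarith), fun h => H.lt_J x hx _ hm (by linarith)⟩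
  · have hp : phase (excPts (n + 1)) x w = 0 := c h
    rw [hp]
    refine ⟨fun _ => H.G_zero x hx, fun hlt => ?_⟩
    exfalso
    have hw : w ≤ blowPos (excPts (n + 1)) x + 0 := by
      by_contra! hcon
      have : 0 < max 0 (min 2 (w - blowPos (excPts (n + 1)) x)) :=
        lt_max_of_lt_right (lt_min (by norm_num) (by linarith))
      exact absurd hp this.ne'
    have := H.monotone_heightW K hw
    rw [val 0 (by norm_num), H.J_zero x hx] at this
    linarith

/-- On the left half the second coordinate follows the tour forwards; its excursion at `x` is made
when the base point is the preimage `x / 2` of `x` under `tau`. -/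
theorem coherent_left {n : ℕ} {S : Set (Amb × Amb)} {E G J : ℝ → ℝ → ℝ}
    (H : Excursions n S E G J) {z w : ℝ}
    (h : ∀ x ∈ excPts (n + 1), (z < 6 * x → G x (phase (excPts (n + 1)) x w) = 0) ∧
      (6 * x < z → G x (phase (excPts (n + 1)) x w) = 2)) :
    Coherent (excPts n) (z / 3) fun x => G (x / 2) (phase (excPts (n + 1)) (x / 2) w) := by
  intro x hx
  have hx' := half_mem_excPts hx
  have hm := H.G_mem hx' (phase_mem (excPts (n + 1)) (x / 2) w)
  exact ⟨hm.1, hm.2, fun h' => (h _ hx').1 (by linarith), fun h' => (h _ hx').2 (by linarith)⟩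

/-- On the right half the tour is followed backwards: the place is reflected, the phases are
reversed, and the excursion at `x` is made at the other preimage `1 - x / 2`. -/
theorem coherent_right {n : ℕ} {S : Set (Amb × Amb)} {E G J : ℝ → ℝ → ℝ}
    (H : Excursions n S E G J) {z w : ℝ}
    (h : ∀ x ∈ excPts (n + 1), (z < 6 * x → G x (phase (excPts (n + 1)) x w) = 0) ∧
      (6 * x < z → G x (phase (excPts (n + 1)) x w) = 2)) :
    Coherent (excPts n) (2 - z / 3)
      fun x => 2 - G (1 - x / 2) (phase (excPts (n + 1)) (1 - x / 2) w) := by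
  intro x hx
  have hx' := one_sub_half_mem_excPts hx
  have hm := H.G_mem hx' (phase_mem (excPts (n + 1)) (1 - x / 2) w)
  refine ⟨by linarith [hm.2], by linarith [hm.1], fun h' => ?_, fun h' => ?_⟩
  · dsimp only; rw [(h _ hx').2 (by linarith)]; ring
  · dsimp only; rw [(h _ hx').1 (by linarith)]; ring

/-- At `2 / 3` the height may be replaced by its right limit. -/
theorem compat_two_thirds {n : ℕ} {S : Set (Amb × Amb)} {E G J : ℝ → ℝ → ℝ}
    (H : Excursions n S E G J) {w : ℝ} (hw : base (excPts (n + 1)) w = 2 / 3) {x : ℝ}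
    (hx : x ∈ excPts (n + 1)) :
    (4 + eps n < 6 * x → G x (phase (excPts (n + 1)) x w) = 0) ∧
    (6 * x < 4 + eps n → G x (phase (excPts (n + 1)) x w) = 2) := by
  obtain ⟨-, -, c, d⟩ := coherent_base (excPts (n + 1)) w x hx
  rw [hw] at c d
  have hε := eps_pos n
  have hd := excPts_dist hx
  have he : 2 / (9 * 2 ^ (n + 1)) = eps n := by unfold eps; rw [pow_succ]; field_simp
  rw [he] at hd
  dsimp only at c d
  refine ⟨fun h => by rw [c (by linarith), H.G_zero x hx], fun h => ?_⟩
  rw [d, H.G_two x hx]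
  by_contra! hcon
  rw [abs_of_nonneg (by linarith)] at hd
  linarith

/-- Coherence identifies place and phases of `posL`. Under `tau` the excursion points in the left
half correspond exactly to those of the tour, with the leg index of `tau (base w)`. -/
theorem tour_left {n : ℕ} {S : Set (Amb × Amb)} {E G J : ℝ → ℝ → ℝ}
    (H : Excursions n S E G J) {u V : ℝ → ℝ} (K : SpineParam n S u V) {w : ℝ}
    (h0 : 0 ≤ base (excPts (n + 1)) w) (h1 : base (excPts (n + 1)) w ≤ 1 / 2) :
    tour n (posL n V G J w) = sndW n V G J w := by
  classical
  set y := base (excPts (n + 1)) w with hy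
  have hz : posMid n V J w = heightW n V J w / 3 := by
    unfold heightW; rw [← hy, if_neg (by linarith)]; ring
  have hI : y ∈ Icc (0 : ℝ) 1 := ⟨h0, by linarith⟩
  have hiff : 2 * y ∈ excPts n ↔ y ∈ excPts (n + 1) := by
    rw [mem_excPts_succ hI, tau_of_le h1]
  unfold posL
  rw [hz, (H.coherent_left fun x hx => H.heightW_compat K hx w).tour_eq, mul_div_cancel₀ _ three_ne_zero,
    sum_single_tri (2 * y)]
  · unfold sndW
    rw [← hy, tau_of_le h1]
    congr 1
    by_cases h : y ∈ excPts (n + 1)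
    · rw [if_pos h, if_pos (hiff.2 h)]; congr 3 <;> ring_nf
    · rw [if_neg h, if_neg (mt hiff.1 h)]
  · intro x hx hne
    exact H.tri_G (half_mem_excPts hx) fun h => hne (by rw [hy, ← h]; ring)

/-- The height enters through an arbitrary `z` with the same image under the wave, so that at `2/3`
either one-sided limit can be used. The reflection is absorbed by `wave_symm` and `tri_two_sub`. -/
theorem tour_right_aux {n : ℕ} {S : Set (Amb × Amb)} {E G J : ℝ → ℝ → ℝ}
    (H : Excursions n S E G J) {w z : ℝ}
    (h0 : 1 / 2 ≤ base (excPts (n + 1)) w) (h1 : base (excPts (n + 1)) w ≤ 1)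
    (hz : ∀ x ∈ excPts (n + 1), (z < 6 * x → G x (phase (excPts (n + 1)) x w) = 0) ∧
      (6 * x < z → G x (phase (excPts (n + 1)) x w) = 2)) {V : ℝ → ℝ}
    (hw : wave z = wave (heightW n V J w)) :
    tour n (2 - z / 3 +
      ∑ x ∈ excPts n, (2 - G (1 - x / 2) (phase (excPts (n + 1)) (1 - x / 2) w))) =
      sndW n V G J w := by
  classical
  set y := base (excPts (n + 1)) w with hy
  have hI : y ∈ Icc (0 : ℝ) 1 := ⟨by linarith, h1⟩
  have hiff : 2 - 2 * y ∈ excPts n ↔ y ∈ excPts (n + 1) := by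
    rw [mem_excPts_succ hI, tau_of_ge h0]
  rw [(H.coherent_right hz).tour_eq, show 3 * (2 - z / 3) = 6 - z by ring, wave_symm,
    sum_single_tri (2 - 2 * y)]
  · unfold sndW
    rw [← hy, tau_of_ge h0, hw]
    congr 1
    by_cases h : y ∈ excPts (n + 1)
    · rw [if_pos h, if_pos (hiff.2 h), tri_two_sub]; congr 3 <;> ring_nf
    · rw [if_neg h, if_neg (mt hiff.1 h)]
  · intro x hx hne
    rw [tri_two_sub]
    exact H.tri_G (one_sub_half_mem_excPts hx) fun h => hne (by rw [hy, ← h]; ring)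

theorem tour_mid {n : ℕ} {S : Set (Amb × Amb)} {E G J : ℝ → ℝ → ℝ}
    (H : Excursions n S E G J) {u V : ℝ → ℝ} (K : SpineParam n S u V) {w : ℝ}
    (h0 : 1 / 2 ≤ base (excPts (n + 1)) w) (h1 : base (excPts (n + 1)) w ≤ 2 / 3) :
    tour n (posR n V G J w) = sndW n V G J w := by
  classical
  have hz : posMid n V J w = heightW n V J w / 3 := by
    unfold heightW; rw [if_neg (by linarith)]; ring
  unfold posR
  rw [hz]
  exact H.tour_right_aux h0 (by linarith) (fun x hx => H.heightW_compat K hx w) rfl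

theorem heightW_two_thirds {n : ℕ} {S : Set (Amb × Amb)} {E G J : ℝ → ℝ → ℝ}
    (H : Excursions n S E G J) {u V : ℝ → ℝ} (K : SpineParam n S u V) {w : ℝ}
    (h0 : base (excPts (n + 1)) w = 2 / 3) : heightW n V J w = 4 - eps n := by
  rw [H.heightW_eq, h0, if_neg (fun h => excPts_ne_two_thirds h rfl), K.unfolded_two_thirds, add_zero]

/-- The height used on the right of `2 / 3`. -/
theorem exists_height_right {n : ℕ} {S : Set (Amb × Amb)} {E G J : ℝ → ℝ → ℝ}
    (H : Excursions n S E G J) {u V : ℝ → ℝ} (K : SpineParam n S u V) {w : ℝ}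
    (h0 : 2 / 3 ≤ base (excPts (n + 1)) w) :
    ∃ z, 3 * posMid n V J w + 2 * eps n = z ∧ wave z = wave (heightW n V J w) ∧
      (2 / 3 < base (excPts (n + 1)) w → z = heightW n V J w) ∧
      ∀ x ∈ excPts (n + 1), (z < 6 * x → G x (phase (excPts (n + 1)) x w) = 0) ∧
      (6 * x < z → G x (phase (excPts (n + 1)) x w) = 2) := by
  refine ⟨_, rfl, ?_⟩
  have hε := eps_pos n
  have hε' := eps_le n
  rcases h0.eq_or_lt with h | h
  · have e := H.heightW_two_thirds K h.symm
    have e' : 3 * posMid n V J w + 2 * eps n = 4 + eps n := by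
      unfold heightW at e
      rw [if_neg (by linarith)] at e; linarith
    rw [e, e', wave_four_sub hε.le (by linarith), wave_four_add hε.le (by linarith)]
    exact ⟨rfl, fun h' => absurd h h'.ne, fun x hx => H.compat_two_thirds h.symm hx⟩
  · have e : 3 * posMid n V J w + 2 * eps n = heightW n V J w := by
      unfold heightW; rw [if_pos h]
    rw [e]
    exact ⟨rfl, fun _ => rfl, fun x hx => H.heightW_compat K hx w⟩

/-- The shift `2 * eps n / 3` is one third of the height jump at `2/3`; it carries the position of
`2/3 + eps n / 3` to that of `2/3 - eps n / 3`. -/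
theorem tour_right {n : ℕ} {S : Set (Amb × Amb)} {E G J : ℝ → ℝ → ℝ}
    (H : Excursions n S E G J) {u V : ℝ → ℝ} (K : SpineParam n S u V) {w : ℝ}
    (h0 : 2 / 3 ≤ base (excPts (n + 1)) w) (h1 : base (excPts (n + 1)) w ≤ 1) :
    tour n (posR n V G J w - 2 * eps n / 3) = sndW n V G J w := by
  obtain ⟨z, hz, hw, -, hc⟩ := H.exists_height_right K h0
  rw [← H.tour_right_aux (by linarith) h1 hc hw, ← hz]
  congr 1
  unfold posR
  ring

/-- Away from excursion points the pair lies on the spine of `Γ`; at an excursion point it is given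
by `mem_leg` or `mem_pt`, according to whether the tour of `T_n` has an excursion there too. -/
theorem mem_path {n : ℕ} {S : Set (Amb × Amb)} {E G J : ℝ → ℝ → ℝ}
    (H : Excursions n S E G J) {u V : ℝ → ℝ} (K : SpineParam n S u V) {w : ℝ}
    (hw : base (excPts (n + 1)) w ∈ Icc (0 : ℝ) 1) :
    (tour n (posF n u E w), sndW n V G J w) ∈ S := by
  classical
  unfold posF sndW
  rw [(H.coherent_posF K w).tour_eq, H.heightW_eq,
    sum_single_tri (base (excPts (n + 1)) w) legIdx _ fun x hx hne => H.tri_E (excPts_subset_succ hx) hne]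
  by_cases h : base (excPts (n + 1)) w ∈ excPts (n + 1)
  · obtain ⟨e1, e2⟩ := K.unfolded_excPts h
    have hp := phase_mem (excPts (n + 1)) (base (excPts (n + 1)) w) w
    rw [if_pos h, if_pos h, e1, e2]
    by_cases h' : base (excPts (n + 1)) w ∈ excPts n
    · rw [if_pos h']; exact H.mem_leg _ h h' _ hp
    · rw [if_neg h']; exact H.mem_pt _ h h' _ hp
  · rw [if_neg h, if_neg h, if_neg fun h' => h (excPts_subset_succ h'), add_zero]
    exact K.mem_unfolded hw

theorem posL_eq {n : ℕ} {S : Set (Amb × Amb)} {E G J : ℝ → ℝ → ℝ}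
    (H : Excursions n S E G J) {u V : ℝ → ℝ} (K : SpineParam n S u V) {q : ℝ}
    (hq : q ∉ excPts (n + 1)) (h1 : q ≤ 2 / 3) (hX : unfolded n V q / 3 ∉ excPts n) :
    posL n V G J (blowPos (excPts (n + 1)) q) = blowPos (excPts n) (unfolded n V q / 3) := by
  have e := H.heightW_eq V (blowPos (excPts (n + 1)) q)
  have hc := H.coherent_left fun x hx => H.heightW_compat K hx (blowPos (excPts (n + 1)) q)
  rw [base_blowPos, if_neg hq, add_zero] at e
  rw [e] at hc
  rw [← hc.eq_blowPos hX]
  unfold posL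
  congr 1
  rw [← e]
  unfold heightW
  rw [base_blowPos, if_neg (by linarith)]; ring

theorem posR_eq {n : ℕ} {S : Set (Amb × Amb)} {E G J : ℝ → ℝ → ℝ}
    (H : Excursions n S E G J) {u V : ℝ → ℝ} (K : SpineParam n S u V) {q : ℝ}
    (hq : q ∉ excPts (n + 1)) (h1 : q ≤ 2 / 3) (hX : 2 - unfolded n V q / 3 ∉ excPts n) :
    posR n V G J (blowPos (excPts (n + 1)) q) = blowPos (excPts n) (2 - unfolded n V q / 3) := by
  have e := H.heightW_eq V (blowPos (excPts (n + 1)) q)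
  have hc := H.coherent_right fun x hx => H.heightW_compat K hx (blowPos (excPts (n + 1)) q)
  rw [base_blowPos, if_neg hq, add_zero] at e
  rw [e] at hc
  rw [← hc.eq_blowPos hX]
  unfold posR
  congr 1
  rw [← e]
  unfold heightW
  rw [base_blowPos, if_neg (by linarith)]; ring

theorem posR_eq_right {n : ℕ} {S : Set (Amb × Amb)} {E G J : ℝ → ℝ → ℝ}
    (H : Excursions n S E G J) {u V : ℝ → ℝ} (K : SpineParam n S u V) {q z : ℝ}
    (hq : q ∉ excPts (n + 1)) (h1 : 2 / 3 ≤ q) (hz : q = 2 / 3 → z = 4 + eps n)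
    (hz' : q ≠ 2 / 3 → z = unfolded n V q) (hX : 2 - z / 3 ∉ excPts n) :
    posR n V G J (blowPos (excPts (n + 1)) q) - 2 * eps n / 3 =
      blowPos (excPts n) (2 - z / 3) := by
  obtain ⟨z', e, -, ez, hc⟩ := H.exists_height_right K (w := blowPos (excPts (n + 1)) q)
    (by rw [base_blowPos]; exact h1)
  have : z' = z := by
    rcases h1.eq_or_lt with h | h
    · have e2 := H.heightW_two_thirds K (w := blowPos (excPts (n + 1)) q) (by rw [base_blowPos, h])
      unfold heightW at e2
      rw [base_blowPos, if_neg (by linarith)] at e2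
      rw [hz h.symm, ← e]; linarith
    · rw [hz' h.ne', ez (by rw [base_blowPos]; exact h), H.heightW_eq, base_blowPos, if_neg hq,
        add_zero]
  subst this
  rw [← (H.coherent_right hc).eq_blowPos hX, ← e]
  unfold posR
  ring

theorem posF_eq {n : ℕ} {S : Set (Amb × Amb)} {E G J : ℝ → ℝ → ℝ}
    (H : Excursions n S E G J) {u V : ℝ → ℝ} (K : SpineParam n S u V) {q : ℝ}
    (hX : ext u q ∉ excPts n) :
    posF n u E (blowPos (excPts (n + 1)) q) = blowPos (excPts n) (ext u q) := by
  have hc := H.coherent_posF K (blowPos (excPts (n + 1)) q)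
  rw [base_blowPos] at hc
  rw [← hc.eq_blowPos hX]
  unfold posF
  rw [base_blowPos]

theorem posF_lt {n : ℕ} {S : Set (Amb × Amb)} {E G J : ℝ → ℝ → ℝ}
    (H : Excursions n S E G J) {u V : ℝ → ℝ} (K : SpineParam n S u V) {c w : ℝ}
    (h : ext u (base (excPts (n + 1)) w) < c) : posF n u E w < blowPos (excPts n) c := by
  rw [blowPos_eq]
  exact (H.coherent_posF K w).lt (coherent_blowPos (excPts n) c) h

theorem lt_posF {n : ℕ} {S : Set (Amb × Amb)} {E G J : ℝ → ℝ → ℝ}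
    (H : Excursions n S E G J) {u V : ℝ → ℝ} (K : SpineParam n S u V) {c w : ℝ}
    (h : c < ext u (base (excPts (n + 1)) w)) : blowPos (excPts n) c < posF n u E w := by
  rw [blowPos_eq]
  exact (coherent_blowPos (excPts n) c).lt (H.coherent_posF K w) h

theorem continuous_posF {n : ℕ} {S : Set (Amb × Amb)} {E G J : ℝ → ℝ → ℝ}
    (H : Excursions n S E G J) {u V : ℝ → ℝ} (K : SpineParam n S u V) :
    Continuous (posF n u E) := by
  unfold posF
  exact ((continuous_ext K.cu).comp (continuous_base _)).add
    (continuous_finsetSum _ fun x hx => (H.cE x (excPts_subset_succ hx)).comp (continuous_phase _ x))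

theorem monotone_posF {n : ℕ} {S : Set (Amb × Amb)} {E G J : ℝ → ℝ → ℝ}
    (H : Excursions n S E G J) {u V : ℝ → ℝ} (K : SpineParam n S u V) :
    Monotone (posF n u E) := by
  intro s t h
  unfold posF
  exact add_le_add (monotone_ext K.mu (monotone_base _ h))
    (Finset.sum_le_sum fun x hx => H.mE x (excPts_subset_succ hx) (monotone_phase _ x h))

theorem continuous_posL {n : ℕ} {S : Set (Amb × Amb)} {E G J : ℝ → ℝ → ℝ}
    (H : Excursions n S E G J) {u V : ℝ → ℝ} (K : SpineParam n S u V) :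
    Continuous (posL n V G J) := by
  unfold posL
  exact (H.continuous_posMid K).add
    (continuous_finsetSum _ fun x hx => (H.cG _ (half_mem_excPts hx)).comp (continuous_phase _ _))

theorem monotone_posL {n : ℕ} {S : Set (Amb × Amb)} {E G J : ℝ → ℝ → ℝ}
    (H : Excursions n S E G J) {u V : ℝ → ℝ} (K : SpineParam n S u V) :
    Monotone (posL n V G J) := by
  intro s t h
  unfold posL
  exact add_le_add (H.monotone_posMid K h)
    (Finset.sum_le_sum fun x hx => H.mG _ (half_mem_excPts hx) (monotone_phase _ _ h))

theorem continuous_posR {n : ℕ} {S : Set (Amb × Amb)} {E G J : ℝ → ℝ → ℝ}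
    (H : Excursions n S E G J) {u V : ℝ → ℝ} (K : SpineParam n S u V) :
    Continuous (posR n V G J) := by
  unfold posR
  exact (continuous_const.sub (H.continuous_posMid K)).add
    (continuous_finsetSum _ fun x hx => continuous_const.sub
      ((H.cG _ (one_sub_half_mem_excPts hx)).comp (continuous_phase _ _)))

theorem antitone_posR {n : ℕ} {S : Set (Amb × Amb)} {E G J : ℝ → ℝ → ℝ}
    (H : Excursions n S E G J) {u V : ℝ → ℝ} (K : SpineParam n S u V) :
    Antitone (posR n V G J) := by
  intro s t h
  unfold posR
  refine add_le_add (sub_le_sub_left (H.monotone_posMid K h) _)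
    (Finset.sum_le_sum fun x hx => sub_le_sub_left (H.mG _ (one_sub_half_mem_excPts hx) (monotone_phase _ _ h)) _)

end Excursions

/-! ### The maps on the interval -/

/-- The positions along the tour of the two maps on the interval: `mu` for `f`, and for `g` the
function `lamL` on the left half, `lamR` on `[1 / 2, 2 / 3]`, and a translate of it on
`[2 / 3, 1]`. -/
structure StepData (n : ℕ) (S : Set (Amb × Amb)) (mu lamL lamR : ℝ → ℝ) : Prop where
  cmu : Continuous mu
  cL : Continuous lamL
  cR : Continuous lamR
  mmu : Monotone mu
  mL : Monotone lamL
  aR : Antitone lamR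
  mu_one : mu 1 = blowPos (excPts n) 1
  mu_attach : ∀ q ∈ attachPts (n + 1), mu q = blowPos (excPts n) q
  mu_eps : mu (eps (n + 1)) = blowPos (excPts n) (eps n / 3)
  mu_gt : ∀ y, eps (n + 1) < y → blowPos (excPts n) (eps n / 3) < mu y
  mu_sub : mu (2 / 3 - eps (n + 1)) = blowPos (excPts n) (2 / 3 - eps n / 3)
  mu_lt_sub : ∀ y < 2 / 3 - eps (n + 1), mu y < blowPos (excPts n) (2 / 3 - eps n / 3)
  mu_add : mu (2 / 3 + eps (n + 1)) = blowPos (excPts n) (2 / 3 + eps n / 3)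
  mu_gt_add : ∀ y, 2 / 3 + eps (n + 1) < y → blowPos (excPts n) (2 / 3 + eps n / 3) < mu y
  L_zero : lamL 0 = blowPos (excPts n) (eps n / 3)
  L_half : lamL (1 / 2) = blowPos (excPts n) 1
  R_half : lamR (1 / 2) = blowPos (excPts n) 1
  R_add : lamR (2 / 3) = blowPos (excPts n) (2 / 3 + eps n / 3)
  R_sub : lamR (2 / 3) - 2 * eps n / 3 = blowPos (excPts n) (2 / 3 - eps n / 3)
  R_one : lamR 1 - 2 * eps n / 3 = blowPos (excPts n) 0
  L_tauPre : ∀ m ≤ n + 1, ∀ q ∈ tauPre m, q ≤ 1 / 2 → lamL q = blowPos (excPts n) (tau q)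
  R_tauPre : ∀ m ≤ n + 1, ∀ q ∈ tauPre m, 1 / 2 ≤ q → q ≤ 2 / 3 →
    lamR q = blowPos (excPts n) (tau q)
  R_tauPre' : ∀ m ≤ n + 1, ∀ q ∈ tauPre m, 2 / 3 ≤ q →
    lamR q - 2 * eps n / 3 = blowPos (excPts n) (tau q)
  mem_left : ∀ x ∈ Icc (0 : ℝ) (1 / 2), (tour n (mu x), tour n (lamL x)) ∈ S
  mem_mid : ∀ x ∈ Icc (1 / 2 : ℝ) (2 / 3), (tour n (mu x), tour n (lamR x)) ∈ S
  mem_right : ∀ x ∈ Icc (2 / 3 : ℝ) 1, (tour n (mu x), tour n (lamR x - 2 * eps n / 3)) ∈ S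

theorem notMem_excPts_of_lt {n : ℕ} {x : ℝ} (h : x < 2 * eps n) : x ∉ excPts n := by
  intro hx
  have := excPts_ge hx
  have he : 2 / (9 * 2 ^ n) = 2 * eps n := by unfold eps; ring
  linarith

theorem notMem_excPts_of_abs_lt {n : ℕ} {x : ℝ} (h : |x - 2 / 3| < 2 * eps n) : x ∉ excPts n := by
  intro hx
  have := excPts_dist hx
  have he : 2 / (9 * 2 ^ n) = 2 * eps n := by unfold eps; ring
  linarith

theorem CondAmb.exists_stepData {n : ℕ} {S : Set (Amb × Amb)} (hS : CondAmb n S) :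
    ∃ mu lamL lamR, StepData n S mu lamL lamR := by
  classical
  obtain ⟨u, V, K⟩ := hS.exists_spineParam
  obtain ⟨E, G, J, H⟩ := hS.exists_excursions
  have hε := eps_pos n
  have hε9 := eps_le n
  have hε' : eps (n + 1) = eps n / 2 := eps_succ n
  -- The interval of `T_{n+1}` is carried onto the blown-up line by `ρ`. As `blowPos` is
  -- discontinuous, agreement with it is asked only at the finitely many points where values of `mu`
  -- and `lam` are prescribed.
  obtain ⟨Q, hQ⟩ := ((finite_special (n + 1)).union
    (Set.toFinite {0, eps (n + 1), 1 / 2, 2 / 3 - eps (n + 1), 2 / 3, 2 / 3 + eps (n + 1), 1})).exists_finset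
  obtain ⟨ρ, cρ, mρ, hρ⟩ := exists_strictMono_interpolation Q (blowPos (excPts (n + 1)))
    ((blowPos_strictMono _).strictMonoOn _)
  have r0 : ρ 0 = blowPos (excPts (n + 1)) 0 := hρ 0 ((hQ _).2 (.inr (by simp)))
  have re : ρ (eps (n + 1)) = blowPos (excPts (n + 1)) (eps (n + 1)) := hρ _ ((hQ _).2 (.inr (by simp)))
  have rh : ρ (1 / 2) = blowPos (excPts (n + 1)) (1 / 2) := hρ _ ((hQ _).2 (.inr (by simp)))
  have rs : ρ (2 / 3 - eps (n + 1)) = blowPos (excPts (n + 1)) (2 / 3 - eps (n + 1)) :=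
    hρ _ ((hQ _).2 (.inr (by simp)))
  have rt : ρ (2 / 3) = blowPos (excPts (n + 1)) (2 / 3) := hρ _ ((hQ _).2 (.inr (by simp)))
  have ra : ρ (2 / 3 + eps (n + 1)) = blowPos (excPts (n + 1)) (2 / 3 + eps (n + 1)) :=
    hρ _ ((hQ _).2 (.inr (by simp)))
  have r1 : ρ 1 = blowPos (excPts (n + 1)) 1 := hρ _ ((hQ _).2 (.inr (by simp)))
  have rq : ∀ m ≤ n + 1, ∀ q ∈ tauPre m, ρ q = blowPos (excPts (n + 1)) q := fun m hm q hq =>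
    hρ _ ((hQ _).2 (.inl (.inl ⟨m, hm, hq⟩)))
  -- values of the unfolded functions
  have ue : ext u (eps (n + 1)) = eps n / 3 := by
    have := ext_of₁ u (x := eps (n + 1)) (by linarith) (by linarith)
    rw [K.u_eps] at this; linarith
  have us : ext u (2 / 3 - eps (n + 1)) = 2 / 3 - eps n / 3 := by
    have := ext_of₂ u (x := 2 / 3 - eps (n + 1)) (by linarith) (by linarith)
    rw [show 2 - 3 * (2 / 3 - eps (n + 1)) = 3 * eps (n + 1) by ring, K.u_eps, K.u_one] at this
    linarith
  have ua : ext u (2 / 3 + eps (n + 1)) = 2 / 3 + eps n / 3 := by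
    have := ext_of₃ u (x := 2 / 3 + eps (n + 1)) (by linarith) (by linarith)
    rw [show 3 * (2 / 3 + eps (n + 1)) - 2 = 3 * eps (n + 1) by ring, K.u_eps, K.u_one,
      K.u_zero] at this
    linarith
  have u1 : ext u 1 = 1 := K.ext_u (by norm_num) (by rw [tau3_one, K.u_one])
  have ugt : ∀ y, eps (n + 1) < y → eps n / 3 < ext u y := by
    intro y hy
    refine lt_of_lt_of_le ?_ (monotone_ext K.mu (min_le_left y (1 / 3)))
    have h1 : eps (n + 1) < min y (1 / 3) := lt_min hy (by linarith)
    have := ext_of₁ u (x := min y (1 / 3)) (by linarith) (min_le_right _ _)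
    have := K.u_gt (3 * min y (1 / 3)) (by linarith)
    linarith
  have ults : ∀ y < 2 / 3 - eps (n + 1), ext u y < 2 / 3 - eps n / 3 := by
    intro y hy
    refine lt_of_le_of_lt (monotone_ext K.mu (le_max_left y (1 / 3))) ?_
    have h1 : max y (1 / 3) < 2 / 3 - eps (n + 1) := max_lt hy (by linarith)
    have := ext_of₂ u (x := max y (1 / 3)) (le_max_right _ _) (by linarith)
    have := K.u_gt (2 - 3 * max y (1 / 3)) (by linarith)
    rw [K.u_one] at *
    linarith
  have ugta : ∀ y, 2 / 3 + eps (n + 1) < y → 2 / 3 + eps n / 3 < ext u y := by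
    intro y hy
    refine lt_of_lt_of_le ?_ (monotone_ext K.mu (min_le_left y 1))
    have h1 : 2 / 3 + eps (n + 1) < min y 1 := lt_min hy (by linarith)
    have := ext_of₃ u (x := min y 1) (by linarith) (min_le_right _ _)
    have := K.u_gt (3 * min y 1 - 2) (by linarith)
    rw [K.u_one, K.u_zero] at *
    linarith
  -- separation from the excursion points
  have ne : eps (n + 1) ∉ excPts (n + 1) := notMem_excPts_of_lt (by linarith)
  have ns : 2 / 3 - eps (n + 1) ∉ excPts (n + 1) := notMem_excPts_of_abs_lt (by
    rw [abs_of_neg (by linarith)]; linarith)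
  have na : 2 / 3 + eps (n + 1) ∉ excPts (n + 1) := notMem_excPts_of_abs_lt (by
    rw [abs_of_pos (by linarith)]; linarith)
  have ne3 : eps n / 3 ∉ excPts n := notMem_excPts_of_lt (by linarith)
  have ns3 : 2 / 3 - eps n / 3 ∉ excPts n := notMem_excPts_of_abs_lt (by
    rw [abs_of_neg (by linarith)]; linarith)
  have na3 : 2 / 3 + eps n / 3 ∉ excPts n := notMem_excPts_of_abs_lt (by
    rw [abs_of_pos (by linarith)]; linarith)
  have n1 : ∀ k, (1 : ℝ) ∉ excPts k := fun k h => excPts_ne_one h rfl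
  have n0 : ∀ k, (0 : ℝ) ∉ excPts k := fun k h => excPts_ne_zero h rfl
  have nh : ∀ k, (1 / 2 : ℝ) ∉ excPts k := fun k h => excPts_ne_half h rfl
  have nt : ∀ k, (2 / 3 : ℝ) ∉ excPts k := fun k h => excPts_ne_two_thirds h rfl
  -- Over a point that is not blown up there is a single position, so strict inequalities survive
  -- the collapse.
  have gtb : ∀ {c y}, ρ c = blowPos (excPts (n + 1)) c → c ∉ excPts (n + 1) → c < y →
      c < base (excPts (n + 1)) (ρ y) := by
    intro c y hc hX hlt
    have h1 := mρ hlt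
    have h2 := monotone_base (excPts (n + 1)) h1.le
    rw [hc, base_blowPos] at h2
    refine lt_of_le_of_ne h2 fun h => ?_
    have := eq_blowPos_of_base_eq h.symm hX
    rw [this, hc] at h1; exact lt_irrefl _ h1
  have ltb : ∀ {c y}, ρ c = blowPos (excPts (n + 1)) c → c ∉ excPts (n + 1) → y < c →
      base (excPts (n + 1)) (ρ y) < c := by
    intro c y hc hX hlt
    have h1 := mρ hlt
    have h2 := monotone_base (excPts (n + 1)) h1.le
    rw [hc, base_blowPos] at h2
    refine lt_of_le_of_ne h2 fun h => ?_
    have := eq_blowPos_of_base_eq h hX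
    rw [this, hc] at h1; exact lt_irrefl _ h1
  have geb : ∀ {c y}, ρ c = blowPos (excPts (n + 1)) c → c ≤ y →
      c ≤ base (excPts (n + 1)) (ρ y) := by
    intro c y hc hle
    have h2 := monotone_base (excPts (n + 1)) (mρ.monotone hle)
    rwa [hc, base_blowPos] at h2
  have leb : ∀ {c y}, ρ c = blowPos (excPts (n + 1)) c → y ≤ c →
      base (excPts (n + 1)) (ρ y) ≤ c := by
    intro c y hc hle
    have h2 := monotone_base (excPts (n + 1)) (mρ.monotone hle)
    rwa [hc, base_blowPos] at h2
  -- the special points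
  have sp : ∀ m ≤ n + 1, ∀ q ∈ tauPre m, unfolded n V q = 6 * q ∧ q ∉ excPts (n + 1) ∧
      tau q ∉ excPts n := by
    intro m hm q hq
    have hX : q ∉ excPts (n + 1) := fun h => excPts_disjoint_tauPre h hq
    refine ⟨K.unfolded_special hq.1 ?_ fun h => hX (cyc_subset_excPts _ h), hX, ?_⟩
    -- For `q` of generation `n + 1` the point `tau3 q` is not in an earlier `tauPre`, but its orbit
    -- meets `1` at time `n + 1`; the second clause of `special` is made for this.
    · rcases hm.lt_or_eq with h | rfl
      · exact .inl ⟨m, by omega, tau3_mem_tauPre hq⟩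
      · exact .inr ⟨tau3_mem hq.1, iterate_tau_tau3_tauPre hq⟩
    · rwa [← mem_excPts_succ hq.1]
  refine ⟨fun x => posF n u E (ρ x), fun x => posL n V G J (ρ x), fun x => posR n V G J (ρ x), ?_⟩
  constructor
  case cmu => exact (H.continuous_posF K).comp cρ
  case cL => exact (H.continuous_posL K).comp cρ
  case cR => exact (H.continuous_posR K).comp cρ
  case mmu => exact (H.monotone_posF K).comp mρ.monotone
  case mL => exact (H.monotone_posL K).comp mρ.monotone
  case aR => exact (H.antitone_posR K).comp_monotone mρ.monotone
  case mu_one =>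
    rw [r1, H.posF_eq K (by rw [u1]; exact n1 n), u1]
  case mu_attach =>
    intro q hq
    have key : ρ q = blowPos (excPts (n + 1)) q ∧ ext u q = q := by
      rcases mem_attachPts.1 hq with rfl | rfl | ⟨m, hm, h⟩
      · exact ⟨r0, K.ext_u (by norm_num) (by rw [tau3_zero, K.u_zero])⟩
      · exact ⟨rt, K.ext_u (by norm_num) (by rw [tau3_two_thirds, K.u_zero])⟩
      · exact ⟨rq m hm.le q h, K.ext_u h.1 (K.u_tauPre m (by omega) _ (tau3_mem_tauPre h))⟩
    rw [key.1, H.posF_eq K, key.2]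
    rw [key.2]
    exact fun h => excPts_notMem_attachPts h hq
  case mu_eps =>
    rw [re, H.posF_eq K (by rw [ue]; exact ne3), ue]
  case mu_gt => exact fun y hy => H.lt_posF K (ugt _ (gtb re ne hy))
  case mu_sub =>
    rw [rs, H.posF_eq K (by rw [us]; exact ns3), us]
  case mu_lt_sub => exact fun y hy => H.posF_lt K (ults _ (ltb rs ns hy))
  case mu_add =>
    rw [ra, H.posF_eq K (by rw [ua]; exact na3), ua]
  case mu_gt_add => exact fun y hy => H.lt_posF K (ugta _ (gtb ra na hy))
  case L_zero =>
    rw [r0, H.posL_eq K (n0 _) (by norm_num) (by rw [K.unfolded_zero]; exact ne3), K.unfolded_zero]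
  case L_half =>
    rw [rh, H.posL_eq K (nh _) (by norm_num) (by rw [K.unfolded_half]; norm_num; exact n1 n),
      K.unfolded_half]
    norm_num
  case R_half =>
    rw [rh, H.posR_eq K (nh _) (by norm_num) (by rw [K.unfolded_half]; norm_num; exact n1 n),
      K.unfolded_half]
    norm_num
  case R_add =>
    have e : 2 - unfolded n V (2 / 3) / 3 = 2 / 3 + eps n / 3 := by
      rw [K.unfolded_two_thirds]; ring
    rw [rt, H.posR_eq K (nt _) le_rfl (by rw [e]; exact na3), e]
  case R_sub =>
    have e : 2 - (4 + eps n) / 3 = 2 / 3 - eps n / 3 := by ring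
    rw [rt, H.posR_eq_right K (nt _) le_rfl (fun _ => rfl) (fun h => absurd rfl h)
      (by rw [e]; exact ns3), e]
  case R_one =>
    have e : 2 - unfolded n V 1 / 3 = 0 := by rw [K.unfolded_one]; norm_num
    rw [r1, H.posR_eq_right K (n1 _) (by norm_num) (fun h => absurd h (by norm_num)) (fun _ => rfl)
      (by rw [e]; exact n0 n), e]
  case L_tauPre =>
    intro m hm q hq h
    obtain ⟨e1, e2, e3⟩ := sp m hm q hq
    have e : unfolded n V q / 3 = tau q := by rw [e1, tau_of_le h]; ring
    rw [rq m hm q hq, H.posL_eq K e2 (by linarith) (by rwa [e]), e]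
  case R_tauPre =>
    intro m hm q hq h h'
    obtain ⟨e1, e2, e3⟩ := sp m hm q hq
    have e : 2 - unfolded n V q / 3 = tau q := by rw [e1, tau_of_ge h]; ring
    rw [rq m hm q hq, H.posR_eq K e2 h' (by rwa [e]), e]
  case R_tauPre' =>
    intro m hm q hq h
    obtain ⟨e1, e2, e3⟩ := sp m hm q hq
    have e : 2 - unfolded n V q / 3 = tau q := by rw [e1, tau_of_ge (by linarith)]; ring
    rw [rq m hm q hq, H.posR_eq_right K e2 h
      (fun h => absurd (h ▸ hq) (two_thirds_notMem_tauPre m)) (fun _ => rfl) (by rwa [e]), e]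
  case mem_left =>
    intro x hx
    have l := geb r0 hx.1
    have r := leb rh hx.2
    rw [H.tour_left K l r]
    exact H.mem_path K ⟨l, by linarith⟩
  case mem_mid =>
    intro x hx
    have l := geb rh hx.1
    have r := leb rt hx.2
    rw [H.tour_mid K l r]
    exact H.mem_path K ⟨by linarith, by linarith⟩
  case mem_right =>
    intro x hx
    have l := geb rt hx.1
    have r := leb r1 hx.2
    rw [H.tour_right K l r]
    exact H.mem_path K ⟨by linarith, r⟩

/-! ### Maps of the trees -/

/-- The formula adds to `φ` the increments along the three leg coordinates; at a point of the tree
at most one of them is nonzero. Continuity holds on the interval and on each leg, which form a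
finite closed cover. -/
theorem exists_treeMap (n : ℕ) (φ : ℝ → Amb) (ψ : ℝ → Fin 3 → ℝ → Amb) (hφ : Continuous φ)
    (hψ : ∀ q ∈ attachPts n, ∀ i, Continuous (ψ q i))
    (h0 : ∀ q ∈ attachPts n, ∀ i, ψ q i 0 = φ q) :
    ∃ F : Amb → Amb, ContinuousOn F (treeSet n) ∧ (∀ x, F (pt x) = φ x) ∧
      ∀ q ∈ attachPts n, ∀ i r, F (leg q i r) = ψ q i r := by
  let F : Amb → Amb := fun z => φ z.1 + ∑ i, (ψ z.1 i (z.2 i) - ψ z.1 i 0)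
  have hpt : ∀ x, F (pt x) = φ x := fun x => by simp [F]
  have hleg : ∀ q ∈ attachPts n, ∀ i r, F (leg q i r) = ψ q i r := by
    intro q hq i r
    simp only [F, leg_fst, leg_snd]
    rw [Finset.sum_eq_single i]
    · rw [h0 q hq i]; simp
    · intro j _ hj; simp [Pi.single_eq_of_ne hj]
    · simp
  have hseg : ContinuousOn F seg := by
    refine (hφ.comp continuous_fst).continuousOn.congr ?_
    rintro _ ⟨x, -, rfl⟩
    exact hpt x
  have hlegc : ∀ q ∈ attachPts n, ∀ i, ContinuousOn F (legArc q i) := by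
    intro q hq i
    have : Continuous fun z : Amb => ψ q i (z.2 i) := (hψ q hq i).comp (by fun_prop)
    refine this.continuousOn.congr ?_
    rintro _ ⟨r, -, rfl⟩
    simp [hleg q hq i r]
  refine ⟨F, ?_, hpt, hleg⟩
  unfold treeSet
  have hfin : (attachPts n).Finite := finite_attachPts n
  have : ContinuousOn F (⋃ p : attachPts n × Fin 3, legArc p.1 p.2) := by
    have : Finite (attachPts n) := hfin
    exact (locallyFinite_of_finite _).continuousOn_iUnion
      (fun p => (isCompact_legArc _ _).isClosed) fun p => hlegc _ p.1.2 _
  have e : (⋃ p ∈ attachPts n, ⋃ i : Fin 3, legArc p i) =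
      ⋃ p : attachPts n × Fin 3, legArc p.1 p.2 := by
    ext z; simp
  have hcl : IsClosed (⋃ p : attachPts n × Fin 3, legArc (p.1 : ℝ) p.2) := by
    have : Finite (attachPts n) := hfin
    exact isClosed_iUnion_of_finite fun p => (isCompact_legArc _ _).isClosed
  rw [e]
  exact hseg.union_of_isClosed this isCompact_seg.isClosed hcl

theorem tour_blowPos {n : ℕ} {y : ℝ} (h : y ∉ excPts n) :
    tour n (blowPos (excPts n) y) = pt (tau3 y) := by
  rw [tour_of_notMem (by rwa [base_blowPos]), base_blowPos]

/-- The two maps of the `n + 1`-st tree to the `n`-th, with their description on the interval and on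
the legs. -/
structure MapData (n : ℕ) (S : Set (Amb × Amb)) where
  mu : ℝ → ℝ
  lamL : ℝ → ℝ
  lamR : ℝ → ℝ
  step : StepData n S mu lamL lamR
  f : Amb → Amb
  g : Amb → Amb
  cf : ContinuousOn f (treeSet (n + 1))
  cg : ContinuousOn g (treeSet (n + 1))
  mem : ∀ z ∈ treeSet (n + 1), (f z, g z) ∈ S
  f_pt : ∀ x, f (pt x) = tour n (mu x)
  g_left : ∀ x ∈ Icc (0 : ℝ) (1 / 2), g (pt x) = tour n (lamL x)
  g_mid : ∀ x ∈ Icc (1 / 2 : ℝ) (2 / 3), g (pt x) = tour n (lamR x)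
  g_right : ∀ x ∈ Icc (2 / 3 : ℝ) 1, g (pt x) = tour n (lamR x - 2 * eps n / 3)
  a : ℝ → Fin 3 → ℝ → ℝ
  ca : ∀ q ∈ attachPts (n + 1), ∀ i, Continuous (a q i)
  ma : ∀ q ∈ attachPts (n + 1), ∀ i, Monotone (a q i)
  a_zero : ∀ q ∈ attachPts (n + 1), ∀ i, a q i 0 = 0
  a_one : ∀ q ∈ attachPts n, ∀ i, a q i 1 = 1
  a_const : ∀ q ∈ tauPre n, ∀ i r, a q i r = 0
  f_leg : ∀ q ∈ attachPts (n + 1), ∀ i r, f (leg q i r) = leg (tau3 q) i (a q i r)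
  b : ℝ → Fin 3 → ℝ → ℝ
  cb : ∀ m ≤ n, ∀ q ∈ tauPre m, ∀ i, Continuous (b q i)
  mb : ∀ m ≤ n, ∀ q ∈ tauPre m, ∀ i, Monotone (b q i)
  b_zero : ∀ m ≤ n, ∀ q ∈ tauPre m, ∀ i, b q i 0 = 0
  b_one : ∀ m ≤ n, ∀ q ∈ tauPre m, ∀ i, b q i 1 = 1
  g_leg : ∀ m ≤ n, ∀ q ∈ tauPre m, ∀ i r, g (leg q i r) = leg (tau3 (tau q)) i (b q i r)
  k : Fin 3 → ℝ → ℝ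
  ck : ∀ i, Continuous (k i)
  k_mono : ∀ i, Monotone (k i)
  k_le : ∀ i, ∀ r ≤ 1 / 4, k i r = -eps n
  k_half : ∀ i, k i (1 / 2) = 0
  k_one : ∀ i, k i 1 = 1
  k_neg : ∀ i, ∀ r < 1 / 2, k i r < 0
  k_pos : ∀ i, ∀ r, 1 / 2 < r → 0 < k i r
  g_bent : ∀ q ∈ ({0, 2 / 3} : Set ℝ), ∀ i r,
    g (leg q i r) = (max (-k i r) 0, Pi.single (i + 1) (max (k i r) 0))

theorem mem_attachPts_succ {n : ℕ} {q : ℝ} (h : q ∈ attachPts (n + 1)) :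
    q ∈ ({0, 2 / 3} : Set ℝ) ∨ ∃ m ≤ n, q ∈ tauPre m := by
  rcases mem_attachPts.1 h with rfl | rfl | ⟨m, hm, h⟩
  · simp
  · simp
  · exact .inr ⟨m, by omega, h⟩

theorem tauPre_ne {m : ℕ} {q : ℝ} (h : q ∈ tauPre m) : q ∉ ({0, 2 / 3} : Set ℝ) := by
  rintro (rfl | rfl)
  · exact zero_notMem_tauPre m h
  · exact two_thirds_notMem_tauPre m h

/-- On the interval the maps are the tour composed with `mu` and `lam`. A leg at `q ∈ tauPre m`
follows the arc of `Γ` over the legs at `tau3 q` and `tau (tau3 q)`. The legs at `0` and `2/3`, both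
lying over `0` under `tau3`, follow the bent arc over the legs at `0`, where the second coordinate
first descends from `eps n` to `0` on the interval. -/
theorem CondAmb.nonempty_mapData {n : ℕ} {S : Set (Amb × Amb)} (hS : CondAmb n S) :
    Nonempty (MapData n S) := by
  classical
  obtain ⟨mu, lamL, lamR, D⟩ := hS.exists_stepData
  have hε := eps_pos n
  have hε9 := eps_le n
  have hl := fun q (h : ∃ m ≤ n, q ∈ tauPre m) (i : Fin 3) =>
    hS.exists_legParam h.choose_spec.1 (tau3_mem_tauPre h.choose_spec.2) i
  choose! a b ca cb ma mb l r r' z hm using hl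
  choose a0 k ca0 ck ma0 mk lk rk hk hm0 kneg kpos using hS.exists_bentParam_zero
  have key : ∀ {m q}, m ≤ n → q ∈ tauPre m → ∃ h : ∃ m ≤ n, q ∈ tauPre m, h.choose = m := by
    intro m q hm hq
    have h : ∃ m ≤ n, q ∈ tauPre m := ⟨m, hm, hq⟩
    exact ⟨h, tauPre_unique h.choose_spec.2 hq⟩
  let A : ℝ → Fin 3 → ℝ → ℝ := fun q => if q ∈ ({0, 2 / 3} : Set ℝ) then a0 else a q
  have A1 : ∀ {q}, q ∈ ({0, 2 / 3} : Set ℝ) → A q = a0 := fun h => if_pos h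
  have A2 : ∀ {q m}, q ∈ tauPre m → A q = a q := fun h => if_neg (tauPre_ne h)
  have tau3_bent : ∀ {q}, q ∈ ({0, 2 / 3} : Set ℝ) → tau3 q = 0 := by
    rintro q (rfl | rfl)
    · exact tau3_zero
    · exact tau3_two_thirds
  have tt : ∀ {m q}, q ∈ tauPre m → tau3 (tau q) = tau (tau3 q) := fun h => tau3_tau h.1
  have hf := exists_treeMap (n + 1) (fun x => tour n (mu x))
    (fun q i r => leg (tau3 q) i (A q i r)) ((continuous_tour n).comp D.cmu)
    (by
      intro q hq i
      refine (continuous_leg _ _).comp ?_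
      rcases mem_attachPts_succ hq with h | ⟨m, hm, h⟩
      · rw [A1 h]; exact ca0 i
      · rw [A2 h]; exact ca q ⟨m, hm, h⟩ i)
    (by
      intro q hq i
      rw [D.mu_attach q hq, tour_blowPos fun h => excPts_notMem_attachPts h hq]
      rcases mem_attachPts_succ hq with h | ⟨m, hm, h⟩
      · rw [A1 h, (lk i 0 (by norm_num)).1, leg_zero]
      · rw [A2 h, (l q ⟨m, hm, h⟩ i 0 le_rfl).1, leg_zero])
  obtain ⟨f, cf, f_pt, f_leg⟩ := hf
  have na3 : 2 / 3 + eps n / 3 ∉ excPts n := notMem_excPts_of_abs_lt (by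
    rw [abs_of_pos (by linarith)]; linarith)
  have ns3 : 2 / 3 - eps n / 3 ∉ excPts n := notMem_excPts_of_abs_lt (by
    rw [abs_of_neg (by linarith)]; linarith)
  have ne3 : eps n / 3 ∉ excPts n := notMem_excPts_of_lt (by linarith)
  -- The two positions joined by the leap of `lam` lie symmetrically about `2/3`, where `tau3` has a
  -- minimum, so the tour sends both to `eps n` and `g` is continuous.
  have v2 : tour n (lamR (2 / 3)) = pt (eps n) := by
    rw [D.R_add, tour_blowPos na3, tau3_of₃ (by linarith) (by linarith)]; congr 1; ring
  have v2' : tour n (lamR (2 / 3) - 2 * eps n / 3) = pt (eps n) := by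
    rw [D.R_sub, tour_blowPos ns3, tau3_of₂ (by linarith) (by linarith)]; congr 1; ring
  have v0 : tour n (lamL 0) = pt (eps n) := by
    rw [D.L_zero, tour_blowPos ne3, tau3_of₁ (by linarith) (by linarith)]; congr 1; ring
  let φ : ℝ → Amb := fun x => if x ≤ 1 / 2 then tour n (lamL x) else
    if x ≤ 2 / 3 then tour n (lamR x) else tour n (lamR x - 2 * eps n / 3)
  have cφ : Continuous φ := by
    refine Continuous.if_le ((continuous_tour n).comp D.cL) ?_ continuous_id continuous_const ?_
    · refine Continuous.if_le ((continuous_tour n).comp D.cR)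
        ((continuous_tour n).comp (D.cR.sub continuous_const)) continuous_id continuous_const ?_
      rintro x rfl; rw [v2, v2']
    · rintro x rfl
      rw [if_pos (by norm_num), D.L_half, D.R_half]
  have φL : ∀ x ∈ Icc (0 : ℝ) (1 / 2), φ x = tour n (lamL x) := fun x hx => if_pos hx.2
  have φM : ∀ x ∈ Icc (1 / 2 : ℝ) (2 / 3), φ x = tour n (lamR x) := by
    intro x hx
    rcases hx.1.eq_or_lt with h | h
    · simp only [φ, ← h]
      rw [if_pos le_rfl, D.L_half, D.R_half]
    · simp only [φ]; rw [if_neg (by linarith), if_pos hx.2]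
  have φR : ∀ x ∈ Icc (2 / 3 : ℝ) 1, φ x = tour n (lamR x - 2 * eps n / 3) := by
    intro x hx
    rcases hx.1.eq_or_lt with h | h
    · simp only [φ, ← h]
      rw [if_neg (by norm_num), if_pos le_rfl, v2, v2']
    · simp only [φ]; rw [if_neg (by linarith), if_neg (by linarith)]
  let ψ : ℝ → Fin 3 → ℝ → Amb := fun q i r => if q ∈ ({0, 2 / 3} : Set ℝ) then
      (max (-k i r) 0, Pi.single (i + 1) (max (k i r) 0)) else leg (tau3 (tau q)) i (b q i r)
  have ψ1 : ∀ {q}, q ∈ ({0, 2 / 3} : Set ℝ) → ∀ i r, ψ q i r =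
      (max (-k i r) 0, Pi.single (i + 1) (max (k i r) 0)) := fun h i r => if_pos h
  have ψ2 : ∀ {q m}, q ∈ tauPre m → ∀ i r, ψ q i r = leg (tau3 (tau q)) i (b q i r) :=
    fun h i r => if_neg (tauPre_ne h)
  have hg := exists_treeMap (n + 1) φ ψ cφ
    (by
      intro q hq i
      rcases mem_attachPts_succ hq with h | ⟨m, hm, h⟩
      · have : ψ q i = fun r => ((max (-k i r) 0, Pi.single (i + 1) (max (k i r) 0)) : Amb) :=
          funext fun r => ψ1 h i r
        rw [this]
        refine Continuous.prodMk (by have := ck i; fun_prop) ?_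
        exact (continuous_leg 0 (i + 1)).snd.comp ((ck i).max continuous_const)
      · have : ψ q i = fun r => leg (tau3 (tau q)) i (b q i r) := funext fun r => ψ2 h i r
        rw [this]
        exact (continuous_leg _ _).comp (cb q ⟨m, hm, h⟩ i))
    (by
      intro q hq i
      rcases mem_attachPts_succ hq with h | ⟨m, hm, h⟩
      · rw [ψ1 h, (lk i 0 (by norm_num)).2]
        have : φ q = pt (eps n) := by
          rcases h with rfl | rfl
          · rw [φL 0 (by norm_num), v0]
          · rw [φM (2 / 3) (by norm_num), v2]
        rw [this, neg_neg, max_eq_left hε.le, max_eq_right (by linarith), Pi.single_zero]; rfl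
      · rw [ψ2 h, (l q ⟨m, hm, h⟩ i 0 le_rfl).2, leg_zero]
        have hX : tau q ∉ excPts n := by
          rw [← mem_excPts_succ h.1]; exact fun h' => excPts_disjoint_tauPre h' h
        rcases le_total q (1 / 2) with h1 | h1
        · rw [φL q ⟨h.1.1, h1⟩, D.L_tauPre m (by omega) q h h1, tour_blowPos hX]
        rcases le_total q (2 / 3) with h2 | h2
        · rw [φM q ⟨h1, h2⟩, D.R_tauPre m (by omega) q h h1 h2, tour_blowPos hX]
        · rw [φR q ⟨h2, h.1.2⟩, D.R_tauPre' m (by omega) q h h2, tour_blowPos hX])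
  obtain ⟨g, cg, g_pt, g_leg⟩ := hg
  refine ⟨{
    mu := mu, lamL := lamL, lamR := lamR, step := D, f := f, g := g, cf := cf, cg := cg
    mem := ?_, f_pt := f_pt
    g_left := fun x hx => by rw [g_pt, φL x hx]
    g_mid := fun x hx => by rw [g_pt, φM x hx]
    g_right := fun x hx => by rw [g_pt, φR x hx]
    a := A
    ca := ?_, ma := ?_, a_zero := ?_, a_one := ?_, a_const := ?_
    f_leg := f_leg
    b := b
    cb := fun m hm q hq => cb q ⟨m, hm, hq⟩
    mb := fun m hm q hq => mb q ⟨m, hm, hq⟩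
    b_zero := fun m hm q hq i => (l q ⟨m, hm, hq⟩ i 0 le_rfl).2
    b_one := fun m hm q hq i => r q ⟨m, hm, hq⟩ i 1 le_rfl
    g_leg := fun m hm q hq i r => by
      rw [g_leg q (mem_attachPts_of_tauPre hq (by omega)), ψ2 hq]
    k := k, ck := ck, k_mono := mk, k_le := fun i r hr => (lk i r hr).2
    k_half := hk, k_one := fun i => (rk i 1 le_rfl).2, k_neg := kneg, k_pos := kpos
    g_bent := fun q hq i r => by
      rw [g_leg q (mem_attachPts.2 (by rcases hq with h | h <;> simp_all)), ψ1 hq] }⟩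
  · intro w hw
    rcases mem_treeSet.1 hw with ⟨x, hx, rfl⟩ | ⟨q, hq, i, t, ht, rfl⟩
    · rw [f_pt, g_pt]
      rcases le_total x (1 / 2) with h1 | h1
      · rw [φL x ⟨hx.1, h1⟩]; exact D.mem_left x ⟨hx.1, h1⟩
      rcases le_total x (2 / 3) with h2 | h2
      · rw [φM x ⟨h1, h2⟩]; exact D.mem_mid x ⟨h1, h2⟩
      · rw [φR x ⟨h2, hx.2⟩]; exact D.mem_right x ⟨h2, hx.2⟩
    · rw [f_leg q hq, g_leg q hq]
      rcases mem_attachPts_succ hq with h | ⟨m, hm', h⟩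
      · rw [ψ1 h, A1 h, tau3_bent h]; exact hm0 i t
      · rw [ψ2 h, A2 h, tt h]; exact hm q ⟨m, hm', h⟩ i t
  · intro q hq i
    rcases mem_attachPts_succ hq with h | ⟨m, hm, h⟩
    · rw [A1 h]; exact ca0 i
    · rw [A2 h]; exact ca q ⟨m, hm, h⟩ i
  · intro q hq i
    rcases mem_attachPts_succ hq with h | ⟨m, hm, h⟩
    · rw [A1 h]; exact ma0 i
    · rw [A2 h]; exact ma q ⟨m, hm, h⟩ i
  · intro q hq i
    rcases mem_attachPts_succ hq with h | ⟨m, hm, h⟩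
    · rw [A1 h]; exact (lk i 0 (by norm_num)).1
    · rw [A2 h]; exact (l q ⟨m, hm, h⟩ i 0 le_rfl).1
  · intro q hq i
    rcases mem_attachPts.1 hq with h | h | ⟨m, hm, h⟩
    · rw [A1 (.inl h)]; exact (rk i 1 le_rfl).1
    · rw [A1 (.inr h)]; exact (rk i 1 le_rfl).1
    · obtain ⟨hx, e⟩ := key hm.le h
      rw [A2 h]; exact r' q hx i (by rw [e]; exact hm) 1 le_rfl
  · intro q hq i s
    obtain ⟨hx, e⟩ := key le_rfl hq
    rw [A2 hq]; exact z q hx i e s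

/-! ### Counting components of fibres -/

/-- Two points lie in a common connected subset of `A`. -/
def Linked (A : Set Amb) (x y : Amb) : Prop := ∃ t ⊆ A, IsPreconnected t ∧ x ∈ t ∧ y ∈ t

theorem Linked.refl {A : Set Amb} {x : Amb} (h : x ∈ A) : Linked A x x :=
  ⟨{x}, singleton_subset_iff.2 h, isPreconnected_singleton, rfl, rfl⟩

theorem Linked.symm {A : Set Amb} {x y : Amb} (h : Linked A x y) : Linked A y x := by
  obtain ⟨t, h1, h2, h3, h4⟩ := h
  exact ⟨t, h1, h2, h4, h3⟩

theorem Linked.trans {A : Set Amb} {x y z : Amb} (h : Linked A x y) (h' : Linked A y z) :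
    Linked A x z := by
  obtain ⟨t, h1, h2, h3, h4⟩ := h
  obtain ⟨t', h1', h2', h3', h4'⟩ := h'
  exact ⟨t ∪ t', union_subset h1 h1', h2.union y h4 h3' h2', .inl h3, .inr h4'⟩

/-- A level set of a monotone function on an interval is an interval, so the curve between the two
parameters stays in `A`. -/
theorem linked_of_monotone {A : Set Amb} {ι : ℝ → Amb} (hι : Continuous ι) {a : ℝ → ℝ}
    (ha : Monotone a ∨ Antitone a) {I : Set ℝ} (hI : I.OrdConnected) {x y : ℝ} (hx : x ∈ I)
    (hy : y ∈ I) (h : a x = a y) (hA : ∀ r ∈ I, a r = a x → ι r ∈ A) : Linked A (ι x) (ι y) := by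
  have key : ∀ {x y}, x ∈ I → y ∈ I → a x = a y → (∀ r ∈ I, a r = a x → ι r ∈ A) → x ≤ y →
      Linked A (ι x) (ι y) := by
    intro x y hx hy h hA hxy
    refine ⟨ι '' Icc x y, ?_, isPreconnected_Icc.image _ hι.continuousOn,
      ⟨x, left_mem_Icc.2 hxy, rfl⟩, ⟨y, right_mem_Icc.2 hxy, rfl⟩⟩
    rintro _ ⟨r, hr, rfl⟩
    refine hA r (hI.out hx hy hr) ?_
    rcases ha with ha | ha
    · exact le_antisymm ((ha hr.2).trans_eq h.symm) (ha hr.1)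
    · exact le_antisymm (ha hr.1) (h.trans_le (ha hr.2))
  rcases le_total x y with hxy | hxy
  · exact key hx hy h hA hxy
  · exact (key hy hx h.symm (fun r hr e => hA r hr (e.trans h.symm)) hxy).symm

/-- Points with a common label are linked, so choosing a point and a label for each component gives
an injection into the labels. -/
theorem card_fiber_le {n : ℕ} {A : Set Amb} {B : Set (T n)} (hB : B = Subtype.val ⁻¹' A)
    (hA : A ⊆ treeSet n) {ι : Type*} [Fintype ι] (c : Amb → ι → Prop)
    (hc : ∀ x ∈ A, ∃ i, c x i)
    (hl : ∀ i, ∀ x ∈ A, ∀ y ∈ A, c x i → c y i → Linked A x y) :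
    ENat.card (ConnectedComponents B) ≤ (Fintype.card ι : ℕ∞) := by
  subst hB
  have hS' : ∀ x : (Subtype.val ⁻¹' A : Set (T n)), ∃ i, c x.1.1 i := fun x => hc _ x.2
  choose d hd using hS'
  choose r hr using fun K : ConnectedComponents (Subtype.val ⁻¹' A : Set (T n)) =>
    ConnectedComponents.surjective_coe K
  have hinj : Function.Injective fun K => d (r K) := by
    intro K K' h
    simp only at h
    rw [← hr K, ← hr K', ConnectedComponents.coe_eq_coe']
    obtain ⟨t, htA, ht, h1, h2⟩ := hl (d (r K)) _ (r K).2 _ (r K').2 (hd _) (h ▸ hd (r K'))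
    have hind : IsInducing fun b : (Subtype.val ⁻¹' A : Set (T n)) => (b.1.1 : Amb) :=
      IsInducing.subtypeVal.comp IsInducing.subtypeVal
    have hpre : IsPreconnected ((fun b : (Subtype.val ⁻¹' A : Set (T n)) => (b.1.1 : Amb)) ⁻¹' t) := by
      rw [← hind.isPreconnected_image, image_preimage_eq_of_subset]
      · exact ht
      · exact fun z hz => ⟨⟨⟨z, hA (htA hz)⟩, htA hz⟩, rfl⟩
    exact hpre.subset_connectedComponent (x := r K') h2 h1
  calc ENat.card (ConnectedComponents (Subtype.val ⁻¹' A : Set (T n))) ≤ ENat.card ι :=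
        ENat.card_le_card_of_injective hinj
    _ = _ := by simp

theorem exists_between_notMem {F : Set ℝ} (hF : F.Finite) {a b : ℝ} (h : a < b) :
    ∃ z, a ≤ z ∧ z ≤ b ∧ z ∉ F := by
  obtain ⟨z, hz, hzF⟩ := ((Ioo_infinite h).sdiff hF).nonempty
  exact ⟨z, hz.1.le, hz.2.le, hzF⟩

/-! ### Fibres of the tour -/

/-- The three points of the interval that `tau3` maps to `t`. -/
noncomputable def lift (t : ℝ) : Fin 3 → ℝ := ![t / 3, (2 - t) / 3, (2 + t) / 3]

theorem exists_lift {y : ℝ} (hy : y ∈ Icc (0 : ℝ) 1) : ∃ k, y = lift (tau3 y) k := by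
  rcases le_total y (1 / 3) with h1 | h1
  · exact ⟨0, by rw [tau3_of₁ hy.1 h1]; simp [lift]⟩
  rcases le_total y (2 / 3) with h2 | h2
  · exact ⟨1, by rw [tau3_of₂ h1 h2]; simp [lift]⟩
  · exact ⟨2, by rw [tau3_of₃ h2 hy.2]; simp [lift]⟩

open Classical in
/-- The positions along the tour that are mapped to `z`. -/
noncomputable def liftPos (n : ℕ) (z : Amb) (k : Fin 3) (b : Bool) : ℝ :=
  blowPos (excPts n) (lift z.1 k) + if lift z.1 k ∈ excPts n then
    (if b then ∑ i, z.2 i else 2 - ∑ i, z.2 i) else 0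

theorem eq_blowPos_add_phase {X : Finset ℝ} {s : ℝ} (h : base X s ∈ X) :
    s = blowPos X (base X s) + phase X (base X s) s := by
  rw [blowPos_add_eq h]
  conv_lhs => rw [← base_add_sum_phase X s]
  congr 1
  refine Finset.sum_congr rfl fun x hx => ?_
  split_ifs with h1 h2
  · exact phase_of_lt_base hx h1
  · rw [h2]
  · exact phase_of_base_lt hx (lt_of_le_of_ne (not_lt.1 h1) (Ne.symm h2))

theorem base_mem_Icc {n : ℕ} {s : ℝ} (h0 : blowPos (excPts n) 0 ≤ s)
    (h1 : s ≤ blowPos (excPts n) 1) : base (excPts n) s ∈ Icc (0 : ℝ) 1 := by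
  have l := monotone_base (excPts n) h0
  have r := monotone_base (excPts n) h1
  rw [base_blowPos] at l r
  exact ⟨l, r⟩

theorem tour_fst (n : ℕ) (s : ℝ) : (tour n s).1 = tau3 (base (excPts n) s) := rfl

/-- The base point is one of the three points over `z.1` under `tau3`. There the height is reached
once on the way up and once on the way down, or there is no excursion and only one position. Hence
six labels. -/
theorem tour_fiber {n : ℕ} {s : ℝ} {z : Amb} (h0 : blowPos (excPts n) 0 ≤ s)
    (h1 : s ≤ blowPos (excPts n) 1) (h : tour n s = z) :
    ∃ k b, base (excPts n) s = lift z.1 k ∧ s = liftPos n z k b ∧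
      (lift z.1 k ∉ excPts n → b = true) := by
  obtain ⟨k, hk⟩ := exists_lift (base_mem_Icc h0 h1)
  have hz : tau3 (base (excPts n) s) = z.1 := by rw [← h, tour_fst]
  rw [hz] at hk
  by_cases hX : base (excPts n) s ∈ excPts n
  · have hs := eq_blowPos_add_phase hX
    have ht := tour_of_mem hX
    rw [h] at ht
    have hsum : ∑ i, z.2 i = tri (phase (excPts n) (base (excPts n) s) s) := by
      rw [ht, leg_snd]; simp
    have hX' : lift z.1 k ∈ excPts n := hk ▸ hX
    rcases tri_eq_iff hsum.symm with e | e
    · refine ⟨k, true, hk, ?_, fun h => absurd hX' h⟩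
      rw [liftPos, if_pos hX', if_pos rfl, ← hk, ← e]; exact hs
    · refine ⟨k, false, hk, ?_, fun h => absurd hX' h⟩
      rw [liftPos, if_pos hX', if_neg (by simp), ← hk, ← e]; exact hs
  · refine ⟨k, true, hk, ?_, fun _ => rfl⟩
    rw [liftPos, if_neg (hk ▸ hX), add_zero, ← hk]
    exact eq_blowPos_of_base_eq rfl hX

theorem lift_two_thirds_mem (k : Fin 3) : lift (2 / 3) k ∈ cyc := by
  fin_cases k <;> norm_num [lift, cyc]

theorem lift_two_thirds_injective : Function.Injective (lift (2 / 3)) := by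
  intro k k' h
  fin_cases k <;> fin_cases k' <;> first | rfl | (exfalso; norm_num [lift] at h)

theorem liftPos_two_thirds (n : ℕ) (k : Fin 3) (b : Bool) :
    liftPos n (pt (2 / 3)) k b =
      blowPos (excPts n) (lift (2 / 3) k) + if b then 0 else 2 := by
  rw [liftPos, pt_fst, if_pos (cyc_subset_excPts n (lift_two_thirds_mem k))]
  simp

theorem base_liftPos_two_thirds (n : ℕ) (k : Fin 3) (b : Bool) :
    base (excPts n) (liftPos n (pt (2 / 3)) k b) = lift (2 / 3) k := by
  rw [liftPos_two_thirds]
  exact base_blowPos_add (cyc_subset_excPts n (lift_two_thirds_mem k)) (by split_ifs <;> norm_num)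

theorem liftPos_two_thirds_injective {n : ℕ} {k k' : Fin 3} {b b' : Bool}
    (h : liftPos n (pt (2 / 3)) k b = liftPos n (pt (2 / 3)) k' b') : k = k' ∧ b = b' := by
  have e := congrArg (base (excPts n)) h
  rw [base_liftPos_two_thirds, base_liftPos_two_thirds] at e
  have e := lift_two_thirds_injective e
  subst e
  rw [liftPos_two_thirds, liftPos_two_thirds] at h
  refine ⟨rfl, ?_⟩
  cases b <;> cases b' <;> first | rfl | (exfalso; norm_num at h)

theorem tour_liftPos_two_thirds (n : ℕ) (k : Fin 3) (b : Bool) :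
    tour n (liftPos n (pt (2 / 3)) k b) = pt (2 / 3) := by
  have hX := cyc_subset_excPts n (lift_two_thirds_mem k)
  have he : (if b then (0 : ℝ) else 2) ∈ Icc (0 : ℝ) 2 := by split_ifs <;> norm_num
  rw [tour_of_mem (by rwa [base_liftPos_two_thirds]), base_liftPos_two_thirds, liftPos_two_thirds,
    phase_blowPos_add hX he, tau3_cyc (lift_two_thirds_mem k)]
  cases b <;> simp

theorem blowPos_le_liftPos {n : ℕ} {c : ℝ} {k : Fin 3} (b : Bool) (h : c < lift (2 / 3) k) :
    blowPos (excPts n) c < liftPos n (pt (2 / 3)) k b := by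
  by_contra! hle
  have := monotone_base (excPts n) hle
  rw [base_liftPos_two_thirds, base_blowPos] at this
  linarith

theorem liftPos_le_blowPos {n : ℕ} {c : ℝ} {k : Fin 3} (b : Bool) (h : lift (2 / 3) k < c) :
    liftPos n (pt (2 / 3)) k b < blowPos (excPts n) c := by
  by_contra! hle
  have := monotone_base (excPts n) hle
  rw [base_liftPos_two_thirds, base_blowPos] at this
  linarith

theorem finite_range_liftPos (n : ℕ) (z : Amb) : {s | ∃ k b, s = liftPos n z k b}.Finite := by
  refine (Set.finite_range fun p : Fin 3 × Bool => liftPos n z p.1 p.2).subset ?_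
  rintro s ⟨k, b, rfl⟩
  exact ⟨(k, b), rfl⟩

theorem treeSet_pt_or_leg {n : ℕ} {z : Amb} (hz : z ∈ treeSet n) :
    (∃ t ∈ Icc (0 : ℝ) 1, z = pt t) ∨ ∃ p j t, 0 < t ∧ z = leg p j t := by
  rcases mem_treeSet.1 hz with ⟨x, hx, rfl⟩ | ⟨p, hp, i, t, ht, rfl⟩
  · exact .inl ⟨x, hx, rfl⟩
  · rcases ht.1.eq_or_lt with rfl | h
    · exact .inl ⟨p, attachPts_subset_Icc hp, leg_zero _ _⟩
    · exact .inr ⟨p, i, t, h, rfl⟩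

/-! ### Fibres of `f` -/

namespace MapData

variable {n : ℕ} {S : Set (Amb × Amb)}

theorem mu_zero (M : MapData n S) : M.mu 0 = blowPos (excPts n) 0 :=
  M.step.mu_attach 0 (zero_mem_attachPts _)

theorem mu_mem (M : MapData n S) {x : ℝ} (hx : x ∈ Icc (0 : ℝ) 1) :
    blowPos (excPts n) 0 ≤ M.mu x ∧ M.mu x ≤ blowPos (excPts n) 1 :=
  ⟨M.mu_zero ▸ M.step.mmu hx.1, M.step.mu_one ▸ M.step.mmu hx.2⟩

/-- The fibre of `f`. -/
def fibF (M : MapData n S) (z : Amb) : Set Amb := {w | w ∈ treeSet (n + 1) ∧ M.f w = z}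

/-- The fibre of `g`. -/
def fibG (M : MapData n S) (z : Amb) : Set Amb := {w | w ∈ treeSet (n + 1) ∧ M.g w = z}

theorem fibF_cover (M : MapData n S) {z : Amb} {x : ℝ} (hx : x ∈ Icc (0 : ℝ) 1)
    (h : pt x ∈ M.fibF z) : ∃ k b, M.mu x = liftPos n z k b ∧
      base (excPts n) (M.mu x) = lift z.1 k := by
  have := h.2
  rw [M.f_pt] at this
  obtain ⟨k, b, h1, h2, -⟩ := tour_fiber (M.mu_mem hx).1 (M.mu_mem hx).2 this
  exact ⟨k, b, h2, h1⟩

theorem fibF_linked (M : MapData n S) {z : Amb} {x y : ℝ} (hx : x ∈ Icc (0 : ℝ) 1)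
    (hy : y ∈ Icc (0 : ℝ) 1) (h : pt x ∈ M.fibF z) (e : M.mu x = M.mu y) :
    Linked (M.fibF z) (pt x) (pt y) := by
  refine linked_of_monotone continuous_pt (.inl M.step.mmu) ordConnected_Icc hx hy e ?_
  intro r hr er
  refine ⟨pt_mem_treeSet hr, ?_⟩
  rw [M.f_pt, er, ← M.f_pt, h.2]

/-- The labels are the six positions of the tour. Over the interval, a fibre point on a leg is
linked to the foot. Over an inner point of a leg, a label is used either by points of the interval
or by points of a leg, never by both, because excursion points are not attaching points. -/
theorem card_fibF_le (M : MapData n S) {z : Amb} (hz : z ∈ treeSet n) {B : Set (T (n + 1))}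
    (hB : B = Subtype.val ⁻¹' (M.fibF z)) : ENat.card (ConnectedComponents B) ≤ 6 := by
  rcases treeSet_pt_or_leg hz with ⟨t, ht, rfl⟩ | ⟨p, j, t, ht, rfl⟩
  · refine card_fiber_le hB (fun w hw => hw.1) (ι := Fin 3 × Bool)
      (fun w i => ∃ x ∈ Icc (0 : ℝ) 1, pt x ∈ M.fibF (pt t) ∧ M.mu x = liftPos n (pt t) i.1 i.2 ∧
        Linked (M.fibF (pt t)) w (pt x)) ?_ ?_
    · intro w hw
      have key : ∃ x ∈ Icc (0 : ℝ) 1, pt x ∈ M.fibF (pt t) ∧ Linked (M.fibF (pt t)) w (pt x) := by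
        rcases mem_treeSet.1 hw.1 with ⟨x, hx, rfl⟩ | ⟨q, hq, i, r, hr, rfl⟩
        · exact ⟨x, hx, hw, Linked.refl hw⟩
        · have h := hw.2
          rw [M.f_leg q hq] at h
          obtain ⟨e1, e2⟩ := pt_eq_leg h.symm
          have e0 := M.a_zero q hq i
          have hl : Linked (M.fibF (pt t)) (leg q i r) (leg q i 0) := by
            refine linked_of_monotone (continuous_leg q i) (.inl (M.ma q hq i)) ordConnected_Icc hr
              (by norm_num) (by rw [e2, e0]) ?_
            intro s hs es
            refine ⟨leg_mem_treeSet hq i hs, ?_⟩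
            rw [M.f_leg q hq, es, e2, leg_zero, e1]
          rw [leg_zero] at hl
          exact ⟨q, attachPts_subset_Icc hq, by obtain ⟨s, h1, -, -, h2⟩ := hl; exact h1 h2, hl⟩
      obtain ⟨x, hx, hx', hl⟩ := key
      obtain ⟨k, b, e, -⟩ := M.fibF_cover hx hx'
      exact ⟨(k, b), x, hx, hx', e, hl⟩
    · rintro ⟨k, b⟩ w - w' - ⟨x, hx, hx', e, hl⟩ ⟨y, hy, hy', e', hl'⟩
      exact hl.trans ((M.fibF_linked hx hy hx' (e.trans e'.symm)).trans hl'.symm)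
  · refine card_fiber_le hB (fun w hw => hw.1) (ι := Fin 3 × Bool)
      (fun w i => (∃ x ∈ Icc (0 : ℝ) 1, w = pt x ∧ M.mu x = liftPos n (leg p j t) i.1 i.2 ∧
        lift p i.1 ∈ excPts n) ∨ ∃ q ∈ attachPts (n + 1), ∃ r ∈ Icc (0 : ℝ) 1, w = leg q j r ∧
          M.a q j r = t ∧ p = tau3 q ∧ q = lift p i.1) ?_ ?_
    · intro w hw
      rcases mem_treeSet.1 hw.1 with ⟨x, hx, rfl⟩ | ⟨q, hq, i, r, hr, rfl⟩
      · obtain ⟨k, b, e, e'⟩ := M.fibF_cover hx hw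
        refine ⟨(k, b), .inl ⟨x, hx, rfl, e, ?_⟩⟩
        by_contra hX
        rw [leg_fst] at e'
        have h := hw.2
        rw [M.f_pt, tour_of_notMem (by rwa [e'])] at h
        exact ht.ne' (pt_eq_leg h).2
      · have h := hw.2
        rw [M.f_leg q hq] at h
        obtain ⟨e1, e2, e3⟩ := leg_eq_leg h
        obtain ⟨k, hk⟩ := exists_lift (attachPts_subset_Icc hq)
        rcases e3 with rfl | e3
        · exact ⟨(k, true), .inr ⟨q, hq, r, hr, rfl, e2, e1.symm, by rw [← e1]; exact hk⟩⟩
        · exact absurd (e2.symm.trans e3) ht.ne'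
    · rintro ⟨k, b⟩ w hw w' hw' (⟨x, hx, rfl, e, hX⟩ | ⟨q, hq, r, hr, rfl, e, ep, hqk⟩)
        (⟨y, hy, rfl, e', hX'⟩ | ⟨q', hq', r', hr', rfl, e', ep', hqk'⟩)
      · exact M.fibF_linked hx hy hw (e.trans e'.symm)
      · dsimp only at hX hqk'
        rw [← hqk'] at hX
        exact absurd hq' (excPts_notMem_attachPts hX)
      · dsimp only at hX' hqk
        rw [← hqk] at hX'
        exact absurd hq (excPts_notMem_attachPts hX')
      · have : q = q' := hqk.trans hqk'.symm
        subst this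
        refine linked_of_monotone (continuous_leg q j) (.inl (M.ma q hq j)) ordConnected_Icc hr hr'
          (e.trans e'.symm) ?_
        intro s hs es
        exact ⟨leg_mem_treeSet hq j hs, by rw [M.f_leg q hq, es, e, ep]⟩

/-- Over `2/3` lies the cycle of period three, whose points carry excursions; their beginnings and
ends are six distinct positions. No leg maps to `2/3`, and on the interval `mu` takes only these
finitely many values on the fibre, so its levels separate them. -/
theorem le_card_fibF (M : MapData n S) {B : Set (T (n + 1))}
    (hB : B = Subtype.val ⁻¹' (M.fibF (pt (2 / 3)))) :
    6 ≤ ENat.card (ConnectedComponents B) := by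
  have hex : ∀ i : Fin 3 × Bool, ∃ x ∈ Icc (0 : ℝ) 1,
      M.mu x = liftPos n (pt (2 / 3)) i.1 i.2 := by
    rintro ⟨k, b⟩
    have hc := lift_two_thirds_mem k
    have h0 := blowPos_le_liftPos (n := n) b (excPts_pos (cyc_subset_excPts 0 hc))
    have h1 := liftPos_le_blowPos (n := n) b (excPts_lt_one (cyc_subset_excPts 0 hc))
    exact intermediate_value_Icc zero_le_one M.step.cmu.continuousOn
      (mem_Icc.2 ⟨by rw [M.mu_zero]; exact h0.le, by rw [M.step.mu_one]; exact h1.le⟩)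
  choose x hx hmu using hex
  subst hB
  have := le_card_connectedComponents (α := T (n + 1)) (S := Subtype.val ⁻¹' M.fibF (pt (2 / 3)))
    (fun i => ⟨pt (x i), pt_mem_treeSet (hx i)⟩)
    (fun i => ⟨pt_mem_treeSet (hx i), by rw [M.f_pt, hmu, tour_liftPos_two_thirds]⟩)
    (φ := fun w => M.mu w.1.1) (M.step.cmu.comp (continuous_fst.comp continuous_subtype_val)) (by
      intro i j hij hle
      simp only [pt_fst, hmu] at hle ⊢
      have hlt := lt_of_le_of_ne hle fun h => hij (by
        obtain ⟨h1, h2⟩ := liftPos_two_thirds_injective h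
        exact Prod.ext h1 h2)
      obtain ⟨z, h1, h2, h3⟩ := exists_between_notMem (finite_range_liftPos n (pt (2 / 3))) hlt
      refine ⟨z, h1, h2, ?_⟩
      rintro ⟨w, hw⟩ hwf rfl
      apply h3
      rcases mem_treeSet.1 hw with ⟨y, hy, rfl⟩ | ⟨q, hq, i, r, hr, rfl⟩
      · obtain ⟨k, b, e, -⟩ := M.fibF_cover hy hwf
        exact ⟨k, b, e⟩
      · exfalso
        have h := hwf.2
        dsimp only at h
        rw [M.f_leg q hq] at h
        obtain ⟨k, hk⟩ := exists_lift (attachPts_subset_Icc hq)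
        rw [← (pt_eq_leg h.symm).1] at hk
        exact excPts_notMem_attachPts (cyc_subset_excPts 0 (lift_two_thirds_mem k)) (hk ▸ hq))
  simpa using this

end MapData

/-! ### Fibres of `g` -/

namespace MapData

variable {n : ℕ} {S : Set (Amb × Amb)}

theorem L_mem (M : MapData n S) {x : ℝ} (hx : x ∈ Icc (0 : ℝ) (1 / 2)) :
    blowPos (excPts n) (eps n / 3) ≤ M.lamL x ∧ M.lamL x ≤ blowPos (excPts n) 1 :=
  ⟨M.step.L_zero ▸ M.step.mL hx.1, M.step.L_half ▸ M.step.mL hx.2⟩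

theorem R_mem (M : MapData n S) {x : ℝ} (hx : x ∈ Icc (1 / 2 : ℝ) (2 / 3)) :
    blowPos (excPts n) (2 / 3 + eps n / 3) ≤ M.lamR x ∧ M.lamR x ≤ blowPos (excPts n) 1 :=
  ⟨M.step.R_add ▸ M.step.aR hx.2, M.step.R_half ▸ M.step.aR hx.1⟩

theorem R_mem' (M : MapData n S) {x : ℝ} (hx : x ∈ Icc (2 / 3 : ℝ) 1) :
    blowPos (excPts n) 0 ≤ M.lamR x - 2 * eps n / 3 ∧
      M.lamR x - 2 * eps n / 3 ≤ blowPos (excPts n) (2 / 3 - eps n / 3) := by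
  have h1 := M.step.aR hx.1
  have h2 := M.step.aR hx.2
  rw [← M.step.R_one, ← M.step.R_sub]
  constructor <;> linarith

theorem blowPos_le_blowPos {X : Finset ℝ} {x y : ℝ} (h : x ≤ y) : blowPos X x ≤ blowPos X y :=
  (blowPos_strictMono X).monotone h

/-- The point `pt x` has position `s` along the tour, seen from the left half or from the right
half. -/
def HasPos (M : MapData n S) (side : Bool) (x s : ℝ) : Prop :=
  (side = true ∧ x ∈ Icc (0 : ℝ) (1 / 2) ∧ M.lamL x = s) ∨
  (side = false ∧ x ∈ Icc (1 / 2 : ℝ) (2 / 3) ∧ M.lamR x = s) ∨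
  (side = false ∧ x ∈ Icc (2 / 3 : ℝ) 1 ∧ M.lamR x - 2 * eps n / 3 = s)

theorem HasPos.g_eq {M : MapData n S} {side : Bool} {x s : ℝ} (h : M.HasPos side x s) :
    M.g (pt x) = tour n s := by
  rcases h with ⟨-, hx, rfl⟩ | ⟨-, hx, rfl⟩ | ⟨-, hx, rfl⟩
  · exact M.g_left x hx
  · exact M.g_mid x hx
  · exact M.g_right x hx

theorem HasPos.mem {M : MapData n S} {side : Bool} {x s : ℝ} (h : M.HasPos side x s) :
    blowPos (excPts n) 0 ≤ s ∧ s ≤ blowPos (excPts n) 1 := by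
  have hε := eps_pos n
  have hε9 := eps_le n
  rcases h with ⟨-, hx, rfl⟩ | ⟨-, hx, rfl⟩ | ⟨-, hx, rfl⟩
  · exact ⟨(blowPos_le_blowPos (by linarith)).trans (M.L_mem hx).1, (M.L_mem hx).2⟩
  · exact ⟨(blowPos_le_blowPos (by linarith)).trans (M.R_mem hx).1, (M.R_mem hx).2⟩
  · exact ⟨(M.R_mem' hx).1, (M.R_mem' hx).2.trans (blowPos_le_blowPos (by linarith))⟩

theorem exists_hasPos (M : MapData n S) {x : ℝ} (hx : x ∈ Icc (0 : ℝ) 1) :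
    ∃ s, M.HasPos (decide (x ≤ 1 / 2)) x s := by
  by_cases h1 : x ≤ 1 / 2
  · exact ⟨_, .inl ⟨by simpa using h1, ⟨hx.1, h1⟩, rfl⟩⟩
  · rw [not_le] at h1
    rcases le_total x (2 / 3) with h2 | h2
    · exact ⟨_, .inr (.inl ⟨by simpa using h1, ⟨h1.le, h2⟩, rfl⟩)⟩
    · exact ⟨_, .inr (.inr ⟨by simpa using h1, ⟨h2, hx.2⟩, rfl⟩)⟩

theorem HasPos.linked {M : MapData n S} {side : Bool} {x y s : ℝ} {z : Amb}
    (hx : M.HasPos side x s) (hy : M.HasPos side y s) (h : pt x ∈ M.fibG z) :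
    Linked (M.fibG z) (pt x) (pt y) := by
  have hz : tour n s = z := by rw [← hx.g_eq, h.2]
  have hε := eps_pos n
  have hlt : blowPos (excPts n) (2 / 3 - eps n / 3) < blowPos (excPts n) (2 / 3 + eps n / 3) :=
    blowPos_strictMono _ (by linarith)
  rcases hx with ⟨e, hx, h1⟩ | ⟨e, hx, h1⟩ | ⟨e, hx, h1⟩ <;>
    rcases hy with ⟨e', hy, h2⟩ | ⟨e', hy, h2⟩ | ⟨e', hy, h2⟩ <;>
    first | (exfalso; rw [e] at e'; exact Bool.noConfusion e') | skip
  · refine linked_of_monotone continuous_pt (.inl M.step.mL) ordConnected_Icc hx hy (h1.trans h2.symm) ?_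
    intro r hr er
    exact ⟨pt_mem_treeSet ⟨hr.1, by linarith [hr.2]⟩, by rw [M.g_left r hr, er, h1, hz]⟩
  · refine linked_of_monotone continuous_pt (.inr M.step.aR) ordConnected_Icc hx hy (h1.trans h2.symm) ?_
    intro r hr er
    exact ⟨pt_mem_treeSet ⟨by linarith [hr.1], by linarith [hr.2]⟩,
      by rw [M.g_mid r hr, er, h1, hz]⟩
  -- The leap separates the positions taken on `[1/2, 2/3]` from those taken on `[2/3, 1]`, so no
  -- position is taken on both.
  · have := (M.R_mem hx).1; have := (M.R_mem' hy).2; linarith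
  · have := (M.R_mem' hx).2; have := (M.R_mem hy).1; linarith
  · refine linked_of_monotone continuous_pt (.inr M.step.aR) ordConnected_Icc hx hy (by linarith) ?_
    intro r hr er
    exact ⟨pt_mem_treeSet ⟨by linarith [hr.1], hr.2⟩, by rw [M.g_right r hr, er, h1, hz]⟩

theorem fibG_cover (M : MapData n S) {z : Amb} {x : ℝ} (hx : x ∈ Icc (0 : ℝ) 1)
    (h : pt x ∈ M.fibG z) : ∃ side k b s, M.HasPos side x s ∧ s = liftPos n z k b ∧
      base (excPts n) s = lift z.1 k ∧ (lift z.1 k ∉ excPts n → b = true) := by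
  obtain ⟨s, hs⟩ := M.exists_hasPos hx
  have := h.2
  rw [hs.g_eq] at this
  obtain ⟨k, b, h1, h2, h3⟩ := tour_fiber hs.mem.1 hs.mem.2 this
  exact ⟨_, k, b, s, hs, h2, h1, h3⟩

theorem neg_eps_le_k (M : MapData n S) (i : Fin 3) (r : ℝ) : -eps n ≤ M.k i r := by
  have := M.k_mono i (min_le_left r (1 / 4))
  rwa [M.k_le i _ (min_le_right _ _)] at this

theorem g_bent_eq_pt (M : MapData n S) {q : ℝ} (hq : q ∈ ({0, 2 / 3} : Set ℝ)) {i : Fin 3}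
    {r t : ℝ} (h : M.g (leg q i r) = pt t) : M.k i r = -t := by
  rw [M.g_bent q hq] at h
  have h1 : max (-M.k i r) 0 = t := congrArg Prod.fst h
  have h2 : max (M.k i r) 0 = 0 := by
    have := congrFun (congrArg Prod.snd h) (i + 1)
    simpa using this
  have h3 : M.k i r ≤ 0 := by rw [← h2]; exact le_max_left _ _
  rw [max_eq_left (by linarith)] at h1
  linarith

theorem g_bent_eq_leg (M : MapData n S) {q : ℝ} (hq : q ∈ ({0, 2 / 3} : Set ℝ)) {i j : Fin 3}
    {r p t : ℝ} (ht : 0 < t) (h : M.g (leg q i r) = leg p j t) :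
    M.k i r = t ∧ p = 0 ∧ i + 1 = j := by
  rw [M.g_bent q hq] at h
  have h1 : max (-M.k i r) 0 = p := congrArg Prod.fst h
  have h2 : (Pi.single (i + 1) (max (M.k i r) 0) : Fin 3 → ℝ) = Pi.single j t :=
    congrArg Prod.snd h
  have hij : i + 1 = j := by
    by_contra hne
    have := congrFun h2 j
    rw [Pi.single_eq_same, Pi.single_eq_of_ne (Ne.symm hne)] at this
    exact ht.ne this
  subst hij
  have h3 : max (M.k i r) 0 = t := by simpa using congrFun h2 (i + 1)
  have h4 : M.k i r = t := by
    rcases le_total (M.k i r) 0 with h | h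
    · rw [max_eq_right h] at h3; exact absurd h3 ht.ne
    · rwa [max_eq_left h] at h3
  exact ⟨h4, by rw [← h1, max_eq_right (by linarith)], rfl⟩

theorem g_bent_of_eq (M : MapData n S) {q : ℝ} (hq : q ∈ ({0, 2 / 3} : Set ℝ)) {i : Fin 3}
    {r s : ℝ} (h : M.k i r = M.k i s) : M.g (leg q i r) = M.g (leg q i s) := by
  rw [M.g_bent q hq, M.g_bent q hq, h]

theorem bent_mem_attachPts {q : ℝ} (hq : q ∈ ({0, 2 / 3} : Set ℝ)) (m : ℕ) : q ∈ attachPts m :=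
  .inl hq

/-- Points of legs over a point of `tauPre` that are mapped into the interval are linked to the
foot of the leg. -/
theorem linked_foot (M : MapData n S) {m : ℕ} (hm : m ≤ n) {q : ℝ} (hq : q ∈ tauPre m) {i : Fin 3}
    {r t : ℝ} (hr : r ∈ Icc (0 : ℝ) 1) (h : M.g (leg q i r) = pt t) :
    Linked (M.fibG (pt t)) (leg q i r) (pt q) := by
  have hq' := mem_attachPts_of_tauPre hq (show m < n + 1 by omega)
  have e := h
  rw [M.g_leg m hm q hq] at e
  obtain ⟨e1, e2⟩ := pt_eq_leg e.symm
  rw [← leg_zero q i]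
  refine linked_of_monotone (continuous_leg q i) (.inl (M.mb m hm q hq i)) ordConnected_Icc hr
    (by norm_num) (by rw [e2, M.b_zero m hm q hq i]) ?_
  intro s hs es
  refine ⟨leg_mem_treeSet hq' i hs, ?_⟩
  rw [M.g_leg m hm q hq, es, e2, leg_zero, e1]

theorem linked_foot_bent (M : MapData n S) {q : ℝ} (hq : q ∈ ({0, 2 / 3} : Set ℝ)) {i : Fin 3}
    {r t : ℝ} (hr : r ∈ Icc (0 : ℝ) 1) (ht : eps n ≤ t) (h : M.g (leg q i r) = pt t) :
    Linked (M.fibG (pt t)) (leg q i r) (pt q) := by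
  have e := M.g_bent_eq_pt hq h
  have e' := M.neg_eps_le_k i r
  have e0 := M.k_le i 0 (by norm_num)
  rw [← leg_zero q i]
  refine linked_of_monotone (continuous_leg q i) (.inl (M.k_mono i)) ordConnected_Icc hr
    (by norm_num) (by linarith) ?_
  intro s hs es
  exact ⟨leg_mem_treeSet (bent_mem_attachPts hq _) i hs, by rw [M.g_bent_of_eq hq es, h]⟩

/-- Six positions on each of the two halves. The legs at `0` and `2/3` reach the interval only below
`eps n`, or at `eps n` while they rest at the foot, so every fibre point is linked to the interval.
-/
theorem card_fibG_pt_le (M : MapData n S) {t : ℝ} (hε : eps n ≤ t)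
    {B : Set (T (n + 1))} (hB : B = Subtype.val ⁻¹' (M.fibG (pt t))) :
    ENat.card (ConnectedComponents B) ≤ 12 := by
  refine card_fiber_le hB (fun w hw => hw.1) (ι := Bool × Fin 3 × Bool)
    (fun w i => ∃ x ∈ Icc (0 : ℝ) 1, pt x ∈ M.fibG (pt t) ∧
      M.HasPos i.1 x (liftPos n (pt t) i.2.1 i.2.2) ∧ Linked (M.fibG (pt t)) w (pt x)) ?_ ?_
  · intro w hw
    have key : ∃ x ∈ Icc (0 : ℝ) 1, Linked (M.fibG (pt t)) w (pt x) := by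
      rcases mem_treeSet.1 hw.1 with ⟨x, hx, rfl⟩ | ⟨q, hq, i, r, hr, rfl⟩
      · exact ⟨x, hx, Linked.refl hw⟩
      · refine ⟨q, attachPts_subset_Icc hq, ?_⟩
        rcases mem_attachPts_succ hq with h | ⟨m, hm, h⟩
        · exact M.linked_foot_bent h hr hε hw.2
        · exact M.linked_foot hm h hr hw.2
    obtain ⟨x, hx, hl⟩ := key
    have hx' : pt x ∈ M.fibG (pt t) := by obtain ⟨s, h1, -, -, h2⟩ := hl; exact h1 h2
    obtain ⟨side, k, b, s, h1, rfl, -, -⟩ := M.fibG_cover hx hx'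
    exact ⟨(side, k, b), x, hx, hx', h1, hl⟩
  · rintro ⟨side, k, b⟩ w - w' - ⟨x, hx, hx', e, hl⟩ ⟨y, hy, hy', e', hl'⟩
    exact hl.trans ((e.linked e' hx').trans hl'.symm)

theorem lift_notMem_of_lt {t : ℝ} (h0 : 0 ≤ t) (h : t < eps n) (k : Fin 3) :
    lift t k ∉ excPts n := by
  have hε := eps_pos n
  fin_cases k
  · exact notMem_excPts_of_lt (by simp [lift]; linarith)
  · refine notMem_excPts_of_abs_lt ?_
    simp only [lift]
    rw [show ((![t / 3, (2 - t) / 3, (2 + t) / 3] : Fin 3 → ℝ) ⟨1, by norm_num⟩) = (2 - t) / 3 from rfl, abs_of_nonpos (by linarith)]; linarith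
  · refine notMem_excPts_of_abs_lt ?_
    simp only [lift]
    rw [show ((![t / 3, (2 - t) / 3, (2 + t) / 3] : Fin 3 → ℝ) ⟨2, by norm_num⟩) = (2 + t) / 3 from rfl, abs_of_nonneg (by linarith)]; linarith

/-- Below `eps n` the six legs at `0` and `2/3` may contribute one component each. In exchange no
excursion point lies over `t`, so the interval contributes at most three positions per half, and `6
+ 6 = 12`. -/
theorem card_fibG_pt_le' (M : MapData n S) {t : ℝ} (ht : t ∈ Icc (0 : ℝ) 1) (hε : t < eps n)
    {B : Set (T (n + 1))} (hB : B = Subtype.val ⁻¹' (M.fibG (pt t))) :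
    ENat.card (ConnectedComponents B) ≤ 12 := by
  have key : ∀ w ∈ M.fibG (pt t), (∃ x ∈ Icc (0 : ℝ) 1, Linked (M.fibG (pt t)) w (pt x)) ∨
      ∃ q ∈ ({0, 2 / 3} : Set ℝ), ∃ i, ∃ r ∈ Icc (0 : ℝ) 1, w = leg q i r := by
    intro w hw
    rcases mem_treeSet.1 hw.1 with ⟨x, hx, rfl⟩ | ⟨q, hq, i, r, hr, rfl⟩
    · exact .inl ⟨x, hx, Linked.refl hw⟩
    · rcases mem_attachPts_succ hq with h | ⟨m, hm, h⟩
      · exact .inr ⟨q, h, i, r, hr, rfl⟩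
      · exact .inl ⟨q, attachPts_subset_Icc hq, M.linked_foot hm h hr hw.2⟩
  refine card_fiber_le hB (fun w hw => hw.1) (ι := (Bool × Fin 3) ⊕ (Bool × Fin 3))
    (fun w => Sum.elim (fun i => ∃ x ∈ Icc (0 : ℝ) 1, pt x ∈ M.fibG (pt t) ∧
      M.HasPos i.1 x (liftPos n (pt t) i.2 true) ∧ Linked (M.fibG (pt t)) w (pt x))
      (fun i => ∃ r ∈ Icc (0 : ℝ) 1, w = leg (if i.1 then 0 else 2 / 3) i.2 r)) ?_ ?_
  · intro w hw
    rcases key w hw with ⟨x, hx, hl⟩ | ⟨q, hq, i, r, hr, rfl⟩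
    · have hx' : pt x ∈ M.fibG (pt t) := by obtain ⟨s, h1, -, -, h2⟩ := hl; exact h1 h2
      obtain ⟨side, k, b, s, h1, rfl, -, h3⟩ := M.fibG_cover hx hx'
      rw [h3 (lift_notMem_of_lt ht.1 hε k)] at h1
      exact ⟨.inl (side, k), x, hx, hx', h1, hl⟩
    · rcases hq with rfl | rfl
      · exact ⟨.inr (true, i), r, hr, by simp⟩
      · exact ⟨.inr (false, i), r, hr, by simp⟩
  · rintro (⟨side, k⟩ | ⟨c, i⟩) w hw w' hw'
    · rintro ⟨x, hx, hx', e, hl⟩ ⟨y, hy, hy', e', hl'⟩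
      exact hl.trans ((e.linked e' hx').trans hl'.symm)
    · rintro ⟨r, hr, rfl⟩ ⟨r', hr', rfl⟩
      have hq : (if c then (0 : ℝ) else 2 / 3) ∈ ({0, 2 / 3} : Set ℝ) := by
        cases c <;> simp
      simp only at hw hw' ⊢
      refine linked_of_monotone (continuous_leg _ i) (.inl (M.k_mono i)) ordConnected_Icc hr hr'
        (by rw [M.g_bent_eq_pt hq hw.2, M.g_bent_eq_pt hq hw'.2]) ?_
      intro s hs es
      exact ⟨leg_mem_treeSet (bent_mem_attachPts hq _) i hs, by rw [M.g_bent_of_eq hq es, hw.2]⟩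

/-- The point of the given half of the interval that `tau` maps to `y`. -/
noncomputable def tauInv (side : Bool) (y : ℝ) : ℝ := if side then y / 2 else 1 - y / 2

theorem tauInv_mem_excPts {y : ℝ} (h : y ∈ excPts n) (side : Bool) :
    tauInv side y ∈ excPts (n + 1) := by
  cases side
  · simpa [tauInv] using one_sub_half_mem_excPts h
  · simpa [tauInv] using half_mem_excPts h

theorem exists_tauInv {q : ℝ} : ∃ side, q = tauInv side (tau q) := by
  rcases le_total q (1 / 2) with h | h
  · exact ⟨true, by rw [tau_of_le h]; simp [tauInv]⟩
  · refine ⟨false, ?_⟩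
    rw [tau_of_ge h]; simp only [tauInv]; norm_num; ring

/-- A label consists of a half, a branch of `tau3` and a direction. It determines the only base
point that can occur, which is either an excursion point or an attaching point. At an attaching
point the direction plays no role, and only one leg can be mapped to the leg in question. -/
theorem card_fibG_leg_le (M : MapData n S) {p t : ℝ} {j : Fin 3} (ht : 0 < t)
    {B : Set (T (n + 1))} (hB : B = Subtype.val ⁻¹' (M.fibG (leg p j t))) :
    ENat.card (ConnectedComponents B) ≤ 12 := by
  refine card_fiber_le hB (fun w hw => hw.1) (ι := Bool × Fin 3 × Bool)
    (fun w c => (∃ x ∈ Icc (0 : ℝ) 1, w = pt x ∧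
      M.HasPos c.1 x (liftPos n (leg p j t) c.2.1 c.2.2) ∧ lift p c.2.1 ∈ excPts n) ∨
      ∃ q ∈ attachPts (n + 1), ∃ i, ∃ r ∈ Icc (0 : ℝ) 1, w = leg q i r ∧
        q = tauInv c.1 (lift p c.2.1)) ?_ ?_
  · intro w hw
    rcases mem_treeSet.1 hw.1 with ⟨x, hx, rfl⟩ | ⟨q, hq, i, r, hr, rfl⟩
    · obtain ⟨side, k, b, s, h1, rfl, h2, -⟩ := M.fibG_cover hx hw
      refine ⟨(side, k, b), .inl ⟨x, hx, rfl, h1, ?_⟩⟩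
      by_contra hX
      rw [leg_fst] at h2
      have h := hw.2
      rw [h1.g_eq, tour_of_notMem (by rwa [h2])] at h
      exact ht.ne' (pt_eq_leg h).2
    · obtain ⟨side, hside⟩ := exists_tauInv (q := q)
      have key : ∃ k, tau q = lift p k := by
        rcases mem_attachPts_succ hq with h | ⟨m, hm, h⟩
        · obtain ⟨-, rfl, -⟩ := M.g_bent_eq_leg h ht hw.2
          rcases h with rfl | rfl
          · exact ⟨0, by rw [tau_zero]; simp [lift]⟩
          · exact ⟨1, by rw [tau_two_thirds]; simp [lift]⟩
        · have h2 := hw.2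
          rw [M.g_leg m hm q h] at h2
          obtain ⟨e1, -, -⟩ := leg_eq_leg h2
          rw [← e1]
          exact exists_lift (tau_mem h.1)
      obtain ⟨k, hk⟩ := key
      exact ⟨(side, k, true), .inr ⟨q, hq, i, r, hr, rfl, by rw [← hk]; exact hside⟩⟩
  · rintro ⟨side, k, b⟩ w hw w' hw' (⟨x, hx, rfl, e, hX⟩ | ⟨q, hq, i, r, hr, rfl, hqk⟩)
      (⟨y, hy, rfl, e', hX'⟩ | ⟨q', hq', i', r', hr', rfl, hqk'⟩)
    · exact e.linked e' hw
    · exact absurd hq' (excPts_notMem_attachPts (hqk' ▸ tauInv_mem_excPts hX side))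
    · exact absurd hq (excPts_notMem_attachPts (hqk ▸ tauInv_mem_excPts hX' side))
    · have : q = q' := hqk.trans hqk'.symm
      subst this
      rcases mem_attachPts_succ hq with h | ⟨m, hm, h⟩
      · obtain ⟨e1, -, e2⟩ := M.g_bent_eq_leg h ht hw.2
        obtain ⟨e1', -, e2'⟩ := M.g_bent_eq_leg h ht hw'.2
        have : i = i' := add_right_cancel (e2.trans e2'.symm)
        subst this
        refine linked_of_monotone (continuous_leg q i) (.inl (M.k_mono i)) ordConnected_Icc hr hr'
          (e1.trans e1'.symm) ?_
        intro s hs es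
        exact ⟨leg_mem_treeSet hq i hs, by rw [M.g_bent_of_eq h es, hw.2]⟩
      · have h1 := hw.2
        have h2 := hw'.2
        rw [M.g_leg m hm q h] at h1 h2
        obtain ⟨-, e1, e2⟩ := leg_eq_leg h1
        obtain ⟨-, e1', e2'⟩ := leg_eq_leg h2
        have hi : i = j := e2.resolve_right (by rw [e1]; exact ht.ne')
        have hi' : i' = j := e2'.resolve_right (by rw [e1']; exact ht.ne')
        subst hi; subst hi'
        refine linked_of_monotone (continuous_leg q _) (.inl (M.mb m hm q h _)) ordConnected_Icc hr
          hr' (e1.trans e1'.symm) ?_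
        intro s hs es
        exact ⟨leg_mem_treeSet hq _ hs, by rw [M.g_leg m hm q h, es, ← hw.2, M.g_leg m hm q h]⟩

theorem card_fibG_le (M : MapData n S) {z : Amb} (hz : z ∈ treeSet n) {B : Set (T (n + 1))}
    (hB : B = Subtype.val ⁻¹' (M.fibG z)) : ENat.card (ConnectedComponents B) ≤ 12 := by
  rcases treeSet_pt_or_leg hz with ⟨t, ht, rfl⟩ | ⟨p, j, t, ht, rfl⟩
  · rcases le_or_gt (eps n) t with h | h
    · exact M.card_fibG_pt_le h hB
    · exact M.card_fibG_pt_le' ht h hB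
  · exact M.card_fibG_leg_le ht hB

/-- A continuous function that follows the unfolded position of `g` along the interval. -/
noncomputable def unfoldG (M : MapData n S) (x : ℝ) : ℝ :=
  M.lamL (min x (1 / 2)) + M.lamR (1 / 2) - M.lamR (min (max x (1 / 2)) (2 / 3)) +
    M.lamR (2 / 3) - M.lamR (max x (2 / 3))

theorem continuous_unfoldG (M : MapData n S) : Continuous M.unfoldG := by
  have := M.step.cL
  have := M.step.cR
  unfold unfoldG; fun_prop

theorem unfoldG_left (M : MapData n S) {x : ℝ} (h : x ≤ 1 / 2) : M.unfoldG x = M.lamL x := by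
  unfold unfoldG
  rw [min_eq_left h, max_eq_right h, min_eq_left (by norm_num), max_eq_right (by linarith)]; ring

theorem unfoldG_mid (M : MapData n S) {x : ℝ} (h : 1 / 2 ≤ x) (h' : x ≤ 2 / 3) :
    M.unfoldG x = 2 * blowPos (excPts n) 1 - M.lamR x := by
  unfold unfoldG
  rw [min_eq_right h, max_eq_left h, min_eq_left h', max_eq_right h', M.step.L_half, M.step.R_half]
  ring

theorem unfoldG_right (M : MapData n S) {x : ℝ} (h : 2 / 3 ≤ x) :
    M.unfoldG x = 2 * blowPos (excPts n) 1 - M.lamR x := by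
  unfold unfoldG
  rw [min_eq_right (by linarith), max_eq_left (by linarith), min_eq_right h, max_eq_left h,
    M.step.L_half, M.step.R_half]
  ring

/-- The six positions over `2/3` are met once on either half, since none of them falls into the leap
of `lam`. The legs do not meet this fibre: the bent ones stay at or below `eps n` on the interval,
and the others would give an excursion point in `tauPre`. -/
theorem le_card_fibG (M : MapData n S) {B : Set (T (n + 1))}
    (hB : B = Subtype.val ⁻¹' (M.fibG (pt (2 / 3)))) :
    12 ≤ ENat.card (ConnectedComponents B) := by
  have hε := eps_pos n
  have hε9 := eps_le n
  have hlt1 : ∀ k b, liftPos n (pt (2 / 3)) k b < blowPos (excPts n) 1 := fun k b =>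
    liftPos_le_blowPos b (excPts_lt_one (cyc_subset_excPts 0 (lift_two_thirds_mem k)))
  have hex : ∀ i : Bool × Fin 3 × Bool, ∃ x ∈ Icc (0 : ℝ) 1,
      M.HasPos i.1 x (liftPos n (pt (2 / 3)) i.2.1 i.2.2) ∧
      ((i.1 = true ∧ M.unfoldG x = liftPos n (pt (2 / 3)) i.2.1 i.2.2) ∨
      (i.1 = false ∧ blowPos (excPts n) (2 / 3 + eps n / 3) < liftPos n (pt (2 / 3)) i.2.1 i.2.2 ∧
        M.unfoldG x = 2 * blowPos (excPts n) 1 - liftPos n (pt (2 / 3)) i.2.1 i.2.2) ∨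
      (i.1 = false ∧ liftPos n (pt (2 / 3)) i.2.1 i.2.2 < blowPos (excPts n) (2 / 3 - eps n / 3) ∧
        M.unfoldG x = 2 * blowPos (excPts n) 1 - liftPos n (pt (2 / 3)) i.2.1 i.2.2 -
          2 * eps n / 3)) := by
    rintro ⟨side, k, b⟩
    have hl := hlt1 k b
    rcases side with _ | _
    -- On the right half the tour is followed backwards: `8/9` is passed before the leap, `4/9` and
    -- `2/9` after it.
    · rcases (show 2 / 3 + eps n / 3 < lift (2 / 3) k ∨ lift (2 / 3) k < 2 / 3 - eps n / 3 by
        fin_cases k <;> simp [lift] <;> first | (left; linarith) | (right; linarith)) with h | h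
      · have h1 := blowPos_le_liftPos (n := n) b h
        obtain ⟨x, hx, e⟩ := intermediate_value_Icc' (show (1 / 2 : ℝ) ≤ 2 / 3 by norm_num)
          M.step.cR.continuousOn
          (show liftPos n (pt (2 / 3)) k b ∈ Icc (M.lamR (2 / 3)) (M.lamR (1 / 2)) by
            rw [M.step.R_add, M.step.R_half]; exact ⟨h1.le, hl.le⟩)
        refine ⟨x, ⟨by linarith [hx.1], by linarith [hx.2]⟩, .inr (.inl ⟨rfl, hx, e⟩),
          .inr (.inl ⟨rfl, h1, ?_⟩)⟩
        rw [M.unfoldG_mid hx.1 hx.2, e]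
      · have h1 := liftPos_le_blowPos (n := n) b h
        have h0 := blowPos_le_liftPos (n := n) b (excPts_pos (cyc_subset_excPts 0 (lift_two_thirds_mem k)))
        obtain ⟨x, hx, e⟩ := intermediate_value_Icc' (show (2 / 3 : ℝ) ≤ 1 by norm_num)
          (f := fun x => M.lamR x - 2 * eps n / 3) (M.step.cR.sub continuous_const).continuousOn
          (show liftPos n (pt (2 / 3)) k b ∈
              Icc (M.lamR 1 - 2 * eps n / 3) (M.lamR (2 / 3) - 2 * eps n / 3) by
            rw [M.step.R_one, M.step.R_sub]; exact ⟨h0.le, h1.le⟩)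
        refine ⟨x, ⟨by linarith [hx.1], by linarith [hx.2]⟩, .inr (.inr ⟨rfl, hx, e⟩),
          .inr (.inr ⟨rfl, h1, ?_⟩)⟩
        rw [M.unfoldG_right hx.1]
        dsimp only at e ⊢; linarith
    · have h0 : blowPos (excPts n) (eps n / 3) < liftPos n (pt (2 / 3)) k b :=
        blowPos_le_liftPos b (by fin_cases k <;> simp [lift] <;> linarith)
      obtain ⟨x, hx, e⟩ := intermediate_value_Icc (show (0 : ℝ) ≤ 1 / 2 by norm_num)
        M.step.cL.continuousOn
        (show liftPos n (pt (2 / 3)) k b ∈ Icc (M.lamL 0) (M.lamL (1 / 2)) by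
          rw [M.step.L_zero, M.step.L_half]; exact ⟨h0.le, hl.le⟩)
      exact ⟨x, ⟨hx.1, by linarith [hx.2]⟩, .inl ⟨rfl, hx, e⟩,
        .inl ⟨rfl, by rw [M.unfoldG_left hx.2, e]⟩⟩
  choose x hx hpos hval using hex
  subst hB
  have hfin : ({v | ∃ k b, v = liftPos n (pt (2 / 3)) k b ∨
      v = 2 * blowPos (excPts n) 1 - liftPos n (pt (2 / 3)) k b ∨
      v = 2 * blowPos (excPts n) 1 - liftPos n (pt (2 / 3)) k b - 2 * eps n / 3} : Set ℝ).Finite := by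
    have h := finite_range_liftPos n (pt (2 / 3))
    refine ((h.union (h.image fun s => 2 * blowPos (excPts n) 1 - s)).union
      (h.image fun s => 2 * blowPos (excPts n) 1 - s - 2 * eps n / 3)).subset ?_
    rintro v ⟨k, b, h | h | h⟩
    · exact .inl (.inl ⟨k, b, h⟩)
    · exact .inl (.inr ⟨_, ⟨k, b, rfl⟩, h.symm⟩)
    · exact .inr ⟨_, ⟨k, b, rfl⟩, h.symm⟩
  -- The three pieces of the interval have disjoint ranges of `unfoldG` on the chosen points: the
  -- left half stays below `blowPos (excPts n) 1`, the right half above it, and the two parts of the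
  -- right half are separated by the value at `2/3`.
  have hinj : ∀ i j, M.unfoldG (x i) = M.unfoldG (x j) → i = j := by
    rintro ⟨s, k, b⟩ ⟨s', k', b'⟩ h
    have e : ∀ {s s' k k' b b'}, s = s' → liftPos n (pt (2 / 3)) k b = liftPos n (pt (2 / 3)) k' b' →
        ((s, k, b) : Bool × Fin 3 × Bool) = (s', k', b') := by
      intro s s' k k' b b' h1 h2
      obtain ⟨h3, h4⟩ := liftPos_two_thirds_injective h2
      rw [h1, h3, h4]
    have h1 := hlt1 k b
    have h2 := hlt1 k' b'
    have R1 := M.step.R_add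
    have R2 := M.step.R_sub
    have R3 := blowPos_strictMono (excPts n) (show 2 / 3 + eps n / 3 < 1 by linarith)
    rcases hval (s, k, b) with ⟨s1, v1⟩ | ⟨s1, c1, v1⟩ | ⟨s1, c1, v1⟩ <;>
      rcases hval (s', k', b') with ⟨s2, v2⟩ | ⟨s2, c2, v2⟩ | ⟨s2, c2, v2⟩ <;>
      dsimp only at * <;> rw [v1, v2] at h
    · exact e (s1.trans s2.symm) h
    · linarith
    · linarith
    · linarith
    · exact e (s1.trans s2.symm) (by linarith)
    · linarith
    · linarith
    · linarith
    · exact e (s1.trans s2.symm) (by linarith)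
  have := le_card_connectedComponents (α := T (n + 1)) (S := Subtype.val ⁻¹' M.fibG (pt (2 / 3)))
    (fun i => ⟨pt (x i), pt_mem_treeSet (hx i)⟩)
    (fun i => ⟨pt_mem_treeSet (hx i), by rw [(hpos i).g_eq, tour_liftPos_two_thirds]⟩)
    (φ := fun w => M.unfoldG w.1.1)
    (M.continuous_unfoldG.comp (continuous_fst.comp continuous_subtype_val)) (by
      intro i j hij hle
      simp only [pt_fst] at hle ⊢
      have hlt := lt_of_le_of_ne hle fun h => hij (hinj i j h)
      obtain ⟨z, h1, h2, h3⟩ := exists_between_notMem hfin hlt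
      refine ⟨z, h1, h2, ?_⟩
      rintro ⟨w, hw⟩ hwf rfl
      apply h3
      rcases mem_treeSet.1 hw with ⟨y, hy, rfl⟩ | ⟨q, hq, i, r, hr, rfl⟩
      · obtain ⟨side, k, b, s, hp, rfl, -, -⟩ := M.fibG_cover hy hwf
        refine ⟨k, b, ?_⟩
        rcases hp with ⟨-, hx, e⟩ | ⟨-, hx, e⟩ | ⟨-, hx, e⟩
        · left; rw [← e]; exact M.unfoldG_left hx.2
        · right; left; rw [← e]; exact M.unfoldG_mid hx.1 hx.2
        · right; right
          have := M.unfoldG_right hx.1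
          dsimp only [pt_fst]
          rw [this]; linarith
      · exfalso
        have h := hwf.2
        dsimp only at h
        rcases mem_attachPts_succ hq with h' | ⟨m, hm, h'⟩
        · have := M.g_bent_eq_pt h' h
          have := M.neg_eps_le_k i r
          linarith
        · rw [M.g_leg m hm q h'] at h
          obtain ⟨k, hk⟩ := exists_lift (tau_mem h'.1)
          rw [← (pt_eq_leg h.symm).1] at hk
          have : tau q ∈ excPts n := by
            rw [hk]; exact cyc_subset_excPts n (lift_two_thirds_mem k)
          rw [← mem_excPts_succ h'.1] at this
          exact excPts_disjoint_tauPre this h')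
  simpa using this

end MapData

/-! ### Arcs in the coincidence set -/

/-- The curve from `exists_matching`, parametrized by the sum of the two parameters, is a monotone
arc. Of the steering by `φ`, an extremality of the arc and its passage through solutions on the
graph of `φ` are retained. -/
theorem exists_matchArc {ι κ : ℝ → Amb} (hι : Continuous ι) (hκ : Continuous κ)
    (hιi : Function.Injective ι) (hκi : Function.Injective κ) {lam mu : ℝ → ℝ}
    (hlc : Continuous lam) (hmc : Continuous mu) (hl : Monotone lam) (hm : Monotone mu)
    {a b c d : ℝ} (hab : a < b) (hcd : c < d) (h0 : lam a = mu c) (h1 : lam b = mu d)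
    {φ : ℝ → ℝ} (hφ : Monotone φ) (hφ' : Monotone fun s => s - φ s) :
    ∃ A, IsMonotoneArcFromTo A (ι a, κ c) (ι b, κ d) ∧
      (∀ z ∈ A, ∃ x ∈ Icc a b, ∃ y ∈ Icc c d, z = (ι x, κ y) ∧ lam x = mu y ∧
        ∀ x' ∈ Icc a b, x + y - x' ∈ Icc c d → lam x' = mu (x + y - x') → x' ≤ φ (x + y) → x' ≤ x) ∧
      ∀ x ∈ Icc a b, ∀ y ∈ Icc c d, lam x = mu y → φ (x + y) = x → (ι x, κ y) ∈ A := by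
  obtain ⟨X, Y, hXY, mX, mY, cX, cY, hs⟩ := exists_matching hlc hmc hl hm hab.le hcd.le h0 h1 hφ hφ'
  have hlt : a + c < b + d := by linarith
  have harc := isMonotoneArcFromTo_image hι hκ hιi hκi hlt cX cY (.inl mX) (.inl mY)
    (fun s _ t _ h1 h2 => by rw [← hXY s, ← hXY t, h1, h2])
  have e0 : X (a + c) = a ∧ Y (a + c) = c := by
    obtain ⟨h1, h2, -⟩ := hs (a + c) (left_mem_Icc.2 hlt.le)
    have := hXY (a + c)
    constructor <;> linarith [h1.1, h2.1]
  have e1 : X (b + d) = b ∧ Y (b + d) = d := by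
    obtain ⟨h1, h2, -⟩ := hs (b + d) (right_mem_Icc.2 hlt.le)
    have := hXY (b + d)
    constructor <;> linarith [h1.2, h2.2]
  rw [e0.1, e0.2, e1.1, e1.2] at harc
  refine ⟨_, harc, ?_, ?_⟩
  · rintro _ ⟨s, hs', rfl⟩
    obtain ⟨h1, h2, h3, h4⟩ := hs s hs'
    refine ⟨X s, h1, Y s, h2, rfl, h3, ?_⟩
    rw [hXY s]
    exact fun x' hx' h5 h6 h7 => (h4 x' hx' h5 h6).1 h7
  · intro x hx y hy h hfix
    have hs' : x + y ∈ Icc (a + c) (b + d) := ⟨add_le_add hx.1 hy.1, add_le_add hx.2 hy.2⟩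
    obtain ⟨-, -, -, h4⟩ := hs _ hs'
    have := h4 x hx (by rwa [add_sub_cancel_left]) (by rwa [add_sub_cancel_left])
    have e : X (x + y) = x := le_antisymm (this.2 hfix.le) (this.1 hfix.ge)
    have e' : Y (x + y) = y := by have := hXY (x + y); linarith
    exact ⟨x + y, hs', by simp only [e, e']⟩

theorem leg_mem_seg {p : ℝ} {i : Fin 3} {s : ℝ} (h : leg p i s ∈ seg) : s = 0 := by
  obtain ⟨x, -, e⟩ := h
  exact (pt_eq_leg e).2

theorem leg_mem_legArc_iff {p p' : ℝ} {i j : Fin 3} {s : ℝ} (h : leg p i s ∈ legArc p' j) :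
    p = p' ∧ (s = 0 ∨ i = j) := by
  obtain ⟨t, -, e⟩ := h
  obtain ⟨e1, e2, e3⟩ := leg_eq_leg e
  refine ⟨e1.symm, ?_⟩
  rcases e3 with h | h
  · exact .inr h.symm
  · exact .inl (e2.symm.trans h)

theorem pt_mem_legArc_iff {x p : ℝ} {j : Fin 3} (h : pt x ∈ legArc p j) : x = p := by
  obtain ⟨t, -, e⟩ := h
  exact (pt_eq_leg e.symm).1

/-- Near a point that is not an excursion point, the tour runs along the interval. -/
theorem tour_near {n : ℕ} {c₀ c₁ s : ℝ} (h : ∀ y ∈ Icc c₀ c₁, y ∉ excPts n)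
    (hs : s ∈ Icc (blowPos (excPts n) c₀) (blowPos (excPts n) c₁)) :
    tour n s = pt (tau3 (c₀ + (s - blowPos (excPts n) c₀))) ∧
      c₀ + (s - blowPos (excPts n) c₀) ∈ Icc c₀ c₁ := by
  have l := monotone_base (excPts n) hs.1
  have r := monotone_base (excPts n) hs.2
  rw [base_blowPos] at l r
  have hX := h _ ⟨l, r⟩
  have e := eq_blowPos_of_base_eq (rfl : base (excPts n) s = base (excPts n) s) hX
  have key : blowPos (excPts n) (base (excPts n) s) - base (excPts n) s =
      blowPos (excPts n) c₀ - c₀ := by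
    rw [blowPos_eq, blowPos_eq, add_sub_cancel_left, add_sub_cancel_left]
    refine Finset.sum_congr rfl fun x hx => ?_
    have : x < base (excPts n) s ↔ x < c₀ := by
      refine ⟨fun h1 => ?_, fun h1 => h1.trans_le l⟩
      by_contra! h2
      exact h x ⟨h2, h1.le.trans r⟩ hx
    simp only [this]
  have e' : c₀ + (s - blowPos (excPts n) c₀) = base (excPts n) s := by linarith
  rw [e']
  exact ⟨tour_of_notMem hX, l, r⟩

theorem tau_mem_attachPts {n m : ℕ} {q : ℝ} (hq : q ∈ tauPre m) (hm : m ≤ n) :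
    tau q ∈ attachPts n := by
  rcases m with _ | m
  · rcases tau_of_mem_tauPre_zero hq with ⟨-, h⟩ | ⟨-, h⟩
    · rw [h]; exact two_thirds_mem_attachPts n
    · rw [h]; exact zero_mem_attachPts n
  · exact mem_attachPts_of_tauPre (tau_mem_tauPre hq) (by omega)

theorem attachPts_subset_succ {n : ℕ} {q : ℝ} (h : q ∈ attachPts n) : q ∈ attachPts (n + 1) := by
  rcases mem_attachPts.1 h with rfl | rfl | ⟨m, hm, h⟩
  · exact zero_mem_attachPts _
  · exact two_thirds_mem_attachPts _
  · exact mem_attachPts_of_tauPre h (by omega)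

/-- Assembling a set that satisfies the conditions from its arcs. -/
theorem exists_condAmb_of_arcs {n : ℕ} {R : Amb × Amb → Prop} {A₁ A₂ A₃ : Set (Amb × Amb)}
    {N P Q : Fin 3 → Set (Amb × Amb)} {K D : ℝ → Fin 3 → Set (Amb × Amb)}
    (h₁ : IsMonotoneArcFromTo A₁ (pt 0, pt (eps n)) (pt (1 / 2), pt 1))
    (h₂ : IsMonotoneArcFromTo A₂ (pt (1 / 2), pt 1) (pt (2 / 3), pt (2 / 3 + eps n)))
    (h₃ : IsMonotoneArcFromTo A₃ (pt (2 / 3), pt (2 / 3 - eps n)) (pt 1, pt 0))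
    (hA : ∀ z ∈ A₁ ∪ A₂ ∪ A₃, ∃ x ∈ Icc (0 : ℝ) 1, ∃ y ∈ Icc (0 : ℝ) 1, z = (pt x, pt y) ∧
      R z ∧ (x = 0 → y = eps n) ∧ (x = 2 / 3 → y = 2 / 3 + eps n ∨ y = 2 / 3 - eps n))
    (hpin : ∀ m ≤ n, ∀ q ∈ tauPre m, (pt q, pt (tau q)) ∈ A₁ ∪ A₂ ∪ A₃)
    (hN : ∀ i, IsMonotoneArcFromTo (N i) (pt 0, pt (eps n)) (leg 0 i (1 / 2), pt 0))
    (hNm : ∀ i, ∀ z ∈ N i, ∃ s ∈ Icc (0 : ℝ) (1 / 2), ∃ y ∈ Icc (0 : ℝ) 1, z = (leg 0 i s, pt y) ∧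
      R z ∧ (s = 0 → y = eps n) ∧ (y = 0 → s = 1 / 2))
    (hP : ∀ i, IsMonotoneArcFromTo (P i) (pt (2 / 3), pt (2 / 3 + eps n))
      (leg (2 / 3) i (1 / 2), pt (2 / 3)))
    (hPm : ∀ i, ∀ z ∈ P i, ∃ s ∈ Icc (0 : ℝ) (1 / 2), ∃ y ∈ Icc (0 : ℝ) 1,
      z = (leg (2 / 3) i s, pt y) ∧ R z ∧ (s = 0 → y = 2 / 3 + eps n) ∧ (y = 2 / 3 → s = 1 / 2))
    (hQ : ∀ i, IsMonotoneArcFromTo (Q i) (pt (2 / 3), pt (2 / 3 - eps n))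
      (leg (2 / 3) i (1 / 2), pt (2 / 3)))
    (hQm : ∀ i, ∀ z ∈ Q i, ∃ s ∈ Icc (0 : ℝ) (1 / 2), ∃ y ∈ Icc (0 : ℝ) 1,
      z = (leg (2 / 3) i s, pt y) ∧ R z ∧ (s = 0 → y = 2 / 3 - eps n) ∧ (y = 2 / 3 → s = 1 / 2))
    (hK : ∀ q ∈ ({0, 2 / 3} : Set ℝ), ∀ i, IsMonotoneArcFromTo (K q i) (leg q i (1 / 2), pt q)
      (leg q i 1, leg q (i + 1) 1))
    (hKm : ∀ q ∈ ({0, 2 / 3} : Set ℝ), ∀ i, ∀ z ∈ K q i, ∃ s ∈ Icc (1 / 2 : ℝ) 1,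
      ∃ t ∈ Icc (0 : ℝ) 1, z = (leg q i s, leg q (i + 1) t) ∧ R z ∧ (t = 0 → s = 1 / 2))
    (hD : ∀ q i, ∀ m < n, q ∈ tauPre m →
      IsMonotoneArcFromTo (D q i) (pt q, pt (tau q)) (leg q i 1, leg (tau q) i 1) ∧
      ∀ z ∈ D q i, ∃ s ∈ Icc (0 : ℝ) 1, ∃ t ∈ Icc (0 : ℝ) 1, z = (leg q i s, leg (tau q) i t) ∧ R z)
    (hR : ∀ q ∈ tauPre n, ∀ i : Fin 3, ∀ t ∈ Icc (0 : ℝ) 1, R (pt q, leg (tau q) i t)) :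
    ∃ Γ : Set (Amb × Amb), Γ ⊆ treeSet n ×ˢ treeSet n ∧ (∀ z ∈ Γ, R z) ∧ CondAmb n Γ := by
  have hε := eps_pos n
  have start : ∀ {A : Set (Amb × Amb)} {a b}, IsMonotoneArcFromTo A a b → a ∈ A := by
    rintro A a b ⟨⟨γ, -, hr, h0, -⟩, -⟩
    rw [← hr, ← h0]; exact mem_range_self _
  have fin : ∀ {A : Set (Amb × Amb)} {a b}, IsMonotoneArcFromTo A a b → b ∈ A := by
    rintro A a b ⟨⟨γ, -, hr, -, h1⟩, -⟩
    rw [← hr, ← h1]; exact mem_range_self _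
  let Γ : Set (Amb × Amb) := {z | z ∈ A₁ ∪ A₂ ∪ A₃ ∨ (∃ i, z ∈ N i) ∨ (∃ i, z ∈ P i ∪ Q i) ∨
    (∃ q ∈ ({0, 2 / 3} : Set ℝ), ∃ i, z ∈ K q i) ∨ (∃ m < n, ∃ q ∈ tauPre m, ∃ i, z ∈ D q i) ∨
    ∃ q ∈ tauPre n, ∃ i, ∃ t ∈ Icc (0 : ℝ) 1, z = (pt q, leg (tau q) i t)}
  have hPQ : ∀ i, ∀ z ∈ P i ∪ Q i, ∃ s ∈ Icc (0 : ℝ) (1 / 2), ∃ y ∈ Icc (0 : ℝ) 1,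
      z = (leg (2 / 3) i s, pt y) ∧ R z ∧
      (s = 0 → (y = 2 / 3 + eps n ∨ y = 2 / 3 - eps n)) ∧ (y = 2 / 3 → s = 1 / 2) := by
    rintro i z (hz | hz)
    · obtain ⟨s, hs, y, hy, e, e1, e2, e3⟩ := hPm i z hz
      exact ⟨s, hs, y, hy, e, e1, fun h => .inl (e2 h), e3⟩
    · obtain ⟨s, hs, y, hy, e, e1, e2, e3⟩ := hQm i z hz
      exact ⟨s, hs, y, hy, e, e1, fun h => .inr (e2 h), e3⟩
  have hPQs : ∀ i, ∀ y, (y = 2 / 3 + eps n ∨ y = 2 / 3 - eps n) →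
      (pt (2 / 3), pt y) ∈ P i ∪ Q i := by
    rintro i y (rfl | rfl)
    · exact .inl (start (hP i))
    · exact .inr (start (hQ i))
  have hAs : ∀ y, (y = 2 / 3 + eps n ∨ y = 2 / 3 - eps n) →
      (pt (2 / 3), pt y) ∈ A₁ ∪ A₂ ∪ A₃ := by
    rintro y (rfl | rfl)
    · exact .inl (.inr (fin h₂))
    · exact .inr (start h₃)
  have hAN : (pt 0, pt (eps n)) ∈ A₁ ∪ A₂ ∪ A₃ := .inl (.inl (start h₁))
  have h023 : ∀ {q : ℝ}, q ∈ ({0, 2 / 3} : Set ℝ) → ∀ m, q ∉ tauPre m := by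
    rintro q hq m h
    exact tauPre_ne h hq
  have hτ : ∀ q ∈ tauPre n, tau q ∈ attachPts n := fun q hq =>
    tau_mem_attachPts hq le_rfl
  refine ⟨Γ, ?_, ?_, ?_, ?_, ?_, ?_, ?_, ?_, ?_⟩
  · rintro z (hz | ⟨i, hz⟩ | ⟨i, hz⟩ | ⟨q, hq, i, hz⟩ | ⟨m, hm, q, hq, i, hz⟩ | ⟨q, hq, i, t, ht, rfl⟩)
    · obtain ⟨x, hx, y, hy, rfl, -⟩ := hA z hz
      exact ⟨pt_mem_treeSet hx, pt_mem_treeSet hy⟩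
    · obtain ⟨s, hs, y, hy, rfl, -⟩ := hNm i z hz
      exact ⟨leg_mem_treeSet (zero_mem_attachPts _) i ⟨hs.1, by linarith [hs.2]⟩, pt_mem_treeSet hy⟩
    · obtain ⟨s, hs, y, hy, rfl, -⟩ := hPQ i z hz
      exact ⟨leg_mem_treeSet (two_thirds_mem_attachPts _) i ⟨hs.1, by linarith [hs.2]⟩,
        pt_mem_treeSet hy⟩
    · obtain ⟨s, hs, t, ht, rfl, -⟩ := hKm q hq i z hz
      exact ⟨leg_mem_treeSet (MapData.bent_mem_attachPts hq _) i ⟨by linarith [hs.1], hs.2⟩,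
        leg_mem_treeSet (MapData.bent_mem_attachPts hq _) _ ht⟩
    · obtain ⟨s, hs, t, ht, rfl, -⟩ := (hD q i m hm hq).2 z hz
      exact ⟨leg_mem_treeSet (mem_attachPts_of_tauPre hq (by omega)) i hs,
        leg_mem_treeSet (tau_mem_attachPts hq hm.le) _ ht⟩
    · exact ⟨pt_mem_treeSet hq.1, leg_mem_treeSet (hτ q hq) i ht⟩
  · rintro z (hz | ⟨i, hz⟩ | ⟨i, hz⟩ | ⟨q, hq, i, hz⟩ | ⟨m, hm, q, hq, i, hz⟩ | ⟨q, hq, i, t, ht, rfl⟩)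
    · obtain ⟨x, hx, y, hy, -, h, -⟩ := hA z hz
      exact h
    · obtain ⟨s, hs, y, hy, -, h, -⟩ := hNm i z hz
      exact h
    · obtain ⟨s, hs, y, hy, -, h, -⟩ := hPQ i z hz
      exact h
    · obtain ⟨s, hs, t, ht, -, h, -⟩ := hKm q hq i z hz
      exact h
    · obtain ⟨s, hs, t, ht, -, h⟩ := (hD q i m hm hq).2 z hz
      exact h
    · exact hR q hq i t ht
  · refine ⟨A₁, A₂, A₃, h₁, h₂, h₃, ?_⟩
    ext z
    constructor
    · rintro ⟨hz | ⟨i, hz⟩ | ⟨i, hz⟩ | ⟨q, hq, i, hz⟩ | ⟨m, hm, q, hq, i, hz⟩ | ⟨q, hq, i, t, ht, rfl⟩,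
        hs1, hs2⟩
      · exact hz
      · obtain ⟨s, hs, y, hy, rfl, -, e, -⟩ := hNm i z hz
        obtain rfl := leg_mem_seg hs1
        rw [leg_zero, e rfl]; exact hAN
      · obtain ⟨s, hs, y, hy, rfl, -, e, -⟩ := hPQ i z hz
        obtain rfl := leg_mem_seg hs1
        rw [leg_zero]; exact hAs y (e rfl)
      · obtain ⟨s, hs, t, ht, rfl, -⟩ := hKm q hq i z hz
        have := leg_mem_seg hs1
        linarith [hs.1]
      · obtain ⟨s, hs, t, ht, rfl, -⟩ := (hD q i m hm hq).2 z hz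
        obtain rfl := leg_mem_seg hs1
        obtain rfl := leg_mem_seg hs2
        rw [leg_zero, leg_zero]; exact hpin m (by omega) q hq
      · obtain rfl := leg_mem_seg hs2
        rw [leg_zero]; exact hpin _ le_rfl q hq
    · intro hz
      obtain ⟨x, hx, y, hy, rfl, -⟩ := hA z hz
      exact ⟨.inl hz, pt_mem_seg hx, pt_mem_seg hy⟩
  · intro m hm q hq
    exact ⟨.inl (hpin m hm q hq), pt_mem_seg hq.1, pt_mem_seg (tau_mem hq.1)⟩
  · intro i
    -- Any other piece meets this product only in an end point of `N i`; the clauses in the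
    -- hypotheses about degenerate parameters are what excludes further points. The other conditions
    -- are treated alike.
    have : Γ ∩ (legArc 0 i ×ˢ seg) = N i := by
      ext z
      constructor
      · rintro ⟨hz | ⟨j, hz⟩ | ⟨j, hz⟩ | ⟨q, hq, j, hz⟩ | ⟨m, hm, q, hq, j, hz⟩ | ⟨q, hq, j, t, ht, rfl⟩,
          hs1, hs2⟩
        · obtain ⟨x, hx, y, hy, rfl, -, e, -⟩ := hA z hz
          obtain rfl := pt_mem_legArc_iff hs1
          rw [e rfl]; exact start (hN i)
        · obtain ⟨s, hs, y, hy, rfl, -, e, -⟩ := hNm j z hz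
          rcases (leg_mem_legArc_iff hs1).2 with rfl | rfl
          · rw [leg_zero, e rfl]; exact start (hN i)
          · exact hz
        · obtain ⟨s, hs, y, hy, rfl, -⟩ := hPQ j z hz
          have := (leg_mem_legArc_iff hs1).1
          norm_num at this
        · obtain ⟨s, hs, t, ht, rfl, -, e⟩ := hKm q hq j z hz
          obtain rfl := leg_mem_seg hs2
          obtain rfl := e rfl
          obtain ⟨rfl, h | rfl⟩ := leg_mem_legArc_iff hs1
          · norm_num at h
          · rw [leg_zero]; exact fin (hN _)
        · obtain ⟨s, hs, t, ht, rfl, -⟩ := (hD q j m hm hq).2 z hz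
          obtain rfl := (leg_mem_legArc_iff hs1).1
          exact absurd hq (zero_notMem_tauPre m)
        · obtain rfl := pt_mem_legArc_iff hs1
          exact absurd hq (zero_notMem_tauPre _)
      · intro hz
        obtain ⟨s, hs, y, hy, rfl, -⟩ := hNm i z hz
        exact ⟨.inr (.inl ⟨i, hz⟩), leg_mem_legArc ⟨hs.1, by linarith [hs.2]⟩, pt_mem_seg hy⟩
    rw [this]; exact hN i
  · intro i
    refine ⟨P i, Q i, hP i, hQ i, ?_⟩
    ext z
    constructor
    · rintro ⟨hz | ⟨j, hz⟩ | ⟨j, hz⟩ | ⟨q, hq, j, hz⟩ | ⟨m, hm, q, hq, j, hz⟩ | ⟨q, hq, j, t, ht, rfl⟩,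
        hs1, hs2⟩
      · obtain ⟨x, hx, y, hy, rfl, -, -, e⟩ := hA z hz
        obtain rfl := pt_mem_legArc_iff hs1
        exact hPQs i y (e rfl)
      · obtain ⟨s, hs, y, hy, rfl, -⟩ := hNm j z hz
        have := (leg_mem_legArc_iff hs1).1
        norm_num at this
      · obtain ⟨s, hs, y, hy, rfl, -, e, -⟩ := hPQ j z hz
        rcases (leg_mem_legArc_iff hs1).2 with rfl | rfl
        · rw [leg_zero]; exact hPQs i y (e rfl)
        · exact hz
      · obtain ⟨s, hs, t, ht, rfl, -, e⟩ := hKm q hq j z hz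
        obtain rfl := leg_mem_seg hs2
        obtain rfl := e rfl
        obtain ⟨rfl, h | rfl⟩ := leg_mem_legArc_iff hs1
        · norm_num at h
        · rw [leg_zero]; exact .inl (fin (hP _))
      · obtain ⟨s, hs, t, ht, rfl, -⟩ := (hD q j m hm hq).2 z hz
        obtain rfl := (leg_mem_legArc_iff hs1).1
        exact absurd hq (two_thirds_notMem_tauPre m)
      · obtain rfl := pt_mem_legArc_iff hs1
        exact absurd hq (two_thirds_notMem_tauPre _)
    · intro hz
      obtain ⟨s, hs, y, hy, rfl, -⟩ := hPQ i z hz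
      exact ⟨.inr (.inr (.inl ⟨i, hz⟩)), leg_mem_legArc ⟨hs.1, by linarith [hs.2]⟩, pt_mem_seg hy⟩
  · intro c hc i
    have : Γ ∩ (legArc c i ×ˢ legArc c (i + 1)) = K c i := by
      ext z
      constructor
      · rintro ⟨hz | ⟨j, hz⟩ | ⟨j, hz⟩ | ⟨q, hq, j, hz⟩ | ⟨m, hm, q, hq, j, hz⟩ | ⟨q, hq, j, t, ht, rfl⟩,
          hs1, hs2⟩
        · exfalso
          obtain ⟨x, hx, y, hy, rfl, -, e, e'⟩ := hA z hz
          obtain rfl := pt_mem_legArc_iff hs1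
          obtain rfl := pt_mem_legArc_iff hs2
          rcases hc with rfl | rfl
          · have := e rfl; linarith
          · rcases e' rfl with h | h <;> linarith
        · obtain ⟨s, hs, y, hy, rfl, -, -, e⟩ := hNm j z hz
          obtain ⟨rfl, h⟩ := leg_mem_legArc_iff hs1
          obtain rfl := pt_mem_legArc_iff hs2
          obtain rfl := e rfl
          rcases h with h | rfl
          · norm_num at h
          · exact start (hK _ hc _)
        · obtain ⟨s, hs, y, hy, rfl, -, -, e⟩ := hPQ j z hz
          obtain ⟨rfl, h⟩ := leg_mem_legArc_iff hs1
          obtain rfl := pt_mem_legArc_iff hs2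
          obtain rfl := e rfl
          rcases h with h | rfl
          · norm_num at h
          · exact start (hK _ hc _)
        · obtain ⟨s, hs, t, ht, rfl, -, e⟩ := hKm q hq j z hz
          obtain ⟨rfl, h | rfl⟩ := leg_mem_legArc_iff hs1
          · linarith [hs.1]
          · exact hz
        · obtain ⟨s, hs, t, ht, rfl, -⟩ := (hD q j m hm hq).2 z hz
          obtain rfl := (leg_mem_legArc_iff hs1).1
          exact absurd hq (h023 hc m)
        · obtain rfl := pt_mem_legArc_iff hs1
          exact absurd hq (h023 hc _)
      · intro hz
        obtain ⟨s, hs, t, ht, rfl, -⟩ := hKm c hc i z hz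
        exact ⟨.inr (.inr (.inr (.inl ⟨c, hc, i, hz⟩))), leg_mem_legArc ⟨by linarith [hs.1], hs.2⟩,
          leg_mem_legArc ht⟩
    rw [this]; exact hK c hc i
  · intro m hm q hq i
    have hm' : m < n := hm
    have : Γ ∩ (legArc q i ×ˢ legArc (tau q) i) = D q i := by
      ext z
      constructor
      · rintro ⟨hz | ⟨j, hz⟩ | ⟨j, hz⟩ | ⟨q', hq', j, hz⟩ | ⟨m', hm'', q', hq', j, hz⟩ |
          ⟨q', hq', j, t, ht, rfl⟩, hs1, hs2⟩
        · obtain ⟨x, hx, y, hy, rfl, -⟩ := hA z hz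
          obtain rfl := pt_mem_legArc_iff hs1
          obtain rfl := pt_mem_legArc_iff hs2
          exact start (hD x i m hm' hq).1
        · obtain ⟨s, hs, y, hy, rfl, -⟩ := hNm j z hz
          obtain rfl := (leg_mem_legArc_iff hs1).1
          exact absurd hq (zero_notMem_tauPre m)
        · obtain ⟨s, hs, y, hy, rfl, -⟩ := hPQ j z hz
          obtain rfl := (leg_mem_legArc_iff hs1).1
          exact absurd hq (two_thirds_notMem_tauPre m)
        · obtain ⟨s, hs, t, ht, rfl, -⟩ := hKm q' hq' j z hz
          obtain rfl := (leg_mem_legArc_iff hs1).1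
          exact absurd hq (h023 hq' m)
        · obtain ⟨s, hs, t, ht, rfl, -⟩ := (hD q' j m' hm'' hq').2 z hz
          obtain ⟨rfl, h⟩ := leg_mem_legArc_iff hs1
          obtain ⟨-, h'⟩ := leg_mem_legArc_iff hs2
          by_cases hji : j = i
          · subst hji; exact hz
          · obtain rfl := h.resolve_right hji
            obtain rfl := h'.resolve_right hji
            rw [leg_zero, leg_zero]
            exact start (hD q' i m hm' hq).1
        · obtain rfl := pt_mem_legArc_iff hs1
          have := tauPre_unique hq hq'
          omega
      · intro hz
        obtain ⟨s, hs, t, ht, rfl, -⟩ := (hD q i m hm' hq).2 z hz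
        exact ⟨.inr (.inr (.inr (.inr (.inl ⟨m, hm', q, hq, i, hz⟩)))), leg_mem_legArc hs,
          leg_mem_legArc ht⟩
    rw [this]; exact (hD q i m hm' hq).1
  · rintro q hq i ⟨w, w'⟩ ⟨rfl, t, ht, rfl⟩
    exact .inr (.inr (.inr (.inr (.inr ⟨q, hq, i, t, ht, rfl⟩))))

namespace MapData

variable {n : ℕ} {S : Set (Amb × Amb)}

theorem g_bent_neg (M : MapData n S) {q : ℝ} (hq : q ∈ ({0, 2 / 3} : Set ℝ)) {i : Fin 3} {s : ℝ}
    (h : M.k i s ≤ 0) : M.g (leg q i s) = pt (-M.k i s) := by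
  rw [M.g_bent q hq, max_eq_left (by linarith), max_eq_right h, Pi.single_zero]; rfl

theorem g_bent_nonneg (M : MapData n S) {q : ℝ} (hq : q ∈ ({0, 2 / 3} : Set ℝ)) {i : Fin 3} {s : ℝ}
    (h : 0 ≤ M.k i s) : M.g (leg q i s) = leg 0 (i + 1) (M.k i s) := by
  rw [M.g_bent q hq, max_eq_right (by linarith), max_eq_left h]; rfl

/-- The matching is steered by `φ s = s - c`: the arc advances along the leg as far as it can before
`y` moves away from `c`. This makes the foot of the leg occur only at the starting point. That `y =
d` occurs only at the end is due to the strict sign of `k` before `1/2`. -/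
theorem exists_bentArc (M : MapData n S) {q : ℝ} (hq : q ∈ ({0, 2 / 3} : Set ℝ)) (i : Fin 3)
    {c d σ : ℝ} (hσ : σ ≠ 0) (hcd : c < d) {ν : ℝ → ℝ} (hν : Continuous ν) (mν : Monotone ν)
    (h0 : ν c = -eps n) (h1 : ν d = 0) (hf : ∀ y ∈ Icc c d, M.f (pt (σ * y)) = pt (-ν y)) :
    ∃ A, IsMonotoneArcFromTo A (pt q, pt (σ * c)) (leg q i (1 / 2), pt (σ * d)) ∧
      ∀ z ∈ A, ∃ s ∈ Icc (0 : ℝ) (1 / 2), ∃ y ∈ Icc c d, z = (leg q i s, pt (σ * y)) ∧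
        M.g z.1 = M.f z.2 ∧ (s = 0 → y = c) ∧ (y = d → s = 1 / 2) := by
  obtain ⟨A, hA, hmem, -⟩ := exists_matchArc (continuous_leg q i)
    (continuous_pt.comp (continuous_const.mul continuous_id)) (leg_injective q i)
    (κ := fun y => pt (σ * y)) (fun y y' h => mul_left_cancel₀ hσ (pt_injective h)) (M.ck i) hν
    (M.k_mono i) mν (a := 0) (b := 1 / 2) (c := c) (d := d) (by norm_num) hcd
    (by rw [M.k_le i 0 (by norm_num), h0]) (by rw [M.k_half, h1]) (φ := fun s => s - c)
    (fun s t h => by dsimp only; linarith) (fun s t h => by dsimp only; linarith)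
  rw [leg_zero] at hA
  refine ⟨A, hA, fun z hz => ?_⟩
  obtain ⟨s, hs, y, hy, rfl, e, hmax⟩ := hmem z hz
  have hk : M.k i s ≤ 0 := by rw [← M.k_half i]; exact M.k_mono i hs.2
  refine ⟨s, hs, y, hy, rfl, ?_, ?_, ?_⟩
  · rw [M.g_bent_neg hq hk, hf y hy, e]
  · rintro rfl
    by_contra hne
    have hlt : c < y := lt_of_le_of_ne hy.1 (Ne.symm hne)
    -- If `y` had moved while the arc is still at the foot, both functions would equal `-eps n` all
    -- along; as `k` rests on `[0, 1/4]`, a point further out on the leg with the same sum would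
    -- also match, against the steering.
    have hx0 : 0 < min (y - c) (1 / 4) := lt_min (by linarith) (by norm_num)
    have hx1 : min (y - c) (1 / 4) ≤ y - c := min_le_left _ _
    have hx2 : min (y - c) (1 / 4) ≤ 1 / 4 := min_le_right _ _
    have hy' : 0 + y - min (y - c) (1 / 4) ∈ Icc c d := ⟨by linarith, by linarith [hy.2]⟩
    have := hmax (min (y - c) (1 / 4)) ⟨hx0.le, by linarith⟩ hy' (by
      rw [M.k_le i 0 (by norm_num)] at e
      rw [M.k_le i _ hx2]
      refine le_antisymm (h0 ▸ mν hy'.1) ?_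
      rw [e]; exact mν (by linarith)) (by linarith)
    linarith
  · rintro rfl
    rw [h1] at e
    by_contra hne
    have := M.k_neg i s (lt_of_le_of_ne hs.2 hne)
    linarith

theorem exists_hookArc (M : MapData n S) {q : ℝ} (hq : q ∈ ({0, 2 / 3} : Set ℝ)) (i : Fin 3) :
    ∃ A, IsMonotoneArcFromTo A (leg q i (1 / 2), pt q) (leg q i 1, leg q (i + 1) 1) ∧
      ∀ z ∈ A, ∃ s ∈ Icc (1 / 2 : ℝ) 1, ∃ t ∈ Icc (0 : ℝ) 1, z = (leg q i s, leg q (i + 1) t) ∧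
        M.g z.1 = M.f z.2 ∧ (t = 0 → s = 1 / 2) := by
  have hq' := bent_mem_attachPts hq (n + 1)
  obtain ⟨A, hA, hmem, -⟩ := exists_matchArc (continuous_leg q i) (continuous_leg q (i + 1))
    (leg_injective q i) (leg_injective q (i + 1)) (M.ck i) (M.ca q hq' (i + 1))
    (M.k_mono i) (M.ma q hq' (i + 1)) (a := 1 / 2) (b := 1) (c := 0) (d := 1) (by norm_num)
    (by norm_num) (by rw [M.k_half, M.a_zero q hq'])
    (by rw [M.k_one, M.a_one q (bent_mem_attachPts hq n)]) (φ := fun s => s)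
    (fun s t h => h) (fun s t h => by simp)
  rw [leg_zero] at hA
  refine ⟨A, hA, fun z hz => ?_⟩
  obtain ⟨s, hs, t, ht, rfl, e, -⟩ := hmem z hz
  have hk : 0 ≤ M.k i s := by rw [← M.k_half i]; exact M.k_mono i hs.1
  have h3 : tau3 q = 0 := by
    rcases hq with rfl | rfl
    · exact tau3_zero
    · exact tau3_two_thirds
  refine ⟨s, hs, t, ht, rfl, ?_, ?_⟩
  · rw [M.g_bent_nonneg hq hk, M.f_leg q hq', h3, e]
  · rintro rfl
    rw [M.a_zero q hq'] at e
    by_contra hne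
    have := M.k_pos i s (lt_of_le_of_ne hs.1 (Ne.symm hne))
    linarith

theorem exists_legMatchArc (M : MapData n S) {m : ℕ} (hm : m ≤ n) {q : ℝ} (hq : q ∈ tauPre m)
    (i : Fin 3) :
    ∃ A, IsMonotoneArcFromTo A (pt q, pt (tau q)) (leg q i 1, leg (tau q) i 1) ∧
      ∀ z ∈ A, ∃ s ∈ Icc (0 : ℝ) 1, ∃ t ∈ Icc (0 : ℝ) 1, z = (leg q i s, leg (tau q) i t) ∧
        M.g z.1 = M.f z.2 := by
  have h1 := tau_mem_attachPts hq hm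
  have h2 := attachPts_subset_succ h1
  obtain ⟨A, hA, hmem, -⟩ := exists_matchArc (continuous_leg q i) (continuous_leg (tau q) i)
    (leg_injective q i) (leg_injective (tau q) i) (M.cb m hm q hq i) (M.ca _ h2 i)
    (M.mb m hm q hq i) (M.ma _ h2 i) (a := 0) (b := 1) (c := 0) (d := 1) (by norm_num)
    (by norm_num) (by rw [M.b_zero m hm q hq, M.a_zero _ h2])
    (by rw [M.b_one m hm q hq, M.a_one _ h1]) (φ := fun s => s)
    (fun s t h => h) (fun s t h => by simp)
  rw [leg_zero, leg_zero] at hA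
  refine ⟨A, hA, fun z hz => ?_⟩
  obtain ⟨s, hs, t, ht, rfl, e, -⟩ := hmem z hz
  refine ⟨s, hs, t, ht, rfl, ?_⟩
  rw [M.g_leg m hm q hq, M.f_leg _ h2, e]

/-- The arcs of the coincidence set in the square of the interval. -/
theorem exists_spineArcs (M : MapData n S) : ∃ A₁ A₂ A₃ : Set (Amb × Amb),
    IsMonotoneArcFromTo A₁ (pt 0, pt (eps (n + 1))) (pt (1 / 2), pt 1) ∧
    IsMonotoneArcFromTo A₂ (pt (1 / 2), pt 1) (pt (2 / 3), pt (2 / 3 + eps (n + 1))) ∧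
    IsMonotoneArcFromTo A₃ (pt (2 / 3), pt (2 / 3 - eps (n + 1))) (pt 1, pt 0) ∧
    (∀ z ∈ A₁ ∪ A₂ ∪ A₃, ∃ x ∈ Icc (0 : ℝ) 1, ∃ y ∈ Icc (0 : ℝ) 1, z = (pt x, pt y) ∧
      M.g z.1 = M.f z.2 ∧ (x = 0 → y = eps (n + 1)) ∧
      (x = 2 / 3 → y = 2 / 3 + eps (n + 1) ∨ y = 2 / 3 - eps (n + 1))) ∧
    ∀ m ≤ n + 1, ∀ q ∈ tauPre m, (pt q, pt (tau q)) ∈ A₁ ∪ A₂ ∪ A₃ := by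
  have hε := eps_pos n
  have hε9 := eps_le n
  have hε' : eps (n + 1) = eps n / 2 := eps_succ n
  have D := M.step
  have hτ : ∀ m ≤ n + 1, ∀ q ∈ tauPre m, M.mu (tau q) = blowPos (excPts n) (tau q) := by
    intro m hm q hq
    refine D.mu_attach _ ?_
    rcases m with _ | m
    · exact attachPts_subset_succ (tau_mem_attachPts hq (Nat.zero_le _))
    · exact mem_attachPts_of_tauPre (tau_mem_tauPre hq) (by omega)
  have negi : Function.Injective fun y => pt (-y) := fun y y' h => neg_injective (pt_injective h)
  have negc : Continuous fun y => pt (-y) := continuous_pt.comp continuous_neg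
  -- The line `x = s / 3` on the antidiagonal of sum `s` is the graph `y = 2 * x` of `tau`; steering
  -- by it puts the points of (C2) on the arc.
  obtain ⟨A₁, h₁, m₁, p₁⟩ := exists_matchArc continuous_pt continuous_pt pt_injective pt_injective
    D.cL D.cmu D.mL D.mmu (a := 0) (b := 1 / 2) (c := eps (n + 1)) (d := 1) (by norm_num)
    (by linarith) (by rw [D.L_zero, D.mu_eps]) (by rw [D.L_half, D.mu_one]) (φ := fun s => s / 3)
    (fun s t h => by dsimp only; linarith) (fun s t h => by dsimp only; linarith)
  have mneg : Monotone fun y => -M.mu (-y) := fun s t h => neg_le_neg (D.mmu (neg_le_neg h))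
  have cneg : Continuous fun y => -M.mu (-y) := (D.cmu.comp continuous_neg).neg
  -- The second coordinate is negated to make both functions increasing; `x = (s + 2) / 3` then
  -- describes `-y = 2 * x - 2`, the right branch of `tau`.
  obtain ⟨A₂, h₂, m₂, p₂⟩ := exists_matchArc continuous_pt negc pt_injective negi
    (lam := fun x => -M.lamR x) D.cR.neg cneg D.aR.neg mneg (a := 1 / 2) (b := 2 / 3) (c := -1)
    (d := -(2 / 3 + eps (n + 1))) (by norm_num) (by linarith)
    (by rw [D.R_half, neg_neg, D.mu_one]) (by rw [D.R_add, neg_neg, D.mu_add])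
    (φ := fun s => (s + 2) / 3)
    (fun s t h => by dsimp only; linarith) (fun s t h => by dsimp only; linarith)
  obtain ⟨A₃, h₃, m₃, p₃⟩ := exists_matchArc continuous_pt negc pt_injective negi
    (lam := fun x => -(M.lamR x - 2 * eps n / 3)) (D.cR.sub continuous_const).neg cneg
    (fun s t h => by have := D.aR h; dsimp only; linarith) mneg (a := 2 / 3) (b := 1)
    (c := -(2 / 3 - eps (n + 1))) (d := 0) (by norm_num) (by linarith)
    (by rw [D.R_sub, neg_neg, D.mu_sub]) (by rw [D.R_one, neg_zero, M.mu_zero])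
    (φ := fun s => (s + 2) / 3)
    (fun s t h => by dsimp only; linarith) (fun s t h => by dsimp only; linarith)
  simp only [neg_neg, neg_zero] at h₂ h₃
  refine ⟨A₁, A₂, A₃, h₁, h₂, h₃, ?_, ?_⟩
  · rintro z ((hz | hz) | hz)
    · obtain ⟨x, hx, y, hy, rfl, e, -⟩ := m₁ z hz
      refine ⟨x, ⟨hx.1, by linarith [hx.2]⟩, y, ⟨by linarith [hy.1], hy.2⟩, rfl, ?_, ?_, ?_⟩
      · rw [M.g_left x hx, M.f_pt, e]
      · rintro rfl
        by_contra hne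
        have := D.mu_gt y (lt_of_le_of_ne hy.1 (Ne.symm hne))
        rw [D.L_zero] at e; linarith
      · rintro rfl; exfalso; linarith [hx.2]
    · obtain ⟨x, hx, y, hy, rfl, e, -⟩ := m₂ z hz
      have e : M.lamR x = M.mu (-y) := neg_injective e
      refine ⟨x, ⟨by linarith [hx.1], by linarith [hx.2]⟩, -y, ⟨by linarith [hy.2], by linarith [hy.1]⟩, rfl, ?_, ?_, ?_⟩
      · rw [M.g_mid x hx, M.f_pt, e]
      · rintro rfl; exfalso; linarith [hx.1]
      · rintro rfl
        left
        by_contra hne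
        have := D.mu_gt_add (-y) (lt_of_le_of_ne (by linarith [hy.2]) (Ne.symm hne))
        rw [D.R_add] at e; linarith
    · obtain ⟨x, hx, y, hy, rfl, e, -⟩ := m₃ z hz
      have e : M.lamR x - 2 * eps n / 3 = M.mu (-y) := neg_injective e
      refine ⟨x, ⟨by linarith [hx.1], by linarith [hx.2]⟩, -y, ⟨by linarith [hy.2], by linarith [hy.1]⟩, rfl, ?_, ?_, ?_⟩
      · rw [M.g_right x hx, M.f_pt, e]
      · rintro rfl; exfalso; linarith [hx.1]
      · rintro rfl
        right
        by_contra hne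
        have := D.mu_lt_sub (-y) (lt_of_le_of_ne (by linarith [hy.1]) hne)
        rw [D.R_sub] at e; linarith
  · intro m hm q hq
    have hsp : special (n + 1) q := .inl ⟨m, hm, hq⟩
    have hge := hsp.ge
    have hd := hsp.dist
    have hmu := hτ m hm q hq
    rcases le_total q (1 / 2) with h1 | h1
    · refine .inl (.inl (p₁ q ⟨hq.1.1, h1⟩ (tau q) ?_ ?_ ?_))
      · rw [tau_of_le h1]; constructor <;> linarith
      · rw [D.L_tauPre m hm q hq h1, hmu]
      · rw [tau_of_le h1]; ring
    rcases le_total q (2 / 3) with h2 | h2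
    · rw [abs_of_nonpos (by linarith)] at hd
      have := p₂ q ⟨h1, h2⟩ (-tau q) ?_ ?_ ?_
      · rw [neg_neg] at this; exact .inl (.inr this)
      · rw [tau_of_ge h1]; constructor <;> linarith
      · rw [neg_neg, hmu, D.R_tauPre m hm q hq h1 h2]
      · rw [tau_of_ge h1]; ring
    · rw [abs_of_nonneg (by linarith)] at hd
      have := p₃ q ⟨h2, hq.1.2⟩ (-tau q) ?_ ?_ ?_
      · rw [neg_neg] at this; exact .inr this
      · rw [tau_of_ge h1]; constructor <;> linarith [hq.1.2]
      · rw [neg_neg, hmu, D.R_tauPre' m hm q hq h2]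
      · rw [tau_of_ge h1]; ring

/-- The arcs over the legs at `0` that lead to the interval. -/
theorem exists_bentArc_zero (M : MapData n S) (i : Fin 3) :
    ∃ A, IsMonotoneArcFromTo A (pt 0, pt (eps (n + 1))) (leg 0 i (1 / 2), pt 0) ∧
      ∀ z ∈ A, ∃ s ∈ Icc (0 : ℝ) (1 / 2), ∃ y ∈ Icc (0 : ℝ) 1, z = (leg 0 i s, pt y) ∧
        M.g z.1 = M.f z.2 ∧ (s = 0 → y = eps (n + 1)) ∧ (y = 0 → s = 1 / 2) := by
  have hε := eps_pos n
  have hε9 := eps_le n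
  have hε' : eps (n + 1) = eps n / 2 := eps_succ n
  have D := M.step
  have hX : ∀ y ∈ Icc 0 (eps n / 3), y ∉ excPts n := fun y hy =>
    notMem_excPts_of_lt (by linarith [hy.2])
  have hval : ∀ y ∈ Icc 0 (eps (n + 1)),
      M.f (pt y) = pt (3 * (M.mu y - blowPos (excPts n) 0)) := by
    intro y hy
    have h1 : M.mu y ∈ Icc (blowPos (excPts n) 0) (blowPos (excPts n) (eps n / 3)) :=
      ⟨M.mu_zero ▸ D.mmu hy.1, D.mu_eps ▸ D.mmu hy.2⟩
    obtain ⟨h2, h3⟩ := tour_near hX h1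
    rw [M.f_pt, h2, tau3_of₁ h3.1 (by linarith [h3.2])]
    congr 1; ring
  have hB : blowPos (excPts n) (eps n / 3) - blowPos (excPts n) 0 = eps n / 3 := by
    have := (tour_near hX (right_mem_Icc.2 (blowPos_le_blowPos (X := excPts n)
      (show 0 ≤ eps n / 3 by linarith)))).1
    rw [tour_blowPos (hX _ (right_mem_Icc.2 (by linarith)))] at this
    have h3 := (tour_near hX (right_mem_Icc.2 (blowPos_le_blowPos (X := excPts n)
      (show 0 ≤ eps n / 3 by linarith)))).2
    have := pt_injective this
    rw [tau3_of₁ (by linarith) (by linarith), tau3_of₁ h3.1 (by linarith [h3.2])] at this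
    linarith
  -- The second coordinate falls from `eps (n + 1)` to `0`, so it is traversed with `σ = -1`. Near
  -- `0` there is no excursion and `f` is three times the progress of `mu`.
  obtain ⟨A, hA, hmem⟩ := M.exists_bentArc (q := 0) (by simp) i (σ := -1) (c := -eps (n + 1))
    (d := 0) (by norm_num) (by linarith)
    (ν := fun y => -(3 * (M.mu (-y) - blowPos (excPts n) 0)))
    (by have := D.cmu; fun_prop)
    (fun s t h => by have := D.mmu (neg_le_neg h); dsimp only; linarith)
    (by rw [neg_neg, D.mu_eps, hB]; ring) (by rw [neg_zero, M.mu_zero]; ring)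
    (fun y hy => by
      rw [neg_one_mul, hval (-y) ⟨by linarith [hy.2], by linarith [hy.1]⟩, neg_neg])
  simp only [neg_one_mul, neg_neg, neg_zero] at hA hmem
  refine ⟨A, hA, fun z hz => ?_⟩
  obtain ⟨s, hs, y, hy, e, e1, e2, e3⟩ := hmem z hz
  refine ⟨s, hs, -y, ⟨by linarith [hy.2], by linarith [hy.1]⟩, e, e1, fun h => ?_, fun h => ?_⟩
  · rw [e2 h, neg_neg]
  · exact e3 (by linarith)

/-- The arcs over the legs at `2 / 3` that lead to the interval. -/
theorem exists_bentArc_two_thirds (M : MapData n S) (i : Fin 3) {σ : ℝ} (hσ : σ = 1 ∨ σ = -1) :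
    ∃ A, IsMonotoneArcFromTo A (pt (2 / 3), pt (2 / 3 + σ * eps (n + 1)))
        (leg (2 / 3) i (1 / 2), pt (2 / 3)) ∧
      ∀ z ∈ A, ∃ s ∈ Icc (0 : ℝ) (1 / 2), ∃ y ∈ Icc (0 : ℝ) 1, z = (leg (2 / 3) i s, pt y) ∧
        M.g z.1 = M.f z.2 ∧ (s = 0 → y = 2 / 3 + σ * eps (n + 1)) ∧ (y = 2 / 3 → s = 1 / 2) := by
  have hε := eps_pos n
  have hε9 := eps_le n
  have hε' : eps (n + 1) = eps n / 2 := eps_succ n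
  have D := M.step
  have hmt := D.mu_attach (2 / 3) (two_thirds_mem_attachPts _)
  have hX : ∀ y ∈ Icc (2 / 3 - eps n / 3) (2 / 3 + eps n / 3), y ∉ excPts n := fun y hy =>
    notMem_excPts_of_abs_lt (by rw [abs_lt]; constructor <;> linarith [hy.1, hy.2])
  have hX₁ : ∀ y ∈ Icc (2 / 3) (2 / 3 + eps n / 3), y ∉ excPts n := fun y hy =>
    hX y ⟨by linarith [hy.1], hy.2⟩
  have hbl : ∀ {c₀ c₁ : ℝ}, (∀ y ∈ Icc c₀ c₁, y ∉ excPts n) → c₀ ≤ c₁ →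
      blowPos (excPts n) c₁ - blowPos (excPts n) c₀ = c₁ - c₀ := by
    intro c₀ c₁ h hle
    rw [blowPos_eq, blowPos_eq]
    have : ∑ x ∈ excPts n, (if x < c₁ then (2 : ℝ) else 0) =
        ∑ x ∈ excPts n, if x < c₀ then (2 : ℝ) else 0 := by
      refine Finset.sum_congr rfl fun x hx => ?_
      have : x < c₁ ↔ x < c₀ := by
        refine ⟨fun h1 => ?_, fun h1 => h1.trans_le hle⟩
        by_contra! h2
        exact h x ⟨h2, h1.le⟩ hx
      simp only [this]
    rw [this]; ring
  rcases hσ with rfl | rfl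
  · have hB := hbl hX₁ (by linarith)
    obtain ⟨A, hA, hmem⟩ := M.exists_bentArc (q := 2 / 3) (by simp) i (σ := -1)
      (c := -(2 / 3 + eps (n + 1))) (d := -(2 / 3)) (by norm_num) (by linarith)
      (ν := fun y => -(3 * (M.mu (-y) - blowPos (excPts n) (2 / 3))))
      (by have := D.cmu; fun_prop)
      (fun s t h => by have := D.mmu (neg_le_neg h); dsimp only; linarith)
      (by rw [neg_neg, D.mu_add, hB]; ring) (by rw [neg_neg, hmt]; ring)
      (fun y hy => by
        have h1 : M.mu (-y) ∈ Icc (blowPos (excPts n) (2 / 3))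
            (blowPos (excPts n) (2 / 3 + eps n / 3)) :=
          ⟨hmt ▸ D.mmu (by linarith [hy.2]), D.mu_add ▸ D.mmu (by linarith [hy.1])⟩
        obtain ⟨h2, h3⟩ := tour_near hX₁ h1
        rw [neg_one_mul, M.f_pt, h2, tau3_of₃ h3.1 (by linarith [h3.2])]
        congr 1; ring)
    simp only [neg_one_mul, neg_neg, one_mul] at hA hmem ⊢
    refine ⟨A, hA, fun z hz => ?_⟩
    obtain ⟨s, hs, y, hy, e, e1, e2, e3⟩ := hmem z hz
    refine ⟨s, hs, -y, ⟨by linarith [hy.2], by linarith [hy.1]⟩, e, e1, fun h => ?_, fun h => ?_⟩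
    · rw [e2 h, neg_neg]
    · exact e3 (by linarith)
  · have hB := hbl (fun y hy => hX y ⟨hy.1, by linarith [hy.2]⟩)
      (show 2 / 3 - eps n / 3 ≤ 2 / 3 by linarith)
    obtain ⟨A, hA, hmem⟩ := M.exists_bentArc (q := 2 / 3) (by simp) i (σ := 1)
      (c := 2 / 3 - eps (n + 1)) (d := 2 / 3) (by norm_num) (by linarith)
      (ν := fun y => 3 * (M.mu y - blowPos (excPts n) (2 / 3)))
      (by have := D.cmu; fun_prop)
      (fun s t h => by have := D.mmu h; dsimp only; linarith)
      (by rw [D.mu_sub]; linarith) (by rw [hmt]; ring)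
      (fun y hy => by
        have h1 : M.mu y ∈ Icc (blowPos (excPts n) (2 / 3 - eps n / 3))
            (blowPos (excPts n) (2 / 3)) :=
          ⟨D.mu_sub ▸ D.mmu hy.1, hmt ▸ D.mmu hy.2⟩
        obtain ⟨h2, h3⟩ := tour_near (fun y hy => hX y ⟨hy.1, by linarith [hy.2]⟩) h1
        rw [one_mul, M.f_pt, h2, tau3_of₂ (by linarith [h3.1]) h3.2]
        congr 1; linarith)
    simp only [one_mul, neg_one_mul, ← sub_eq_add_neg] at hA hmem ⊢
    refine ⟨A, hA, fun z hz => ?_⟩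
    obtain ⟨s, hs, y, hy, e, e1, e2, e3⟩ := hmem z hz
    exact ⟨s, hs, y, ⟨by linarith [hy.1], by linarith [hy.2]⟩, e, e1, e2, e3⟩

theorem exists_condAmb (M : MapData n S) : ∃ Γ : Set (Amb × Amb),
    Γ ⊆ treeSet (n + 1) ×ˢ treeSet (n + 1) ∧ (∀ z ∈ Γ, M.g z.1 = M.f z.2) ∧
      CondAmb (n + 1) Γ := by
  obtain ⟨A₁, A₂, A₃, h₁, h₂, h₃, hA, hpin⟩ := M.exists_spineArcs
  choose N hN hNm using M.exists_bentArc_zero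
  choose P hP hPm using fun i => M.exists_bentArc_two_thirds i (σ := 1) (.inl rfl)
  choose Q hQ hQm using fun i => M.exists_bentArc_two_thirds i (σ := -1) (.inr rfl)
  choose! K hK hKm using fun q (hq : q ∈ ({0, 2 / 3} : Set ℝ)) (i : Fin 3) => M.exists_hookArc hq i
  have hD : ∀ q i, ∃ A, ∀ m ≤ n, q ∈ tauPre m →
      IsMonotoneArcFromTo A (pt q, pt (tau q)) (leg q i 1, leg (tau q) i 1) ∧
      ∀ z ∈ A, ∃ s ∈ Icc (0 : ℝ) 1, ∃ t ∈ Icc (0 : ℝ) 1, z = (leg q i s, leg (tau q) i t) ∧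
        M.g z.1 = M.f z.2 := by
    intro q i
    by_cases h : ∃ m ≤ n, q ∈ tauPre m
    · obtain ⟨m, hm, hq⟩ := h
      obtain ⟨A, hA⟩ := M.exists_legMatchArc hm hq i
      exact ⟨A, fun _ _ _ => hA⟩
    · exact ⟨∅, fun m hm hq => absurd ⟨m, hm, hq⟩ h⟩
  choose D hD using hD
  simp only [one_mul, neg_one_mul, ← sub_eq_add_neg] at hP hPm hQ hQm
  refine exists_condAmb_of_arcs h₁ h₂ h₃ hA hpin hN hNm hP hPm hQ hQm hK hKm
    (fun q i m hm => hD q i m (by omega)) fun q hq i t ht => ?_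
  -- For (C6) at level `n + 1`: the legs at `tau q ∈ tauPre n` are collapsed by `f`, so the
  -- coincidence at the foot extends to the whole leg.
  obtain ⟨x, -, y, -, -, h, -⟩ := hA _ (hpin (n + 1) le_rfl q hq)
  have hf0 := M.f_leg (tau q) (tau_mem_attachPts hq le_rfl) i
  have h1 := hf0 0
  rw [leg_zero, M.a_const _ (tau_mem_tauPre hq)] at h1
  dsimp only at h ⊢
  rw [h, h1, hf0 t, M.a_const _ (tau_mem_tauPre hq)]

end MapData

/-! ### The inductive step -/

theorem image_val_preimage {n : ℕ} {S : Set (Amb × Amb)} (h : S ⊆ treeSet n ×ˢ treeSet n) :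
    Prod.map Subtype.val Subtype.val '' ((Prod.map Subtype.val Subtype.val : T n × T n → Amb × Amb) ⁻¹' S) =
      S := by
  refine image_preimage_eq_of_subset fun z hz => ?_
  exact ⟨(⟨z.1, (h hz).1⟩, ⟨z.2, (h hz).2⟩), rfl⟩

theorem hasValence_of_le {X Y : Type*} [TopologicalSpace X] {f : X → Y} {k : ℕ∞}
    (h : ∀ y, ENat.card (ConnectedComponents ↥(f ⁻¹' {y})) ≤ k) {y₀ : Y}
    (h₀ : k ≤ ENat.card (ConnectedComponents ↥(f ⁻¹' {y₀}))) : HasValence f k :=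
  ⟨⟨y₀, le_antisymm (h y₀) h₀⟩, by rintro _ ⟨y, rfl⟩; exact h y⟩

theorem exists_step {n : ℕ} {Γ : Set (T n × T n)} (hΓ : Disjoint Γ (diagonal (T n)))
    (hC : Cond n Γ) :
    ∃ f g : C(T (n + 1), T n),
      (∀ x, (f x, g x) ∈ Γ) ∧ Disjoint (coincidenceSet g f) (diagonal (T (n + 1))) ∧
      HasValence f 6 ∧ HasValence g 12 ∧
      ∃ Γ' : Set (T (n + 1) × T (n + 1)), Γ' ⊆ coincidenceSet g f ∧ Cond (n + 1) Γ' := by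
  obtain ⟨M⟩ := CondAmb.nonempty_mapData hC
  have hmem : ∀ x : T (n + 1), ∃ z ∈ Γ, z.1.1 = M.f x ∧ z.2.1 = M.g x := by
    intro x
    obtain ⟨z, hz, e⟩ := M.mem x.1 x.2
    exact ⟨z, hz, congrArg Prod.fst e, congrArg Prod.snd e⟩
  have hf : ∀ x : T (n + 1), M.f x ∈ treeSet n := fun x => by
    obtain ⟨z, -, e, -⟩ := hmem x
    exact e ▸ z.1.2
  have hg : ∀ x : T (n + 1), M.g x ∈ treeSet n := fun x => by
    obtain ⟨z, -, -, e⟩ := hmem x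
    exact e ▸ z.2.2
  let f : C(T (n + 1), T n) := ⟨fun x => ⟨M.f x, hf x⟩, M.cf.domRestrict.subtype_mk hf⟩
  let g : C(T (n + 1), T n) := ⟨fun x => ⟨M.g x, hg x⟩, M.cg.domRestrict.subtype_mk hg⟩
  have hfg : ∀ x, (f x, g x) ∈ Γ := fun x => by
    obtain ⟨z, hz, e1, e2⟩ := hmem x
    have : z = (f x, g x) := Prod.ext (Subtype.ext e1) (Subtype.ext e2)
    exact this ▸ hz
  have hne : ∀ x, f x ≠ g x := fun x e => disjoint_left.1 hΓ (hfg x) e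
  have hpF : ∀ y : T n, f ⁻¹' {y} = Subtype.val ⁻¹' (M.fibF y) := fun y => by
    ext x
    exact ⟨fun h => ⟨x.2, congrArg Subtype.val h⟩, fun h => Subtype.ext h.2⟩
  have hpG : ∀ y : T n, g ⁻¹' {y} = Subtype.val ⁻¹' (M.fibG y) := fun y => by
    ext x
    exact ⟨fun h => ⟨x.2, congrArg Subtype.val h⟩, fun h => Subtype.ext h.2⟩
  let y₀ : T n := ⟨pt (2 / 3), pt_mem_treeSet ⟨by norm_num, by norm_num⟩⟩
  obtain ⟨Γ', hs, hco, hC'⟩ := M.exists_condAmb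
  refine ⟨f, g, hfg, ?_, hasValence_of_le (fun y => M.card_fibF_le y.2 (hpF y)) (y₀ := y₀)
    (M.le_card_fibF (hpF y₀)), hasValence_of_le (fun y => M.card_fibG_le y.2 (hpG y)) (y₀ := y₀)
    (M.le_card_fibG (hpG y₀)), Prod.map Subtype.val Subtype.val ⁻¹' Γ', ?_, ?_⟩
  · rw [disjoint_left]
    rintro ⟨x, y⟩ h e
    obtain rfl : x = y := e
    exact hne x (Eq.symm h)
  · rintro ⟨x, y⟩ h
    exact Subtype.ext (hco _ h)
  · unfold Cond
    rwa [image_val_preimage hs]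

/-! ### The initial set -/

theorem eps_zero : eps 0 = 1 / 9 := by norm_num [eps]

theorem exists_linearBentArc {c e : ℝ} (he : e ≠ 0) (i : Fin 3) :
    ∃ A, IsMonotoneArcFromTo A (pt c, pt (c + e)) (leg c i (1 / 2), pt c) ∧
      ∀ z ∈ A, ∃ s ∈ Icc (0 : ℝ) (1 / 2), z = (leg c i s, pt (c + e * (1 - 2 * s))) ∧
        z.1 ≠ z.2 := by
  have h := isMonotoneArcFromTo_image (continuous_leg c i)
    (κ := fun r => pt (c + e * (1 - 2 * r))) (continuous_pt.comp (by fun_prop))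
    (leg_injective c i) (fun r r' h => by
      have := pt_injective h
      have := mul_left_cancel₀ he (add_left_cancel this)
      linarith)
    (X := fun s => s) (Y := fun s => s) (a := 0) (b := 1 / 2) (by norm_num) continuousOn_id continuousOn_id
    (.inl monotoneOn_id) (.inl monotoneOn_id) (fun s _ t _ h _ => h)
  rw [leg_zero, show c + e * (1 - 2 * 0) = c + e by ring,
    show c + e * (1 - 2 * (1 / 2)) = c by ring] at h
  refine ⟨_, h, ?_⟩
  rintro _ ⟨s, hs, rfl⟩
  refine ⟨s, hs, rfl, fun h => ?_⟩
  obtain ⟨h1, rfl⟩ := pt_eq_leg h.symm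
  exact he (by linarith)

theorem exists_linearHookArc (c : ℝ) (i : Fin 3) :
    ∃ A, IsMonotoneArcFromTo A (leg c i (1 / 2), pt c) (leg c i 1, leg c (i + 1) 1) ∧
      ∀ z ∈ A, ∃ s ∈ Icc (1 / 2 : ℝ) 1, z = (leg c i s, leg c (i + 1) (2 * s - 1)) ∧
        z.1 ≠ z.2 := by
  have h := isMonotoneArcFromTo_image (continuous_leg c i)
    (κ := fun r => leg c (i + 1) (2 * r - 1)) ((continuous_leg c _).comp (by fun_prop))
    (leg_injective c i) (fun r r' h => by
      have := leg_injective c _ h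
      linarith)
    (X := fun s => s) (Y := fun s => s) (a := 1 / 2) (b := 1) (by norm_num) continuousOn_id continuousOn_id
    (.inl monotoneOn_id) (.inl monotoneOn_id) (fun s _ t _ h _ => h)
  rw [show (2 * (1 / 2) - 1 : ℝ) = 0 by norm_num, show (2 * 1 - 1 : ℝ) = 1 by norm_num,
    leg_zero] at h
  refine ⟨_, h, ?_⟩
  rintro _ ⟨s, hs, rfl⟩
  refine ⟨s, hs, rfl, fun h => ?_⟩
  obtain ⟨-, -, h | rfl⟩ := leg_eq_leg h
  · simp at h
  · norm_num at hs

theorem exists_linearSpineArc {a b m k : ℝ} (hab : a < b) :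
    ∃ A, IsMonotoneArcFromTo A (pt a, pt (m * a + k)) (pt b, pt (m * b + k)) ∧
      ∀ z ∈ A, ∃ x ∈ Icc a b, z = (pt x, pt (m * x + k)) := by
  refine ⟨_, isMonotoneArcFromTo_image continuous_pt continuous_pt pt_injective pt_injective
    (X := fun s => s) (Y := fun x => m * x + k) hab continuousOn_id (by fun_prop)
    (.inl monotoneOn_id) ?_ (fun s _ t _ h _ => h), ?_⟩
  · rcases le_total 0 m with hm | hm
    · refine .inl fun s _ t _ h => ?_
      have := mul_le_mul_of_nonneg_left h hm
      dsimp only; linarith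
    · refine .inr fun s _ t _ h => ?_
      have := mul_le_mul_of_nonpos_left h hm
      dsimp only; linarith
  · rintro _ ⟨s, hs, rfl⟩
    exact ⟨s, hs, rfl⟩

theorem exists_condAmb_zero : ∃ Γ : Set (Amb × Amb), Γ ⊆ treeSet 0 ×ˢ treeSet 0 ∧
    (∀ z ∈ Γ, z.1 ≠ z.2) ∧ CondAmb 0 Γ := by
  -- The graph of `tau` is lifted off the diagonal at `0`: the line `1 / 9 + 5 / 3 * x` joins `(0,
  -- 1/9)` to `(1/3, 2/3)`, from where `2 * x` takes over. So (C2) holds at `1/3`, and the graph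
  -- stays above the diagonal.
  have h₁ := isMonotoneArcFromTo_image continuous_pt continuous_pt pt_injective pt_injective
    (X := fun s => s) (Y := fun x => max (1 / 9 + 5 / 3 * x) (2 * x)) (a := 0) (b := 1 / 2)
    (by norm_num) continuousOn_id (by fun_prop) (.inl monotoneOn_id)
    (.inl fun s _ t _ h => max_le_max (by linarith) (by linarith)) (fun s _ t _ h _ => h)
  set A₁ := (fun x : ℝ => (pt x, pt (max (1 / 9 + 5 / 3 * x) (2 * x)))) '' Icc 0 (1 / 2)
  obtain ⟨A₂, h₂, m₂⟩ := exists_linearSpineArc (a := 1 / 2) (b := 2 / 3) (m := -(4 / 3))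
    (k := 5 / 3) (by norm_num)
  obtain ⟨A₃, h₃, m₃⟩ := exists_linearSpineArc (a := 2 / 3) (b := 1) (m := -(5 / 3))
    (k := 5 / 3) (by norm_num)
  choose N hN hNm using exists_linearBentArc (c := 0) (e := 1 / 9) (by norm_num)
  choose P hP hPm using exists_linearBentArc (c := 2 / 3) (e := 1 / 9) (by norm_num)
  choose Q hQ hQm using exists_linearBentArc (c := 2 / 3) (e := -(1 / 9)) (by norm_num)
  choose K hK hKm using exists_linearHookArc
  refine exists_condAmb_of_arcs (R := fun z => z.1 ≠ z.2) (A₁ := A₁) (A₂ := A₂) (A₃ := A₃)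
    (N := N) (P := P) (Q := Q) (K := K) (D := fun _ _ => ∅) ?_ ?_ ?_ ?_ ?_ ?_ ?_ ?_ ?_ ?_ ?_
    (fun q _ => hK q) ?_ (fun q i m hm => by omega) ?_
  · convert h₁ using 3 <;> norm_num [eps]
  · convert h₂ using 3 <;> norm_num [eps]
  · convert h₃ using 3 <;> norm_num [eps]
  · rw [eps_zero]
    rintro z ((⟨x, hx, rfl⟩ | hz) | hz)
    · have l1 := le_max_left (1 / 9 + 5 / 3 * x) (2 * x)
      have l2 : max (1 / 9 + 5 / 3 * x) (2 * x) ≤ 1 :=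
        max_le (by linarith [hx.2]) (by linarith [hx.2])
      refine ⟨x, ⟨hx.1, by linarith [hx.2]⟩, _, ⟨by linarith [hx.1], l2⟩, rfl, fun h => ?_, ?_, ?_⟩
      · have := pt_injective h
        linarith [hx.1]
      · rintro rfl; norm_num
      · rintro rfl; norm_num at hx
    · obtain ⟨x, ⟨hx, hx'⟩, rfl⟩ := m₂ z hz
      refine ⟨x, ⟨by linarith, by linarith⟩, _, ⟨by linarith, by linarith⟩, rfl, fun h => ?_, ?_, ?_⟩
      · have := pt_injective h
        linarith
      · rintro rfl; norm_num at hx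
      · rintro rfl; norm_num
    · obtain ⟨x, ⟨hx, hx'⟩, rfl⟩ := m₃ z hz
      refine ⟨x, ⟨by linarith, by linarith⟩, _, ⟨by linarith, by linarith⟩, rfl, fun h => ?_, ?_, ?_⟩
      · have := pt_injective h
        linarith
      · rintro rfl; norm_num at hx
      · rintro rfl; norm_num
  · intro m hm q hq
    obtain rfl : m = 0 := by omega
    rcases tau_of_mem_tauPre_zero hq with ⟨rfl, h⟩ | ⟨rfl, h⟩
    · rw [h]
      exact .inl (.inl ⟨1 / 3, by norm_num, by norm_num⟩)
    · rw [h]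
      obtain ⟨⟨γ, -, hr, -, h1⟩, -⟩ := h₃
      right
      rw [← hr]
      exact ⟨1, by rw [h1]; norm_num⟩
  · intro i; convert hN i using 3; norm_num [eps]
  · intro i z hz
    obtain ⟨s, ⟨hs, hs'⟩, e, h⟩ := hNm i z hz
    rw [eps_zero]
    exact ⟨s, ⟨hs, hs'⟩, _, ⟨by linarith, by linarith⟩, e, h, fun h => by rw [h]; norm_num,
      fun h => by linarith⟩
  · intro i; rw [eps_zero]; exact hP i
  · intro i z hz
    obtain ⟨s, ⟨hs, hs'⟩, e, h⟩ := hPm i z hz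
    rw [eps_zero]
    exact ⟨s, ⟨hs, hs'⟩, _, ⟨by linarith, by linarith⟩, e, h, fun h => by rw [h]; norm_num,
      fun h => by linarith⟩
  · intro i; rw [eps_zero, sub_eq_add_neg]; exact hQ i
  · intro i z hz
    obtain ⟨s, ⟨hs, hs'⟩, e, h⟩ := hQm i z hz
    rw [eps_zero]
    exact ⟨s, ⟨hs, hs'⟩, _, ⟨by linarith, by linarith⟩, e, h, fun h => by rw [h]; norm_num,
      fun h => by linarith⟩
  · intro q _ i z hz
    obtain ⟨s, ⟨hs, hs'⟩, e, h⟩ := hKm q i z hz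
    exact ⟨s, ⟨hs, hs'⟩, _, ⟨by linarith, by linarith⟩, e, h, fun h => by linarith⟩
  · intro q hq i t _ h
    have h := (pt_eq_leg h).1
    rcases tau_of_mem_tauPre_zero hq with ⟨rfl, h'⟩ | ⟨rfl, h'⟩ <;> rw [h'] at h <;> norm_num at h

theorem exists_cond_zero : ∃ Γ : Set (T 0 × T 0), Disjoint Γ (diagonal (T 0)) ∧ Cond 0 Γ := by
  obtain ⟨Γ, hs, hne, hC⟩ := exists_condAmb_zero
  refine ⟨Prod.map Subtype.val Subtype.val ⁻¹' Γ, ?_, ?_⟩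
  · rw [disjoint_left]
    rintro ⟨x, y⟩ h e
    exact hne _ h (congrArg Subtype.val e)
  · unfold Cond
    rwa [image_val_preimage hs]

/-! ### Inverse limits of continua -/

/-- A separation of the intersection by disjoint open sets would, by compactness, already separate
some `K n`. -/
theorem isPreconnected_iInter_of_antitone {X : Type*} [TopologicalSpace X] [T2Space X]
    {K : ℕ → Set X} (hK : Antitone K) (hc : ∀ n, IsCompact (K n))
    (hp : ∀ n, IsPreconnected (K n)) : IsPreconnected (⋂ n, K n) := by
  have hcl : IsClosed (⋂ n, K n) := isClosed_iInter fun n => (hc n).isClosed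
  have hcI : IsCompact (⋂ n, K n) := (hc 0).of_isClosed_subset hcl (iInter_subset K 0)
  rw [isPreconnected_closed_iff]
  intro A B hA hB hAB hKA hKB
  by_contra hne
  have hd : Disjoint ((⋂ n, K n) ∩ A) ((⋂ n, K n) ∩ B) := by
    rw [disjoint_left]
    exact fun x hx hx' => hne ⟨x, hx.1, hx.2, hx'.2⟩
  obtain ⟨U, V, hU, hV, hAU, hBV, hUV⟩ := SeparatedNhds.of_isCompact_isCompact
    (hcI.inter_right hA) (hcI.inter_right hB) hd
  have hsub : (⋂ n, K n) ⊆ U ∪ V := fun x hx => (hAB hx).imp (fun h => hAU ⟨hx, h⟩)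
    fun h => hBV ⟨hx, h⟩
  obtain ⟨n, hn⟩ := exists_subset_nhds_of_isCompact' hK.directed_ge hc
    (fun n => (hc n).isClosed) (fun x hx => (hU.union hV).mem_nhds (hsub hx))
  obtain ⟨a, ha⟩ := hKA
  obtain ⟨b, hb⟩ := hKB
  obtain ⟨x, -, hx⟩ := hp n U V hU hV hn ⟨a, mem_iInter.1 ha.1 n, hAU ha⟩
    ⟨b, mem_iInter.1 hb.1 n, hBV hb⟩
  exact disjoint_left.1 hUV hx.1 hx.2

section InverseLimit

variable {X : ℕ → Type}

theorem inverseLimit_apply_eq {f : ∀ n, X (n + 1) → X n} {x y : InverseLimit f} {n : ℕ}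
    (h : x.1 n = y.1 n) : ∀ {m : ℕ}, m ≤ n → x.1 m = y.1 m := by
  intro m hm
  induction hm using Nat.decreasingInduction with
  | self => exact h
  | of_succ k _ ih => rw [← x.2 k, ← y.2 k, ih]

variable [∀ n, TopologicalSpace (X n)]

/-- Coordinates below `N` are recomputed from the `N`-th one. So the sequences that are compatible
up to `N` form a retract of the full product and inherit its connectedness; the inverse limit is
their decreasing intersection. -/
theorem exists_retraction {f : ∀ n, X (n + 1) → X n} (hf : ∀ n, Continuous (f n)) (N : ℕ) :
    ∃ R : (∀ n, X n) → ∀ n, X n, Continuous R ∧ (∀ x, ∀ m ≥ N, R x m = x m) ∧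
      (∀ x, ∀ n < N, f n (R x (n + 1)) = R x n) ∧
      ∀ x : ∀ n, X n, (∀ n < N, f n (x (n + 1)) = x n) → R x = x := by
  induction N with
  | zero => exact ⟨id, continuous_id, fun _ _ _ => rfl, fun _ _ h => by omega, fun _ _ => rfl⟩
  | succ N ih =>
    obtain ⟨R, hR, h1, h2, h3⟩ := ih
    refine ⟨fun x => R (Function.update x N (f N (x (N + 1)))),
      hR.comp (continuous_id.update N ((hf N).comp (continuous_apply _))), ?_, ?_, ?_⟩
    · intro x m hm
      dsimp only
      rw [h1 _ m (by omega), Function.update_of_ne (by omega)]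
    · intro x n hn
      rcases Nat.lt_succ_iff_lt_or_eq.1 hn with hn | rfl
      · exact h2 _ n hn
      · dsimp only
        rw [h1 _ n le_rfl, h1 _ (n + 1) (by omega), Function.update_of_ne (by omega),
          Function.update_self]
    · intro x hx
      dsimp only
      rw [hx N (by omega), Function.update_eq_self]
      exact h3 x fun n hn => hx n (by omega)

theorem isClosed_threads [∀ n, T2Space (X n)] {f : ∀ n, X (n + 1) → X n} (hf : ∀ n, Continuous (f n)) (N : ℕ) :
    IsClosed {x : ∀ n, X n | ∀ n < N, f n (x (n + 1)) = x n} := by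
  simp only [ofPred_forall]
  exact isClosed_iInter fun n => isClosed_iInter fun _ =>
    isClosed_eq ((hf n).comp (continuous_apply _)) (continuous_apply _)

variable [∀ n, CompactSpace (X n)] [∀ n, T2Space (X n)] [∀ n, ConnectedSpace (X n)]

theorem isConnected_inverseLimit {f : ∀ n, X (n + 1) → X n} (hf : ∀ n, Continuous (f n)) :
    IsConnected {x : ∀ n, X n | ∀ n, f n (x (n + 1)) = x n} := by
  set K : ℕ → Set (∀ n, X n) := fun N => {x | ∀ n < N, f n (x (n + 1)) = x n} with hK
  have hcl : ∀ N, IsClosed (K N) := isClosed_threads hf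
  have hconn : ∀ N, IsConnected (K N) := by
    intro N
    obtain ⟨R, hR, -, h2, h3⟩ := exists_retraction hf N
    have : K N = range R :=
      Subset.antisymm (fun x hx => ⟨x, h3 x hx⟩) (by rintro _ ⟨x, rfl⟩; exact h2 x)
    rw [this]
    exact isConnected_range hR
  have hanti : Antitone K := fun M N h x hx n hn => hx n (hn.trans_le h)
  have e : {x : ∀ n, X n | ∀ n, f n (x (n + 1)) = x n} = ⋂ N, K N := by
    ext x
    rw [mem_iInter]
    exact ⟨fun h N n _ => h n, fun h n => h (n + 1) n (by omega)⟩
  rw [e]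
  refine ⟨?_, isPreconnected_iInter_of_antitone hanti (fun N => (hcl N).isCompact)
    fun N => (hconn N).isPreconnected⟩
  exact IsCompact.nonempty_iInter_of_sequence_nonempty_isCompact_isClosed K
    (fun N => hanti (Nat.le_succ N)) (fun N => (hconn N).nonempty) (hcl 0).isCompact hcl

theorem isContinuum_inverseLimit [∀ n, TopologicalSpace.MetrizableSpace (X n)]
    {f : ∀ n, X (n + 1) → X n} (hf : ∀ n, Continuous (f n)) : IsContinuum (InverseLimit f) := by
  have hm : TopologicalSpace.MetrizableSpace (∀ n, X n) := by
    let := fun n => TopologicalSpace.metrizableSpaceMetric (X n)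
    infer_instance
  refine ⟨?_, isConnected_iff_connectedSpace.1 (isConnected_inverseLimit hf), IsEmbedding.subtypeVal.metrizableSpace⟩
  have hcl : IsClosed {x : ∀ n, X n | ∀ n, f n (x (n + 1)) = x n} := by
    simp only [ofPred_forall]
    exact isClosed_iInter fun n =>
      isClosed_eq ((hf n).comp (continuous_apply _)) (continuous_apply _)
  exact isCompact_iff_compactSpace.1 hcl.isCompact

/-- A basic open set restricts finitely many coordinates, and all of these are functions of the
highest one. After passing to a finite subcover a single projection is fine enough for the whole
cover. -/
theorem isTreeLike_inverseLimit {f : ∀ n, X (n + 1) → X n} (hf : ∀ n, Continuous (f n))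
    (hX : ∀ n, IsTree (X n)) : IsTreeLike (InverseLimit f) := by
  have := fun n => (hX n).1.2.2
  have hL := isContinuum_inverseLimit hf
  have := hL.1
  have := hL.2.1
  refine ⟨hL, fun 𝒰 ho hcov => ?_⟩
  have key : ∀ x : InverseLimit f, ∃ (n : ℕ) (W : Set (InverseLimit f)), IsOpen W ∧ x ∈ W ∧
      ∃ U ∈ 𝒰, ∀ a ∈ W, ∀ b : InverseLimit f, a.1 n = b.1 n → b ∈ U := by
    intro x
    obtain ⟨U, hU, hx⟩ : x ∈ ⋃₀ 𝒰 := hcov ▸ mem_univ x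
    obtain ⟨V, hV, rfl⟩ := isOpen_induced_iff.1 (ho U hU)
    obtain ⟨I, u, hu, hsub⟩ := isOpen_pi_iff.1 hV x.1 hx
    refine ⟨I.sup id, Subtype.val ⁻¹' (I : Set ℕ).pi u,
      (isOpen_set_pi I.finite_toSet fun i hi => (hu i hi).1).preimage continuous_subtype_val,
      fun i hi => (hu i hi).2, _, hU, fun a ha b hab => hsub fun i hi => ?_⟩
    have := inverseLimit_apply_eq hab (Finset.le_sup (f := id) hi)
    exact this ▸ ha i hi
  choose n W hWo hxW hW using key
  obtain ⟨s, hs⟩ := isCompact_univ.elim_finite_subcover W hWo fun x _ => mem_iUnion.2 ⟨x, hxW x⟩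
  refine ⟨X (s.sup n), inferInstance,
    ⟨fun x => x.1 (s.sup n), (continuous_apply _).comp continuous_subtype_val⟩, hX _, fun y => ?_⟩
  by_cases hy : ∃ a : InverseLimit f, a.1 (s.sup n) = y
  · obtain ⟨a, rfl⟩ := hy
    obtain ⟨x, hx, ha⟩ := mem_iUnion₂.1 (hs (mem_univ a))
    obtain ⟨U, hU, hWU⟩ := hW x
    exact ⟨U, hU, fun b hb => hWU a ha b (inverseLimit_apply_eq (Eq.symm hb) (Finset.le_sup hx))⟩
  · obtain ⟨x⟩ := (inferInstance : Nonempty (InverseLimit f))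
    obtain ⟨U, hU, -⟩ := hW x
    exact ⟨U, hU, fun b hb => absurd ⟨b, hb⟩ hy⟩

end InverseLimit

/-! ### The inverse system -/

theorem exists_system : ∃ (Γ : ∀ n, Set (T n × T n)) (f g : ∀ n, C(T (n + 1), T n)),
    (∀ n, Disjoint (Γ n) (diagonal (T n)) ∧ Cond n (Γ n)) ∧ (∀ n x, (f n x, g n x) ∈ Γ n) ∧
    (∀ n, Γ (n + 1) ⊆ coincidenceSet (g n) (f n)) ∧
    ∀ n, HasValence (f n) 6 ∧ HasValence (g n) 12 := by
  let G (n : ℕ) := {Γ : Set (T n × T n) // Disjoint Γ (diagonal (T n)) ∧ Cond n Γ}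
  have step : ∀ n (Γ : G n), ∃ (Γ' : G (n + 1)) (f g : C(T (n + 1), T n)),
      (∀ x, (f x, g x) ∈ Γ.1) ∧ Γ'.1 ⊆ coincidenceSet g f ∧ HasValence f 6 ∧ HasValence g 12 := by
    rintro n ⟨Γ, h, hC⟩
    obtain ⟨f, g, h1, h2, h3, h4, Γ', h5, h6⟩ := exists_step h hC
    exact ⟨⟨Γ', h2.mono_left h5, h6⟩, f, g, h1, h5, h3, h4⟩
  choose next f g h1 h2 h3 h4 using step
  obtain ⟨Γ₀, h₀⟩ := exists_cond_zero
  let Γ : ∀ n, G n := fun n => Nat.rec (motive := G) ⟨Γ₀, h₀⟩ next n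
  exact ⟨fun n => (Γ n).1, fun n => f n (Γ n), fun n => g n (Γ n), fun n => (Γ n).2,
    fun n => h1 n (Γ n), fun n => h2 n (Γ n), fun n => ⟨h3 n (Γ n), h4 n (Γ n)⟩⟩

end TriodTrees

open TriodTrees

theorem mainTheorem1 :
    (∀ n, IsTree (T n)) ∧
    (∀ (n : ℕ) (Γ : Set (T n × T n)), Disjoint Γ (Set.diagonal (T n)) → Cond n Γ →
      ∃ f g : C(T (n + 1), T n),
        (∀ x, (f x, g x) ∈ Γ) ∧
        Disjoint (coincidenceSet g f) (Set.diagonal (T (n + 1))) ∧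
        HasValence f 6 ∧ HasValence g 12 ∧
        ∃ Γ' : Set (T (n + 1) × T (n + 1)), Γ' ⊆ coincidenceSet g f ∧ Cond (n + 1) Γ') ∧
    (∃ (Γ : ∀ n, Set (T n × T n)) (f g : ∀ n, C(T (n + 1), T n)),
      (∀ n, Disjoint (Γ n) (Set.diagonal (T n)) ∧ Cond n (Γ n)) ∧
      (∀ n x, (f n x, g n x) ∈ Γ n) ∧
      (∀ n, Γ (n + 1) ⊆ coincidenceSet (g n) (f n)) ∧
      (∀ n x, f n (g (n + 1) x) = g n (f (n + 1) x)) ∧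
      (∀ x, f 0 x ≠ g 0 x) ∧
      (∀ n, HasValence (f n) 6 ∧ HasValence (g n) 12) ∧
      IsTreeLike (InverseLimit fun n => f n) ∧
      ∃ h : C(InverseLimit fun n => f n, InverseLimit fun n => f n),
        (∀ x n, (h x).1 n = g n (x.1 (n + 1))) ∧ ∀ x, h x ≠ x) := by
  refine ⟨isTree_T, fun n Γ => exists_step, ?_⟩
  obtain ⟨Γ, f, g, hΓ, hmem, hsub, hval⟩ := exists_system
  -- The pair of values at level `n + 1` lies in `Γ (n + 1)`, which is part of the coincidence set
  -- at level `n`.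
  have hcomm : ∀ n x, f n (g (n + 1) x) = g n (f (n + 1) x) := fun n x =>
    Eq.symm (hsub n (hmem (n + 1) x))
  have hne : ∀ x, f 0 x ≠ g 0 x := fun x e => Set.disjoint_left.1 (hΓ 0).1 (hmem 0 x) e
  refine ⟨Γ, f, g, hΓ, hmem, hsub, hcomm, hne, hval,
    isTreeLike_inverseLimit (fun n => (f n).continuous) isTree_T, ?_⟩
  refine ⟨⟨fun x => ⟨fun n => g n (x.1 (n + 1)), fun n => ?_⟩, ?_⟩, fun x n => rfl, fun x hx => ?_⟩
  · exact (hcomm n _).trans (congrArg (g n) (x.2 (n + 1)))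
  · exact Continuous.subtype_mk (continuous_pi fun n => (g n).continuous.comp
      ((continuous_apply _).comp continuous_subtype_val)) _
  -- The zeroth coordinate of a fixed point equals both `f 0` and `g 0` of its first coordinate.
  · have h := congrFun (congrArg Subtype.val hx) 0
    exact hne (x.1 1) ((x.2 0).trans h.symm)
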